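/- **Terms and signature.** Terms are built from variables $x$, names $a$ and constructor applications $f(M_1,\dots,M_n)$. The signature consists of finite sets of constructors and destructors taken from the following list. Constructors (all public): $n$-tuples $(M_1,\dots,M_n)$ (the only data constructors), $\mathit{sencrypt}/2$, $\mathit{sencrypt}_p/3$, $\mathit{pencrypt}_p/3$, $\mathit{pk}/1$, $\mathit{sign}/2$, $\mathit{nmrsign}/2$, $\mathit{true}/0$, $\mathit{hash}/1$, $\mathit{mac}/2$, $\mathit{host}/1$. Destructors, each with one rewrite rule: $i\mathrm{th}_n((x_1,\dots,x_n))\to x_i$; $\mathit{sdecrypt}(\mathit{sencrypt}(x,y),y)\to x$; $\mathit{sdecrypt}_p(\mathit{sencrypt}_p(x,y,z),y)\to x$; $\mathit{pdecrypt}_p(\mathit{pencrypt}_p(x,\mathit{pk}(y),z),y)\to x$; $\mathit{checksignature}(\mathit{sign}(x,y),\mathit{pk}(y))\to x$; $\mathit{getmessage}(\mathit{sign}(x,y))\to x$; $\mathit{nmrchecksign}(\mathit{nmrsign}(x,y),\mathit{pk}(y),x)\to\mathit{true}$; $\mathit{getkey}(\mathit{host}(x))\to x$ (private; all others are public); $\mathit{equal}(x,x)\to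 x$. A destructor of the signature comes with the constructors of its rule, a tuple constructor with all its projections, and $\mathit{checksignature}$ with $\mathit{getmessage}$. **Processes.** $P,Q ::= 0 \mid P\mid Q \mid {!P} \mid (\nu a)P \mid M(x).P \mid \overline{M}\langle N\rangle.P \mid \mathsf{let}\ x=g(M_1,\dots,M_n)\ \mathsf{in}\ P\ \mathsf{else}\ Q \mid \mathsf{if}\ M=N\ \mathsf{then}\ P\ \mathsf{else}\ Q \mid \mathsf{event}(M).P \mid \mathsf{let}\ x=M\ \mathsf{in}\ P$, with the usual reduction semantics (communication, unfolding of replication, creation of fresh names, destructor application with else branch on failure, equality test, events; $\mathsf{let}\ x=M\ \mathsf{in}\ P$ behaves as $P\{M/x\}$, but $M$ counts as one occurrence below). The argument of an event is a term, possibly under one event symbol $e$, which occurs nowhere else. **Tagged protocols.** Let $\mathit{Init}$ be a finite set of (public) names and $P_0$ a closed process over the signature whose bound names are pairwise distinct and distinct from its free names and from $\mathit{Init}$. A *constant* is a free name of $P_0$, a name bound by a restriction of $P_0$ that is under no input and no replication, or $\mathit{true}$. The protocol $(\mathit{Init},P_0)$ is *tagged* when: * (C1) its constructors and destructors are those listed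 above; * (C2) every channel of an input or output is a free name of $P_0$ that belongs to $\mathit{Init}$; * (C3) at each occurrence in $P_0$ of a constructor $f\in\{\mathit{sencrypt},\mathit{sencrypt}_p,\mathit{pencrypt}_p,\mathit{sign},\mathit{nmrsign},\mathit{hash},\mathit{mac}\}$, the first argument of $f$ is a tuple $(ct,M_1,\dots,M_n)$ whose first component, the tag $ct$, is a constant; different occurrences of the same $f$ have different tags; * (C4) each result $x$ of $\mathit{sdecrypt},\mathit{sdecrypt}_p,\mathit{pdecrypt}_p,\mathit{checksignature},\mathit{getmessage}$ is checked at once, i.e. the destructor application is followed by $\mathsf{let}\ y=1\mathrm{th}_n(x)\ \mathsf{in}\ \mathsf{if}\ y=ct\ \mathsf{then}\cdots$ for some constant $ct$; and the third argument of each $\mathit{nmrchecksign}$ is a tuple $(ct,M_1,\dots,M_n)$ with $ct$ a constant; * (C5) all else branches are $0$, and there is a trace of $P_0$ (without adversary, starting with the free names of $P_0$ as the set of names in use) that executes each program point of $P_0$ (else branches aside) exactly once; * (C6) in the same trace, the second argument of $\mathit{pencrypt}_p$ is always of the form $\mathit{pk}(M)$; * (C7) in the same trace, the arguments of $\mathit{pk}$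 and $\mathit{host}$ are always atomic constants (free names, or names created by restrictions under no input and no replication) that are not tags. **Clauses.** Patterns are built from variables, names $a[p_1,\dots,p_n,i_1,\dots,i_k]$ (with session identifiers $i_j$, a separate sort of variables and constants; $a[]$ for a free name $a$; a special symbol $b_0[x]$ for names created by the adversary), and constructors. Facts are $\mathsf{attacker}(p)$, $\mathsf{message}(p,p')$, $\mathsf{m\text{-}event}(p)$, $\mathsf{event}(p)$; clauses are $H\Rightarrow C$ with $H$ a finite multiset of facts and $C$ a fact. The initial set $\mathcal{R}_0$ consists of: * for the adversary: $\mathsf{attacker}(a[])$ for $a\in\mathit{Init}$; $\mathsf{attacker}(b_0[x])$; $\mathsf{attacker}(x_1)\wedge\dots\wedge\mathsf{attacker}(x_n)\Rightarrow\mathsf{attacker}(f(x_1,\dots,x_n))$ for each constructor $f$; $\mathsf{attacker}(M_1)\wedge\dots\wedge\mathsf{attacker}(M_n)\Rightarrow\mathsf{attacker}(M)$ for each public destructor with rule $g(M_1,\dots,M_n)\to M$; $\mathsf{message}(x,y)\wedge\mathsf{attacker}(x)\Rightarrow\mathsf{attacker}(y)$; $\mathsf{attacker}(x)\wedge\mathsf{attacker}(y)\Rightarrow\mathsf{message}(x,y)$;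 * for the protocol: the clauses generated from $P_0$ by walking through it. Replication adds a fresh session identifier variable to the current list. A restriction $(\nu a)$ encodes $a$ as $a[x_1,\dots,x_n,i_1,\dots,i_k]$, where the $x_j$ are the (current instances of the) variables of the inputs above it and the $i_j$ the session identifiers above it. An input $M(x)$ adds the hypothesis $\mathsf{message}(M,x)$. A destructor application (success branch) and an equality test (equal branch) apply the most general substitution that makes them succeed, and are dropped when there is none; else branches are translated without added hypothesis. An output $\overline M\langle N\rangle$ yields $H\Rightarrow\mathsf{message}(M,N)$ and an event yields $H\Rightarrow\mathsf{event}(M)$, where $H$ is the current multiset of hypotheses. Events add no hypothesis $\mathsf{m\text{-}event}$ (for queries $\alpha\rightsquigarrow\mathsf{false}$ no event occurs after $\rightsquigarrow$). In these clauses, $\mathsf{message}(c[],p)$ with $c\in\mathit{Init}$ is replaced with $\mathsf{attacker}(p)$. **The algorithm.** Clauses are considered up to renaming of variables. The selection function $\mathrm{sel}_0$: $\mathrm{sel}_0(H\Rightarrow C)=\emptyset$ if every hypothesis in $H$ is of the form $\mathsf{attacker}(x)$ with $x$ a variable or $\mathsf{m\text{-}event}(p)$; otherwise $\mathrm{sel}_0(H\Rightarrow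 C)=\{F_0\}$ for some $F_0\in H$ that is not of these forms (any choice of $F_0$ is allowed). If $R=H\Rightarrow C$ and $R'=F_0\wedge H'\Rightarrow C'$ (variables renamed apart) and $C$, $F_0$ have most general unifier $\sigma$, then $R\circ_{F_0}R'=\sigma(H\wedge H')\Rightarrow\sigma C'$. $H_1\Rightarrow C_1$ subsumes $H_2\Rightarrow C_2$ if $\sigma C_1=C_2$ and $\sigma H_1\subseteq H_2$ (multiset inclusion) for some $\sigma$. Let $\mathcal F_{\mathrm{not}}$ be a finite set of facts (secrecy assumptions). Put $\mathit{simplify}=\mathit{elimattx}\circ\mathit{elimtaut}\circ\mathit{elimnot}\circ\mathit{elimredundanthyp}\circ\mathit{elimdup}\circ\mathit{decomp}$ and $\mathit{simplify}'=\mathit{elimattx}\circ\mathit{elimnot}\circ\mathit{elimredundanthyp}\circ\mathit{elimdup}\circ\mathit{decomphyp}$, where * $\mathit{decomp}$ replaces recursively $\mathsf{attacker}((p_1,\dots,p_n))$ with $\mathsf{attacker}(p_1),\dots,\mathsf{attacker}(p_n)$, in hypotheses and (giving one clause per component) in the conclusion, except in the adversary's own clauses for tuples and projections; $\mathit{decomphyp}$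 does so in hypotheses only; * $\mathit{elimdup}$ removes duplicate hypotheses; * $\mathit{elimredundanthyp}$ turns $H\wedge H'\Rightarrow C$ into $H'\Rightarrow C$ for some $\sigma$ with $\sigma H\subseteq H'$ that leaves the variables of $H'$ and $C$ unchanged; which such eliminations are performed is an arbitrary user setting (possibly none); * $\mathit{elimnot}$ removes clauses that have an instance of a fact of $\mathcal F_{\mathrm{not}}$ among their hypotheses; * $\mathit{elimtaut}$ removes clauses whose conclusion is among their hypotheses; * $\mathit{elimattx}$ removes hypotheses $\mathsf{attacker}(x)$ with $x$ a variable that occurs nowhere else in the clause. $\mathit{elim}$ removes subsumed clauses from a set of clauses. $\mathit{saturate}(\mathcal R_0)$ starts from $\mathcal R=\emptyset$; for each $R\in\mathcal R_0$ (in any order) it sets $\mathcal R\leftarrow\mathit{elim}(\mathit{simplify}(R)\cup\mathcal R)$; then it iterates $\mathcal R\leftarrow\mathit{elim}(\mathit{simplify}(R\circ_{F_0}R')\cup\mathcal R)$ for $R,R'\in\mathcal R$ with $\mathrm{sel}_0(R)=\emptyset$ and $F_0\in\mathrm{sel}_0(R')$ whenever $R\circ_{F_0}R'$ is defined, until a fixpoint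 is reached, and returns $\mathcal R_1=\{R\in\mathcal R\mid\mathrm{sel}_0(R)=\emptyset\}$. $\mathit{derivable}(F,\mathcal R_1)$ calls $\mathit{deriv}(F\Rightarrow F,\emptyset,\mathcal R_1)$, where $\mathit{deriv}(R,\mathcal R,\mathcal R_1)$ returns $\emptyset$ if some clause of $\mathcal R$ subsumes $R$; returns $\{R\}$ if otherwise $\mathrm{sel}_0(R)=\emptyset$; and otherwise calls $\mathit{deriv}(R'',\{R\}\cup\mathcal R,\mathcal R_1)$ for all $R''\in\mathit{simplify}'(R'\circ_{F_0}R)$ with $R'\in\mathcal R_1$, $F_0\in\mathrm{sel}_0(R)$ and $R'\circ_{F_0}R$ defined. To solve the query $\alpha\rightsquigarrow\mathsf{false}$, where $\alpha$ is an atom $\mathsf{attacker}(M)$, $\mathsf{message}(M,M')$ or $\mathsf{event}(M)$, the solving algorithm computes $\mathcal R_1=\mathit{saturate}(\mathcal R_0)$, checks the secrecy assumptions by $\mathit{derivable}(F,\mathcal R_1)$ for $F\in\mathcal F_{\mathrm{not}}$, and computes $\mathit{derivable}(\overline{\alpha},\mathcal R_1)$, where $\overline{\alpha}$ is the fact obtained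 from $\alpha$ by replacing each name $a$ with $a[]$. **Proposition.** Let $(\mathit{Init},P_0)$ be a tagged protocol, let $\alpha$ be a closed atom (one without variables) and let all facts in $\mathcal F_{\mathrm{not}}$ be closed. Then, with the selection function $\mathrm{sel}_0$, the solving algorithm terminates on $P_0$ for the query $\alpha\rightsquigarrow\mathsf{false}$. That is: the set $\mathcal R_0$ is finite; in whatever order its clauses are inserted and whatever choices are made, no run of $\mathit{saturate}(\mathcal R_0)$ makes infinitely many iterations that change the set of clauses; and every resulting set $\mathcal R_1$ is finite and has no infinite sequence of nested recursive calls of $\mathit{deriv}$ in $\mathit{derivable}(\overline{\alpha},\mathcal R_1)$ or in $\mathit{derivable}(F,\mathcal R_1)$ for $F\in\mathcal F_{\mathrm{not}}$. -/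

import Mathlib

namespace CryptoHorn

/-! ## Terms, constructors and destructors -/

/-- Constructors. All of them are public. `evt e` is not a constructor of the signature: it is an
event symbol, which may be used only at the root of the argument of an event. -/
inductive Constr
  | tuple (n : ℕ)
  | sencrypt
  | sencryptP
  | pencryptP
  | pk
  | sign
  | nmrsign
  | tru
  | hash
  | mac
  | host
  | evt (e : ℕ)

/-- Arities (irrelevant for event symbols). -/
def Constr.arity : Constr → ℕ
  | .tuple n => n
  | .sencrypt => 2
  | .sencryptP => 3
  | .pencryptP => 3
  | .pk => 1
  | .sign => 2
  | .nmrsign => 2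
  | .tru => 0
  | .hash => 1
  | .mac => 2
  | .host => 1
  | .evt _ => 0

/-- Terms of the process calculus: variables, names, constructor applications. -/
inductive Term
  | var (x : ℕ)
  | name (a : ℕ)
  | app (f : Constr) (args : List Term)

/-- Destructors. `nth i n` is the projection of an `n`-tuple on its component number `i`, where
the components are numbered from `0`. -/
inductive Destr
  | nth (i n : ℕ)
  | sdecrypt
  | sdecryptP
  | pdecryptP
  | checksignature
  | getmessage
  | nmrchecksign
  | getkey
  | equal

/-- The arguments of the left-hand side of the (only) rewrite rule of a destructor. -/
def Destr.lhs : Destr → List Term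
  | .nth _ n => [.app (.tuple n) ((List.range n).map .var)]
  | .sdecrypt => [.app .sencrypt [.var 0, .var 1], .var 1]
  | .sdecryptP => [.app .sencryptP [.var 0, .var 1, .var 2], .var 1]
  | .pdecryptP => [.app .pencryptP [.var 0, .app .pk [.var 1], .var 2], .var 1]
  | .checksignature => [.app .sign [.var 0, .var 1], .app .pk [.var 1]]
  | .getmessage => [.app .sign [.var 0, .var 1]]
  | .nmrchecksign => [.app .nmrsign [.var 0, .var 1], .app .pk [.var 1], .var 0]
  | .getkey => [.app .host [.var 0]]
  | .equal => [.var 0, .var 0]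

/-- The right-hand side of the rewrite rule of a destructor. -/
def Destr.rhs : Destr → Term
  | .nth i _ => .var i
  | .nmrchecksign => .app .tru []
  | _ => .var 0

/-- The variables of the rewrite rule are among `0, …, nvars - 1`. -/
def Destr.nvars : Destr → ℕ
  | .nth _ n => n
  | _ => 3

/-- The table lookup `getkey` is the only private destructor. -/
def Destr.IsPublic (g : Destr) : Prop := g ≠ .getkey

/-- Simultaneous replacement of variables and of names by terms. -/
def Term.inst (η ν : ℕ → Term) : Term → Term
  | .var x => η x
  | .name a => ν a
  | .app f args => .app f (args.map (Term.inst η ν))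

/-- `g(M₁, …, Mₙ) → M'`. -/
def Destr.Reduces (g : Destr) (args : List Term) (M' : Term) : Prop :=
  ∃ σ : ℕ → Term, args = g.lhs.map (Term.inst σ .name) ∧ M' = g.rhs.inst σ .name

/-- `N` is a subterm of `M`. -/
inductive Term.Sub (N : Term) : Term → Prop
  | refl : Term.Sub N N
  | app {f : Constr} {args : List Term} {M : Term} :
      M ∈ args → Term.Sub N M → Term.Sub N (.app f args)

/-- A signature: finite sets of constructors and destructors. -/
structure Signature where
  constrs : Finset Constr
  destrs : Finset Destr

/-- Terms built over a signature, with the right number of arguments everywhere. -/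
inductive Term.WF (Sg : Signature) : Term → Prop
  | var (x : ℕ) : Term.WF Sg (.var x)
  | name (a : ℕ) : Term.WF Sg (.name a)
  | app {f : Constr} {args : List Term} (hf : f ∈ Sg.constrs) (hl : args.length = f.arity)
      (h : ∀ M ∈ args, Term.WF Sg M) : Term.WF Sg (.app f args)

/-- Arguments of events: terms over the signature, possibly under one event symbol. -/
def Term.EventWF (Sg : Signature) (M : Term) : Prop :=
  M.WF Sg ∨ ∃ (e : ℕ) (args : List Term), M = .app (.evt e) args ∧ ∀ N ∈ args, N.WF Sg

/-- The constructors and destructors of the signature are among those listed above, and the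
destructors are there together with the symbols they come with: the constructors of their rewrite
rules, all projections for a tuple constructor (tuples are data constructors), and message
recovery `getmessage` for signature verification. The full list of symbols, with tuples of
finitely many lengths, is the typical example. -/
structure Signature.Admissible (Sg : Signature) : Prop where
  noEvt : ∀ e, Constr.evt e ∉ Sg.constrs
  rules : ∀ g ∈ Sg.destrs, (∀ M ∈ g.lhs, M.WF Sg) ∧ g.rhs.WF Sg
  nth_lt : ∀ i n, Destr.nth i n ∈ Sg.destrs → i < n
  nth_mem : ∀ n, Constr.tuple n ∈ Sg.constrs → ∀ i < n, Destr.nth i n ∈ Sg.destrs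
  getmessage_mem : Destr.checksignature ∈ Sg.destrs → Destr.getmessage ∈ Sg.destrs

/-! ## Processes -/

/-- Processes. `letT x M P` is `let x = M in P`, an abbreviation of `P{M/x}`; its semantics and
its clauses are those of `P{M/x}`. It is a construct of its own so that a term
that is bound once and used several times counts as one occurrence. -/
inductive Proc
  | nil
  | par (P Q : Proc)
  | repl (P : Proc)
  | res (a : ℕ) (P : Proc)
  | inp (M : Term) (x : ℕ) (P : Proc)
  | out (M N : Term) (P : Proc)
  | letD (x : ℕ) (g : Destr) (Ms : List Term) (P Q : Proc)
  | cond (M N : Term) (P Q : Proc)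
  | event (M : Term) (P : Proc)
  | letT (x : ℕ) (M : Term) (P : Proc)

namespace Proc

/-- The list of the occurrences of subprocesses. -/
def subs : Proc → List Proc
  | nil => [nil]
  | par P Q => par P Q :: (subs P ++ subs Q)
  | repl P => repl P :: subs P
  | res a P => res a P :: subs P
  | inp M x P => inp M x P :: subs P
  | out M N P => out M N P :: subs P
  | letD x g Ms P Q => letD x g Ms P Q :: (subs P ++ subs Q)
  | cond M N P Q => cond M N P Q :: (subs P ++ subs Q)
  | event M P => event M P :: subs P
  | letT x M P => letT x M P :: subs P

/-- The terms in the first action of a process. -/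
def headTerms : Proc → List Term
  | inp M _ _ => [M]
  | out M N _ => [M, N]
  | letD _ _ Ms _ _ => Ms
  | cond M N _ _ => [M, N]
  | event M _ => [M]
  | letT _ M _ => [M]
  | _ => []

/-- Free variables. -/
def fv : Proc → Set ℕ
  | nil => ∅
  | par P Q => fv P ∪ fv Q
  | repl P => fv P
  | res _ P => fv P
  | inp M x P => {y | Term.Sub (.var y) M} ∪ (fv P \ {x})
  | out M N P => {y | Term.Sub (.var y) M ∨ Term.Sub (.var y) N} ∪ fv P
  | letD x _ Ms P Q => {y | ∃ M ∈ Ms, Term.Sub (.var y) M} ∪ (fv P \ {x}) ∪ fv Q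
  | cond M N P Q => {y | Term.Sub (.var y) M ∨ Term.Sub (.var y) N} ∪ fv P ∪ fv Q
  | event M P => {y | Term.Sub (.var y) M} ∪ fv P
  | letT x M P => {y | Term.Sub (.var y) M} ∪ (fv P \ {x})

/-- Free names. -/
def fn : Proc → Set ℕ
  | nil => ∅
  | par P Q => fn P ∪ fn Q
  | repl P => fn P
  | res a P => fn P \ {a}
  | inp M _ P => {b | Term.Sub (.name b) M} ∪ fn P
  | out M N P => {b | Term.Sub (.name b) M ∨ Term.Sub (.name b) N} ∪ fn P
  | letD _ _ Ms P Q => {b | ∃ M ∈ Ms, Term.Sub (.name b) M} ∪ fn P ∪ fn Q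
  | cond M N P Q => {b | Term.Sub (.name b) M ∨ Term.Sub (.name b) N} ∪ fn P ∪ fn Q
  | event M P => {b | Term.Sub (.name b) M} ∪ fn P
  | letT _ M P => {b | Term.Sub (.name b) M} ∪ fn P

/-- Bound names, one entry for each restriction. -/
def bn : Proc → List ℕ
  | nil => []
  | par P Q => bn P ++ bn Q
  | repl P => bn P
  | res a P => a :: bn P
  | inp _ _ P => bn P
  | out _ _ P => bn P
  | letD _ _ _ P Q => bn P ++ bn Q
  | cond _ _ P Q => bn P ++ bn Q
  | event _ P => bn P
  | letT _ _ P => bn P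

/-- Names bound by restrictions that are neither under an input nor under a replication. (All
destructors above are deterministic.) -/
def topNames : Proc → Set ℕ
  | par P Q => topNames P ∪ topNames Q
  | res a P => {a} ∪ topNames P
  | out _ _ P => topNames P
  | letD _ _ _ P Q => topNames P ∪ topNames Q
  | cond _ _ P Q => topNames P ∪ topNames Q
  | event _ P => topNames P
  | letT _ _ P => topNames P
  | _ => ∅

/-- Program points: paths in the syntax tree. Else branches are left out (this is used for
processes without else branches, that is, in which all of them are `nil`). -/
def points : Proc → Set (List ℕ)
  | nil => {[]}
  | par P Q => {[]} ∪ (List.cons 0 '' points P) ∪ (List.cons 1 '' points Q)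
  | repl P => {[]} ∪ (List.cons 0 '' points P)
  | res _ P => {[]} ∪ (List.cons 0 '' points P)
  | inp _ _ P => {[]} ∪ (List.cons 0 '' points P)
  | out _ _ P => {[]} ∪ (List.cons 0 '' points P)
  | letD _ _ _ P _ => {[]} ∪ (List.cons 0 '' points P)
  | cond _ _ P _ => {[]} ∪ (List.cons 0 '' points P)
  | event _ P => {[]} ∪ (List.cons 0 '' points P)
  | letT _ _ P => {[]} ∪ (List.cons 0 '' points P)

end Proc

/-! ## Operational semantics -/

/-- A thread stands for the closed process `proc η ν`: the free variables of `proc` are replaced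
according to `η` and its free names are renamed according to `ν`. Keeping the replacements apart
makes substitution capture-avoiding. The process `proc` is the subprocess found at the place
`path` of the initial process. -/
structure Thread where
  path : List ℕ
  η : ℕ → Term
  ν : ℕ → ℕ
  proc : Proc

/-- The closed term that `M` denotes in a thread. -/
def Thread.eval (t : Thread) (M : Term) : Term := M.inst t.η (fun a => .name (t.ν a))

/-- The thread that goes on with the `i`-th immediate subprocess `P`. -/
def Thread.next (t : Thread) (i : ℕ) (P : Proc) : Thread :=
  { t with path := t.path ++ [i], proc := P }

/-- Binding of a variable in a thread. -/
def Thread.bindVar (t : Thread) (x : ℕ) (M : Term) : Thread :=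
  { t with η := Function.update t.η x M }

/-- Renaming of a name in a thread. -/
def Thread.bindName (t : Thread) (a a' : ℕ) : Thread :=
  { t with ν := Function.update t.ν a a' }

/-- Semantic configurations: the names used so far and a multiset of processes. -/
structure Config where
  env : Finset ℕ
  threads : Multiset Thread

/-- The execution of a program point: its place, the pair `(a, a')` when a restriction of `a`
creates the name `a'`, and the closed terms that occur in this execution. -/
structure Action where
  path : List ℕ
  created : Option (ℕ × ℕ)
  terms : List Term

/-- Reduction; the list contains the executions of program points that the step performs. -/
inductive Red : Config → List Action → Config → Prop
  | nil {E T t} : t.proc = .nil → Red ⟨E, t ::ₘ T⟩ [⟨t.path, none, []⟩] ⟨E, T⟩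
  | repl {E T t P} : t.proc = .repl P →
      Red ⟨E, t ::ₘ T⟩ [⟨t.path, none, []⟩] ⟨E, t.next 0 P ::ₘ t ::ₘ T⟩
  | par {E T t P Q} : t.proc = .par P Q →
      Red ⟨E, t ::ₘ T⟩ [⟨t.path, none, []⟩] ⟨E, t.next 0 P ::ₘ t.next 1 Q ::ₘ T⟩
  | res {E T t a P a'} : t.proc = .res a P → a' ∉ E →
      Red ⟨E, t ::ₘ T⟩ [⟨t.path, some (a, a'), []⟩]
        ⟨insert a' E, (t.bindName a a').next 0 P ::ₘ T⟩
  | io {E T t u M N Q M' x P} : t.proc = .out M N Q → u.proc = .inp M' x P →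
      t.eval M = u.eval M' →
      Red ⟨E, t ::ₘ u ::ₘ T⟩
        [⟨t.path, none, [t.eval M, t.eval N]⟩, ⟨u.path, none, [t.eval M, t.eval N]⟩]
        ⟨E, t.next 0 Q ::ₘ (u.bindVar x (t.eval N)).next 0 P ::ₘ T⟩
  | destr₁ {E T t x g Ms P Q M'} : t.proc = .letD x g Ms P Q →
      g.Reduces (Ms.map t.eval) M' →
      Red ⟨E, t ::ₘ T⟩ [⟨t.path, none, Ms.map t.eval ++ [M']⟩]
        ⟨E, (t.bindVar x M').next 0 P ::ₘ T⟩
  | destr₂ {E T t x g Ms P Q} : t.proc = .letD x g Ms P Q →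
      (¬ ∃ M', g.Reduces (Ms.map t.eval) M') →
      Red ⟨E, t ::ₘ T⟩ [⟨t.path, none, Ms.map t.eval⟩] ⟨E, t.next 1 Q ::ₘ T⟩
  | cond₁ {E T t M N P Q} : t.proc = .cond M N P Q → t.eval M = t.eval N →
      Red ⟨E, t ::ₘ T⟩ [⟨t.path, none, [t.eval M, t.eval N]⟩] ⟨E, t.next 0 P ::ₘ T⟩
  | cond₂ {E T t M N P Q} : t.proc = .cond M N P Q → t.eval M ≠ t.eval N →
      Red ⟨E, t ::ₘ T⟩ [⟨t.path, none, [t.eval M, t.eval N]⟩] ⟨E, t.next 1 Q ::ₘ T⟩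
  | event {E T t M P} : t.proc = .event M P →
      Red ⟨E, t ::ₘ T⟩ [⟨t.path, none, [t.eval M]⟩] ⟨E, t.next 0 P ::ₘ T⟩
  | letT {E T t x M P} : t.proc = .letT x M P →
      Red ⟨E, t ::ₘ T⟩ [⟨t.path, none, [t.eval M]⟩]
        ⟨E, (t.bindVar x (t.eval M)).next 0 P ::ₘ T⟩

/-- Traces, with the executions of program points in order. -/
inductive Trace : Config → List Action → Config → Prop
  | refl (c : Config) : Trace c [] c
  | step {c c' c'' : Config} {l l' : List Action} :
      Red c l c' → Trace c' l' c'' → Trace c (l ++ l') c''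

/-- The process `P` alone, without adversary, with the set `E` of names. -/
def Config.initial (E : Finset ℕ) (P : Proc) : Config :=
  ⟨E, {{ path := [], η := .var, ν := id, proc := P }}⟩

/-! ## Tagged protocols -/

/-- The constructors whose first argument has to be tagged. -/
def Constr.NeedsTag : Constr → Prop
  | .sencrypt | .sencryptP | .pencryptP | .sign | .nmrsign | .hash | .mac => True
  | _ => False

/-- All occurrences of constructor applications in a term. -/
def Term.occs : Term → List (Constr × List Term)
  | .app f args => (f, args) :: args.flatMap Term.occs
  | _ => []

/-- All occurrences of constructor applications in a process. -/
def Proc.occs (P : Proc) : List (Constr × List Term) :=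
  P.subs.flatMap fun S => S.headTerms.flatMap Term.occs

/-- Constants: free names, names bound by restrictions that are neither under inputs nor under
replications, and the constant `true`. -/
def IsConstant (P₀ : Proc) (M : Term) : Prop :=
  (∃ a, M = .name a ∧ (a ∈ P₀.fn ∨ a ∈ P₀.topNames)) ∨ M = .app .tru []

/-- The first of the arguments `args` is a tuple with first component `ct`. -/
def HasTag (args : List Term) (ct : Term) : Prop :=
  ∃ (Ms rest : List Term), args = .app (.tuple (Ms.length + 1)) (ct :: Ms) :: rest

/-- `M` is used as a tag in `P₀`. -/
def IsTag (P₀ : Proc) (M : Term) : Prop :=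
  ∃ o ∈ P₀.occs, o.1.NeedsTag ∧ HasTag o.2 M

/-- Destructors whose result has to be checked for a tag immediately. -/
def Destr.ChecksTag : Destr → Prop
  | .sdecrypt | .sdecryptP | .pdecryptP | .checksignature | .getmessage => True
  | _ => False

/-- The runtime name `n` of a trace with actions `acts` is an atomic constant of `P₀`, and comes
from the name `a` of `P₀`: it is a free name, or it was created by a restriction of `a` that is
neither under inputs nor under replications. -/
def IsAtomic (P₀ : Proc) (acts : List Action) (n a : ℕ) : Prop :=
  (n = a ∧ a ∈ P₀.fn) ∨ (a ∈ P₀.topNames ∧ ∃ A ∈ acts, A.created = some (a, n))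

/-- The intended execution: a trace of `P₀` without adversary that executes all program points
exactly once, in which public-key encryption is used only with public keys and the arguments
of `pk` and `host` are atomic constants that are not tags. -/
def IntendedTrace (P₀ : Proc) (acts : List Action) : Prop :=
  (∃ (E : Finset ℕ) (c : Config), (E : Set ℕ) = P₀.fn ∧ Trace (.initial E P₀) acts c) ∧
  (∀ p ∈ P₀.points, (acts.map Action.path).count p = 1) ∧
  (∀ A ∈ acts, ∀ M ∈ A.terms, ∀ M₁ M₂ M₃ : Term,
    Term.Sub (.app .pencryptP [M₁, M₂, M₃]) M → ∃ K, M₂ = .app .pk [K]) ∧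
  (∀ A ∈ acts, ∀ M ∈ A.terms, ∀ K : Term,
    (Term.Sub (.app .pk [K]) M ∨ Term.Sub (.app .host [K]) M) →
      ∃ n a, K = .name n ∧ IsAtomic P₀ acts n a ∧ ¬ IsTag P₀ (.name a))

/-- Tagged protocols. `Init` is the set of public names. -/
structure IsTagged (Sg : Signature) (Init : Finset ℕ) (P₀ : Proc) : Prop where
  /-- The process is closed, and its bound names have been renamed so that they are pairwise
  distinct and distinct from free and public names. -/
  closed : P₀.fv = ∅
  bn_nodup : P₀.bn.Nodup
  bn_fresh : ∀ a ∈ P₀.bn, a ∉ P₀.fn ∧ a ∉ Init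
  /-- The allowed constructors and destructors; the process is built over the signature. -/
  sig : Sg.Admissible
  wf_event : ∀ M P, Proc.event M P ∈ P₀.subs → M.EventWF Sg
  wf_term : ∀ S ∈ P₀.subs, (∀ M P, S ≠ .event M P) → ∀ M ∈ S.headTerms, M.WF Sg
  wf_destr : ∀ x g Ms P Q, Proc.letD x g Ms P Q ∈ P₀.subs →
    g ∈ Sg.destrs ∧ Ms.length = g.lhs.length
  /-- All channels are public: names free in the process and known to the adversary. -/
  chan_inp : ∀ M x P, Proc.inp M x P ∈ P₀.subs → ∃ c, M = .name c ∧ c ∈ P₀.fn ∧ c ∈ Init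
  chan_out : ∀ M N P, Proc.out M N P ∈ P₀.subs → ∃ c, M = .name c ∧ c ∈ P₀.fn ∧ c ∈ Init
  /-- All cryptographic terms are tagged, and different occurrences of the same constructor have
  different tags. -/
  tagged : ∀ o ∈ P₀.occs, o.1.NeedsTag → ∃ ct, HasTag o.2 ct ∧ IsConstant P₀ ct
  tags_distinct : P₀.occs.Pairwise fun o o' =>
    o.1 = o'.1 → o.1.NeedsTag → ∀ ct, HasTag o.2 ct → ¬ HasTag o'.2 ct
  /-- Tags are checked. -/
  tag_checked : ∀ x g Ms P Q, Proc.letD x g Ms P Q ∈ P₀.subs → g.ChecksTag →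
    ∃ y n ct P' Q₁ Q₂, P = .letD y (.nth 0 n) [.var x] (.cond (.var y) ct P' Q₁) Q₂ ∧
      IsConstant P₀ ct
  nmr_tagged : ∀ x Ms P Q, Proc.letD x .nmrchecksign Ms P Q ∈ P₀.subs →
    ∃ M₁ M₂ ct Ms', Ms = [M₁, M₂, .app (.tuple (Ms'.length + 1)) (ct :: Ms')] ∧ IsConstant P₀ ct
  /-- There are no else branches, and the intended execution exists. -/
  no_else_letD : ∀ x g Ms P Q, Proc.letD x g Ms P Q ∈ P₀.subs → Q = .nil
  no_else_cond : ∀ M N P Q, Proc.cond M N P Q ∈ P₀.subs → Q = .nil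
  trace : ∃ acts, IntendedTrace P₀ acts

/-! ## Patterns, facts and clauses -/

/-- Session identifiers: variables and constants. -/
inductive SessId
  | var (i : ℕ)
  | const (l : ℕ)

/-- Name function symbols: one for each name, and the special symbol `b₀` for the names that the
adversary creates. -/
inductive NameSym
  | nm (a : ℕ)
  | b₀

/-- Patterns: variables, `a[p₁, …, pₙ, i₁, …, iₖ]`, and constructor applications. -/
inductive Pattern
  | var (x : ℕ)
  | name (a : NameSym) (ps : List Pattern) (is : List SessId)
  | app (f : Constr) (ps : List Pattern)

/-- The pattern of a term, when `ρ` and `θ` give the patterns of variables and names. -/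
def Term.toPattern (ρ θ : ℕ → Pattern) : Term → Pattern
  | .var x => ρ x
  | .name a => θ a
  | .app f args => .app f (args.map (Term.toPattern ρ θ))

/-- The encoding `a[]` of a free name. -/
def freeName (a : ℕ) : Pattern := .name (.nm a) [] []

/-- Variables of patterns: ordinary ones and session identifiers. -/
inductive Var
  | ord (x : ℕ)
  | sess (i : ℕ)

/-- Substitutions map ordinary variables to patterns and session identifier variables to session
identifiers. -/
structure Subst where
  pat : ℕ → Pattern
  sess : ℕ → SessId

def SessId.subst (σ : Subst) : SessId → SessId
  | .var i => σ.sess i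
  | .const l => .const l

def Pattern.subst (σ : Subst) : Pattern → Pattern
  | .var x => σ.pat x
  | .name a ps is => .name a (ps.map (Pattern.subst σ)) (is.map (SessId.subst σ))
  | .app f ps => .app f (ps.map (Pattern.subst σ))

/-- `σ.comp τ` first applies `σ`, then `τ`. -/
def Subst.comp (σ τ : Subst) : Subst :=
  ⟨fun x => (σ.pat x).subst τ, fun i => (σ.sess i).subst τ⟩

/-- The variable occurs in the pattern. -/
inductive Var.Occurs : Var → Pattern → Prop
  | var (x : ℕ) : Var.Occurs (.ord x) (.var x)
  | name {v a ps is p} : p ∈ ps → Var.Occurs v p → Var.Occurs v (.name a ps is)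
  | sess {i a ps is} : SessId.var i ∈ is → Var.Occurs (.sess i) (.name a ps is)
  | app {v f ps p} : p ∈ ps → Var.Occurs v p → Var.Occurs v (.app f ps)

/-- Facts. -/
inductive HornFact
  | attacker (p : Pattern)
  | message (p q : Pattern)
  | mevent (p : Pattern)
  | event (p : Pattern)

def HornFact.subst (σ : Subst) : HornFact → HornFact
  | .attacker p => .attacker (p.subst σ)
  | .message p q => .message (p.subst σ) (q.subst σ)
  | .mevent p => .mevent (p.subst σ)
  | .event p => .event (p.subst σ)

def HornFact.patterns : HornFact → List Pattern
  | .attacker p => [p]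
  | .message p q => [p, q]
  | .mevent p => [p]
  | .event p => [p]

/-- The variables of a fact. -/
def HornFact.vars (F : HornFact) : Set Var := {v | ∃ p ∈ F.patterns, v.Occurs p}

/-- Closed facts. -/
def HornFact.Closed (F : HornFact) : Prop := F.vars = ∅

/-- Clauses `H ⇒ C`. -/
structure Clause where
  hyps : Multiset HornFact
  concl : HornFact

def Clause.subst (σ : Subst) (R : Clause) : Clause := ⟨R.hyps.map (HornFact.subst σ), R.concl.subst σ⟩

def Clause.vars (R : Clause) : Set Var := {v | v ∈ R.concl.vars ∨ ∃ F ∈ R.hyps, v ∈ F.vars}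

/-- The renaming of variables given by two permutations. -/
def permSubst (π π' : Equiv.Perm ℕ) : Subst := ⟨fun x => .var (π x), fun i => .var (π' i)⟩

/-- Equality of clauses up to renaming of variables. -/
def Clause.Variant (R R' : Clause) : Prop := ∃ π π', R' = R.subst (permSubst π π')

/-- Equality of sets of clauses up to renaming of the variables of clauses. -/
def SameClauses (A B : Set Clause) : Prop :=
  (∀ R ∈ A, ∃ R' ∈ B, R.Variant R') ∧ (∀ R' ∈ B, ∃ R ∈ A, R.Variant R')

/-- `σ` is a most general element of the set `U` of unifiers of objects with variables in `V`;
it introduces no other variable, and changes no other variable. -/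
structure IsMGU (U : Set Subst) (V : Set Var) (σ : Subst) : Prop where
  unifies : σ ∈ U
  general : ∀ θ ∈ U, ∃ τ, θ = σ.comp τ
  pat_eq : ∀ x, Var.ord x ∉ V → σ.pat x = .var x
  sess_eq : ∀ i, Var.sess i ∉ V → σ.sess i = .var i
  pat_vars : ∀ x, Var.ord x ∈ V → ∀ v : Var, v.Occurs (σ.pat x) → v ∈ V
  sess_vars : ∀ i, Var.sess i ∈ V → ∀ j, σ.sess i = .var j → Var.sess j ∈ V

open Classical in
/-- The most general unifier, if there is one. -/
noncomputable def mgu (U : Set Subst) (V : Set Var) : Option Subst :=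
  if h : ∃ σ, IsMGU U V σ then some h.choose else none

/-! ## Generation of clauses -/

/-- The data carried along the translation: the environment (`var`, `name`), the sequence `hyps`
of hypotheses, and the arguments of the label of a restriction at this place, namely
the patterns `ins` of the variables bound by inputs above and the identifiers `sids` of the
replications above (all destructors are deterministic, so their results are not included). All
variables in use are smaller than `fresh`. -/
structure Ctx where
  fresh : ℕ
  var : ℕ → Pattern
  name : ℕ → Pattern
  hyps : List HornFact
  ins : List Pattern
  sids : List SessId

def Ctx.subst (σ : Subst) (c : Ctx) : Ctx :=
  { fresh := c.fresh
    var := fun x => (c.var x).subst σ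
    name := fun a => (c.name a).subst σ
    hyps := c.hyps.map (HornFact.subst σ)
    ins := c.ins.map (Pattern.subst σ)
    sids := c.sids.map (SessId.subst σ) }

def Ctx.eval (c : Ctx) (M : Term) : Pattern := M.toPattern c.var c.name

def Ctx.clause (c : Ctx) (F : HornFact) : Clause := ⟨c.hyps, F⟩

open Classical in
/-- The fact `message(p, q)`, which is replaced with `attacker(q)` when `p` is a public name. -/
noncomputable def messageFact (Init : Finset ℕ) (p q : Pattern) : HornFact :=
  if ∃ a ∈ Init, p = freeName a then .attacker q else .message p q

/-- The patterns of the rewrite rule of a destructor, with variables renamed to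
`n, n + 1, …`. -/
def Destr.lhsPat (g : Destr) (n : ℕ) : List Pattern :=
  g.lhs.map (Term.toPattern (fun i => .var (n + i)) freeName)

def Destr.rhsPat (g : Destr) (n : ℕ) : Pattern :=
  g.rhs.toPattern (fun i => .var (n + i)) freeName

def listVars (ps : List Pattern) : Set Var := {v | ∃ p ∈ ps, v.Occurs p}

/-- Most general pairs of substitutions that make the arguments `ps` of a destructor equal to the
left-hand side `qs` of its rule (whose variables are disjoint from those of `ps`), and most
general unifiers. -/
noncomputable def mguLists (ps qs : List Pattern) : Option Subst :=
  mgu {σ | ps.map (Pattern.subst σ) = qs.map (Pattern.subst σ)} (listVars ps ∪ listVars qs)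

/-- The clauses of a process. This is the translation for queries
`α ⇝ false`: since no event occurs after `⇝`, events add no must-event hypothesis. The process
is instrumented on the way: replications get fresh session identifiers, and a restricted name `a`
is encoded as `a[t, s]`, with the inputs and the session identifiers above it. -/
noncomputable def translate (Init : Finset ℕ) : Proc → Ctx → Set Clause
  | .nil, _ => ∅
  | .par P Q, c => translate Init P c ∪ translate Init Q c
  | .repl P, c =>
      translate Init P { c with fresh := c.fresh + 1, sids := c.sids ++ [.var c.fresh] }
  | .res a P, c =>
      translate Init P { c with name := Function.update c.name a (.name (.nm a) c.ins c.sids) }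
  | .inp M x P, c =>
      translate Init P
        { c with
          fresh := c.fresh + 1
          var := Function.update c.var x (.var c.fresh)
          hyps := c.hyps ++ [messageFact Init (c.eval M) (.var c.fresh)]
          ins := c.ins ++ [.var c.fresh] }
  | .out M N P, c =>
      translate Init P c ∪ {c.clause (messageFact Init (c.eval M) (c.eval N))}
  | .letD x g Ms P Q, c =>
      (match mguLists (Ms.map c.eval) (g.lhsPat c.fresh) with
        | some σ =>
            translate Init P
              { c.subst σ with
                fresh := c.fresh + g.nvars
                var := Function.update (c.subst σ).var x ((g.rhsPat c.fresh).subst σ) }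
        | none => ∅) ∪ translate Init Q c
  | .cond M N P Q, c =>
      (match mguLists [c.eval M] [c.eval N] with
        | some σ => translate Init P (c.subst σ)
        | none => ∅) ∪ translate Init Q c
  | .event M P, c => translate Init P c ∪ {c.clause (.event (c.eval M))}
  | .letT x M P, c => translate Init P { c with var := Function.update c.var x (c.eval M) }

/-- The initial environment maps free names `a` to `a[]`. -/
def Ctx.initial : Ctx :=
  { fresh := 0, var := .var, name := freeName, hyps := [], ins := [], sids := [] }

/-- The clauses for the adversary. -/
inductive AttackerClause (Sg : Signature) (Init : Finset ℕ) : Clause → Prop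
  | init (a : ℕ) (ha : a ∈ Init) : AttackerClause Sg Init ⟨0, .attacker (freeName a)⟩
  | rn : AttackerClause Sg Init ⟨0, .attacker (.name .b₀ [.var 0] [])⟩
  | rf (f : Constr) (hf : f ∈ Sg.constrs) : AttackerClause Sg Init
      ⟨((List.range f.arity).map fun i => HornFact.attacker (.var i) : List HornFact),
        .attacker (.app f ((List.range f.arity).map .var))⟩
  | rg (g : Destr) (hg : g ∈ Sg.destrs) (hp : g.IsPublic) : AttackerClause Sg Init
      ⟨((g.lhsPat 0).map HornFact.attacker : List HornFact), .attacker (g.rhsPat 0)⟩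
  | rl : AttackerClause Sg Init
      ⟨{.message (.var 0) (.var 1), .attacker (.var 0)}, .attacker (.var 1)⟩
  | rs : AttackerClause Sg Init
      ⟨{.attacker (.var 0), .attacker (.var 1)}, .message (.var 0) (.var 1)⟩

/-- All clauses for the protocol `P₀` in parallel with any adversary. -/
def protocolClauses (Sg : Signature) (Init : Finset ℕ) (P₀ : Proc) : Set Clause :=
  translate Init P₀ Ctx.initial ∪ {R | AttackerClause Sg Init R}

/-! ## Resolution, subsumption and simplification -/

/-- `R''` is the resolvent `R ∘_{F₀} R'` (unique up to renaming of variables): the variables of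
`R` are renamed apart, then the conclusion of `R` is unified with the hypothesis `F₀` of `R'`. -/
def IsResolvent (R : Clause) (F₀ : HornFact) (R' R'' : Clause) : Prop :=
  ∃ (S : Clause) (K : Multiset HornFact) (σ : Subst),
    R.Variant S ∧ Disjoint S.vars R'.vars ∧ R'.hyps = F₀ ::ₘ K ∧
    IsMGU {θ | S.concl.subst θ = F₀.subst θ} (S.concl.vars ∪ F₀.vars) σ ∧
    R'' = Clause.subst σ ⟨S.hyps + K, R'.concl⟩

/-- `R` subsumes `R'`. -/
def Subsumes (R R' : Clause) : Prop :=
  ∃ σ : Subst, R.concl.subst σ = R'.concl ∧ R.hyps.map (HornFact.subst σ) ≤ R'.hyps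

/-- `B` is obtained from `A` by removing subsumed clauses. -/
def IsElim (A B : Set Clause) : Prop :=
  B ⊆ A ∧ (∀ R ∈ A, ∃ R' ∈ B, Subsumes R' R) ∧ (∀ R ∈ B, ∀ R' ∈ B, Subsumes R' R → R' = R)

/-- Recursive decomposition of data constructors, that is, of tuples. -/
def Pattern.flatten : Pattern → List Pattern
  | .app (.tuple _) ps => ps.flatMap Pattern.flatten
  | p => [p]

def HornFact.decomp : HornFact → List HornFact
  | .attacker p => p.flatten.map .attacker
  | F => [F]

/-- The attacker clauses for tuples and projections, up to renaming. -/
def IsDataClause (R : Clause) : Prop :=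
  ∃ xs : List ℕ, xs.Nodup ∧
    (R = ⟨(xs.map fun x => HornFact.attacker (.var x) : List HornFact),
        .attacker (.app (.tuple xs.length) (xs.map .var))⟩ ∨
     ∃ x ∈ xs, R = ⟨{.attacker (.app (.tuple xs.length) (xs.map .var))}, .attacker (.var x)⟩)

def Clause.decompHyps (R : Clause) : Multiset HornFact :=
  R.hyps.bind fun F => (F.decomp : Multiset HornFact)

open Classical in
noncomputable def decomp (R : Clause) : Set Clause :=
  if IsDataClause R then {R} else {R' | R'.hyps = R.decompHyps ∧ R'.concl ∈ R.concl.decomp}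

open Classical in
noncomputable def decomphyp (R : Clause) : Clause :=
  if IsDataClause R then R else ⟨R.decompHyps, R.concl⟩

open Classical in
noncomputable def elimdup (R : Clause) : Clause := ⟨R.hyps.dedup, R.concl⟩

/-- The hypothesis `F` of `R` is `attacker(x)` for a variable `x` that occurs nowhere else. -/
def UselessAttacker (R : Clause) (F : HornFact) : Prop :=
  ∃ (x : ℕ) (K : Multiset HornFact), F = .attacker (.var x) ∧ R.hyps = F ::ₘ K ∧
    Var.ord x ∉ R.concl.vars ∧ ∀ F' ∈ K, Var.ord x ∉ F'.vars

open Classical in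
noncomputable def elimattx (R : Clause) : Clause :=
  ⟨R.hyps.filter fun F => ¬ UselessAttacker R F, R.concl⟩

/-- The conclusion is among the hypotheses. -/
def IsTautology (R : Clause) : Prop := R.concl ∈ R.hyps

/-- Some hypothesis is an instance of a fact of `Fnot`. -/
def HasNotHyp (Fnot : Finset HornFact) (R : Clause) : Prop :=
  ∃ F ∈ R.hyps, ∃ F' ∈ Fnot, ∃ σ, F = F'.subst σ

/-- `red` is a version of the elimination of redundant hypotheses: `red` replaces clauses
`H ∧ H' ⇒ C` with `H' ⇒ C`, where `σ H ⊆ H'` for some `σ` that does not change the variables of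
`H'` and `C`. (Which clauses are replaced depends on user settings; taking
`red R = R`, the elimination is switched off.) -/
def IsElimRedundantHyp (red : Clause → Clause) : Prop :=
  ∀ R, ∃ (H : Multiset HornFact) (σ : Subst),
    R.hyps = H + (red R).hyps ∧ (red R).concl = R.concl ∧
    (∀ F ∈ H, F.subst σ ∈ (red R).hyps) ∧
    (∀ x, Var.ord x ∈ (red R).vars → σ.pat x = .var x) ∧
    (∀ i, Var.sess i ∈ (red R).vars → σ.sess i = .var i)

/-- `elimattx ∘ elimtaut ∘ elimnot ∘ elimredundanthyp ∘ elimdup ∘ decomp`. -/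
noncomputable def simplify (Fnot : Finset HornFact) (red : Clause → Clause) (R : Clause) :
    Set Clause :=
  {R'' | ∃ D ∈ decomp R, ¬ HasNotHyp Fnot (red (elimdup D)) ∧ ¬ IsTautology (red (elimdup D)) ∧
    R'' = elimattx (red (elimdup D))}

/-- `elimattx ∘ elimnot ∘ elimredundanthyp ∘ elimdup ∘ decomphyp`. -/
noncomputable def simplify' (Fnot : Finset HornFact) (red : Clause → Clause) (R : Clause) :
    Set Clause :=
  {R'' | ¬ HasNotHyp Fnot (red (elimdup (decomphyp R))) ∧
    R'' = elimattx (red (elimdup (decomphyp R)))}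

/-! ## The solving algorithm -/

/-- Unselectable facts: `attacker(x)` and must-events. -/
def HornFact.Unselectable (F : HornFact) : Prop :=
  (∃ x, F = .attacker (.var x)) ∨ ∃ p, F = .mevent p

/-- `sel` is a basic selection function `sel₀`: it selects one selectable hypothesis, if there
is any. -/
def IsSel₀ (sel : Clause → Set HornFact) : Prop :=
  ∀ R, ((∀ F ∈ R.hyps, F.Unselectable) → sel R = ∅) ∧
    ((∃ F ∈ R.hyps, ¬ F.Unselectable) → ∃ F₀ ∈ R.hyps, ¬ F₀.Unselectable ∧ sel R = {F₀})

/-- The parameters of the algorithm: the set of secrecy assumptions, the selection function and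
the elimination of redundant hypotheses. -/
structure Params where
  Fnot : Finset HornFact
  sel : Clause → Set HornFact
  red : Clause → Clause

/-- First step of the saturation: the clauses of the list are inserted one by one. -/
inductive Inserts (A : Params) : List Clause → Set Clause → Set Clause → Prop
  | nil (𝓡 : Set Clause) : Inserts A [] 𝓡 𝓡
  | cons {R : Clause} {L : List Clause} {𝓡 𝓡' 𝓡'' : Set Clause} :
      IsElim (simplify A.Fnot A.red R ∪ 𝓡) 𝓡' → Inserts A L 𝓡' 𝓡'' → Inserts A (R :: L) 𝓡 𝓡''

/-- Second step of the saturation, one effective iteration: a resolvent is added, and the set of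
clauses changes (up to renaming of variables). -/
def SatStep (A : Params) (𝓡 𝓡' : Set Clause) : Prop :=
  ∃ R ∈ 𝓡, A.sel R = ∅ ∧ ∃ R' ∈ 𝓡, ∃ F₀ ∈ A.sel R', ∃ R'', IsResolvent R F₀ R' R'' ∧
    IsElim (simplify A.Fnot A.red R'' ∪ 𝓡) 𝓡' ∧ ¬ SameClauses 𝓡 𝓡'

/-- `𝓡` is a fixpoint: no iteration changes it. -/
def IsFixpoint (A : Params) (𝓡 : Set Clause) : Prop := ¬ ∃ 𝓡', SatStep A 𝓡 𝓡'

/-- `𝓡₁` is a result of `saturate(𝓡₀)`, where the clauses of `𝓡₀` are inserted in the order of the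
list `L`. -/
def SaturateResult (A : Params) (L : List Clause) (𝓡₁ : Set Clause) : Prop :=
  ∃ 𝓡 𝓡', Inserts A L ∅ 𝓡 ∧ Relation.ReflTransGen (SatStep A) 𝓡 𝓡' ∧ IsFixpoint A 𝓡' ∧
    𝓡₁ = {R ∈ 𝓡' | A.sel R = ∅}

/-- `saturate(𝓡₀)` terminates: there is no infinite sequence of iterations. -/
def SaturateTerminates (A : Params) (L : List Clause) : Prop :=
  ∀ 𝓡, Inserts A L ∅ 𝓡 → Acc (fun 𝓡₂ 𝓡₁ => SatStep A 𝓡₁ 𝓡₂) 𝓡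

/-- The call `deriv(c.1, c.2, 𝓡₁)` makes the recursive call `deriv(d.1, d.2, 𝓡₁)`. -/
def DerivCalls (A : Params) (𝓡₁ : Set Clause) (c d : Clause × Set Clause) : Prop :=
  (¬ ∃ R' ∈ c.2, Subsumes R' c.1) ∧ A.sel c.1 ≠ ∅ ∧
    ∃ R' ∈ 𝓡₁, ∃ F₀ ∈ A.sel c.1, ∃ R'', IsResolvent R' F₀ c.1 R'' ∧
      d.1 ∈ simplify' A.Fnot A.red R'' ∧ d.2 = insert c.1 c.2

/-- `derivable(F, 𝓡₁) = deriv(F ⇒ F, ∅, 𝓡₁)` terminates: there is no infinite sequence of nested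
recursive calls. (Each call makes finitely many calls when `𝓡₁` is finite.) -/
def DerivableTerminates (A : Params) (F : HornFact) (𝓡₁ : Set Clause) : Prop :=
  Acc (fun d c => DerivCalls A 𝓡₁ c d) (⟨{F}, F⟩, ∅)

/-- The solving algorithm terminates on the fact `F` for the set `𝓡₀` of initial clauses:
the set `𝓡₀` is finite and, in whatever order its clauses are inserted, `saturate` terminates, its
result is finite, and `derivable` terminates on the secrecy assumptions and on `F`. -/
def SolveTerminates (A : Params) (𝓡₀ : Set Clause) (F : HornFact) : Prop :=
  𝓡₀.Finite ∧ ∀ L : List Clause, (∀ R, R ∈ L ↔ R ∈ 𝓡₀) →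
    SaturateTerminates A L ∧
    ∀ 𝓡₁, SaturateResult A L 𝓡₁ → 𝓡₁.Finite ∧
      (∀ F' ∈ A.Fnot, DerivableTerminates A F' 𝓡₁) ∧ DerivableTerminates A F 𝓡₁

/-! ## Queries -/

/-- Atoms of queries. -/
inductive Atom
  | attacker (M : Term)
  | message (M N : Term)
  | event (M : Term)

def Atom.terms : Atom → List Term
  | .attacker M => [M]
  | .message M N => [M, N]
  | .event M => [M]

/-- Closed atoms contain no variable (but may contain names). -/
def Atom.Closed (α : Atom) : Prop := ∀ M ∈ α.terms, ∀ x, ¬ Term.Sub (.var x) M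

/-- The fact of an atom: names `a` are replaced with `a[]`. -/
def Atom.toFact : Atom → HornFact
  | .attacker M => .attacker (M.toPattern .var freeName)
  | .message M N => .message (M.toPattern .var freeName) (N.toPattern .var freeName)
  | .event M => .event (M.toPattern .var freeName)

end CryptoHorn

open CryptoHorn

namespace CryptoHorn

/-! ## Patterns: induction, size, substitution -/

-- The intended execution supplies types. Its runtime names are encoded as patterns in the way the
-- clauses encode them, and the types are the finitely many subterms of the terms handled in it,
-- where all constants that are not tags (the keys) are identified with one pattern `star`. Every
-- protocol clause has an instance whose hypotheses and conclusion have such types: the translation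
-- walks through the same branches of the process, and the most general unifiers that it computes
-- are more general than the values of the execution (`Execution.translate_prot`). Each program
-- point is executed once and each tag belongs to one occurrence of a constructor, so the tag of a
-- cryptographic term determines its type, and the symbol of a name determines its arguments
-- (`Execution.typing`). Keys are identified because `pk` and `host` are not tagged: their arguments
-- may differ from place to place, but they are always keys.
--
-- Resolution preserves types. When a hypothesis `attacker(q)` and a conclusion `attacker(p)` unify
-- and neither is a variable or a tuple, their roots and their tags agree, hence so do their types
-- (`Typing.erase_eq`). Unifiable patterns with equal types have a unifier that respects the types
-- (`exists_unifier_of_erase_eq`); it factors through the most general one, so the resolvent has a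
-- typed instance again. Taggedness survives too. Replacing the untagged cryptographic terms in a
-- most general unifier of tagged patterns yields another unifier, which must be an instance of the
-- first, and this is impossible if anything was replaced (`IsMGU.tagged`).
--
-- The typed instances do not grow. In a simplified clause without selected hypothesis, the
-- hypotheses are `attacker(x)` for distinct variables `x` of the conclusion, and there are none if
-- the conclusion is `attacker` of a variable. So the instances of the hypotheses are together
-- smaller than that of the conclusion (`Solved.weight_lt`), and a resolution step replaces a typed
-- hypothesis by lighter ones. Finitely many types and a bounded weight leave finitely many clauses
-- up to renaming (`finite_prot`).
--
-- The clauses of the adversary need not be typed, but they have few shapes (`Shape`). Constructor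
-- clauses split a typed hypothesis into typed components. Decryption of a typed conclusion yields a
-- typed clause, of weight at most twice the size of a type. Projecting or decrypting what a
-- constructor clause builds, or listening to what the adversary sends, gives tautologies
-- (`saturation_step`). Signature verification is subsumed by message recovery, and its variant
-- without recovery by the clause for `true`.
--
-- Hence saturation stops: the set of representatives that are subsumed by the current clauses grows
-- strictly at each effective iteration (`acc_satStep`). Backward search from a closed fact stops
-- because the goals remain closed and their total size decreases, by `Solved.weight_lt` once more
-- (`derivable_terminates`).

theorem Pattern.induct {P : Pattern → Prop} (hv : ∀ x, P (.var x))
    (hn : ∀ a ps is, (∀ p ∈ ps, P p) → P (.name a ps is))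
    (ha : ∀ f ps, (∀ p ∈ ps, P p) → P (.app f ps)) : ∀ p, P p
  | .var x => hv x
  | .name a ps is => hn a ps is fun p _ => Pattern.induct hv hn ha p
  | .app f ps => ha f ps fun p _ => Pattern.induct hv hn ha p

theorem Term.induct {P : Term → Prop} (hv : ∀ x, P (.var x)) (hn : ∀ a, P (.name a))
    (ha : ∀ f Ms, (∀ M ∈ Ms, P M) → P (.app f Ms)) : ∀ M, P M
  | .var x => hv x
  | .name a => hn a
  | .app f Ms => ha f Ms fun M _ => Term.induct hv hn ha M

theorem occurs_var {v : Var} {x : ℕ} : v.Occurs (.var x) ↔ v = .ord x :=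
  ⟨fun h => by cases h; rfl, fun h => h ▸ .var x⟩

theorem occurs_name {v : Var} {s : NameSym} {ps : List Pattern} {is : List SessId} :
    v.Occurs (.name s ps is) ↔ (∃ p ∈ ps, v.Occurs p) ∨ ∃ i, v = .sess i ∧ SessId.var i ∈ is := by
  constructor
  · intro h
    cases h with
    | name h1 h2 => exact .inl ⟨_, h1, h2⟩
    | sess h => exact .inr ⟨_, rfl, h⟩
  · rintro (⟨p, h1, h2⟩ | ⟨i, rfl, h⟩)
    · exact .name h1 h2
    · exact .sess h

theorem occurs_app {v : Var} {f : Constr} {ps : List Pattern} :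
    v.Occurs (.app f ps) ↔ ∃ p ∈ ps, v.Occurs p := by
  constructor
  · intro h
    cases h with
    | app h1 h2 => exact ⟨_, h1, h2⟩
  · rintro ⟨p, h1, h2⟩
    exact .app h1 h2

/-- The size of a session identifier; replacing a variable by a constant increases it. -/
def SessId.size : SessId → ℕ
  | .var _ => 1
  | .const _ => 2

/-- The size of a pattern; replacing a variable by anything but a variable increases it. -/
def Pattern.size : Pattern → ℕ
  | .var _ => 1
  | .name _ ps is => 2 + (ps.map Pattern.size).sum + (is.map SessId.size).sum
  | .app _ ps => 2 + (ps.map Pattern.size).sum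

theorem Pattern.size_pos (p : Pattern) : 0 < p.size := by
  cases p <;> simp [Pattern.size]

theorem SessId.subst_subst (σ τ : Subst) (i : SessId) :
    (i.subst σ).subst τ = i.subst (σ.comp τ) := by
  cases i <;> rfl

theorem Pattern.subst_subst (σ τ : Subst) (p : Pattern) :
    (p.subst σ).subst τ = p.subst (σ.comp τ) := by
  induction p using Pattern.induct with
  | hv x => simp [Pattern.subst, Subst.comp]
  | hn a ps is ih =>
    simp only [Pattern.subst, List.map_map, Pattern.name.injEq, true_and]
    exact ⟨List.map_congr_left ih, List.map_congr_left fun i _ => SessId.subst_subst σ τ i⟩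
  | ha f ps ih =>
    simp only [Pattern.subst, List.map_map, Pattern.app.injEq, true_and]
    exact List.map_congr_left ih

/-- Two substitutions agree on a variable. -/
def Var.Agree (σ τ : Subst) : Var → Prop
  | .ord x => σ.pat x = τ.pat x
  | .sess i => σ.sess i = τ.sess i

theorem Pattern.subst_congr {σ τ : Subst} {p : Pattern} (h : ∀ v : Var, v.Occurs p → v.Agree σ τ) :
    p.subst σ = p.subst τ := by
  induction p using Pattern.induct with
  | hv x => simpa [Pattern.subst, Var.Agree] using h (.ord x) (.var x)
  | hn a ps is ih =>
    simp only [Pattern.subst, Pattern.name.injEq, true_and]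
    refine ⟨List.map_congr_left fun p hp => ih p hp fun v hv => h v (.name hp hv),
      List.map_congr_left fun i hi => ?_⟩
    cases i with
    | var i => exact h (.sess i) (.sess hi)
    | const l => rfl
  | ha f ps ih =>
    simp only [Pattern.subst, Pattern.app.injEq, true_and]
    exact List.map_congr_left fun p hp => ih p hp fun v hv => h v (.app hp hv)

/-- The identity substitution. -/
def Subst.id : Subst := ⟨.var, .var⟩

theorem Pattern.subst_id (p : Pattern) : p.subst .id = p := by
  induction p using Pattern.induct with
  | hv x => simp [Pattern.subst, Subst.id]
  | hn a ps is ih =>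
    simp only [Pattern.subst, Pattern.name.injEq, true_and]
    refine ⟨(List.map_congr_left ih).trans (List.map_id _), ?_⟩
    refine (List.map_congr_left fun i _ => ?_).trans (List.map_id _)
    cases i <;> rfl
  | ha f ps ih =>
    simp only [Pattern.subst, Pattern.app.injEq, true_and]
    exact (List.map_congr_left ih).trans (List.map_id _)

theorem Pattern.subst_eq_self {σ : Subst} {p : Pattern}
    (h : ∀ v : Var, v.Occurs p → v.Agree σ .id) : p.subst σ = p :=
  (Pattern.subst_congr h).trans p.subst_id

theorem Pattern.occurs_subst {σ : Subst} {p : Pattern} {v : Var} :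
    v.Occurs (p.subst σ) ↔ (∃ x, Var.Occurs (.ord x) p ∧ v.Occurs (σ.pat x)) ∨
      ∃ i j, Var.Occurs (.sess i) p ∧ v = .sess j ∧ σ.sess i = .var j := by
  induction p using Pattern.induct with
  | hv x => simp [Pattern.subst, occurs_var]
  | hn a ps is ih =>
    simp only [Pattern.subst, occurs_name, List.mem_map, reduceCtorEq, false_and, exists_false,
      or_false, Var.sess.injEq]
    constructor
    · rintro (⟨_, ⟨p, hp, rfl⟩, hv⟩ | ⟨j, rfl, i, hi, hj⟩)
      · rcases (ih p hp).1 hv with ⟨x, h1, h2⟩ | ⟨i, j, h1, h2, h3⟩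
        · exact .inl ⟨x, ⟨p, hp, h1⟩, h2⟩
        · exact .inr ⟨i, j, .inl ⟨p, hp, h1⟩, h2, h3⟩
      · cases i with
        | var i => exact .inr ⟨i, j, .inr ⟨i, rfl, hi⟩, rfl, hj⟩
        | const l => simp [SessId.subst] at hj
    · rintro (⟨x, ⟨p, hp, h1⟩, h2⟩ | ⟨i, j, ⟨p, hp, h1⟩ | ⟨i', rfl, hi⟩, rfl, h3⟩)
      · exact .inl ⟨_, ⟨p, hp, rfl⟩, (ih p hp).2 (.inl ⟨x, h1, h2⟩)⟩
      · exact .inl ⟨_, ⟨p, hp, rfl⟩, (ih p hp).2 (.inr ⟨i, j, h1, rfl, h3⟩)⟩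
      · exact .inr ⟨j, rfl, _, hi, h3⟩
  | ha f ps ih =>
    simp only [Pattern.subst, occurs_app, List.mem_map]
    constructor
    · rintro ⟨_, ⟨p, hp, rfl⟩, hv⟩
      rcases (ih p hp).1 hv with ⟨x, h1, h2⟩ | ⟨i, j, h1, h2, h3⟩
      · exact .inl ⟨x, ⟨p, hp, h1⟩, h2⟩
      · exact .inr ⟨i, j, ⟨p, hp, h1⟩, h2, h3⟩
    · rintro (⟨x, ⟨p, hp, h1⟩, h2⟩ | ⟨i, j, ⟨p, hp, h1⟩, rfl, h3⟩)
      · exact ⟨_, ⟨p, hp, rfl⟩, (ih p hp).2 (.inl ⟨x, h1, h2⟩)⟩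
      · exact ⟨_, ⟨p, hp, rfl⟩, (ih p hp).2 (.inr ⟨i, j, h1, rfl, h3⟩)⟩

/-- The occurrences of ordinary variables. -/
def Pattern.ovars : Pattern → List ℕ
  | .var x => [x]
  | .name _ ps _ => ps.flatMap Pattern.ovars
  | .app _ ps => ps.flatMap Pattern.ovars

/-- The session identifier variable of a session identifier. -/
def SessId.svars : SessId → List ℕ
  | .var i => [i]
  | .const _ => []

/-- The occurrences of session identifier variables. -/
def Pattern.svars : Pattern → List ℕ
  | .var _ => []
  | .name _ ps is => ps.flatMap Pattern.svars ++ is.flatMap SessId.svars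
  | .app _ ps => ps.flatMap Pattern.svars

theorem Pattern.mem_ovars {p : Pattern} {x : ℕ} : x ∈ p.ovars ↔ Var.Occurs (.ord x) p := by
  induction p using Pattern.induct with
  | hv y => simp [Pattern.ovars, occurs_var]
  | hn a ps is ih =>
    simp only [Pattern.ovars, occurs_name, List.mem_flatMap, reduceCtorEq, false_and, exists_false,
      or_false]
    exact exists_congr fun p => and_congr_right fun hp => ih p hp
  | ha f ps ih =>
    simp only [Pattern.ovars, occurs_app, List.mem_flatMap]
    exact exists_congr fun p => and_congr_right fun hp => ih p hp

theorem SessId.mem_svars {i : SessId} {j : ℕ} : j ∈ i.svars ↔ i = .var j := by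
  cases i <;> simp [SessId.svars, eq_comm]

theorem Pattern.mem_svars {p : Pattern} {i : ℕ} : i ∈ p.svars ↔ Var.Occurs (.sess i) p := by
  induction p using Pattern.induct with
  | hv y => simp [Pattern.svars, occurs_var]
  | hn a ps is ih =>
    simp only [Pattern.svars, occurs_name, List.mem_flatMap, List.mem_append, Var.sess.injEq,
      SessId.mem_svars, exists_eq_right, exists_eq_left']
    exact or_congr_left (exists_congr fun p => and_congr_right fun hp => ih p hp)
  | ha f ps ih =>
    simp only [Pattern.svars, occurs_app, List.mem_flatMap]
    exact exists_congr fun p => and_congr_right fun hp => ih p hp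

-- Sizes of instances, and numbers of variables

theorem list_sum_map_le {α : Type*} {l : List α} {f g : α → ℕ} (h : ∀ a ∈ l, f a ≤ g a) :
    (l.map f).sum ≤ (l.map g).sum := List.sum_le_sum h

theorem list_flatMap_map_sum {α β : Type*} (l : List α) (f : α → List β) (g : β → ℕ) :
    ((l.flatMap f).map g).sum = (l.map fun a => ((f a).map g).sum).sum := by
  induction l with
  | nil => simp
  | cons a l ih => simp [ih]

theorem SessId.size_le_subst (σ : Subst) (i : SessId) : i.size ≤ (i.subst σ).size := by
  cases i with
  | var i => simp only [SessId.size]; cases h : (SessId.var i).subst σ <;> simp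
  | const l => simp [SessId.subst]

theorem Pattern.size_le_subst (σ : Subst) (p : Pattern) : p.size ≤ (p.subst σ).size := by
  induction p using Pattern.induct with
  | hv x => simpa only [Pattern.size] using Nat.succ_le_of_lt (Pattern.size_pos (Pattern.subst σ (.var x)))
  | hn a ps is ih =>
    simp only [Pattern.subst, Pattern.size, List.map_map]
    have h1 := list_sum_map_le (f := Pattern.size) (g := Pattern.size ∘ Pattern.subst σ) ih
    have h2 := list_sum_map_le (l := is) (f := SessId.size) (g := SessId.size ∘ SessId.subst σ)
      fun i _ => SessId.size_le_subst σ i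
    omega
  | ha f ps ih =>
    simp only [Pattern.subst, Pattern.size, List.map_map]
    have h1 := list_sum_map_le (f := Pattern.size) (g := Pattern.size ∘ Pattern.subst σ) ih
    omega

/-- Every occurrence of a variable contributes at least 1 to the size. A bound on sizes thus bounds
the number of variables, which allows clauses to be counted up to renaming. -/
theorem Pattern.vars_length_le (p : Pattern) : p.ovars.length + p.svars.length ≤ p.size := by
  have key : ∀ ps : List Pattern, (∀ p ∈ ps, p.ovars.length + p.svars.length ≤ p.size) →
      (ps.flatMap Pattern.ovars).length + (ps.flatMap Pattern.svars).length ≤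
        (ps.map Pattern.size).sum := by
    intro ps
    induction ps with
    | nil => simp
    | cons p ps ih =>
      intro h
      have h1 := h p (by simp)
      have h2 := ih fun q hq => h q (by simp [hq])
      simp only [List.flatMap_cons, List.length_append, List.map_cons, List.sum_cons]
      omega
  induction p using Pattern.induct with
  | hv x => simp [Pattern.ovars, Pattern.svars, Pattern.size]
  | hn a ps is ih =>
    have h1 := key ps ih
    have h2 : (is.flatMap SessId.svars).length ≤ (is.map SessId.size).sum := by
      rw [List.length_flatMap]
      refine list_sum_map_le fun i _ => ?_
      cases i <;> simp [SessId.svars, SessId.size]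
    simp only [Pattern.ovars, Pattern.svars, Pattern.size, List.length_append]
    omega
  | ha f ps ih =>
    have h1 := key ps ih
    simp only [Pattern.ovars, Pattern.svars, Pattern.size]
    omega

/-- The pattern is a variable. -/
def Pattern.IsVar (p : Pattern) : Prop := ∃ x, p = .var x

/-- Each occurrence of `x` in `p` puts a separate copy of `σ x` into the instance. Unless `p` is a
variable, its root symbol adds to the size, which makes the inequality strict. -/
theorem Pattern.sum_ovars_add_le (σ : Subst) (p : Pattern) :
    (p.ovars.map fun x => (σ.pat x).size).sum ≤ (p.subst σ).size ∧
    (¬ p.IsVar → (p.ovars.map fun x => (σ.pat x).size).sum < (p.subst σ).size) := by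
  have key : ∀ ps : List Pattern,
      (∀ p ∈ ps, (p.ovars.map fun x => (σ.pat x).size).sum ≤ (p.subst σ).size) →
      ((ps.flatMap Pattern.ovars).map fun x => (σ.pat x).size).sum ≤
        ((ps.map (Pattern.subst σ)).map Pattern.size).sum := by
    intro ps h
    rw [list_flatMap_map_sum, List.map_map]
    exact list_sum_map_le h
  induction p using Pattern.induct with
  | hv x => exact ⟨by simp [Pattern.ovars, Pattern.subst], fun h => (h ⟨x, rfl⟩).elim⟩
  | hn a ps is ih =>
    have h1 := key ps fun p hp => (ih p hp).1
    simp only [Pattern.ovars, Pattern.subst, Pattern.size]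
    omega
  | ha f ps ih =>
    have h1 := key ps fun p hp => (ih p hp).1
    simp only [Pattern.ovars, Pattern.subst, Pattern.size]
    omega

theorem Pattern.sum_le_of_nodup {σ : Subst} {p : Pattern} {l : List ℕ} (hl : l.Nodup)
    (h : ∀ x ∈ l, Var.Occurs (.ord x) p) :
    (l.map fun x => (σ.pat x).size).sum ≤ (p.ovars.map fun x => (σ.pat x).size).sum := by
  have h1 : l.Subperm p.ovars := hl.subperm fun x hx => Pattern.mem_ovars.2 (h x hx)
  obtain ⟨l', h2, h3⟩ := h1
  have h4 := (h2.map fun x => (σ.pat x).size).sum_eq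
  rw [← h4]
  exact (h3.map _).sum_le_sum fun _ _ => Nat.zero_le _

/-! ## Facts and clauses -/

theorem HornFact.subst_subst (σ τ : Subst) (F : HornFact) :
    (F.subst σ).subst τ = F.subst (σ.comp τ) := by
  cases F <;> simp [HornFact.subst, Pattern.subst_subst]

theorem HornFact.subst_congr {σ τ : Subst} {F : HornFact} (h : ∀ v ∈ F.vars, v.Agree σ τ) :
    F.subst σ = F.subst τ := by
  have key : ∀ p ∈ F.patterns, p.subst σ = p.subst τ :=
    fun p hp => Pattern.subst_congr fun v hv => h v ⟨p, hp, hv⟩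
  cases F <;> simp_all [HornFact.subst, HornFact.patterns]

theorem HornFact.subst_eq_self {σ : Subst} {F : HornFact} (h : ∀ v ∈ F.vars, v.Agree σ .id) :
    F.subst σ = F := by
  rw [HornFact.subst_congr h]
  cases F <;> simp [HornFact.subst, Pattern.subst_id]

theorem HornFact.Closed.subst_eq {F : HornFact} (h : F.Closed) (σ : Subst) : F.subst σ = F :=
  HornFact.subst_eq_self fun v hv => by
    rw [HornFact.Closed] at h
    rw [h] at hv
    exact hv.elim

theorem HornFact.mem_vars_subst {σ : Subst} {F : HornFact} {v : Var} :
    v ∈ (F.subst σ).vars ↔ (∃ x, Var.ord x ∈ F.vars ∧ v.Occurs (σ.pat x)) ∨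
      ∃ i j, Var.sess i ∈ F.vars ∧ v = .sess j ∧ σ.sess i = .var j := by
  have hp : (F.subst σ).patterns = F.patterns.map (Pattern.subst σ) := by cases F <;> rfl
  simp only [HornFact.vars, Set.mem_ofPred_eq, hp, List.mem_map]
  constructor
  · rintro ⟨_, ⟨p, hp, rfl⟩, hv⟩
    rcases Pattern.occurs_subst.1 hv with ⟨x, h1, h2⟩ | ⟨i, j, h1, h2, h3⟩
    · exact .inl ⟨x, ⟨p, hp, h1⟩, h2⟩
    · exact .inr ⟨i, j, ⟨p, hp, h1⟩, h2, h3⟩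
  · rintro (⟨x, ⟨p, hp, h1⟩, h2⟩ | ⟨i, j, ⟨p, hp, h1⟩, rfl, h3⟩)
    · exact ⟨_, ⟨p, hp, rfl⟩, Pattern.occurs_subst.2 (.inl ⟨x, h1, h2⟩)⟩
    · exact ⟨_, ⟨p, hp, rfl⟩, Pattern.occurs_subst.2 (.inr ⟨i, j, h1, rfl, h3⟩)⟩

theorem vars_attacker {p : Pattern} {v : Var} : v ∈ (HornFact.attacker p).vars ↔ v.Occurs p := by
  simp [HornFact.vars, HornFact.patterns]

theorem vars_event {p : Pattern} {v : Var} : v ∈ (HornFact.event p).vars ↔ v.Occurs p := by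
  simp [HornFact.vars, HornFact.patterns]

theorem vars_message {p q : Pattern} {v : Var} :
    v ∈ (HornFact.message p q).vars ↔ v.Occurs p ∨ v.Occurs q := by
  simp [HornFact.vars, HornFact.patterns]

/-- The size of a fact. -/
def HornFact.size : HornFact → ℕ
  | .attacker p => p.size
  | .message p q => 1 + p.size + q.size
  | .mevent p => 1 + p.size
  | .event p => 1 + p.size

/-- The total size of the instances of facts. -/
def weight (σ : Subst) (H : Multiset HornFact) : ℕ := (H.map fun F => (F.subst σ).size).sum

theorem weight_add (σ : Subst) (H H' : Multiset HornFact) :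
    weight σ (H + H') = weight σ H + weight σ H' := by simp [weight]

theorem weight_cons (σ : Subst) (F : HornFact) (H : Multiset HornFact) :
    weight σ (F ::ₘ H) = (F.subst σ).size + weight σ H := by simp [weight]

theorem weight_le {σ : Subst} {H H' : Multiset HornFact} (h : H ≤ H') :
    weight σ H ≤ weight σ H' := by
  obtain ⟨K, rfl⟩ := Multiset.le_iff_exists_add.1 h
  rw [weight_add]
  omega

theorem weight_subst (σ τ : Subst) (H : Multiset HornFact) :
    weight τ (H.map (HornFact.subst σ)) = weight (σ.comp τ) H := by
  simp only [weight, Multiset.map_map, Function.comp_def, HornFact.subst_subst]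

theorem weight_congr {σ τ : Subst} {H : Multiset HornFact}
    (h : ∀ F ∈ H, (F.subst σ).size = (F.subst τ).size) : weight σ H = weight τ H := by
  rw [weight, weight, Multiset.map_congr rfl h]

theorem multiset_sum_le_of_forall {α : Type*} {m : Multiset α} {f g : α → ℕ}
    (h : ∀ a ∈ m, f a ≤ g a) : (m.map f).sum ≤ (m.map g).sum :=
  Multiset.sum_map_le_sum_map f g h

theorem list_eq_of_sum_eq {α : Type*} {l : List α} {f g : α → ℕ} (h : ∀ a ∈ l, f a ≤ g a)
    (hs : (l.map f).sum = (l.map g).sum) : ∀ a ∈ l, f a = g a := by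
  induction l with
  | nil => simp
  | cons b l ih =>
    simp only [List.map_cons, List.sum_cons] at hs
    have h1 := h b (by simp)
    have h2 := list_sum_map_le (l := l) (f := f) (g := g) fun a ha => h a (by simp [ha])
    intro a ha
    rcases List.mem_cons.1 ha with rfl | ha
    · omega
    · exact ih (fun a ha => h a (by simp [ha])) (by omega) a ha

theorem multiset_eq_of_sum_eq {α : Type*} {m : Multiset α} {f g : α → ℕ}
    (h : ∀ a ∈ m, f a ≤ g a) (hs : (m.map f).sum = (m.map g).sum) : ∀ a ∈ m, f a = g a := by
  induction m using Quotient.inductionOn with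
  | h l => exact list_eq_of_sum_eq (l := l) h (by simpa using hs)

/-! ## Subsumption -/

theorem Clause.subst_subst (σ τ : Subst) (R : Clause) :
    (R.subst σ).subst τ = R.subst (σ.comp τ) := by
  simp only [Clause.subst, Multiset.map_map, HornFact.subst_subst, Clause.mk.injEq, and_true]
  exact Multiset.map_congr rfl fun F _ => HornFact.subst_subst σ τ F

theorem Clause.subst_congr {σ τ : Subst} {R : Clause} (h : ∀ v ∈ R.vars, v.Agree σ τ) :
    R.subst σ = R.subst τ := by
  simp only [Clause.subst, Clause.mk.injEq]
  exact ⟨Multiset.map_congr rfl fun F hF => HornFact.subst_congr fun v hv => h v (.inr ⟨F, hF, hv⟩),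
    HornFact.subst_congr fun v hv => h v (.inl hv)⟩

theorem Clause.subst_eq_self {σ : Subst} {R : Clause} (h : ∀ v ∈ R.vars, v.Agree σ .id) :
    R.subst σ = R := by
  simp only [Clause.subst]
  congr 1
  · exact (Multiset.map_congr rfl fun F hF => HornFact.subst_eq_self fun v hv =>
      h v (.inr ⟨F, hF, hv⟩)).trans (Multiset.map_id _)
  · exact HornFact.subst_eq_self fun v hv => h v (.inl hv)

theorem Clause.mem_vars_subst {σ : Subst} {R : Clause} {v : Var} :
    v ∈ (R.subst σ).vars ↔ (∃ x, Var.ord x ∈ R.vars ∧ v.Occurs (σ.pat x)) ∨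
      ∃ i j, Var.sess i ∈ R.vars ∧ v = .sess j ∧ σ.sess i = .var j := by
  simp only [Clause.vars, Clause.subst, Set.mem_ofPred_eq, Multiset.mem_map, exists_exists_and_eq_and,
    HornFact.mem_vars_subst]
  constructor
  · rintro ((⟨x, h1, h2⟩ | ⟨i, j, h1, h2⟩) | ⟨F, hF, (⟨x, h1, h2⟩ | ⟨i, j, h1, h2⟩)⟩)
    · exact .inl ⟨x, .inl h1, h2⟩
    · exact .inr ⟨i, j, .inl h1, h2⟩
    · exact .inl ⟨x, .inr ⟨F, hF, h1⟩, h2⟩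
    · exact .inr ⟨i, j, .inr ⟨F, hF, h1⟩, h2⟩
  · rintro (⟨x, h1 | ⟨F, hF, h1⟩, h2⟩ | ⟨i, j, h1 | ⟨F, hF, h1⟩, h2⟩)
    · exact .inl (.inl ⟨x, h1, h2⟩)
    · exact .inr ⟨F, hF, .inl ⟨x, h1, h2⟩⟩
    · exact .inl (.inr ⟨i, j, h1, h2⟩)
    · exact .inr ⟨F, hF, .inr ⟨i, j, h1, h2⟩⟩

theorem Subsumes.refl (R : Clause) : Subsumes R R :=
  ⟨.id, HornFact.subst_eq_self fun v _ => by cases v <;> rfl,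
    ((Multiset.map_congr rfl fun F _ => HornFact.subst_eq_self fun v _ => by
      cases v <;> rfl).trans (Multiset.map_id _)).le⟩

theorem Subsumes.trans {R₁ R₂ R₃ : Clause} (h₁ : Subsumes R₁ R₂) (h₂ : Subsumes R₂ R₃) :
    Subsumes R₁ R₃ := by
  obtain ⟨σ, h1, h2⟩ := h₁
  obtain ⟨τ, h3, h4⟩ := h₂
  refine ⟨σ.comp τ, by rw [← HornFact.subst_subst, h1, h3], le_trans ?_ h4⟩
  have := Multiset.map_le_map (f := HornFact.subst τ) h2
  rw [Multiset.map_map] at this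
  rwa [Multiset.map_congr rfl fun F _ => (HornFact.subst_subst σ τ F).symm]

/-- The total size of a clause. -/
def Clause.size (R : Clause) : ℕ := R.concl.size + (R.hyps.map HornFact.size).sum

theorem HornFact.size_le_subst (σ : Subst) (F : HornFact) : F.size ≤ (F.subst σ).size := by
  cases F <;> simp only [HornFact.subst, HornFact.size]
  · exact Pattern.size_le_subst σ _
  · rename_i p q
    have := p.size_le_subst σ
    have := q.size_le_subst σ
    omega
  · rename_i p
    have := p.size_le_subst σ
    omega
  · rename_i p
    have := p.size_le_subst σ
    omega

/-- The substitution replaces the variable by a variable. -/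
def Var.Renamed (σ : Subst) : Var → Prop
  | .ord x => ∃ y, σ.pat x = .var y
  | .sess i => ∃ j, σ.sess i = .var j

/-- A variable has size 1 and any other pattern at least 2; likewise a constant session identifier
is larger than a variable one. A substitution that leaves the size unchanged can therefore only put
variables for variables, though not necessarily injectively. -/
theorem Pattern.renamed_of_size_eq {σ : Subst} {p : Pattern} (h : (p.subst σ).size = p.size) :
    ∀ v : Var, v.Occurs p → v.Renamed σ := by
  induction p using Pattern.induct with
  | hv x =>
    intro v hv
    rw [occurs_var] at hv
    subst hv
    simp only [Pattern.subst] at h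
    simp only [Var.Renamed]
    cases h1 : σ.pat x with
    | var y => exact ⟨y, rfl⟩
    | name a ps is => rw [h1] at h; simp [Pattern.size] at h; omega
    | app f ps => rw [h1] at h; simp [Pattern.size] at h; omega
  | hn a ps is ih =>
    simp only [Pattern.subst, Pattern.size, List.map_map] at h
    have h1 := list_sum_map_le (l := ps) (f := Pattern.size) (g := Pattern.size ∘ Pattern.subst σ)
      fun p _ => p.size_le_subst σ
    have h2 := list_sum_map_le (l := is) (f := SessId.size) (g := SessId.size ∘ SessId.subst σ)
      fun i _ => SessId.size_le_subst σ i
    intro v hv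
    rcases occurs_name.1 hv with ⟨p, hp, hv⟩ | ⟨i, rfl, hi⟩
    · exact ih p hp (list_eq_of_sum_eq (fun p _ => p.size_le_subst σ)
        (g := Pattern.size ∘ Pattern.subst σ) (by omega) p hp).symm v hv
    · have h3 := list_eq_of_sum_eq (l := is) (f := SessId.size) (g := SessId.size ∘ SessId.subst σ)
        (fun i _ => SessId.size_le_subst σ i) (by omega) _ hi
      simp only [Function.comp, SessId.subst, SessId.size] at h3
      simp only [Var.Renamed]
      cases h4 : σ.sess i with
      | var j => exact ⟨j, rfl⟩
      | const l => rw [h4] at h3; simp at h3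
  | ha f ps ih =>
    simp only [Pattern.subst, Pattern.size, List.map_map] at h
    intro v hv
    obtain ⟨p, hp, hv⟩ := occurs_app.1 hv
    exact ih p hp (list_eq_of_sum_eq (fun p _ => p.size_le_subst σ)
        (g := Pattern.size ∘ Pattern.subst σ) (by omega) p hp).symm v hv

theorem HornFact.renamed_of_size_eq {σ : Subst} {F : HornFact} (h : (F.subst σ).size = F.size) :
    ∀ v ∈ F.vars, v.Renamed σ := by
  rintro v ⟨p, hp, hv⟩
  cases F with
  | attacker q =>
    simp only [HornFact.patterns, List.mem_singleton] at hp
    subst hp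
    exact Pattern.renamed_of_size_eq h v hv
  | message q q' =>
    simp only [HornFact.subst, HornFact.size] at h
    have h1 := q.size_le_subst σ
    have h2 := q'.size_le_subst σ
    simp only [HornFact.patterns, List.mem_cons, List.not_mem_nil, or_false] at hp
    rcases hp with rfl | rfl
    · exact Pattern.renamed_of_size_eq (by omega) v hv
    · exact Pattern.renamed_of_size_eq (by omega) v hv
  | mevent q =>
    simp only [HornFact.patterns, List.mem_singleton] at hp
    subst hp
    simp only [HornFact.subst, HornFact.size] at h
    exact Pattern.renamed_of_size_eq (by omega) v hv
  | event q =>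
    simp only [HornFact.patterns, List.mem_singleton] at hp
    subst hp
    simp only [HornFact.subst, HornFact.size] at h
    exact Pattern.renamed_of_size_eq (by omega) v hv

theorem Clause.size_le_subst (σ : Subst) (R : Clause) : R.size ≤ (R.subst σ).size := by
  simp only [Clause.size, Clause.subst, Multiset.map_map]
  have h1 := R.concl.size_le_subst σ
  have h2 := multiset_sum_le_of_forall (m := R.hyps) (f := HornFact.size)
    (g := HornFact.size ∘ HornFact.subst σ) fun F _ => F.size_le_subst σ
  omega

theorem Clause.renamed_of_size_eq {σ : Subst} {R : Clause} (h : (R.subst σ).size = R.size) :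
    ∀ v ∈ R.vars, v.Renamed σ := by
  simp only [Clause.size, Clause.subst, Multiset.map_map] at h
  have h1 := R.concl.size_le_subst σ
  have h2 := multiset_sum_le_of_forall (m := R.hyps) (f := HornFact.size)
    (g := HornFact.size ∘ HornFact.subst σ) fun F _ => F.size_le_subst σ
  rintro v (hv | ⟨F, hF, hv⟩)
  · exact HornFact.renamed_of_size_eq (by omega) v hv
  · exact HornFact.renamed_of_size_eq (multiset_eq_of_sum_eq (m := R.hyps) (f := HornFact.size)
      (g := HornFact.size ∘ HornFact.subst σ) (fun F _ => F.size_le_subst σ) (by omega) F hF).symm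
      v hv

-- Mutual subsumption is equality up to renaming

theorem Pattern.finite_vars (p : Pattern) : {v : Var | v.Occurs p}.Finite := by
  refine ((p.ovars.finite_toSet.image Var.ord).union (p.svars.finite_toSet.image Var.sess)).subset ?_
  intro v hv
  cases v with
  | ord x => exact .inl ⟨x, Pattern.mem_ovars.2 hv, rfl⟩
  | sess x => exact .inr ⟨x, Pattern.mem_svars.2 hv, rfl⟩

theorem HornFact.finite_vars (F : HornFact) : F.vars.Finite := by
  have : F.vars = ⋃ p ∈ {p | p ∈ F.patterns}, {v : Var | v.Occurs p} := by
    ext v; simp [HornFact.vars]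
  rw [this]
  exact (List.finite_toSet _).biUnion fun p _ => p.finite_vars

theorem Clause.finite_vars (R : Clause) : R.vars.Finite := by
  have : R.vars = R.concl.vars ∪ ⋃ F ∈ {F | F ∈ R.hyps}, F.vars := by
    ext v; simp [Clause.vars]
  rw [this]
  refine R.concl.finite_vars.union (Set.Finite.biUnion ?_ fun F _ => F.finite_vars)
  exact Multiset.finite_toSet _

/-- The cardinalities force `W` to be the whole image of `V` and `f` to be injective on `V`. The
complements of `V` and of the image are both denumerable, so the bijection extends to all of `ℕ`. -/
theorem exists_perm_extend {V W : Set ℕ} (hV : V.Finite) {f : ℕ → ℕ}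
    (hf : W ⊆ f '' V) (hVW : V.ncard ≤ W.ncard) : ∃ π : Equiv.Perm ℕ, ∀ x ∈ V, π x = f x := by
  have h1 : (f '' V).ncard ≤ V.ncard := Set.ncard_image_le hV
  have h2 : W = f '' V := Set.eq_of_subset_of_ncard_le hf (by omega) (hV.image f)
  have h3 : Set.InjOn f V := Set.injOn_of_ncard_image_eq (by rw [← h2]; rw [← h2] at h1; omega) hV
  have h4 : Vᶜ.Infinite := hV.infinite_compl
  have h5 : (f '' V)ᶜ.Infinite := (hV.image f).infinite_compl
  have : Infinite {x // ¬ x ∈ V} := h4.to_subtype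
  have : Infinite {x // ¬ x ∈ f '' V} := h5.to_subtype
  obtain ⟨d1⟩ := nonempty_denumerable {x // ¬ x ∈ V}
  obtain ⟨d2⟩ := nonempty_denumerable {x // ¬ x ∈ f '' V}
  classical
  let e : {x // x ∈ V} ≃ {x // x ∈ f '' V} := Equiv.Set.imageOfInjOn f V h3
  refine ⟨Equiv.subtypeCongr e (Denumerable.equiv₂ _ _), fun x hx => ?_⟩
  simp [Equiv.subtypeCongr, Equiv.sumCompl_symm_apply_of_pos hx, e, Equiv.Set.imageOfInjOn]

/-- The variable that replaces the ordinary variable `x`. -/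
def Subst.ordName (σ : Subst) (x : ℕ) : ℕ :=
  match σ.pat x with
  | .var y => y
  | _ => 0

/-- The variable that replaces the session identifier variable `i`. -/
def Subst.sessName (σ : Subst) (i : ℕ) : ℕ :=
  match σ.sess i with
  | .var j => j
  | _ => 0

/-- Instances are never smaller, so neither substitution changes the size and both only rename
variables. Each renaming is onto the variables of the other clause; counting, separately for the two
sorts of variables, makes them bijective. -/
theorem Clause.exists_perm {R R' : Clause} {σ τ : Subst} (h : R.subst σ = R')
    (h' : R'.subst τ = R) : R.Variant R' := by
  have hs1 := R.size_le_subst σ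
  have hs2 := R'.size_le_subst τ
  rw [h] at hs1
  rw [h'] at hs2
  have hσ := Clause.renamed_of_size_eq (R := R) (σ := σ) (by rw [h]; omega)
  have hτ := Clause.renamed_of_size_eq (R := R') (σ := τ) (by rw [h']; omega)
  have hord : ∀ {S S' : Clause} {ρ : Subst}, S.subst ρ = S' → (∀ v ∈ S.vars, v.Renamed ρ) →
      Var.ord ⁻¹' S'.vars ⊆ ρ.ordName '' (Var.ord ⁻¹' S.vars) := by
    rintro S _ ρ rfl hρ y hy
    rcases Clause.mem_vars_subst.1 hy with ⟨x, hx, hxy⟩ | ⟨i, j, _, hv, _⟩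
    · obtain ⟨z, hz⟩ := hρ _ hx
      rw [hz, occurs_var] at hxy
      cases hxy
      exact ⟨x, hx, by simp [Subst.ordName, hz]⟩
    · cases hv
  have hsess : ∀ {S S' : Clause} {ρ : Subst}, S.subst ρ = S' → (∀ v ∈ S.vars, v.Renamed ρ) →
      Var.sess ⁻¹' S'.vars ⊆ ρ.sessName '' (Var.sess ⁻¹' S.vars) := by
    rintro S _ ρ rfl hρ y hy
    rcases Clause.mem_vars_subst.1 hy with ⟨x, hx, hxy⟩ | ⟨i, j, hi, hv, hj⟩
    · obtain ⟨z, hz⟩ := hρ _ hx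
      rw [hz, occurs_var] at hxy
      cases hxy
    · cases hv
      exact ⟨i, hi, by simp [Subst.sessName, hj]⟩
  have fo : ∀ S : Clause, (Var.ord ⁻¹' S.vars).Finite := fun S =>
    S.finite_vars.preimage fun _ _ _ _ h => by cases h; rfl
  have fs : ∀ S : Clause, (Var.sess ⁻¹' S.vars).Finite := fun S =>
    S.finite_vars.preimage fun _ _ _ _ h => by cases h; rfl
  obtain ⟨π, hπ⟩ := exists_perm_extend (fo R) (hord h hσ)
    ((Set.ncard_le_ncard (hord h' hτ) ((fo R').image _)).trans (Set.ncard_image_le (fo R')))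
  obtain ⟨π', hπ'⟩ := exists_perm_extend (fs R) (hsess h hσ)
    ((Set.ncard_le_ncard (hsess h' hτ) ((fs R').image _)).trans (Set.ncard_image_le (fs R')))
  refine ⟨π, π', ?_⟩
  rw [← h]
  refine Clause.subst_congr fun v hv => ?_
  cases v with
  | ord x =>
    obtain ⟨y, hy⟩ := hσ _ hv
    simp [Var.Agree, permSubst, hπ x hv, hy, Subst.ordName]
  | sess x =>
    obtain ⟨y, hy⟩ := hσ _ hv
    simp [Var.Agree, permSubst, hπ' x hv, hy, Subst.sessName]

theorem Subsumes.card_le {R R' : Clause} (h : Subsumes R R') : R.hyps.card ≤ R'.hyps.card := by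
  obtain ⟨σ, -, h⟩ := h
  simpa using Multiset.card_le_card h

/-- The two inclusions of multisets force equal numbers of hypotheses, hence equalities, so each
clause is an instance of the other. -/
theorem variant_of_subsumes {R R' : Clause} (h : Subsumes R R') (h' : Subsumes R' R) :
    R.Variant R' := by
  have c1 := h.card_le
  have c2 := h'.card_le
  obtain ⟨σ, h1, h2⟩ := h
  obtain ⟨τ, h3, h4⟩ := h'
  refine Clause.exists_perm (σ := σ) (τ := τ) ?_ ?_
  · rw [Clause.subst, h1, Multiset.eq_of_le_of_card_le h2 (by simpa using c2)]
  · rw [Clause.subst, h3, Multiset.eq_of_le_of_card_le h4 (by simpa using c1)]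

/-! ## Termination of the saturation from an invariant with finitely many clauses -/

/-- No clause of the set subsumes another one. -/
def ClauseAntichain (𝓡 : Set Clause) : Prop := ∀ R ∈ 𝓡, ∀ R' ∈ 𝓡, Subsumes R' R → R' = R

/-- The measure is the number of representatives in `𝒞` that no clause of the current set subsumes.
Elimination loses none of those already subsumed. If an iteration gained none, the old and the new
set would subsume each other clause by clause; as neither contains two comparable clauses, they
would coincide up to renaming, and the iteration would not be effective. -/
theorem acc_satStep {A : Params} {Cl : Clause → Prop} {𝒞 : Set Clause} (h𝒞 : 𝒞.Finite)
    (hrep : ∀ R, Cl R → ∃ C ∈ 𝒞, Subsumes R C ∧ Subsumes C R)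
    (hstep : ∀ 𝓡, ClauseAntichain 𝓡 → (∀ R ∈ 𝓡, Cl R) → ∀ R ∈ 𝓡, A.sel R = ∅ → ∀ R' ∈ 𝓡,
      ∀ F₀ ∈ A.sel R', ∀ R'', IsResolvent R F₀ R' R'' → ∀ D ∈ simplify A.Fnot A.red R'', Cl D)
    (𝓡 : Set Clause) (hanti : ClauseAntichain 𝓡) (hCl : ∀ R ∈ 𝓡, Cl R) :
    Acc (fun 𝓡₂ 𝓡₁ => SatStep A 𝓡₁ 𝓡₂) 𝓡 := by
  set U : Set Clause → Set Clause := fun 𝓢 => {C ∈ 𝒞 | ∃ R ∈ 𝓢, Subsumes R C} with hU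
  have hUf : ∀ 𝓢, (U 𝓢).Finite := fun 𝓢 => h𝒞.subset fun _ h => h.1
  induction hn : 𝒞.ncard - (U 𝓡).ncard using Nat.strong_induction_on generalizing 𝓡 with
  | _ n ih =>
    subst hn
    refine ⟨_, fun 𝓡' hs => ?_⟩
    obtain ⟨R, hR, hRs, R', hR', F₀, hF₀, R'', hres, hel, hne⟩ := hs
    have hCl' : ∀ S ∈ 𝓡', Cl S := fun S hS => (hel.1 hS).elim
      (hstep 𝓡 hanti hCl R hR hRs R' hR' F₀ hF₀ R'' hres S) (hCl S)
    have hanti' : ClauseAntichain 𝓡' := hel.2.2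
    have hsub : U 𝓡 ⊆ U 𝓡' := by
      rintro C ⟨hC, S, hS, hSC⟩
      obtain ⟨S', hS', h⟩ := hel.2.1 S (.inr hS)
      exact ⟨hC, S', hS', h.trans hSC⟩
    have hneU : U 𝓡 ≠ U 𝓡' := by
      intro heq
      have back : ∀ S' ∈ 𝓡', ∃ S ∈ 𝓡, Subsumes S S' := by
        intro S' hS'
        obtain ⟨C, hC, h1, h2⟩ := hrep S' (hCl' S' hS')
        have : C ∈ U 𝓡 := heq ▸ ⟨hC, S', hS', h1⟩
        obtain ⟨-, S, hS, h3⟩ := this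
        exact ⟨S, hS, h3.trans h2⟩
      have forth : ∀ S ∈ 𝓡, ∃ S' ∈ 𝓡', Subsumes S' S := fun S hS => hel.2.1 S (.inr hS)
      refine hne ⟨fun S hS => ?_, fun S' hS' => ?_⟩
      · obtain ⟨S', hS', h1⟩ := forth S hS
        -- Going to the other set and back yields a clause that subsumes `S`; in an antichain this
        -- is `S` itself.
        obtain ⟨S₂, hS₂, h2⟩ := back S' hS'
        have := hanti S hS S₂ hS₂ (h2.trans h1)
        subst this
        exact ⟨S', hS', variant_of_subsumes h2 h1⟩
      · obtain ⟨S, hS, h1⟩ := back S' hS'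
        obtain ⟨S₂, hS₂, h2⟩ := forth S hS
        have := hanti' S' hS' S₂ hS₂ (h2.trans h1)
        subst this
        exact ⟨S, hS, variant_of_subsumes h1 h2⟩
    have hlt : (U 𝓡).ncard < (U 𝓡').ncard :=
      Set.ncard_lt_ncard (hsub.ssubset_of_ne hneU) (hUf _)
    have hle : (U 𝓡').ncard ≤ 𝒞.ncard := Set.ncard_le_ncard (fun _ h => h.1) h𝒞
    exact ih _ (by omega) 𝓡' hanti' hCl' rfl

/-! ## Decomposition of tuples -/

/-- The pattern is a tuple. -/
def Pattern.IsTuple (p : Pattern) : Prop := ∃ n ps, p = .app (.tuple n) ps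

theorem Pattern.flatten_of_not_isTuple {p : Pattern} (h : ¬ p.IsTuple) : p.flatten = [p] := by
  cases p with
  | var x => simp [Pattern.flatten]
  | name a ps is => simp [Pattern.flatten]
  | app f ps =>
    cases f <;> first | exact (h ⟨_, _, rfl⟩).elim | simp [Pattern.flatten]

theorem Pattern.flatten_tuple (n : ℕ) (ps : List Pattern) :
    (Pattern.app (.tuple n) ps).flatten = ps.flatMap Pattern.flatten := by
  simp [Pattern.flatten]

theorem Pattern.flatten_induct {P : Pattern → Prop} (h : ∀ p : Pattern, ¬ p.IsTuple → P p)
    (ht : ∀ n ps, (∀ p ∈ ps, P p) → P (.app (.tuple n) ps)) (p : Pattern) : P p := by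
  induction p using Pattern.induct with
  | hv x => exact h _ (by rintro ⟨n, ps, h⟩; cases h)
  | hn a ps is _ => exact h _ (by rintro ⟨n, ps, h⟩; cases h)
  | ha f ps ih =>
    by_cases hf : (Pattern.app f ps).IsTuple
    · obtain ⟨n, ps', he⟩ := hf
      cases he
      exact ht n ps ih
    · exact h _ hf

theorem Pattern.not_isTuple_of_mem_flatten {p q : Pattern} (hq : q ∈ p.flatten) : ¬ q.IsTuple := by
  induction p using Pattern.flatten_induct with
  | h p hp =>
    rw [Pattern.flatten_of_not_isTuple hp, List.mem_singleton] at hq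
    exact hq ▸ hp
  | ht n ps ih =>
    rw [Pattern.flatten_tuple, List.mem_flatMap] at hq
    obtain ⟨p, hp, hq⟩ := hq
    exact ih p hp hq

theorem Pattern.flatten_forall {P : Pattern → Prop}
    (hP : ∀ n ps, P (.app (.tuple n) ps) → ∀ p ∈ ps, P p) {p q : Pattern} (hp : P p)
    (hq : q ∈ p.flatten) : P q := by
  induction p using Pattern.flatten_induct with
  | h p h =>
    rw [Pattern.flatten_of_not_isTuple h, List.mem_singleton] at hq
    exact hq ▸ hp
  | ht n ps ih =>
    rw [Pattern.flatten_tuple, List.mem_flatMap] at hq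
    obtain ⟨p, h, hq⟩ := hq
    exact ih p h (hP n ps hp p h) hq

/-- Decomposition only discards tuple symbols, so it never makes the hypotheses of a clause heavier.
-/
theorem Pattern.flatten_sum_le (σ : Subst) (p : Pattern) :
    (p.flatten.map fun q => (q.subst σ).size).sum ≤ (p.subst σ).size := by
  induction p using Pattern.flatten_induct with
  | h p h => simp [Pattern.flatten_of_not_isTuple h]
  | ht n ps ih =>
    rw [Pattern.flatten_tuple, list_flatMap_map_sum]
    simp only [Pattern.subst, Pattern.size, List.map_map]
    have := list_sum_map_le (g := Pattern.size ∘ Pattern.subst σ) ih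
    omega

theorem HornFact.decomp_weight_le (σ : Subst) (F : HornFact) :
    weight σ (F.decomp : Multiset HornFact) ≤ (F.subst σ).size := by
  cases F with
  | attacker p =>
    have := p.flatten_sum_le σ
    simpa [weight, HornFact.decomp, HornFact.subst, HornFact.size, Function.comp_def] using this
  | _ => simp [weight, HornFact.decomp]

theorem Clause.mem_decompHyps {R : Clause} {F : HornFact} :
    F ∈ R.decompHyps ↔ ∃ G ∈ R.hyps, F ∈ G.decomp := by
  simp [Clause.decompHyps]

theorem Clause.weight_decompHyps_le (σ : Subst) (R : Clause) :
    weight σ R.decompHyps ≤ weight σ R.hyps := by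
  simp only [weight, Clause.decompHyps, Multiset.map_bind, Multiset.sum_bind]
  exact multiset_sum_le_of_forall fun F _ => F.decomp_weight_le σ

theorem HornFact.vars_of_mem_decomp {F G : HornFact} (h : F ∈ G.decomp) : F.vars ⊆ G.vars := by
  intro v hv
  cases G with
  | attacker p =>
    simp only [HornFact.decomp, List.mem_map] at h
    obtain ⟨q, hq, rfl⟩ := h
    rw [vars_attacker] at hv ⊢
    exact Pattern.flatten_forall (P := fun r => v.Occurs r → v.Occurs p)
      (fun n ps hr r hr' hv => hr (.app hr' hv)) id hq hv
  | _ =>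
    simp only [HornFact.decomp, List.mem_singleton] at h
    exact h ▸ hv

/-! ## Elimination of hypotheses -/

/-- If `F` were eliminated, its image under `σ` would remain. But `σ` fixes the variables of the
conclusion, hence `F` itself. -/
theorem HornFact.mem_of_red {red : Clause → Clause} (hred : IsElimRedundantHyp red) {R : Clause}
    {F : HornFact} (hF : F ∈ R.hyps) (hv : F.vars ⊆ R.concl.vars) : F ∈ (red R).hyps := by
  obtain ⟨H, σ, h1, h2, h3, h4, h5⟩ := hred R
  rw [h1, Multiset.mem_add] at hF
  refine hF.elim (fun hF => ?_) id
  have h6 := h3 F hF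
  rwa [HornFact.subst_eq_self] at h6
  intro v hvF
  have h7 : v ∈ (red R).vars := .inl (h2 ▸ hv hvF)
  cases v with
  | ord x => exact h4 x h7
  | sess i => exact h5 i h7

/-- The elimination of duplicate, redundant and useless hypotheses. -/
noncomputable def elimhyps (red : Clause → Clause) (R : Clause) : Clause :=
  elimattx (red (elimdup R))

theorem elimattx_hyps_le (R : Clause) : (elimattx R).hyps ≤ R.hyps := by
  classical
  simp only [elimattx]
  exact Multiset.filter_le _ _

theorem red_concl {red : Clause → Clause} (hred : IsElimRedundantHyp red) (R : Clause)
    : (red R).concl = R.concl := by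
  obtain ⟨H, σ, h1, h2, -⟩ := hred R
  exact h2

theorem red_hyps_le {red : Clause → Clause} (hred : IsElimRedundantHyp red) (R : Clause)
    : (red R).hyps ≤ R.hyps := by
  obtain ⟨H, σ, h1, h2, -⟩ := hred R
  conv_rhs => rw [h1]
  exact Multiset.le_add_left _ _

theorem elimhyps_concl {red : Clause → Clause} (hred : IsElimRedundantHyp red) (R : Clause)
    : (elimhyps red R).concl = R.concl := red_concl hred _

theorem red_elimdup_hyps_le {red : Clause → Clause} (hred : IsElimRedundantHyp red) (R : Clause)
    : (red (elimdup R)).hyps ≤ R.hyps := by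
  classical
  refine (red_hyps_le hred _).trans ?_
  simp only [elimdup]
  convert Multiset.dedup_le R.hyps

theorem red_elimdup_nodup {red : Clause → Clause} (hred : IsElimRedundantHyp red) (R : Clause)
    : (red (elimdup R)).hyps.Nodup := by
  classical
  refine Multiset.nodup_of_le (red_hyps_le hred _) ?_
  simp only [elimdup]
  convert Multiset.nodup_dedup R.hyps

theorem elimhyps_hyps_le {red : Clause → Clause} (hred : IsElimRedundantHyp red) (R : Clause)
    : (elimhyps red R).hyps ≤ R.hyps :=
  (elimattx_hyps_le _).trans (red_elimdup_hyps_le hred R)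

theorem elimhyps_nodup {red : Clause → Clause} (hred : IsElimRedundantHyp red) (R : Clause)
    : (elimhyps red R).hyps.Nodup :=
  Multiset.nodup_of_le (elimattx_hyps_le _) (red_elimdup_nodup hred R)

theorem mem_red_elimdup {red : Clause → Clause} (hred : IsElimRedundantHyp red) (R : Clause)
    {F : HornFact} (hF : F ∈ R.hyps) (hv : F.vars ⊆ R.concl.vars) :
    F ∈ (red (elimdup R)).hyps := by
  classical
  refine HornFact.mem_of_red hred ?_ hv
  simpa [elimdup] using hF

theorem mem_elimhyps {red : Clause → Clause} (hred : IsElimRedundantHyp red) (R : Clause)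
    {F : HornFact} (hF : F ∈ R.hyps) (hv : F.vars ⊆ R.concl.vars) :
    F ∈ (elimhyps red R).hyps := by
  classical
  have h1 := mem_red_elimdup hred R hF hv
  simp only [elimhyps, elimattx, Multiset.mem_filter]
  refine ⟨h1, ?_⟩
  rintro ⟨x, K, rfl, -, h2, -⟩
  rw [red_concl hred] at h2
  exact h2 (hv (vars_attacker.2 (.var x)))

/-- When all remaining hypotheses are `attacker` of variables and there are no duplicates, each
variable occurs in one hypothesis only. If it were also absent from the conclusion, `elimattx` would
have removed that hypothesis. -/
theorem elimhyps_useful {red : Clause → Clause} (hred : IsElimRedundantHyp red) (R : Clause)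
    (h : ∀ F ∈ (elimhyps red R).hyps, ∃ x, F = .attacker (.var x)) :
    ∀ F ∈ (elimhyps red R).hyps, F.vars ⊆ R.concl.vars := by
  classical
  have hnd := red_elimdup_nodup hred R
  have hc : (red (elimdup R)).concl = R.concl := red_concl hred _
  set D := red (elimdup R) with hD
  intro F hF
  obtain ⟨x, rfl⟩ := h F hF
  have hF' := hF
  simp only [elimhyps, elimattx, Multiset.mem_filter, ← hD] at hF
  obtain ⟨h1, h2⟩ := hF
  obtain ⟨K, hK⟩ := Multiset.exists_cons_of_mem h1
  intro v hv
  rw [vars_attacker, occurs_var] at hv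
  subst hv
  by_contra hx
  refine h2 ⟨x, K, rfl, hK, by rwa [hc], fun F' hF'K hxF' => ?_⟩
  rw [hK, Multiset.nodup_cons] at hnd
  have hne : F' ≠ .attacker (.var x) := fun he => hnd.1 (he ▸ hF'K)
  have hmem : F' ∈ D.hyps := hK ▸ Multiset.mem_cons_of_mem hF'K
  -- The uselessness of `attacker(x)` is judged before anything is removed, so `F'` may itself be a
  -- hypothesis that `elimattx` drops. In that case it is `attacker` of a variable as well.
  by_cases hu : UselessAttacker D F'
  · obtain ⟨y, K', rfl, -⟩ := hu
    rw [vars_attacker, occurs_var] at hxF'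
    cases hxF'
    exact hne rfl
  · have h3 : F' ∈ (elimhyps red R).hyps := by
      simp only [elimhyps, elimattx, Multiset.mem_filter, ← hD]
      exact ⟨hmem, hu⟩
    obtain ⟨y, rfl⟩ := h F' h3
    rw [vars_attacker, occurs_var] at hxF'
    cases hxF'
    exact hne rfl

/-- Secrecy assumptions only discard clauses, so their test can be forgotten. The tautology test may
be moved before the eliminations, since a hypothesis equal to the conclusion is never redundant. -/
theorem mem_simplify {Fnot : Finset HornFact} {red : Clause → Clause}
    (hred : IsElimRedundantHyp red) {R D : Clause} (h : D ∈ simplify Fnot red R) :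
    ∃ D₀ ∈ decomp R, D = elimhyps red D₀ ∧ D₀.concl ∉ D₀.hyps := by
  obtain ⟨D₀, h1, -, h3, rfl⟩ := h
  refine ⟨D₀, h1, rfl, fun h4 => h3 ?_⟩
  rw [IsTautology, red_concl hred]
  exact mem_red_elimdup hred D₀ h4 subset_rfl

theorem elimhyps_not_taut {red : Clause → Clause} (hred : IsElimRedundantHyp red) {D₀ : Clause}
    (h : D₀.concl ∉ D₀.hyps) : (elimhyps red D₀).concl ∉ (elimhyps red D₀).hyps := by
  rw [elimhyps_concl hred]
  exact fun h1 => h (Multiset.mem_of_le (elimhyps_hyps_le hred D₀) h1)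

/-- Decomposition treats hypotheses and conclusion alike, so every component of the conclusion of a
tautology is again among the hypotheses. -/
theorem simplify_of_taut {Fnot : Finset HornFact} {red : Clause → Clause}
    (hred : IsElimRedundantHyp red) {R : Clause} (h : R.concl ∈ R.hyps) :
    simplify Fnot red R = ∅ := by
  refine Set.eq_empty_of_forall_notMem fun D hD => ?_
  obtain ⟨D₀, h1, -, h2⟩ := mem_simplify hred hD
  refine h2 ?_
  unfold decomp at h1
  split_ifs at h1 with hd
  · rw [Set.mem_singleton_iff] at h1
    exact h1 ▸ h
  · obtain ⟨h3, h4⟩ := h1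
    rw [h3]
    exact Clause.mem_decompHyps.2 ⟨_, h, h4⟩

theorem attackers_eq_list {H : Multiset HornFact} (h : ∀ F ∈ H, ∃ x, F = .attacker (.var x))
    (hn : H.Nodup) : ∃ l : List ℕ, l.Nodup ∧
      H = ((l.map fun x => HornFact.attacker (.var x) : List HornFact) : Multiset HornFact) := by
  induction H using Multiset.induction with
  | empty => exact ⟨[], by simp, by simp⟩
  | cons F H ih =>
    obtain ⟨x, rfl⟩ := h F (by simp)
    obtain ⟨h1, h2⟩ := Multiset.nodup_cons.1 hn
    obtain ⟨l, h3, rfl⟩ := ih (fun F hF => h F (by simp [hF])) h2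
    refine ⟨x :: l, List.nodup_cons.2 ⟨fun hx => h1 ?_, h3⟩, by simp⟩
    simpa using hx

theorem weight_attackers (σ : Subst) (l : List ℕ) :
    weight σ ((l.map fun x => HornFact.attacker (.var x) : List HornFact) : Multiset HornFact) =
      (l.map fun x => (σ.pat x).size).sum := by
  simp [weight, HornFact.subst, Pattern.subst, HornFact.size, Function.comp_def]

/-! ## Termination of backward search from closed facts -/

/-- The properties of a clause of the result of the saturation on which the termination of the
backward search relies. -/
structure Solved (R : Clause) : Prop where
  hyps_var : ∀ F ∈ R.hyps, ∃ x, F = .attacker (.var x) ∧ Var.ord x ∈ R.concl.vars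
  nodup : R.hyps.Nodup
  concl_var : ∀ x, R.concl = .attacker (.var x) → R.hyps = 0

/-- The variables of the hypotheses are distinct and occur in the conclusion, so their instances sit
at disjoint places of the instance of the conclusion. This inequality drives both termination
arguments: it bounds the weight during saturation and makes backward search decrease. -/
theorem Solved.weight_lt {R : Clause} (h : Solved R) (σ : Subst) :
    weight σ R.hyps < (R.concl.subst σ).size := by
  obtain ⟨l, hl, hH⟩ := attackers_eq_list (fun F hF => (h.hyps_var F hF).imp fun _ h => h.1) h.nodup
  have hlv : ∀ x ∈ l, Var.ord x ∈ R.concl.vars := by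
    intro x hx
    obtain ⟨y, h1, h2⟩ := h.hyps_var (.attacker (.var x)) (by rw [hH]; simpa using hx)
    cases h1
    exact h2
  have hc := h.concl_var
  rw [hH, weight_attackers]
  cases hR : R.concl with
  | attacker p =>
    simp only [HornFact.subst, HornFact.size]
    rw [hR] at hlv
    by_cases hp : p.IsVar
    · obtain ⟨x, rfl⟩ := hp
      -- Strictness could fail only for `attacker(x) ⇒ attacker(x)`; a clause with such a conclusion
      -- has no hypothesis at all.
      have h0 := hc x hR
      rw [hH] at h0
      have : l = [] := by simpa using h0
      subst this
      simpa using Pattern.size_pos _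
    · exact (Pattern.sum_le_of_nodup hl fun x hx => vars_attacker.1 (hlv x hx)).trans_lt
        ((Pattern.sum_ovars_add_le σ p).2 hp)
  | message p q =>
    simp only [HornFact.subst, HornFact.size]
    rw [hR] at hlv
    have h1 : l.Subperm (p.ovars ++ q.ovars) := hl.subperm fun x hx => by
      rw [List.mem_append, Pattern.mem_ovars, Pattern.mem_ovars]
      exact vars_message.1 (hlv x hx)
    obtain ⟨l', h2, h3⟩ := h1
    have h4 := (h2.map fun x => (σ.pat x).size).sum_eq
    have h5 := (h3.map fun x => (σ.pat x).size).sum_le_sum fun _ _ => Nat.zero_le _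
    have h6 := (Pattern.sum_ovars_add_le σ p).1
    have h7 := (Pattern.sum_ovars_add_le σ q).1
    rw [List.map_append, List.sum_append] at h5
    omega
  | mevent p =>
    simp only [HornFact.subst, HornFact.size]
    rw [hR] at hlv
    have h1 := (Pattern.sum_le_of_nodup (σ := σ) (p := p) hl fun x hx => by
      simpa [HornFact.vars, HornFact.patterns] using hlv x hx)
    have h2 := (Pattern.sum_ovars_add_le σ p).1
    omega
  | event p =>
    simp only [HornFact.subst, HornFact.size]
    rw [hR] at hlv
    have h1 := (Pattern.sum_le_of_nodup (σ := σ) (p := p) hl fun x hx => vars_event.1 (hlv x hx))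
    have h2 := (Pattern.sum_ovars_add_le σ p).1
    omega

theorem Solved.variant {R S : Clause} (h : Solved R) (hS : R.Variant S) : Solved S := by
  obtain ⟨π, π', rfl⟩ := hS
  have hinj : Function.Injective fun x => HornFact.attacker (.var (π x)) :=
    fun x y hxy => by simpa using hxy
  obtain ⟨l, hl, hH⟩ := attackers_eq_list (fun F hF => (h.hyps_var F hF).imp fun _ h => h.1) h.nodup
  refine ⟨fun F hF => ?_, ?_, fun x hx => ?_⟩
  · obtain ⟨G, hG, rfl⟩ := Multiset.mem_map.1 hF
    obtain ⟨x, rfl, hx⟩ := h.hyps_var G hG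
    refine ⟨π x, by simp [HornFact.subst, Pattern.subst, permSubst], ?_⟩
    exact HornFact.mem_vars_subst.2 (.inl ⟨x, hx, .var _⟩)
  · simp only [Clause.subst, hH, Multiset.map_coe, List.map_map, Function.comp_def,
      HornFact.subst, Pattern.subst, permSubst, Multiset.coe_nodup]
    exact hl.map hinj
  · simp only [Clause.subst] at hx ⊢
    cases hc : R.concl with
    | attacker p =>
      rw [hc] at hx
      simp only [HornFact.subst, HornFact.attacker.injEq] at hx
      cases p with
      | var y => rw [h.concl_var y hc]; simp
      | name a ps is => simp [Pattern.subst] at hx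
      | app f ps => simp [Pattern.subst] at hx
    | _ => rw [hc] at hx; simp [HornFact.subst] at hx

/-- The selected goal `F₀` is closed, so it is the instance of the conclusion of the clause used.
The new goals are instances of variables of that conclusion: they are closed and together smaller
than `F₀`. Simplification does not increase the total size, and the subsumption test of the search
plays no role. -/
theorem derivable_terminates {A : Params} (hred : IsElimRedundantHyp A.red)
    {𝓡₁ : Set Clause} (h𝓡 : ∀ R ∈ 𝓡₁, Solved R) {F : HornFact}
    (hF : F.Closed) : DerivableTerminates A F 𝓡₁ := by
  suffices H : ∀ (n : ℕ) (c : Clause × Set Clause), (∀ G ∈ c.1.hyps, G.Closed) →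
      weight .id c.1.hyps = n → Acc (fun d c => DerivCalls A 𝓡₁ c d) c by
    refine H _ _ ?_ rfl
    simpa using hF
  intro n
  induction n using Nat.strong_induction_on with
  | _ n ih =>
    rintro c hc rfl
    refine ⟨_, fun d hd => ?_⟩
    obtain ⟨-, -, R', hR', F₀, hF₀, R'', ⟨S, K, θ, hRS, -, hK, hθ, rfl⟩, hd, -⟩ := hd
    have hF₀c : F₀.Closed := hc F₀ (by rw [hK]; simp)
    have hSs := (h𝓡 R' hR').variant hRS
    have hun : S.concl.subst θ = F₀ := hθ.unifies.trans (hF₀c.subst_eq θ)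
    have hclosed : ∀ G ∈ (S.hyps + K).map (HornFact.subst θ), G.Closed := by
      intro G hG
      obtain ⟨G', hG', rfl⟩ := Multiset.mem_map.1 hG
      rcases Multiset.mem_add.1 hG' with h | h
      · obtain ⟨x, rfl, hx⟩ := hSs.hyps_var G' h
        refine Set.eq_empty_of_forall_notMem fun v hv => ?_
        have : v ∈ F₀.vars := by
          rw [← hun]
          refine HornFact.mem_vars_subst.2 (.inl ⟨x, hx, ?_⟩)
          simpa [HornFact.subst, Pattern.subst, vars_attacker] using hv
        rw [hF₀c] at this
        exact this
      · have hG'c := hc G' (by rw [hK]; simp [h])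
        rwa [hG'c.subst_eq]
    obtain ⟨-, hd⟩ := hd
    set R'' := Clause.subst θ ⟨S.hyps + K, c.1.concl⟩ with hR''
    have hle : (d.1).hyps ≤ (decomphyp R'').hyps := by
      rw [hd]
      exact elimhyps_hyps_le hred _
    have hdec : (∀ G ∈ (decomphyp R'').hyps, G.Closed) ∧
        weight .id (decomphyp R'').hyps ≤ weight .id R''.hyps := by
      unfold decomphyp
      split_ifs with hdc
      · exact ⟨hclosed, le_rfl⟩
      · refine ⟨fun G hG => ?_, Clause.weight_decompHyps_le _ _⟩
        obtain ⟨G', h1, h2⟩ := Clause.mem_decompHyps.1 hG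
        have h3 := hclosed G' h1
        exact Set.subset_empty_iff.1 (h3 ▸ HornFact.vars_of_mem_decomp h2)
    refine ih _ ?_ d (fun G hG => hdec.1 G (Multiset.mem_of_le hle hG)) rfl
    refine (weight_le hle).trans_lt (hdec.2.trans_lt ?_)
    rw [hR'', hK]
    simp only [Clause.subst]
    rw [weight_subst, weight_add, weight_cons]
    have h1 := hSs.weight_lt (θ.comp .id)
    rw [← HornFact.subst_subst, hun] at h1
    have h2 : weight (θ.comp .id) K = weight .id K := by
      refine weight_congr fun G hG => ?_
      have hGc := hc G (by rw [hK]; simp [hG])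
      rw [hGc.subst_eq, hGc.subst_eq]
    omega

theorem list_map_eq_self {α : Type*} {l : List α} {f : α → α} :
    l.map f = l ↔ ∀ a ∈ l, f a = a := by
  induction l with
  | nil => simp
  | cons a l ih => simp [ih]

/-! ## Types: patterns up to the choice of keys -/

/-- The pattern that stands for all keys in types. -/
def star : Pattern := .name .b₀ [] []

/-- The pattern is the name of a key. -/
def IsKey (K : Set ℕ) (p : Pattern) : Prop := ∃ a ∈ K, p = freeName a

open Classical in
/-- The type of a pattern: all keys are identified. -/
noncomputable def Pattern.erase (K : Set ℕ) : Pattern → Pattern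
  | .var x => .var x
  | .name s ps is =>
      if IsKey K (.name s ps is) then star else .name s (ps.map (Pattern.erase K)) is
  | .app f ps => .app f (ps.map (Pattern.erase K))

theorem isKey_name {K : Set ℕ} {s : NameSym} {ps : List Pattern} {is : List SessId} :
    IsKey K (.name s ps is) ↔ (∃ a ∈ K, s = .nm a) ∧ ps = [] ∧ is = [] := by
  constructor
  · rintro ⟨a, ha, h⟩
    cases h
    exact ⟨⟨a, ha, rfl⟩, rfl, rfl⟩
  · rintro ⟨⟨a, ha, rfl⟩, rfl, rfl⟩
    exact ⟨a, ha, rfl⟩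

theorem not_isKey_star (K : Set ℕ) : ¬ IsKey K star := by
  rintro ⟨a, -, h⟩
  cases h

theorem erase_key {K : Set ℕ} {p : Pattern} (h : IsKey K p) : p.erase K = star := by
  obtain ⟨a, ha, rfl⟩ := h
  have : IsKey K (.name (.nm a) [] []) := ⟨a, ha, rfl⟩
  simp [freeName, Pattern.erase, this]

theorem erase_name {K : Set ℕ} {s : NameSym} {ps : List Pattern} {is : List SessId}
    (h : ¬ IsKey K (.name s ps is)) :
    (Pattern.name s ps is).erase K = .name s (ps.map (Pattern.erase K)) is := by
  simp [Pattern.erase, h]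

theorem erase_app (K : Set ℕ) (f : Constr) (ps : List Pattern) :
    (Pattern.app f ps).erase K = .app f (ps.map (Pattern.erase K)) := by
  simp [Pattern.erase]

theorem erase_star (K : Set ℕ) : star.erase K = star := by
  rw [star, erase_name (not_isKey_star K), List.map_nil]

theorem erase_erase (K : Set ℕ) (p : Pattern) : (p.erase K).erase K = p.erase K := by
  induction p using Pattern.induct with
  | hv x => simp [Pattern.erase]
  | hn s ps is ih =>
    by_cases h : IsKey K (.name s ps is)
    · rw [erase_key h, erase_star]
    · have h' : ¬ IsKey K (.name s (ps.map (Pattern.erase K)) is) := by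
        rw [isKey_name] at h ⊢
        simpa using h
      rw [erase_name h, erase_name h', List.map_map]
      congr 1
      exact List.map_congr_left ih
  | ha f ps ih =>
    rw [erase_app, erase_app, List.map_map]
    congr 1
    exact List.map_congr_left ih

theorem size_erase (K : Set ℕ) (p : Pattern) : (p.erase K).size = p.size := by
  induction p using Pattern.induct with
  | hv x => simp [Pattern.erase]
  | hn s ps is ih =>
    by_cases h : IsKey K (.name s ps is)
    · rw [erase_key h]
      obtain ⟨a, -, h⟩ := h
      rw [h]
      simp [star, freeName, Pattern.size]
    · rw [erase_name h]
      simp only [Pattern.size, List.map_map]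
      rw [List.map_congr_left (f := Pattern.size ∘ Pattern.erase K) (g := Pattern.size) ih]
  | ha f ps ih =>
    rw [erase_app]
    simp only [Pattern.size, List.map_map]
    rw [List.map_congr_left (f := Pattern.size ∘ Pattern.erase K) (g := Pattern.size) ih]

theorem erase_subst_congr {K : Set ℕ} {σ τ : Subst}
    (h : ∀ x, (σ.pat x).erase K = (τ.pat x).erase K) (hs : σ.sess = τ.sess) (p : Pattern) :
    (p.subst σ).erase K = (p.subst τ).erase K := by
  induction p using Pattern.induct with
  | hv x => simpa [Pattern.subst] using h x
  | hn s ps is ih =>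
    have his : is.map (SessId.subst σ) = is.map (SessId.subst τ) :=
      List.map_congr_left fun i _ => by cases i <;> simp [SessId.subst, hs]
    simp only [Pattern.subst]
    by_cases hk : IsKey K (.name s (ps.map (Pattern.subst σ)) (is.map (SessId.subst σ)))
    · have hk' : IsKey K (.name s (ps.map (Pattern.subst τ)) (is.map (SessId.subst τ))) := by
        rw [isKey_name] at hk ⊢
        simpa using hk
      rw [erase_key hk, erase_key hk']
    · have hk' : ¬ IsKey K (.name s (ps.map (Pattern.subst τ)) (is.map (SessId.subst τ))) := by
        rw [isKey_name] at hk ⊢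
        simpa using hk
      rw [erase_name hk, erase_name hk', his, List.map_map, List.map_map]
      congr 1
      exact List.map_congr_left ih
  | ha f ps ih =>
    simp only [Pattern.subst, erase_app, List.map_map, Pattern.app.injEq, true_and]
    exact List.map_congr_left ih

/-- The immediate subpatterns. -/
def Pattern.children : Pattern → List Pattern
  | .var _ => []
  | .name _ ps _ => ps
  | .app _ ps => ps

open Classical in
mutual
/-- A pattern of type `s`, with the keys that `t` has at the same places. -/
noncomputable def refineType (K : Set ℕ) : Pattern → Pattern → Pattern
  | _, .var x => .var x
  | t, .name s ss is =>
      if Pattern.name s ss is = star then (if IsKey K t then t else star)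
      else .name s (refineTypes K t.children ss) is
  | t, .app f ss => .app f (refineTypes K t.children ss)
/-- Patterns of given types with the keys that other patterns have at the same places. -/
noncomputable def refineTypes (K : Set ℕ) : List Pattern → List Pattern → List Pattern
  | _, [] => []
  | ts, s :: ss => refineType K (ts.headD star) s :: refineTypes K ts.tail ss
end

theorem refineTypes_map {K : Set ℕ} {α : Type*} (ps : List α) (f g h : α → Pattern)
    (H : ∀ p ∈ ps, refineType K (f p) (g p) = h p) :
    refineTypes K (ps.map f) (ps.map g) = ps.map h := by
  induction ps with
  | nil => simp [refineTypes]
  | cons p ps ih =>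
    simp only [List.map_cons, refineTypes, List.headD_cons, List.tail_cons]
    rw [H p (by simp), ih fun q hq => H q (by simp [hq])]

theorem refineTypes_erase {K : Set ℕ} {ss : List Pattern}
    (H : ∀ s ∈ ss, ∀ t, (refineType K t s).erase K = s) (ts : List Pattern) :
    (refineTypes K ts ss).map (Pattern.erase K) = ss := by
  induction ss generalizing ts with
  | nil => simp [refineTypes]
  | cons s ss ih =>
    simp only [refineTypes, List.map_cons]
    rw [H s (by simp), ih fun q hq => H q (by simp [hq])]

/-- Refinement follows the two instances in parallel. Above the variables of `p` both have the
structure of `p`, so the result is again an instance of `p`, with the refinement carried out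
variable by variable. -/
theorem refineType_subst (K : Set ℕ) (θ σ : Subst) (p : Pattern) :
    refineType K (p.subst θ) ((p.subst σ).erase K) =
      p.subst ⟨fun x => refineType K (θ.pat x) ((σ.pat x).erase K), σ.sess⟩ := by
  induction p using Pattern.induct with
  | hv x => simp [Pattern.subst]
  | hn s ps is ih =>
    have his : ∀ ρ : ℕ → Pattern, is.map (SessId.subst σ) = is.map (SessId.subst ⟨ρ, σ.sess⟩) :=
      fun ρ => List.map_congr_left fun i _ => by cases i <;> rfl
    -- Keys have no arguments. A key produced at a name node of `p` is therefore already written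
    -- there, and both instances contain it.
    by_cases hk : IsKey K ((Pattern.name s ps is).subst σ)
    · rw [erase_key hk]
      simp only [Pattern.subst] at hk
      obtain ⟨⟨a, ha, rfl⟩, h1, h2⟩ := isKey_name.1 hk
      rw [List.map_eq_nil_iff] at h1 h2
      subst h1 h2
      have : IsKey K (.name (.nm a) [] []) := ⟨a, ha, rfl⟩
      simp [Pattern.subst, star, refineType, this]
    · simp only [Pattern.subst] at hk ⊢
      rw [erase_name hk, refineType]
      -- The erased instance can be `star` without being a key only if `p` is `star` itself; then
      -- the other instance is `star` too and cannot be a key.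
      split_ifs with h1 h2
      · simp only [star, Pattern.name.injEq, List.map_eq_nil_iff] at h1
        obtain ⟨a, -, h⟩ := h2
        rw [h1.1] at h
        cases h
      · simp only [star, Pattern.name.injEq, List.map_eq_nil_iff] at h1
        obtain ⟨rfl, rfl, rfl⟩ := h1
        simp [star]
      · simp only [Pattern.children, List.map_map]
        rw [refineTypes_map ps (Pattern.subst θ) (Pattern.erase K ∘ Pattern.subst σ) _ ih, his]
  | ha f ps ih =>
    simp only [Pattern.subst, erase_app, refineType, Pattern.children, List.map_map]
    rw [refineTypes_map ps (Pattern.subst θ) (Pattern.erase K ∘ Pattern.subst σ) _ ih]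

/-- Only occurrences of `star` are changed, and only into keys, which erasure turns back into
`star`. As `s` is a type, it contains no key that erasure would alter. -/
theorem erase_refineType {K : Set ℕ} {s : Pattern} (hs : s.erase K = s) (t : Pattern) :
    (refineType K t s).erase K = s := by
  induction s using Pattern.induct generalizing t with
  | hv x => simp [refineType, Pattern.erase]
  | hn a ss is ih =>
    rw [refineType]
    split_ifs with h1 h2
    · rw [erase_key h2, h1]
    · rw [erase_star, h1]
    · have hk : ¬ IsKey K (.name a ss is) := fun hk => h1 (by rw [← hs, erase_key hk])
      rw [erase_name hk, Pattern.name.injEq] at hs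
      have h3 := refineTypes_erase (K := K) (ss := ss) (fun s hs' t => ih s hs'
        (list_map_eq_self.1 hs.2.1 s hs') t) t.children
      have hk' : ¬ IsKey K (.name a (refineTypes K t.children ss) is) := by
        rw [isKey_name] at hk ⊢
        rintro ⟨h4, h5, h6⟩
        rw [h5] at h3
        exact hk ⟨h4, h3.symm, h6⟩
      rw [erase_name hk', h3]
  | ha f ss ih =>
    rw [erase_app, Pattern.app.injEq] at hs
    have h3 := refineTypes_erase (K := K) (ss := ss) (fun s hs' t => ih s hs'
      (list_map_eq_self.1 hs.2 s hs') t) t.children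
    rw [refineType, erase_app, h3]

/-- Unifiable patterns of the same type have a unifier that respects the types. -/
theorem exists_unifier_of_erase_eq {K : Set ℕ} {p q : Pattern} {θ σ : Subst}
    (hθ : p.subst θ = q.subst θ) (hσ : (p.subst σ).erase K = (q.subst σ).erase K) :
    ∃ θ₀ : Subst, p.subst θ₀ = q.subst θ₀ ∧
      ∀ r : Pattern, (r.subst θ₀).erase K = (r.subst σ).erase K := by
  -- The keys are taken from the unifier `θ`; everything else, session identifiers included, from
  -- `σ`, under which the two patterns already agree up to keys.
  set θ₀ : Subst := ⟨fun x => refineType K (θ.pat x) ((σ.pat x).erase K), σ.sess⟩ with hθ₀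
  have h1 : ∀ x, (θ₀.pat x).erase K = (σ.pat x).erase K :=
    fun x => erase_refineType (erase_erase K (σ.pat x)) _
  refine ⟨θ₀, ?_, fun r => erase_subst_congr h1 rfl r⟩
  rw [hθ₀, ← refineType_subst, ← refineType_subst, hθ, hσ]

/-- The descent from `p` to the occurrence of `x` stays in `T` by closure under subterms. No name
above the occurrence is collapsed to `star`, because keys have no arguments. -/
theorem erase_occurs_mem {K : Set ℕ} {T : Set Pattern}
    (hn : ∀ s ps is, Pattern.name s ps is ∈ T → ∀ p ∈ ps, p ∈ T)
    (ha : ∀ f ps, Pattern.app f ps ∈ T → ∀ p ∈ ps, p ∈ T) {σ : Subst} {p : Pattern}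
    (h : (p.subst σ).erase K ∈ T) {x : ℕ} (hx : Var.Occurs (.ord x) p) :
    (σ.pat x).erase K ∈ T := by
  induction p using Pattern.induct with
  | hv y =>
    rw [occurs_var] at hx
    cases hx
    simpa [Pattern.subst] using h
  | hn s ps is ih =>
    obtain ⟨p, hp, hx⟩ | ⟨i, hi, -⟩ := occurs_name.1 hx
    · simp only [Pattern.subst] at h
      rw [erase_name] at h
      · exact ih p hp (hn _ _ _ h _ (by simpa using ⟨p, hp, rfl⟩)) hx
      · rw [isKey_name]
        rintro ⟨-, h1, -⟩
        rw [List.map_eq_nil_iff] at h1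
        simp [h1] at hp
    · cases hi
  | ha f ps ih =>
    obtain ⟨p, hp, hx⟩ := occurs_app.1 hx
    simp only [Pattern.subst] at h
    rw [erase_app] at h
    exact ih p hp (ha _ _ h _ (by simpa using ⟨p, hp, rfl⟩)) hx

/-! ## Tagged patterns -/

/-- Constants: free names and `true`. -/
def IsConstPat (p : Pattern) : Prop := (∃ a, p = freeName a) ∨ p = .app .tru []

theorem IsConstPat.subst {p : Pattern} (h : IsConstPat p) (σ : Subst) : p.subst σ = p := by
  rcases h with ⟨a, rfl⟩ | rfl <;> simp [freeName, Pattern.subst]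

/-- The first argument is a tuple that starts with the constant `ct`. -/
def TaggedBy (ps : List Pattern) (ct : Pattern) : Prop :=
  IsConstPat ct ∧ ∃ n us vs, ps = .app (.tuple n) (ct :: us) :: vs

theorem TaggedBy.map_subst {ps : List Pattern} {ct : Pattern} (h : TaggedBy ps ct) (σ : Subst) :
    TaggedBy (ps.map (Pattern.subst σ)) ct := by
  obtain ⟨h, n, us, vs, rfl⟩ := h
  exact ⟨h, n, us.map (Pattern.subst σ), vs.map (Pattern.subst σ), by
    simp [Pattern.subst, h.subst σ]⟩

open Classical in
/-- Replacement of untagged cryptographic terms. -/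
noncomputable def Pattern.cut : Pattern → Pattern
  | .var x => .var x
  | .name s ps is => .name s (ps.map Pattern.cut) is
  | .app f ps =>
      if f.NeedsTag ∧ ¬ ∃ ct, TaggedBy ps ct then .app .tru [] else .app f (ps.map Pattern.cut)

theorem cut_name (s : NameSym) (ps : List Pattern) (is : List SessId) :
    (Pattern.name s ps is).cut = .name s (ps.map Pattern.cut) is := by simp [Pattern.cut]

theorem cut_app {f : Constr} {ps : List Pattern} (h : f.NeedsTag → ∃ ct, TaggedBy ps ct) :
    (Pattern.app f ps).cut = .app f (ps.map Pattern.cut) := by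
  rw [Pattern.cut, if_neg]
  tauto

theorem needsTag_ne_tru {f : Constr} (h : f.NeedsTag) : f ≠ .tru := by
  rintro rfl
  exact h

/-- All cryptographic terms in the pattern are tagged. -/
def Pattern.Tagged (p : Pattern) : Prop := p.cut = p

/-- Substitution after replacement of untagged cryptographic terms. -/
noncomputable def Subst.cut (σ : Subst) : Subst := ⟨fun x => (σ.pat x).cut, σ.sess⟩

/-- The instance of a pattern has no untagged cryptographic terms but those of the
substitution. -/
def CutOK (σ : Subst) (p : Pattern) : Prop := (p.subst σ).cut = p.subst σ.cut

theorem CutOK.var (σ : Subst) (x : ℕ) : CutOK σ (.var x) := by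
  simp [CutOK, Pattern.subst, Subst.cut]

theorem map_sess_cut (σ : Subst) (is : List SessId) :
    is.map (SessId.subst σ) = is.map (SessId.subst σ.cut) :=
  List.map_congr_left fun i _ => by cases i <;> rfl

theorem CutOK.name {σ : Subst} {s : NameSym} {ps : List Pattern} {is : List SessId}
    (h : ∀ p ∈ ps, CutOK σ p) : CutOK σ (.name s ps is) := by
  simp only [CutOK, Pattern.subst, cut_name, List.map_map, Pattern.name.injEq, true_and]
  exact ⟨List.map_congr_left h, map_sess_cut σ is⟩

theorem CutOK.app {σ : Subst} {f : Constr} {ps : List Pattern} (h : ∀ p ∈ ps, CutOK σ p)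
    (ht : f.NeedsTag → ∃ ct, TaggedBy (ps.map (Pattern.subst σ)) ct) : CutOK σ (.app f ps) := by
  simp only [CutOK, Pattern.subst]
  rw [cut_app ht, List.map_map]
  congr 1
  exact List.map_congr_left h

theorem Pattern.tagged_name {s : NameSym} {ps : List Pattern} {is : List SessId} :
    (Pattern.name s ps is).Tagged ↔ ∀ p ∈ ps, p.Tagged := by
  simp only [Pattern.Tagged, cut_name, Pattern.name.injEq, true_and, and_true]
  exact list_map_eq_self

theorem Pattern.tagged_app {f : Constr} {ps : List Pattern} :
    (Pattern.app f ps).Tagged ↔ (f.NeedsTag → ∃ ct, TaggedBy ps ct) ∧ ∀ p ∈ ps, p.Tagged := by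
  constructor
  · intro h
    have h1 : f.NeedsTag → ∃ ct, TaggedBy ps ct := by
      intro hf
      by_contra hc
      rw [Pattern.Tagged, Pattern.cut, if_pos ⟨hf, hc⟩, Pattern.app.injEq] at h
      exact needsTag_ne_tru hf h.1.symm
    rw [Pattern.Tagged, cut_app h1, Pattern.app.injEq] at h
    exact ⟨h1, list_map_eq_self.1 h.2⟩
  · rintro ⟨h1, h2⟩
    rw [Pattern.Tagged, cut_app h1, Pattern.app.injEq]
    exact ⟨rfl, list_map_eq_self.2 h2⟩

theorem Pattern.tagged_var (x : ℕ) : (Pattern.var x).Tagged := by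
  simp [Pattern.Tagged, Pattern.cut]

theorem Pattern.Tagged.cutOK {p : Pattern} (h : p.Tagged) (σ : Subst) : CutOK σ p := by
  induction p using Pattern.induct with
  | hv x => exact .var σ x
  | hn s ps is ih => exact .name fun p hp => ih p hp (Pattern.tagged_name.1 h p hp)
  | ha f ps ih =>
    obtain ⟨h1, h2⟩ := Pattern.tagged_app.1 h
    exact .app (fun p hp => ih p hp (h2 p hp)) fun hf =>
      (h1 hf).imp fun ct hct => hct.map_subst σ

/-- Had `cut` replaced an instance of a non-variable subterm of `p`, the symbol there would be
`true`, whereas `p` and all its instances have a cryptographic symbol at that place. So the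
comparison reaches the variables of `p`. -/
theorem agree_of_cut_subst_eq {σ τ : Subst} {p : Pattern} (h : (p.subst σ).cut = p.subst τ) :
    ∀ v : Var, v.Occurs p → v.Agree σ.cut τ := by
  induction p using Pattern.induct with
  | hv x =>
    intro v hv
    rw [occurs_var] at hv
    subst hv
    simpa [Pattern.subst, Var.Agree, Subst.cut] using h
  | hn s ps is ih =>
    intro v hv
    simp only [Pattern.subst, cut_name, List.map_map, Pattern.name.injEq, true_and,
      List.map_inj_left] at h
    rcases occurs_name.1 hv with ⟨p, hp, hv⟩ | ⟨i, rfl, hi⟩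
    · exact ih p hp (h.1 p hp) v hv
    · exact h.2 _ hi
  | ha f ps ih =>
    intro v hv
    have hf : f.NeedsTag → ∃ ct, TaggedBy (ps.map (Pattern.subst σ)) ct := by
      intro hf
      by_contra hc
      simp only [Pattern.subst] at h
      rw [Pattern.cut, if_pos ⟨hf, hc⟩, Pattern.app.injEq] at h
      exact needsTag_ne_tru hf h.1.symm
    simp only [Pattern.subst] at h
    rw [cut_app hf] at h
    simp only [List.map_map, Pattern.app.injEq, true_and, List.map_inj_left] at h
    obtain ⟨p, hp, hv⟩ := occurs_app.1 hv
    exact ih p hp (h p hp) v hv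

/-- The cut of `μ` followed by `σ` is a unifier, hence factors through `μ` by some `τ`. So the cut
of an instance of `μ x` is still an instance of `μ x`, which means that no symbol of `μ x` was cut.
-/
theorem IsMGU.cutOK {U : Set Subst} {V : Set Var} {μ : Subst} (hμ : IsMGU U V μ) {σ : Subst}
    (h : (μ.comp σ).cut ∈ U) (x : ℕ) : CutOK σ (μ.pat x) := by
  obtain ⟨τ, hτ⟩ := hμ.general _ h
  have h1 : ((μ.pat x).subst σ).cut = (μ.pat x).subst τ := congrFun (congrArg Subst.pat hτ) x
  rw [CutOK, h1]
  exact (Pattern.subst_congr (agree_of_cut_subst_eq h1)).symm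

theorem CutOK.comp {μ σ : Subst} {p : Pattern} (h : CutOK (μ.comp σ) p)
    (hμ : ∀ x, CutOK σ (μ.pat x)) : CutOK σ (p.subst μ) := by
  rw [CutOK, Pattern.subst_subst, h, Pattern.subst_subst]
  refine Pattern.subst_congr fun v _ => ?_
  cases v with
  | ord x => exact hμ x
  | sess i =>
    simp only [Var.Agree, Subst.cut, Subst.comp]
    cases μ.sess i <;> rfl

theorem cutOK_id {p : Pattern} : CutOK .id p ↔ p.Tagged := by
  have : Subst.id.cut = .id := by simp [Subst.cut, Subst.id, Pattern.cut]
  rw [CutOK, this, Pattern.subst_id, Pattern.Tagged]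

theorem Subst.comp_id (σ : Subst) : σ.comp .id = σ := by
  have : ∀ i : SessId, i.subst .id = i := fun i => by cases i <;> rfl
  simp [Subst.comp, Pattern.subst_id, this]

/-- Most general unifiers invent no cryptographic terms: an untagged one could be replaced by `true`
without losing unification, and `μ` would not be most general. -/
theorem IsMGU.tagged {U : Set Subst} {V : Set Var} {μ : Subst} (hμ : IsMGU U V μ)
    (h : μ.cut ∈ U) (x : ℕ) : (μ.pat x).Tagged :=
  cutOK_id.1 (hμ.cutOK (by rwa [Subst.comp_id]) x)

theorem Pattern.Tagged.subst {p : Pattern} (h : p.Tagged) {σ : Subst}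
    (hσ : ∀ x, (σ.pat x).Tagged) : (p.subst σ).Tagged :=
  cutOK_id.1 ((h.cutOK _).comp fun x => cutOK_id.2 (hσ x))

/-! ## Types of clauses -/

/-- A finite set `T` of types, closed under subterms, in which the type of a tagged term is
determined by its tag and the type of a name by its symbol, and in which `pk` and `host` are
applied only to keys. -/
structure Typing (K : Set ℕ) (T : Set Pattern) : Prop where
  keys_finite : K.Finite
  finite : T.Finite
  name_mem : ∀ s ps is, Pattern.name s ps is ∈ T → ∀ p ∈ ps, p ∈ T
  app_mem : ∀ f ps, Pattern.app f ps ∈ T → ∀ p ∈ ps, p ∈ T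
  name_eq : ∀ s ps is ps' is', Pattern.name s ps is ∈ T → Pattern.name s ps' is' ∈ T →
    ps = ps' ∧ is = is'
  fresh : ∀ ps is, Pattern.name .b₀ ps is ∈ T → ps = []
  pk : ∀ ps, Pattern.app .pk ps ∈ T → ps = [star]
  host : ∀ ps, Pattern.app .host ps ∈ T → ps = [star]
  tru : ∀ ps, Pattern.app .tru ps ∈ T → ps = []
  evt : ∀ e ps, Pattern.app (.evt e) ps ∉ T
  pencrypt : ∀ p q r, Pattern.app .pencryptP [p, q, r] ∈ T → ∃ qs, q = .app .pk qs
  tag : ∀ f, f.NeedsTag → ∀ ct n us vs n' us' vs',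
    Pattern.app f (.app (.tuple n) (ct :: us) :: vs) ∈ T →
    Pattern.app f (.app (.tuple n') (ct :: us') :: vs') ∈ T →
    Pattern.app f (.app (.tuple n) (ct :: us) :: vs) =
      Pattern.app f (.app (.tuple n') (ct :: us') :: vs')

theorem Typing.mem_of_occurs {K : Set ℕ} {T : Set Pattern} (hT : Typing K T) {σ : Subst}
    {p : Pattern} (h : (p.subst σ).erase K ∈ T) {x : ℕ} (hx : Var.Occurs (.ord x) p) :
    (σ.pat x).erase K ∈ T := erase_occurs_mem hT.name_mem hT.app_mem h hx

-- Types of unifiable patterns, and typed clauses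

theorem subst_eq_app {μ : Subst} {p : Pattern} {f : Constr} {ps : List Pattern} (hp : ¬ p.IsVar)
    (h : p.subst μ = .app f ps) : ∃ qs, p = .app f qs ∧ qs.map (Pattern.subst μ) = ps := by
  cases p with
  | var x => exact (hp ⟨x, rfl⟩).elim
  | name s qs is => simp [Pattern.subst] at h
  | app g qs =>
    simp only [Pattern.subst, Pattern.app.injEq] at h
    obtain ⟨rfl, h⟩ := h
    exact ⟨qs, rfl, h⟩

theorem subst_eq_name {μ : Subst} {p : Pattern} {s : NameSym} {ps : List Pattern}
    {is : List SessId} (hp : ¬ p.IsVar) (h : p.subst μ = .name s ps is) :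
    ∃ qs js, p = .name s qs js ∧ qs.map (Pattern.subst μ) = ps ∧
      js.map (SessId.subst μ) = is := by
  cases p with
  | var x => exact (hp ⟨x, rfl⟩).elim
  | name s' qs js =>
    simp only [Pattern.subst, Pattern.name.injEq] at h
    obtain ⟨rfl, h, h'⟩ := h
    exact ⟨qs, js, rfl, h, h'⟩
  | app g qs => simp [Pattern.subst] at h

/-- Unifiable patterns that are not variables have the same root. For names, the symbol determines
the type. For cryptographic terms, the tags are constants, untouched by substitutions; unifiability
makes them equal, and the tag determines the type. The arguments of `pk` and `host` are `star`, and
`true` has none. Tuples must be excluded, since their type is not determined by the root. -/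
theorem Typing.erase_eq {K : Set ℕ} {T : Set Pattern} (hT : Typing K T) {p q : Pattern}
    {θ σ τ : Subst} (hp : p.Tagged) (hq : q.Tagged) (hpv : ¬ p.IsVar) (hqv : ¬ q.IsVar)
    (hpt : ¬ p.IsTuple) (h : p.subst θ = q.subst θ) (hpT : (p.subst σ).erase K ∈ T)
    (hqT : (q.subst τ).erase K ∈ T) : (p.subst σ).erase K = (q.subst τ).erase K := by
  cases p with
  | var x => exact (hpv ⟨x, rfl⟩).elim
  | name s ps is =>
    simp only [Pattern.subst] at h
    obtain ⟨qs, js, rfl, h1, h2⟩ := subst_eq_name hqv h.symm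
    have h1l := congrArg List.length h1
    have h2l := congrArg List.length h2
    simp only [List.length_map] at h1l h2l
    have hkey : ∀ (rs : List Pattern) (ks : List SessId) (ρ : Subst),
        IsKey K ((Pattern.name s rs ks).subst ρ) → rs = [] ∧ ks = [] := by
      intro rs ks ρ hk
      simp only [Pattern.subst] at hk
      rw [isKey_name, List.map_eq_nil_iff, List.map_eq_nil_iff] at hk
      exact hk.2
    -- A key has empty argument lists, and unifiability transfers this to the other name, which then
    -- is the same one.
    by_cases hk : IsKey K ((Pattern.name s ps is).subst σ)
    · obtain ⟨rfl, rfl⟩ := hkey _ _ _ hk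
      simp only [List.length_nil, List.length_eq_zero_iff] at h1l h2l
      subst h1l h2l
      simp [Pattern.subst]
    · by_cases hk' : IsKey K ((Pattern.name s qs js).subst τ)
      · obtain ⟨rfl, rfl⟩ := hkey _ _ _ hk'
        simp only [List.length_nil] at h1l h2l
        rw [eq_comm, List.length_eq_zero_iff] at h1l h2l
        subst h1l h2l
        simp [Pattern.subst]
      · simp only [Pattern.subst] at hk hk' hpT hqT ⊢
        rw [erase_name hk] at hpT ⊢
        rw [erase_name hk'] at hqT ⊢
        obtain ⟨h3, h4⟩ := hT.name_eq _ _ _ _ _ hpT hqT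
        rw [h3, h4]
  | app f ps =>
    simp only [Pattern.subst] at h
    obtain ⟨qs, rfl, h1⟩ := subst_eq_app hqv h.symm
    simp only [Pattern.subst, erase_app, List.map_map] at hpT hqT ⊢
    by_cases hf : f.NeedsTag
    · obtain ⟨ct, hct, n, us, vs, rfl⟩ := (Pattern.tagged_app.1 hp).1 hf
      obtain ⟨ct', hct', n', us', vs', rfl⟩ := (Pattern.tagged_app.1 hq).1 hf
      simp only [List.map_cons, Pattern.subst, List.cons.injEq, Pattern.app.injEq,
        hct.subst, hct'.subst] at h1
      obtain ⟨⟨-, rfl, -⟩, -⟩ := h1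
      simp only [List.map_cons, Function.comp, Pattern.subst, erase_app, hct.subst] at hpT hqT ⊢
      exact hT.tag f hf _ _ _ _ _ _ _ hpT hqT
    · cases f with
      | tuple n => exact (hpt ⟨n, ps, rfl⟩).elim
      | pk => rw [hT.pk _ hpT, hT.pk _ hqT]
      | host => rw [hT.host _ hpT, hT.host _ hqT]
      | tru => rw [hT.tru _ hpT, hT.tru _ hqT]
      | evt e => exact (hT.evt _ _ hpT).elim
      | _ => exact (hf trivial).elim

/-- The fact is `attacker(p)` for a tagged pattern `p` with instance of a type in `T`. -/
def Typed (K : Set ℕ) (T : Set Pattern) (σ : Subst) (F : HornFact) : Prop :=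
  ∃ p, F = .attacker p ∧ (p.subst σ).erase K ∈ T ∧ p.Tagged

/-- Conclusions may also be events with arguments of types in `T'`. -/
def TypedConcl (K : Set ℕ) (T T' : Set Pattern) (σ : Subst) (F : HornFact) : Prop :=
  Typed K T σ F ∨ ∃ p, F = .event p ∧ (p.subst σ).erase K ∈ T'

/-- Clauses with a typed instance of bounded size. -/
def Prot (K : Set ℕ) (T T' : Set Pattern) (B : ℕ) (R : Clause) : Prop :=
  ∃ σ, (∀ F ∈ R.hyps, Typed K T σ F) ∧ TypedConcl K T T' σ R.concl ∧ weight σ R.hyps ≤ B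

theorem Prot.of_hyps_le {K : Set ℕ} {T T' : Set Pattern} {B : ℕ} {R R' : Clause}
    (h : Prot K T T' B R) (hc : R'.concl = R.concl) (hh : R'.hyps ≤ R.hyps) :
    Prot K T T' B R' := by
  obtain ⟨σ, h1, h2, h3⟩ := h
  exact ⟨σ, fun F hF => h1 F (Multiset.mem_of_le hh hF), hc ▸ h2, (weight_le hh).trans h3⟩

theorem Typed.decomp {K : Set ℕ} {T : Set Pattern} (hT : Typing K T) {σ : Subst} {F G : HornFact}
    (hF : Typed K T σ F) (hG : G ∈ F.decomp) : Typed K T σ G := by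
  obtain ⟨p, rfl, h1, h2⟩ := hF
  simp only [HornFact.decomp, List.mem_map] at hG
  obtain ⟨q, hq, rfl⟩ := hG
  refine ⟨q, rfl, ?_⟩
  refine Pattern.flatten_forall (P := fun r => (r.subst σ).erase K ∈ T ∧ r.Tagged)
    (fun n ps h p hp => ?_) ⟨h1, h2⟩ hq
  refine ⟨?_, (Pattern.tagged_app.1 h.2).2 p hp⟩
  have h3 := h.1
  simp only [Pattern.subst] at h3
  rw [erase_app] at h3
  exact hT.app_mem _ _ h3 _ (by simpa using ⟨p, hp, rfl⟩)

theorem Prot.decomp {K : Set ℕ} {T T' : Set Pattern} (hT : Typing K T) {B : ℕ} {R D : Clause}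
    (h : Prot K T T' B R) (hD : D ∈ decomp R) : Prot K T T' B D := by
  unfold CryptoHorn.decomp at hD
  split_ifs at hD with hd
  · rw [Set.mem_singleton_iff] at hD
    exact hD ▸ h
  · obtain ⟨σ, h1, h2, h3⟩ := h
    obtain ⟨h4, h5⟩ := hD
    refine ⟨σ, fun F hF => ?_, ?_, ?_⟩
    · rw [h4] at hF
      obtain ⟨G, hG, hFG⟩ := Clause.mem_decompHyps.1 hF
      exact (h1 G hG).decomp hT hFG
    · refine h2.elim (fun h2 => .inl (h2.decomp hT h5)) ?_
      rintro ⟨p, h6, h7⟩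
      rw [h6] at h5
      simp only [HornFact.decomp, List.mem_singleton] at h5
      exact .inr ⟨p, h5, h7⟩
    · rw [h4]
      exact (R.weight_decompHyps_le σ).trans h3

/-- A unifier that respects types exists and factors through `μ`; the second factor is the typed
instance of the resolvent. Erasing keys preserves sizes, so equality of types is enough to keep the
weight. -/
theorem prot_resolvent {K : Set ℕ} {T T' : Set Pattern} {B : ℕ} {H : Multiset HornFact}
    {C : HornFact} {σ μ : Subst} {p q : Pattern} {V : Set Var}
    (hH : ∀ F ∈ H, Typed K T σ F) (hC : TypedConcl K T T' σ C) (hw : weight σ H ≤ B)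
    (hμ : IsMGU {θ | (HornFact.attacker p).subst θ = (HornFact.attacker q).subst θ} V μ)
    (hE : (p.subst σ).erase K = (q.subst σ).erase K) (hp : CutOK μ p) (hq : CutOK μ q) :
    Prot K T T' B (Clause.subst μ ⟨H, C⟩) := by
  have hpq : p.subst μ = q.subst μ := HornFact.attacker.inj hμ.unifies
  obtain ⟨θ₀, h1, h2⟩ := exists_unifier_of_erase_eq hpq hE
  obtain ⟨τ, rfl⟩ := hμ.general θ₀ (congrArg HornFact.attacker h1)
  have hμt : ∀ x, (μ.pat x).Tagged := hμ.tagged (congrArg HornFact.attacker (by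
    rw [← hp, ← hq, hpq]))
  have htyped : ∀ F, Typed K T σ F → Typed K T τ (F.subst μ) := by
    rintro _ ⟨r, rfl, h3, h4⟩
    refine ⟨r.subst μ, rfl, ?_, h4.subst hμt⟩
    rwa [Pattern.subst_subst, h2]
  refine ⟨τ, fun F hF => ?_, ?_, ?_⟩
  · obtain ⟨G, hG, rfl⟩ := Multiset.mem_map.1 hF
    exact htyped G (hH G hG)
  · rcases hC with hC | ⟨r, rfl, h3⟩
    · exact .inl (htyped C hC)
    · refine .inr ⟨r.subst μ, rfl, ?_⟩
      rwa [Pattern.subst_subst, h2]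
  · refine le_trans (le_of_eq ?_) hw
    simp only [Clause.subst]
    rw [weight_subst]
    refine weight_congr fun F hF => ?_
    obtain ⟨r, rfl, -⟩ := hH F hF
    simp only [HornFact.subst, HornFact.size]
    rw [← size_erase K, h2, size_erase]

open Classical in
/-- The substitution that is `σ` on the variables in `V` and `τ` on the others. -/
noncomputable def Subst.merge (V : Set Var) (σ τ : Subst) : Subst :=
  ⟨fun x => if .ord x ∈ V then σ.pat x else τ.pat x,
    fun i => if .sess i ∈ V then σ.sess i else τ.sess i⟩

theorem merge_agree_left {V : Set Var} {σ τ : Subst} : ∀ {v : Var}, v ∈ V →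
    v.Agree (.merge V σ τ) σ := by
  rintro (x | i) h <;> simp [Var.Agree, Subst.merge, h]

theorem merge_agree_right {V : Set Var} {σ τ : Subst} : ∀ {v : Var}, v ∉ V →
    v.Agree (.merge V σ τ) τ := by
  rintro (x | i) h <;> simp [Var.Agree, Subst.merge, h]

theorem HornFact.merge_left {V : Set Var} {σ τ : Subst} {F : HornFact}
    (h : F.vars ⊆ V) : F.subst (.merge V σ τ) = F.subst σ :=
  HornFact.subst_congr fun _ hv => merge_agree_left (h hv)

theorem HornFact.merge_right {V : Set Var} {σ τ : Subst} {F : HornFact}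
    (h : Disjoint V F.vars) : F.subst (.merge V σ τ) = F.subst τ :=
  HornFact.subst_congr fun _ hv => merge_agree_right fun hV => h.notMem_of_mem_left hV hv

theorem Typed.congr {K : Set ℕ} {T : Set Pattern} {σ τ : Subst} {F : HornFact}
    (h : Typed K T σ F) (hF : F.subst τ = F.subst σ) : Typed K T τ F := by
  obtain ⟨p, rfl, h1, h2⟩ := h
  exact ⟨p, rfl, by rwa [HornFact.attacker.inj hF], h2⟩

theorem TypedConcl.congr {K : Set ℕ} {T T' : Set Pattern} {σ τ : Subst} {F : HornFact}
    (h : TypedConcl K T T' σ F) (hF : F.subst τ = F.subst σ) : TypedConcl K T T' τ F := by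
  refine h.imp (fun h => h.congr hF) ?_
  rintro ⟨p, rfl, h1⟩
  exact ⟨p, rfl, by rwa [HornFact.event.inj hF]⟩

theorem Clause.vars_hyps {R : Clause} {F : HornFact} (h : F ∈ R.hyps) : F.vars ⊆ R.vars :=
  fun _ hv => .inr ⟨F, h, hv⟩

theorem Clause.vars_concl (R : Clause) : R.concl.vars ⊆ R.vars := fun _ hv => .inl hv

/-- The resolvent of a clause with conclusion `attacker(p)` and a typed clause is typed if `p` has
an instance of the type of the hypothesis `attacker(q)`. -/
theorem prot_step {K : Set ℕ} {T T' : Set Pattern} (hT : Typing K T) {B : ℕ} {S R' : Clause}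
    {H : Multiset HornFact} {μ σ' σS : Subst} {p q : Pattern} {V : Set Var} (hS : Solved S)
    (hdisj : Disjoint S.vars R'.vars) (hK : R'.hyps = .attacker q ::ₘ H)
    (hh : ∀ F ∈ R'.hyps, Typed K T σ' F) (hc : TypedConcl K T T' σ' R'.concl)
    (hw : weight σ' R'.hyps ≤ B) (hp : S.concl = .attacker p)
    (hμ : IsMGU {θ | S.concl.subst θ = (HornFact.attacker q).subst θ} V μ)
    (hE : (p.subst σS).erase K = (q.subst σ').erase K) (hcut : CutOK μ p) :
    Prot K T T' B (Clause.subst μ ⟨S.hyps + H, R'.concl⟩) := by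
  -- The clauses share no variable, so one substitution can give both of them their typed instances.
  set σ := Subst.merge S.vars σS σ' with hσ
  have hq := hh (.attacker q) (by rw [hK]; simp)
  obtain ⟨q', hq', hqT, hqt⟩ := hq
  cases hq'
  have hR' : ∀ F : HornFact, F.vars ⊆ R'.vars → F.subst σ = F.subst σ' :=
    fun F hF => HornFact.merge_right (hdisj.mono_right hF)
  have hpS : p.subst σ = p.subst σS := by
    have := HornFact.merge_left (σ := σS) (τ := σ') (Clause.vars_concl S)
    rw [hp] at this
    exact HornFact.attacker.inj this
  have hqS : q.subst σ = q.subst σ' := HornFact.attacker.inj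
    (hR' (.attacker q) (Clause.vars_hyps (by rw [hK]; simp)))
  have hE' : (p.subst σ).erase K = (q.subst σ).erase K := by rw [hpS, hqS, hE]
  rw [hp] at hμ
  refine prot_resolvent (σ := σ) (fun F hF => ?_) (hc.congr (hR' _ (Clause.vars_concl R'))) ?_ hμ
    hE' hcut (hqt.cutOK μ)
  · rcases Multiset.mem_add.1 hF with hF | hF
    · obtain ⟨x, rfl, hx⟩ := hS.hyps_var F hF
      -- The variable of a new hypothesis occurs in `p`, and the type of `p` is that of `q`, so the
      -- type of the variable lies in `T` by closure under subterms.
      refine ⟨_, rfl, ?_, Pattern.tagged_var x⟩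
      simp only [Pattern.subst]
      refine hT.mem_of_occurs (p := p) ?_ (vars_attacker.1 (hp ▸ hx))
      rwa [hE', hqS]
    · have hF' : F ∈ R'.hyps := by rw [hK]; simp [hF]
      exact (hh F hF').congr (hR' F (Clause.vars_hyps hF'))
  -- The hypothesis `attacker(q)` that disappears weighs as much as the conclusion `attacker(p)`,
  -- since their types agree, and this is more than the hypotheses that replace it.
  · rw [hK, weight_cons] at hw
    rw [weight_add]
    have h1 := hS.weight_lt σ
    have h2 : weight σ H = weight σ' H := weight_congr fun F hF => by
      rw [hR' F (Clause.vars_hyps (by rw [hK]; simp [hF]))]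
    rw [hp] at h1
    simp only [HornFact.subst, HornFact.size] at h1 hw
    rw [← size_erase K, hE', hqS, size_erase] at h1
    omega

/-! ## Shapes of clauses -/

/-- Hypotheses `attacker(x)` for the variables `x` of a list. -/
def attackers (l : List ℕ) : Multiset HornFact :=
  (l.map fun x => HornFact.attacker (.var x) : List HornFact)

/-- No hypothesis and no conclusion is `attacker` of a tuple. -/
def Flat (R : Clause) : Prop :=
  (∀ p, .attacker p ∈ R.hyps → ¬ p.IsTuple) ∧ ∀ p, R.concl = .attacker p → ¬ p.IsTuple

/-- The cryptographic term on the left-hand side of a decryption rule. -/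
def DecryptArgs (f : Constr) (ps : List Pattern) : Prop :=
  f.NeedsTag ∧ (ps = [.var 0, .var 1] ∨ ps = [.var 0, .var 1, .var 2] ∨
    f = .pencryptP ∧ ps = [.var 0, .app .pk [.var 1], .var 2])

/-- The shapes of the clauses that occur during the saturation. -/
inductive Shape (K : Set ℕ) (T T' : Set Pattern) (B : ℕ) : Clause → Prop
  | prot {R : Clause} : Prot K T T' B R → Flat R → Shape K T T' B R
  | con (f : Constr) {l : List ℕ} : l.Nodup →
      Shape K T T' B ⟨attackers l, .attacker (.app f (l.map .var))⟩
  | proj {R : Clause} {n : ℕ} {l : List ℕ} {x : ℕ} : x ∈ l →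
      R.hyps ≤ {.attacker (.app (.tuple n) (l.map .var))} →
      R.concl = .attacker (.var x) → Shape K T T' B R
  | decrypt {R : Clause} {f : Constr} {ps : List Pattern} : DecryptArgs f ps →
      R.hyps ≤ {.attacker (.app f ps), .attacker (.var 1)} →
      R.concl = .attacker (.var 0) → Shape K T T' B R
  | fresh (x : ℕ) : Shape K T T' B ⟨0, .attacker (.name .b₀ [.var x] [])⟩
  | free (a : ℕ) : Shape K T T' B ⟨0, .attacker (freeName a)⟩
  | listen {R : Clause} : R.hyps ≤ {.message (.var 0) (.var 1), .attacker (.var 0)} →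
      R.concl = .attacker (.var 1) → Shape K T T' B R
  | send (x y : ℕ) : Shape K T T' B
      ⟨{.attacker (.var x), .attacker (.var y)}, .message (.var x) (.var y)⟩

/-- The shapes of the clauses all of whose hypotheses are `attacker(x)`. -/
inductive PosShape (K : Set ℕ) (T T' : Set Pattern) (B : ℕ) : Clause → Prop
  | prot {R : Clause} : Prot K T T' B R → Flat R → PosShape K T T' B R
  | con (f : Constr) {l : List ℕ} : l.Nodup →
      PosShape K T T' B ⟨attackers l, .attacker (.app f (l.map .var))⟩
  | fresh (x : ℕ) : PosShape K T T' B ⟨0, .attacker (.name .b₀ [.var x] [])⟩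
  | free (a : ℕ) : PosShape K T T' B ⟨0, .attacker (freeName a)⟩
  | var {R : Clause} (x : ℕ) : R.concl = .attacker (.var x) → PosShape K T T' B R
  | send (x y : ℕ) : PosShape K T T' B
      ⟨{.attacker (.var x), .attacker (.var y)}, .message (.var x) (.var y)⟩

theorem Shape.pos {K : Set ℕ} {T T' : Set Pattern} {B : ℕ} {R : Clause} (h : Shape K T T' B R) :
    PosShape K T T' B R := by
  cases h with
  | prot h1 h2 => exact .prot h1 h2
  | con f h => exact .con f h
  | proj _ _ h => exact .var _ h
  | decrypt _ _ h => exact .var _ h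
  | fresh x => exact .fresh x
  | free a => exact .free a
  | listen _ h => exact .var _ h
  | send x y => exact .send x y

theorem permSubst_comp_symm (π π' : Equiv.Perm ℕ) (σ : Subst) :
    (permSubst π π').comp ((permSubst π.symm π'.symm).comp σ) = σ := by
  simp [Subst.comp, permSubst, Pattern.subst, SessId.subst]

theorem Pattern.isTuple_subst_perm {p : Pattern} {π π' : Equiv.Perm ℕ}
    (h : (p.subst (permSubst π π')).IsTuple) : p.IsTuple := by
  obtain ⟨n, ps, h⟩ := h
  cases p with
  | var x => simp [Pattern.subst, permSubst] at h
  | name s qs is => simp [Pattern.subst] at h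
  | app f qs =>
    simp only [Pattern.subst, Pattern.app.injEq] at h
    exact ⟨n, qs, by rw [h.1]⟩

theorem PosShape.variant {K : Set ℕ} {T T' : Set Pattern} {B : ℕ} {R S : Clause}
    (h : PosShape K T T' B R) (hS : R.Variant S) : PosShape K T T' B S := by
  obtain ⟨π, π', rfl⟩ := hS
  cases h with
  | prot h1 h2 =>
    refine .prot ?_ ⟨fun p hp ht => ?_, fun p hp ht => ?_⟩
    · obtain ⟨σ, h3, h4, h5⟩ := h1
      have key : ∀ p : Pattern, (p.subst (permSubst π π')).subst
          ((permSubst π.symm π'.symm).comp σ) = p.subst σ := fun p => by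
        rw [Pattern.subst_subst, permSubst_comp_symm]
      have hty : ∀ F, Typed K T σ F → Typed K T ((permSubst π.symm π'.symm).comp σ)
          (F.subst (permSubst π π')) := by
        rintro _ ⟨p, rfl, h6, h7⟩
        exact ⟨_, rfl, by rwa [key], h7.subst fun _ => Pattern.tagged_var _⟩
      refine ⟨(permSubst π.symm π'.symm).comp σ, fun F hF => ?_, ?_, ?_⟩
      · obtain ⟨G, hG, rfl⟩ := Multiset.mem_map.1 hF
        exact hty G (h3 G hG)
      · rcases h4 with h4 | ⟨p, h6, h7⟩
        · exact .inl (hty _ h4)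
        · refine .inr ⟨p.subst (permSubst π π'), ?_, by rwa [key]⟩
          simp [Clause.subst, h6, HornFact.subst]
      · simp only [Clause.subst]
        rwa [weight_subst, permSubst_comp_symm]
    · obtain ⟨G, hG, hGp⟩ := Multiset.mem_map.1 hp
      cases G with
      | attacker q =>
        cases hGp
        exact h2.1 q hG (Pattern.isTuple_subst_perm ht)
      | _ => cases hGp
    · simp only [Clause.subst] at hp
      cases hc : R.concl with
      | attacker q =>
        rw [hc] at hp
        cases hp
        exact h2.2 q hc (Pattern.isTuple_subst_perm ht)
      | _ => rw [hc] at hp; cases hp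
  | @con f l hl =>
    have : Clause.subst (permSubst π π') ⟨attackers l, .attacker (.app f (l.map .var))⟩ =
        ⟨attackers (l.map π), .attacker (.app f ((l.map π).map .var))⟩ := by
      simp [Clause.subst, attackers, HornFact.subst, Pattern.subst, permSubst, Function.comp_def]
    rw [this]
    exact .con f (hl.map π.injective)
  | fresh x =>
    have : Clause.subst (permSubst π π') ⟨0, .attacker (.name .b₀ [.var x] [])⟩ =
        ⟨0, .attacker (.name .b₀ [.var (π x)] [])⟩ := by
      simp [Clause.subst, HornFact.subst, Pattern.subst, permSubst]
    rw [this]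
    exact .fresh _
  | free a =>
    have : Clause.subst (permSubst π π') ⟨0, .attacker (freeName a)⟩ =
        ⟨0, .attacker (freeName a)⟩ := by
      simp [Clause.subst, HornFact.subst, Pattern.subst, freeName]
    rw [this]
    exact .free a
  | var x h => exact .var (π x) (by simp [Clause.subst, h, HornFact.subst, Pattern.subst, permSubst])
  | send x y =>
    have : Clause.subst (permSubst π π')
        ⟨{.attacker (.var x), .attacker (.var y)}, .message (.var x) (.var y)⟩ =
        ⟨{.attacker (.var (π x)), .attacker (.var (π y))}, .message (.var (π x)) (.var (π y))⟩ := by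
      simp [Clause.subst, HornFact.subst, Pattern.subst, permSubst]
    rw [this]
    exact .send _ _

/-- The properties that the simplification of clauses ensures. -/
structure Reduced (R : Clause) : Prop where
  nodup : R.hyps.Nodup
  not_taut : R.concl ∉ R.hyps
  useful : (∀ F ∈ R.hyps, ∃ x, F = .attacker (.var x)) → ∀ F ∈ R.hyps, F.vars ⊆ R.concl.vars

/-- If the conclusion is `attacker(x)`, a useful hypothesis could only be `attacker(x)` as well, and
the clause would be a tautology. -/
theorem Reduced.solved {R : Clause} (h : Reduced R)
    (hv : ∀ F ∈ R.hyps, ∃ x, F = .attacker (.var x)) : Solved R := by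
  refine ⟨fun F hF => ?_, h.nodup, fun x hx => ?_⟩
  · obtain ⟨x, rfl⟩ := hv F hF
    exact ⟨x, rfl, h.useful hv _ hF (vars_attacker.2 (.var x))⟩
  · refine Multiset.eq_zero_of_forall_notMem fun F hF => ?_
    obtain ⟨y, rfl⟩ := hv F hF
    have h1 := h.useful hv _ hF (vars_attacker.2 (.var y))
    rw [hx, vars_attacker, occurs_var] at h1
    cases h1
    exact h.not_taut (hx ▸ hF)

theorem reduced_of_mem_simplify {Fnot : Finset HornFact} {red : Clause → Clause}
    (hred : IsElimRedundantHyp red) {R D : Clause} (h : D ∈ simplify Fnot red R) : Reduced D := by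
  obtain ⟨D₀, -, rfl, h2⟩ := mem_simplify hred h
  refine ⟨elimhyps_nodup hred D₀, elimhyps_not_taut hred h2, fun hv F hF => ?_⟩
  rw [elimhyps_concl hred]
  exact elimhyps_useful hred D₀ hv F hF

theorem Flat.of_hyps_le {R R' : Clause} (h : Flat R) (hc : R'.concl = R.concl)
    (hh : R'.hyps ≤ R.hyps) : Flat R' :=
  ⟨fun p hp => h.1 p (Multiset.mem_of_le hh hp), fun p hp => h.2 p (hc ▸ hp)⟩

/-- The clauses of shape `con` are not changed by the elimination of hypotheses. -/
theorem elimhyps_con {red : Clause → Clause} (hred : IsElimRedundantHyp red) (f : Constr)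
    {l : List ℕ} (hl : l.Nodup) :
    elimhyps red ⟨attackers l, .attacker (.app f (l.map .var))⟩ =
      ⟨attackers l, .attacker (.app f (l.map .var))⟩ := by
  have h1 := elimhyps_concl hred ⟨attackers l, .attacker (.app f (l.map .var))⟩
  have h2 := elimhyps_hyps_le hred ⟨attackers l, .attacker (.app f (l.map .var))⟩
  have h3 : (elimhyps red ⟨attackers l, .attacker (.app f (l.map .var))⟩).hyps = attackers l := by
    refine le_antisymm h2 ((Multiset.le_iff_subset ?_).2 fun F hF => mem_elimhyps hred _ hF ?_)
    · exact Multiset.coe_nodup.2 (hl.map fun x y h => by simpa using h)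
    · simp only [attackers, Multiset.mem_coe, List.mem_map] at hF
      obtain ⟨x, hx, rfl⟩ := hF
      intro v hv
      rw [vars_attacker, occurs_var] at hv
      subst hv
      exact vars_attacker.2 (.app (List.mem_map.2 ⟨x, hx, rfl⟩) (.var x))
  cases h : elimhyps red ⟨attackers l, .attacker (.app f (l.map .var))⟩
  rw [h] at h1 h3
  simp only at h1 h3
  rw [h1, h3]

/-- Decomposition makes a clause flat unless it is literally one of the tuple or projection clauses,
which are exempt from decomposition. A typed clause that happens to be one of these falls under
their shapes. -/
theorem shape_of_prot {K : Set ℕ} {T T' : Set Pattern} (hT : Typing K T) {B : ℕ}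
    {Fnot : Finset HornFact} {red : Clause → Clause} (hred : IsElimRedundantHyp red) {R D : Clause}
    (h : Prot K T T' B R) (hD : D ∈ simplify Fnot red R) :
    Prot K T T' B D ∧ Shape K T T' B D := by
  obtain ⟨D₀, h1, rfl, -⟩ := mem_simplify hred hD
  have h2 := (h.decomp hT h1).of_hyps_le (elimhyps_concl hred D₀) (elimhyps_hyps_le hred D₀)
  refine ⟨h2, ?_⟩
  unfold decomp at h1
  split_ifs at h1 with hd
  · rw [Set.mem_singleton_iff] at h1
    subst h1
    obtain ⟨xs, hn, rfl | ⟨x, hx, rfl⟩⟩ := hd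
    · have := elimhyps_con hred (.tuple xs.length) hn
      simp only [attackers] at this
      rw [this]
      exact .con _ hn
    · exact .proj hx (elimhyps_hyps_le hred _) (elimhyps_concl hred _)
  · refine .prot h2 (Flat.of_hyps_le ?_ (elimhyps_concl hred D₀) (elimhyps_hyps_le hred D₀))
    obtain ⟨h3, h4⟩ := h1
    have key : ∀ (F : HornFact) (p : Pattern), .attacker p ∈ F.decomp → ¬ p.IsTuple := by
      intro F p hF
      cases F with
      | attacker q =>
        simp only [HornFact.decomp, List.mem_map, HornFact.attacker.injEq, exists_eq_right] at hF
        exact Pattern.not_isTuple_of_mem_flatten hF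
      | _ => simp [HornFact.decomp] at hF
    refine ⟨fun p hp => ?_, fun p hp => key _ p (hp ▸ h4)⟩
    rw [h3] at hp
    obtain ⟨G, -, hG⟩ := Clause.mem_decompHyps.1 hp
    exact key G p hG

theorem exists_map_eq {l : List ℕ} (hl : l.Nodup) {ts : List Pattern} (h : l.length = ts.length) :
    ∃ f : ℕ → Pattern, l.map f = ts := by
  refine ⟨fun x => ts.getD (l.idxOf x) star, List.ext_getElem (by simpa using h) ?_⟩
  intro i h1 h2
  simp only [List.length_map] at h1
  simp [hl.idxOf_getElem, h2]

theorem mem_attackers {l : List ℕ} {F : HornFact} :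
    F ∈ attackers l ↔ ∃ x ∈ l, F = .attacker (.var x) := by
  simp [attackers, eq_comm]

theorem unselectable_var (x : ℕ) : (HornFact.attacker (.var x)).Unselectable := .inl ⟨x, rfl⟩

theorem attacker_unify {C : HornFact} {q : Pattern} {μ : Subst}
    (h : C.subst μ = (HornFact.attacker q).subst μ) :
    ∃ p, C = .attacker p ∧ p.subst μ = q.subst μ := by
  cases C with
  | attacker p => exact ⟨p, rfl, HornFact.attacker.inj h⟩
  | _ => cases h

/-- Resolution on a hypothesis of a typed clause yields typed clauses. -/
theorem prot_of_prot {K : Set ℕ} {T T' : Set Pattern} (hT : Typing K T) {B : ℕ} {S R' : Clause}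
    {F₀ : HornFact} {H : Multiset HornFact} {μ : Subst} {V : Set Var} (hS : Solved S)
    (hSs : PosShape K T T' B S) (hR' : Prot K T T' B R') (hflat : Flat R')
    (hdisj : Disjoint S.vars R'.vars) (hK : R'.hyps = F₀ ::ₘ H) (hF₀ : ¬ F₀.Unselectable)
    (hμ : IsMGU {θ | S.concl.subst θ = F₀.subst θ} V μ) :
    Prot K T T' B (Clause.subst μ ⟨S.hyps + H, R'.concl⟩) := by
  obtain ⟨σ', h1, h2, h3⟩ := hR'
  obtain ⟨q, rfl, hqT, hqt⟩ := h1 F₀ (by rw [hK]; simp)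
  have hqv : ¬ q.IsVar := by
    rintro ⟨x, rfl⟩
    exact hF₀ (unselectable_var x)
  have hqtup : ¬ q.IsTuple := hflat.1 q (by rw [hK]; simp)
  obtain ⟨p, hp, hpq⟩ := attacker_unify hμ.unifies
  have step := fun σS => prot_step (σS := σS) (p := p) hT hS hdisj hK h1 h2 h3 hp hμ
  -- If the conclusion is `attacker(x)`, the typed instance of `x` is chosen to be that of `q`.
  have hvar : ∀ x, p = .var x → Prot K T T' B (Clause.subst μ ⟨S.hyps + H, R'.concl⟩) := by
    rintro x rfl
    exact step ⟨fun _ => q.subst σ', .var⟩ (by simp [Pattern.subst]) (.var μ x)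
  cases hSs with
  | prot h4 h5 =>
    by_cases hpv : p.IsVar
    · obtain ⟨x, hx⟩ := hpv
      exact hvar x hx
    · obtain ⟨σS, -, h6, -⟩ := h4
      rcases h6 with ⟨p', h6, h7, h8⟩ | ⟨p', h6, -⟩
      · rw [hp] at h6
        cases h6
        exact step σS (hT.erase_eq h8 hqt hpv hqv (h5.2 p hp) hpq h7 hqT) (h8.cutOK μ)
      · rw [hp] at h6
        cases h6
  | @con f l hl =>
    cases hp
    simp only [Pattern.subst] at hpq
    obtain ⟨qs, rfl, hqs⟩ := subst_eq_app hqv hpq.symm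
    have hlen := congrArg List.length hqs
    simp only [List.length_map] at hlen
    -- The distinct variables of the constructor clause receive the typed instances of the arguments
    -- of `q`. The clause itself is untagged, but unification gives it the tagged arguments of `q`.
    obtain ⟨g, hg⟩ := exists_map_eq hl (ts := qs.map (Pattern.subst σ')) (by simp [hlen])
    refine step ⟨g, .var⟩ ?_ (.app (fun p hp => ?_) fun hf => ?_)
    · simp only [Pattern.subst, ← hg, List.map_map]
      congr 2
      exact List.map_congr_left fun x _ => by simp [Pattern.subst]
    · obtain ⟨x, -, rfl⟩ := List.mem_map.1 hp
      exact .var μ x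
    · rw [← hqs]
      exact ((Pattern.tagged_app.1 hqt).1 hf).imp fun ct hct => hct.map_subst μ
  | fresh x =>
    cases hp
    simp only [Pattern.subst] at hpq
    obtain ⟨qs, js, rfl, hqs, -⟩ := subst_eq_name hqv hpq.symm
    simp only [Pattern.subst] at hqT
    rw [erase_name (by rw [isKey_name]; rintro ⟨⟨a, -, h⟩, -⟩; cases h)] at hqT
    -- A typed `b₀` can only be `star`, without arguments, so `b₀[x]` does not unify with it.
    have := hT.fresh _ _ hqT
    simp only [List.map_eq_nil_iff] at this
    subst this
    simp at hqs
  | free a =>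
    cases hp
    simp only [freeName, Pattern.subst] at hpq
    obtain ⟨qs, js, rfl, hqs, hjs⟩ := subst_eq_name hqv hpq.symm
    simp only [List.map_nil, List.map_eq_nil_iff] at hqs hjs
    subst hqs hjs
    exact step σ' (by simp [freeName]) (.name (by simp))
  | var x h =>
    rw [hp] at h
    exact hvar x (HornFact.attacker.inj h)
  | send x y => cases hp

/-- The left-hand side of a decryption rule carries no tag of its own, but the tagged term that it
is unified with puts a tagged tuple in the place of its first argument. -/
theorem TaggedBy.cutOK_decrypt {f : Constr} {ps qs : List Pattern} {μ : Subst}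
    (hps : DecryptArgs f ps) (hq : (Pattern.app f qs).Tagged)
    (h : qs.map (Pattern.subst μ) = ps.map (Pattern.subst μ)) : CutOK μ (.app f ps) := by
  refine .app (fun p hp => ?_) fun hf => ?_
  · have : (∃ x, p = .var x) ∨ ∃ x, p = .app .pk [.var x] := by
      rcases hps.2 with rfl | rfl | ⟨-, rfl⟩ <;> simp at hp <;> rcases hp with rfl | rfl | rfl <;>
        simp
    rcases this with ⟨x, rfl⟩ | ⟨x, rfl⟩
    · exact .var μ x
    · exact .app (by simpa using CutOK.var μ x) fun h => h.elim
  · rw [← h]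
    exact ((Pattern.tagged_app.1 hq).1 hf).imp fun ct hct => hct.map_subst μ

/-- Where the arguments of the rule are variables, they take the arguments of the typed term. Only
the second argument `pk(y)` of public-key encryption needs care: the type requires a public key
there, and all keys have the type `star`. -/
theorem decrypt_instance {K : Set ℕ} {T : Set Pattern} (hT : Typing K T) {f : Constr}
    {ps qs : List Pattern} {σS μ : Subst} (hps : DecryptArgs f ps)
    (h : qs.map (Pattern.subst μ) = ps.map (Pattern.subst μ))
    (hqT : ((Pattern.app f qs).subst σS).erase K ∈ T) :
    ∃ σ' : Subst, ((Pattern.app f ps).subst σ').erase K = ((Pattern.app f qs).subst σS).erase K := by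
  have hlen := congrArg List.length h
  simp only [List.length_map] at hlen
  rcases hps.2 with rfl | rfl | ⟨rfl, rfl⟩
  · obtain ⟨a, b, rfl⟩ := List.length_eq_two.1 hlen
    exact ⟨⟨fun n => if n = 0 then a.subst σS else b.subst σS, .var⟩, by simp [Pattern.subst]⟩
  · obtain ⟨a, b, c, rfl⟩ := List.length_eq_three.1 hlen
    exact ⟨⟨fun n => if n = 0 then a.subst σS else if n = 1 then b.subst σS else c.subst σS, .var⟩,
      by simp [Pattern.subst]⟩
  · obtain ⟨a, b, c, rfl⟩ := List.length_eq_three.1 hlen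
    simp only [Pattern.subst, erase_app, List.map_cons, List.map_nil] at hqT
    obtain ⟨rs, hrs⟩ := hT.pencrypt _ _ _ hqT
    have h1 : Pattern.app .pk rs ∈ T := hrs ▸ hT.app_mem _ _ hqT _ (by simp)
    have h2 := hT.pk rs h1
    subst h2
    refine ⟨⟨fun n => if n = 0 then a.subst σS else if n = 1 then star else c.subst σS, .var⟩, ?_⟩
    simp [Pattern.subst, erase_app, hrs, erase_star]

/-- Decryption of a term from a typed clause yields typed clauses. -/
theorem prot_of_decrypt {K : Set ℕ} {T T' : Set Pattern} (hT : Typing K T) {B : ℕ}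
    (hB : ∀ t ∈ T, 2 * t.size ≤ B) {S R' : Clause} {f : Constr} {ps : List Pattern}
    {H : Multiset HornFact} {μ : Subst} {V : Set Var} {p : Pattern} (hS : Solved S)
    (hSp : Prot K T T' B S) (hp : S.concl = .attacker p) (hpv : ¬ p.IsVar)
    (hdisj : Disjoint S.vars R'.vars) (hps : DecryptArgs f ps)
    (hK : R'.hyps = .attacker (.app f ps) ::ₘ H) (hH : H ≤ {.attacker (.var 1)})
    (hc : R'.concl = .attacker (.var 0))
    (hμ : IsMGU {θ | S.concl.subst θ = (HornFact.attacker (.app f ps)).subst θ} V μ) :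
    Prot K T T' B (Clause.subst μ ⟨S.hyps + H, R'.concl⟩) := by
  obtain ⟨σS, h1, h2, -⟩ := hSp
  have hun : p.subst μ = (Pattern.app f ps).subst μ := by
    have := hμ.unifies
    rw [hp] at this
    exact HornFact.attacker.inj this
  simp only [Pattern.subst] at hun
  obtain ⟨qs, rfl, hqs⟩ := subst_eq_app hpv hun
  obtain ⟨hpT, hpt⟩ : ((Pattern.app f qs).subst σS).erase K ∈ T ∧ (Pattern.app f qs).Tagged := by
    rcases h2 with ⟨p', h6, h7, h8⟩ | ⟨p', h6, -⟩
    · rw [hp] at h6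
      cases h6
      exact ⟨h7, h8⟩
    · rw [hp] at h6
      cases h6
  obtain ⟨σ', hσ'⟩ := decrypt_instance hT hps hqs hpT
  set σ := Subst.merge S.vars σS σ' with hσ
  have hR' : ∀ F : HornFact, F.vars ⊆ R'.vars → F.subst σ = F.subst σ' :=
    fun F hF => HornFact.merge_right (hdisj.mono_right hF)
  have hpS : (Pattern.app f qs).subst σ = (Pattern.app f qs).subst σS := by
    have := HornFact.merge_left (σ := σS) (τ := σ') (Clause.vars_concl S)
    rw [hp] at this
    exact HornFact.attacker.inj this
  have hqS : (Pattern.app f ps).subst σ = (Pattern.app f ps).subst σ' := HornFact.attacker.inj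
    (hR' (.attacker (.app f ps)) (Clause.vars_hyps (by rw [hK]; simp)))
  have hE : ((Pattern.app f qs).subst σ).erase K = ((Pattern.app f ps).subst σ).erase K := by
    rw [hpS, hqS, hσ']
  have hpsT : ((Pattern.app f ps).subst σ).erase K ∈ T := by rwa [hqS, hσ']
  have hocc0 : Var.Occurs (.ord 0) (.app f ps) := by
    rcases hps.2 with rfl | rfl | ⟨-, rfl⟩ <;> simp [occurs_app, occurs_var]
  have hocc1 : Var.Occurs (.ord 1) (.app f ps) := by
    rcases hps.2 with rfl | rfl | ⟨-, rfl⟩ <;> simp [occurs_app, occurs_var]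
  rw [hp] at hμ
  refine prot_resolvent (σ := σ) (fun F hF => ?_) ?_ ?_ hμ hE (hpt.cutOK μ)
    (TaggedBy.cutOK_decrypt hps hpt hqs)
  · rcases Multiset.mem_add.1 hF with hF | hF
    · exact (h1 F hF).congr (HornFact.merge_left (Clause.vars_hyps hF))
    · have := Multiset.mem_of_le hH hF
      rw [Multiset.mem_singleton] at this
      exact ⟨_, this, by simpa [Pattern.subst] using hT.mem_of_occurs hpsT hocc1,
        Pattern.tagged_var _⟩
  · exact .inl ⟨_, hc, by simpa [Pattern.subst] using hT.mem_of_occurs hpsT hocc0,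
      Pattern.tagged_var _⟩
  -- The hypotheses of the typed clause weigh less than the decrypted term. The hypothesis on the
  -- decryption key weighs at most as much, since variable `1` occurs in that term. Hence the factor
  -- 2 in `hB`.
  · have h3 := hS.weight_lt σ
    rw [hp] at h3
    simp only [HornFact.subst, HornFact.size] at h3
    rw [hpS, ← size_erase K] at h3
    have h4 := weight_le (σ := σ) hH
    have h5 := hB _ hpT
    have h6 : weight σ {.attacker (.var 1)} ≤ (((Pattern.app f qs).subst σS).erase K).size := by
      rw [← hpS, hE, size_erase]
      have h7 := Pattern.sum_le_of_nodup (σ := σ) (p := .app f ps) (l := [1]) (by simp)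
        (by simpa using hocc1)
      have h8 := (Pattern.sum_ovars_add_le σ (.app f ps)).1
      simp only [List.map_cons, List.map_nil, List.sum_cons, List.sum_nil] at h7
      simp only [weight, Multiset.map_singleton, Multiset.sum_singleton, HornFact.subst,
        HornFact.size, Pattern.subst] at h7 h8 ⊢
      omega
    rw [weight_add]
    omega

/-! ## Finitely many clauses of bounded types, up to renaming -/

/-- The number of a variable. -/
def Var.idx : Var → ℕ
  | .ord x => x
  | .sess i => i

theorem finite_forall₂ {α β : Type*} {A : α → β → Prop} {l : List β}
    (h : ∀ b ∈ l, {a | A a b}.Finite) : {l' | List.Forall₂ A l' l}.Finite := by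
  induction l with
  | nil => simp
  | cons b l ih =>
    have h1 := h b (by simp)
    have h2 := ih fun b hb => h b (by simp [hb])
    refine (h1.image2 List.cons h2).subset ?_
    rintro _ hl
    cases hl with
    | cons h3 h4 => exact ⟨_, h3, _, h4, rfl⟩

theorem forall₂_of_map_eq {α β : Type*} {A : α → β → Prop} {f : α → β} {l : List α} {l' : List β}
    (h : l.map f = l') (hA : ∀ a ∈ l, A a (f a)) : List.Forall₂ A l l' := by
  subst h
  induction l with
  | nil => exact .nil
  | cons a l ih => exact .cons (hA a (by simp)) (ih fun b hb => hA b (by simp [hb]))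

/-- Such a pattern arises from `t` by putting bounded variables for some subterms, keys for some
occurrences of `star`, and bounded variables for some session identifiers. At each node of `t` there
are finitely many choices. -/
theorem finite_patterns {K : Set ℕ} (hK : K.Finite) (M : ℕ) (t : Pattern) :
    {p : Pattern | (∀ v : Var, v.Occurs p → v.idx < M) ∧ ∃ σ, (p.subst σ).erase K = t}.Finite := by
  set A : Pattern → Pattern → Prop := fun p t =>
    (∀ v : Var, v.Occurs p → v.idx < M) ∧ ∃ σ, (p.subst σ).erase K = t with hA
  have hvar : ((Pattern.var) '' Set.Iio M ∪ freeName '' K).Finite :=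
    ((Set.finite_Iio M).image _).union (hK.image _)
  have hsess : ∀ i : SessId, ({j | j = i} ∪ SessId.var '' Set.Iio M).Finite := fun i =>
    (Set.finite_singleton i).union ((Set.finite_Iio M).image _)
  induction t using Pattern.induct with
  | hv y =>
    refine hvar.subset ?_
    rintro p ⟨h1, σ, h2⟩
    cases p with
    | var x => exact .inl ⟨x, h1 (.ord x) (.var x), rfl⟩
    | name s ps is =>
      simp only [Pattern.subst] at h2
      by_cases hk : IsKey K (.name s (ps.map (Pattern.subst σ)) (is.map (SessId.subst σ)))
      · rw [erase_key hk] at h2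
        cases h2
      · rw [erase_name hk] at h2
        cases h2
    | app f ps =>
      simp only [Pattern.subst] at h2
      rw [erase_app] at h2
      cases h2
  | hn s ts is ih =>
    have h3 := finite_forall₂ (A := A) (l := ts) ih
    have h4 := finite_forall₂ (A := fun j i => j ∈ ({j | j = i} ∪ SessId.var '' Set.Iio M))
      (l := is) fun i _ => hsess i
    refine (hvar.union (h3.image2 (fun ps js => Pattern.name s ps js) h4)).subset ?_
    rintro p ⟨h1, σ, h2⟩
    cases p with
    | var x => exact .inl (.inl ⟨x, h1 (.ord x) (.var x), rfl⟩)
    | name s' ps js =>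
      simp only [Pattern.subst] at h2
      by_cases hk : IsKey K (.name s' (ps.map (Pattern.subst σ)) (js.map (SessId.subst σ)))
      · obtain ⟨⟨a, ha, rfl⟩, h5, h6⟩ := isKey_name.1 hk
        rw [List.map_eq_nil_iff] at h5 h6
        subst h5 h6
        exact .inl (.inr ⟨a, ha, rfl⟩)
      · rw [erase_name hk, List.map_map] at h2
        simp only [Pattern.name.injEq] at h2
        obtain ⟨rfl, h5, h6⟩ := h2
        refine .inr ⟨ps, forall₂_of_map_eq h5 fun p hp => ?_, js, forall₂_of_map_eq h6 fun j hj => ?_,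
          rfl⟩
        · exact ⟨fun v hv => h1 v (.name hp hv), σ, rfl⟩
        · cases j with
          | var j => exact .inr ⟨j, h1 (.sess j) (.sess hj), rfl⟩
          | const l => exact .inl rfl
    | app f ps =>
      simp only [Pattern.subst] at h2
      rw [erase_app] at h2
      cases h2
  | ha f ts ih =>
    have h3 := finite_forall₂ (A := A) (l := ts) ih
    refine (hvar.union (h3.image (Pattern.app f))).subset ?_
    rintro p ⟨h1, σ, h2⟩
    cases p with
    | var x => exact .inl (.inl ⟨x, h1 (.ord x) (.var x), rfl⟩)
    | name s' ps js =>
      simp only [Pattern.subst] at h2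
      by_cases hk : IsKey K (.name s' (ps.map (Pattern.subst σ)) (js.map (SessId.subst σ)))
      · rw [erase_key hk] at h2
        cases h2
      · rw [erase_name hk] at h2
        cases h2
    | app f ps =>
      simp only [Pattern.subst] at h2
      rw [erase_app, List.map_map] at h2
      simp only [Pattern.app.injEq] at h2
      obtain ⟨rfl, h5⟩ := h2
      refine .inr ⟨ps, forall₂_of_map_eq h5 fun p hp => ?_, rfl⟩
      exact ⟨fun v hv => h1 v (.app hp hv), σ, rfl⟩

theorem finite_clauses {𝓕 : Set HornFact} (h𝓕 : 𝓕.Finite) :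
    {R : Clause | R.hyps.Nodup ∧ (∀ F ∈ R.hyps, F ∈ 𝓕) ∧ R.concl ∈ 𝓕}.Finite := by
  have h1 : {H : Multiset HornFact | H.Nodup ∧ ∀ F ∈ H, F ∈ 𝓕}.Finite := by
    refine ((h𝓕.toFinset.powerset.finite_toSet).image Finset.val).subset ?_
    rintro H ⟨hn, hH⟩
    refine ⟨⟨H, hn⟩, ?_, rfl⟩
    simp only [Finset.coe_powerset, Set.mem_preimage, Set.mem_powerset_iff]
    intro F hF
    simpa using hH F hF
  refine (h1.image2 Clause.mk h𝓕).subset ?_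
  rintro ⟨H, C⟩ ⟨h2, h3, h4⟩
  exact ⟨H, ⟨h2, h3⟩, C, h4, rfl⟩

theorem HornFact.vars_length_le (F : HornFact) :
    (F.patterns.flatMap Pattern.ovars).length ≤ F.size ∧
    (F.patterns.flatMap Pattern.svars).length ≤ F.size := by
  cases F with
  | message p q =>
    have h1 := p.vars_length_le
    have h2 := q.vars_length_le
    simp only [HornFact.patterns, List.flatMap_cons, List.flatMap_nil, List.length_append,
      List.length_nil, HornFact.size]
    omega
  | attacker p | mevent p | event p =>
    have h1 := p.vars_length_le
    simp only [HornFact.patterns, List.flatMap_cons, List.flatMap_nil, List.length_append,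
      List.length_nil, HornFact.size]
    omega

/-- The lists collect all occurrences of variables, so they may contain repetitions, but the size of
the clause bounds their lengths. Positions in them serve as bounded names for the variables. -/
theorem exists_varLists (R : Clause) : ∃ l l' : List ℕ, l.length ≤ R.size ∧ l'.length ≤ R.size ∧
    (∀ x, Var.ord x ∈ R.vars → x ∈ l) ∧ ∀ i, Var.sess i ∈ R.vars → i ∈ l' := by
  obtain ⟨hl, hhl⟩ := Quot.exists_rep R.hyps
  have hmem : ∀ F, F ∈ R.hyps ↔ F ∈ hl := fun F => by rw [← hhl]; exact Iff.rfl
  have hsize : R.size = ((R.concl :: hl).map HornFact.size).sum := by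
    rw [Clause.size, ← hhl]
    simp
  refine ⟨(R.concl :: hl).flatMap fun F => F.patterns.flatMap Pattern.ovars,
    (R.concl :: hl).flatMap fun F => F.patterns.flatMap Pattern.svars, ?_, ?_, ?_, ?_⟩
  · rw [hsize, List.length_flatMap]
    exact list_sum_map_le fun F _ => F.vars_length_le.1
  · rw [hsize, List.length_flatMap]
    exact list_sum_map_le fun F _ => F.vars_length_le.2
  · rintro x (⟨p, hp, hx⟩ | ⟨F, hF, p, hp, hx⟩)
    · exact List.mem_flatMap.2 ⟨_, by simp, List.mem_flatMap.2 ⟨p, hp, Pattern.mem_ovars.2 hx⟩⟩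
    · exact List.mem_flatMap.2 ⟨F, by simp [(hmem F).1 hF],
        List.mem_flatMap.2 ⟨p, hp, Pattern.mem_ovars.2 hx⟩⟩
  · rintro x (⟨p, hp, hx⟩ | ⟨F, hF, p, hp, hx⟩)
    · exact List.mem_flatMap.2 ⟨_, by simp, List.mem_flatMap.2 ⟨p, hp, Pattern.mem_svars.2 hx⟩⟩
    · exact List.mem_flatMap.2 ⟨F, by simp [(hmem F).1 hF],
        List.mem_flatMap.2 ⟨p, hp, Pattern.mem_svars.2 hx⟩⟩

theorem subsumes_of_subst_eq {R R' : Clause} {σ : Subst} (h : R.subst σ = R') :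
    Subsumes R R' := by
  subst h
  exact ⟨σ, rfl, le_rfl⟩

/-- The typed instance bounds the size of the clause, hence the number of its variables. After
renaming these to small numbers, all facts come from a finite set, and without duplicate hypotheses
only finitely many clauses can be formed. -/
theorem finite_prot {K : Set ℕ} {T T' : Set Pattern} (hT : Typing K T) (hT' : T'.Finite) (B : ℕ) :
    ∃ 𝒞 : Set Clause, 𝒞.Finite ∧ ∀ R, Prot K T T' B R → R.hyps.Nodup →
      ∃ C ∈ 𝒞, Subsumes R C ∧ Subsumes C R := by
  obtain ⟨N, hN⟩ : ∃ N, ∀ t ∈ T ∪ T', t.size ≤ N := by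
    obtain ⟨N, hN⟩ := ((hT.finite.union hT').image Pattern.size).bddAbove
    exact ⟨N, fun t ht => hN ⟨t, ht, rfl⟩⟩
  -- The conclusion has size at most `1 + N`, where 1 accounts for the predicate `event`, and the
  -- hypotheses together at most `B`.
  set M := 1 + N + B with hM
  set G : Set Pattern := ⋃ t ∈ T ∪ T',
    {p : Pattern | (∀ v : Var, v.Occurs p → v.idx < M) ∧ ∃ σ, (p.subst σ).erase K = t} with hG
  have hGf : G.Finite := (hT.finite.union hT').biUnion fun t _ => finite_patterns hT.keys_finite M t
  have h𝓕 : (HornFact.attacker '' G ∪ HornFact.event '' G).Finite :=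
    (hGf.image _).union (hGf.image _)
  refine ⟨_, finite_clauses h𝓕, fun R hR hn => ?_⟩
  obtain ⟨σ, h1, h2, h3⟩ := hR
  have hsize : R.size ≤ M := by
    have h4 : (R.hyps.map HornFact.size).sum ≤ weight σ R.hyps :=
      multiset_sum_le_of_forall fun F _ => F.size_le_subst σ
    have h5 : R.concl.size ≤ 1 + N := by
      rcases h2 with ⟨p, h6, h7, -⟩ | ⟨p, h6, h7⟩
      · have h8 := hN _ (.inl h7)
        rw [size_erase] at h8
        have h9 := p.size_le_subst σ
        rw [h6, HornFact.size]
        omega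
      · have h8 := hN _ (.inr h7)
        rw [size_erase] at h8
        have h9 := p.size_le_subst σ
        rw [h6, HornFact.size]
        omega
    rw [Clause.size]
    omega
  obtain ⟨l, l', hl1, hl1', hl2, hl2'⟩ := exists_varLists R
  -- Every variable becomes its position in the list, and `ρ'` reads the list back; the default
  -- value 0 is irrelevant, since the positions of variables of `R` are in range.
  set ρ : Subst := ⟨fun x => .var (l.idxOf x), fun i => .var (l'.idxOf i)⟩ with hρ
  set ρ' : Subst := ⟨fun x => .var (l.getD x 0), fun i => .var (l'.getD i 0)⟩ with hρ'
  have hinv : ∀ v ∈ R.vars, v.Agree (ρ.comp ρ') .id := by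
    intro v hv
    cases v with
    | ord x =>
      have := hl2 x hv
      simp [Var.Agree, Subst.comp, hρ, hρ', Pattern.subst, Subst.id, this]
    | sess i =>
      have := hl2' i hv
      simp [Var.Agree, Subst.comp, hρ, hρ', SessId.subst, Subst.id, this]
  have hback : (R.subst ρ).subst ρ' = R := by
    rw [Clause.subst_subst]
    exact Clause.subst_eq_self hinv
  have hidx : ∀ p : Pattern, (∀ v : Var, v.Occurs p → v ∈ R.vars) →
      ∀ v : Var, v.Occurs (p.subst ρ) → v.idx < M := by
    intro p hp v hv
    rcases Pattern.occurs_subst.1 hv with ⟨x, hx, hxv⟩ | ⟨i, j, hi, rfl, hj⟩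
    · simp only [hρ, occurs_var] at hxv
      subst hxv
      have := List.idxOf_lt_length_of_mem (hl2 x (hp _ hx))
      simp only [Var.idx]
      omega
    · simp only [hρ, SessId.var.injEq] at hj
      subst hj
      have := List.idxOf_lt_length_of_mem (hl2' i (hp _ hi))
      simp only [Var.idx]
      omega
  have hGmem : ∀ p : Pattern, (∀ v : Var, v.Occurs p → v ∈ R.vars) →
      (p.subst σ).erase K ∈ T ∪ T' → p.subst ρ ∈ G := by
    intro p hp hpT
    refine Set.mem_biUnion hpT ⟨hidx p hp, ρ'.comp σ, ?_⟩
    rw [← Pattern.subst_subst, Pattern.subst_subst ρ,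
      Pattern.subst_eq_self (σ := ρ.comp ρ') fun v hv => hinv v (hp v hv)]
  refine ⟨R.subst ρ, ⟨?_, ?_, ?_⟩, subsumes_of_subst_eq rfl, subsumes_of_subst_eq hback⟩
  · refine Multiset.Nodup.map_on (fun F hF F' hF' hFF' => ?_) hn
    have h4 : ∀ F ∈ R.hyps, (F.subst ρ).subst ρ' = F := fun F hF => by
      rw [HornFact.subst_subst]
      exact HornFact.subst_eq_self fun v hv => hinv v (Clause.vars_hyps hF hv)
    rw [← h4 F hF, hFF', h4 F' hF']
  · intro F hF
    obtain ⟨F', hF', rfl⟩ := Multiset.mem_map.1 hF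
    obtain ⟨p, rfl, hp, -⟩ := h1 F' hF'
    exact .inl ⟨_, hGmem p (fun v hv => Clause.vars_hyps hF' (vars_attacker.2 hv)) (.inl hp), rfl⟩
  · have hc := Clause.vars_concl R
    rcases h2 with ⟨p, h6, h7, -⟩ | ⟨p, h6, h7⟩
    · rw [h6] at hc
      exact .inl ⟨_, hGmem p (fun v hv => hc (vars_attacker.2 hv)) (.inl h7), by
        simp [Clause.subst, h6, HornFact.subst]⟩
    · rw [h6] at hc
      exact .inr ⟨_, hGmem p (fun v hv => hc (vars_event.2 hv)) (.inr h7), by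
        simp [Clause.subst, h6, HornFact.subst]⟩

/-! ## The invariant of the saturation -/

/-- Must-events never arise for these queries, so the only unselectable hypotheses are `attacker` of
variables. -/
theorem Shape.hyps_kind {K : Set ℕ} {T T' : Set Pattern} {B : ℕ} {R : Clause}
    (h : Shape K T T' B R) {F : HornFact} (hF : F ∈ R.hyps) (hu : F.Unselectable) :
    ∃ x, F = .attacker (.var x) := by
  refine hu.elim id ?_
  rintro ⟨q, rfl⟩
  exfalso
  cases h with
  | prot h1 _ =>
    obtain ⟨σ, h1, -⟩ := h1
    obtain ⟨p, h2, -⟩ := h1 _ hF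
    cases h2
  | con f _ =>
    obtain ⟨x, -, h⟩ := mem_attackers.1 hF
    cases h
  | proj _ h _ => simpa using Multiset.mem_of_le h hF
  | decrypt _ h _ => simpa using Multiset.mem_of_le h hF
  | fresh x => simp at hF
  | free a => simp at hF
  | listen h _ => simpa using Multiset.mem_of_le h hF
  | send x y => simp at hF

/-- Resolution steps of the saturation lead to clauses of the shapes above. -/
theorem saturation_step {K : Set ℕ} {T T' : Set Pattern} (hT : Typing K T) {B : ℕ}
    (hB : ∀ t ∈ T, 2 * t.size ≤ B) {A : Params} (hred : IsElimRedundantHyp A.red)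
    (hsel : IsSel₀ A.sel) {𝓡 : Set Clause} (hanti : ClauseAntichain 𝓡)
    (hCl : ∀ R ∈ 𝓡, Shape K T T' B R ∧ Reduced R) {R R' R'' D : Clause} {F₀ : HornFact}
    (hR : R ∈ 𝓡) (hRs : A.sel R = ∅) (hR' : R' ∈ 𝓡) (hF₀ : F₀ ∈ A.sel R')
    (hres : IsResolvent R F₀ R' R'') (hD : D ∈ simplify A.Fnot A.red R'') :
    Prot K T T' B D ∧ Shape K T T' B D ∧ Reduced D := by
  obtain ⟨S, H, μ, hRS, hdisj, hK, hμ, rfl⟩ := hres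
  have hRv : ∀ F ∈ R.hyps, ∃ x, F = .attacker (.var x) := by
    intro F hF
    refine (hCl R hR).1.hyps_kind hF ?_
    by_contra hu
    obtain ⟨F', -, -, h⟩ := (hsel R).2 ⟨F, hF, hu⟩
    rw [hRs] at h
    exact Set.singleton_ne_empty _ h.symm
  have hF₀u : ¬ F₀.Unselectable := by
    by_cases h : ∃ F ∈ R'.hyps, ¬ F.Unselectable
    · obtain ⟨F', -, h1, h2⟩ := (hsel R').2 h
      rw [h2, Set.mem_singleton_iff] at hF₀
      exact hF₀ ▸ h1
    · push Not at h
      rw [(hsel R').1 h] at hF₀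
      exact hF₀.elim
  have hRsol := (hCl R hR).2.solved hRv
  have hS : Solved S := hRsol.variant hRS
  have hSs : PosShape K T T' B S := (hCl R hR).1.pos.variant hRS
  -- A solved clause with conclusion `attacker(x)` has no hypothesis and subsumes all clauses that
  -- conclude some `attacker` fact. In an antichain it would equal `R'`, which has the hypothesis
  -- `F₀`.
  have hvar : ∀ p', R'.concl = .attacker p' → ∀ p, S.concl = .attacker p → ¬ p.IsVar := by
    rintro p' hp' _ hx ⟨x, rfl⟩
    have h1 : ∃ y, R.concl = .attacker (.var y) := by
      obtain ⟨π, π', rfl⟩ := hRS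
      simp only [Clause.subst] at hx
      cases hc : R.concl with
      | attacker p =>
        rw [hc] at hx
        cases p with
        | var y => exact ⟨y, rfl⟩
        | _ => simp [HornFact.subst, Pattern.subst] at hx
      | _ => rw [hc] at hx; simp [HornFact.subst] at hx
    obtain ⟨y, hy⟩ := h1
    have h2 := hRsol.concl_var y hy
    have h3 : Subsumes R R' := ⟨⟨fun _ => p', .var⟩, by
      simp [hy, hp', HornFact.subst, Pattern.subst], by simp [h2]⟩
    have h4 := hanti R' hR' R hR h3
    rw [h4, hK] at h2
    exact Multiset.cons_ne_zero h2
  have hmem : F₀ ∈ R'.hyps := by rw [hK]; simp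
  have taut : HornFact.subst μ R'.concl ∈ (S.hyps + H).map (HornFact.subst μ) →
      Prot K T T' B D ∧ Shape K T T' B D ∧ Reduced D := by
    intro h
    rw [simplify_of_taut hred (R := Clause.subst μ ⟨S.hyps + H, R'.concl⟩) h] at hD
    exact hD.elim
  have fin : Prot K T T' B (Clause.subst μ ⟨S.hyps + H, R'.concl⟩) →
      Prot K T T' B D ∧ Shape K T T' B D ∧ Reduced D := by
    intro h
    have h1 := shape_of_prot hT hred h hD
    exact ⟨h1.1, h1.2, reduced_of_mem_simplify hred hD⟩
  have h := (hCl R' hR').1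
  cases h with
  | prot h1 h2 => exact fin (prot_of_prot hT hS hSs h1 h2 hdisj hK hF₀u hμ)
  | con f _ =>
    obtain ⟨x, -, rfl⟩ := mem_attackers.1 hmem
    exact (hF₀u (unselectable_var x)).elim
  | @proj _ n l x hx hh hc =>
    have hF := Multiset.mem_singleton.1 (Multiset.mem_of_le hh hmem)
    subst hF
    obtain ⟨p, hp, hpq⟩ := attacker_unify hμ.unifies
    have hpv := hvar _ hc p hp
    simp only [Pattern.subst] at hpq
    obtain ⟨qs, rfl, hqs⟩ := subst_eq_app hpv hpq
    cases hSs with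
    -- Typed clauses are flat, so they never conclude `attacker` of a tuple.
    | prot _ h2 => exact (h2.2 _ hp ⟨_, _, rfl⟩).elim
    -- Building a tuple and projecting it gives back one of the hypotheses: a tautology.
    | @con f l' hl' =>
      cases hp
      refine taut ?_
      rw [hc]
      have h3 : (Pattern.var x).subst μ ∈ (l'.map Pattern.var).map (Pattern.subst μ) := by
        rw [hqs]
        exact List.mem_map_of_mem (List.mem_map_of_mem hx)
      obtain ⟨z, hz, hzx⟩ := List.mem_map.1 h3
      obtain ⟨y, hy, rfl⟩ := List.mem_map.1 hz
      refine Multiset.mem_map.2 ⟨.attacker (.var y), ?_, by simp [HornFact.subst, hzx]⟩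
      exact Multiset.mem_add.2 (.inl (mem_attackers.2 ⟨y, hy, rfl⟩))
    | fresh y => cases hp
    | free a => cases hp
    | var y h => rw [h] at hp; cases hp
    | send y z => cases hp
  | @decrypt _ f ps hps hh hc =>
    have hF : F₀ = .attacker (.app f ps) := by
      have := Multiset.mem_of_le hh hmem
      simp only [Multiset.insert_eq_cons, Multiset.mem_cons, Multiset.mem_singleton] at this
      refine this.elim id fun h => (hF₀u ?_).elim
      exact h ▸ unselectable_var 1
    subst hF
    obtain ⟨p, hp, hpq⟩ := attacker_unify hμ.unifies
    have hpv := hvar _ hc p hp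
    simp only [Pattern.subst] at hpq
    obtain ⟨qs, rfl, hqs⟩ := subst_eq_app hpv hpq
    cases hSs with
    | prot h1 h2 =>
      refine fin (prot_of_decrypt hT hB hS h1 hp hpv hdisj hps hK ?_ hc hμ)
      rw [hK, Multiset.insert_eq_cons, Multiset.cons_le_cons_iff] at hh
      exact hh
    -- Encrypting or signing and then recovering the message gives back the first hypothesis of the
    -- constructor clause.
    | @con f l' hl' =>
      cases hp
      refine taut ?_
      rw [hc]
      obtain ⟨rest, hrest⟩ : ∃ rest, ps = .var 0 :: rest := by
        rcases hps.2 with rfl | rfl | ⟨-, rfl⟩ <;> exact ⟨_, rfl⟩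
      subst hrest
      cases l' with
      | nil => simp at hqs
      | cons y l' =>
        simp only [List.map_cons, List.cons.injEq] at hqs
        refine Multiset.mem_map.2 ⟨.attacker (.var y), ?_, by simp [HornFact.subst, hqs.1]⟩
        exact Multiset.mem_add.2 (.inl (mem_attackers.2 ⟨y, by simp, rfl⟩))
    | fresh y => cases hp
    | free a => cases hp
    | var y h => rw [h] at hp; cases hp
    | send y z => cases hp
  | fresh x => simp at hmem
  | free a => simp at hmem
  | listen hh hc =>
    have hF : F₀ = .message (.var 0) (.var 1) := by
      have := Multiset.mem_of_le hh hmem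
      simp only [Multiset.insert_eq_cons, Multiset.mem_cons, Multiset.mem_singleton] at this
      refine this.elim id fun h => (hF₀u ?_).elim
      exact h ▸ unselectable_var 0
    subst hF
    have hun : S.concl.subst μ = (HornFact.message (.var 0) (.var 1)).subst μ := hμ.unifies
    cases hSs with
    -- All channels are public, so typed clauses conclude `attacker` or `event`, never `message`.
    | prot h1 _ =>
      obtain ⟨σ, -, ⟨p, h3, -⟩ | ⟨p, h3, -⟩, -⟩ := h1 <;> rw [h3] at hun <;> cases hun
    | con f _ => cases hun
    | fresh y => cases hun
    | free a => cases hun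
    | var y h => rw [h] at hun; cases hun
    -- Listening to a message that the adversary sent teaches nothing new.
    | send y z =>
      refine taut ?_
      rw [hc]
      simp only [HornFact.subst, HornFact.message.injEq] at hun
      exact Multiset.mem_map.2 ⟨.attacker (.var z), by simp, by simp [HornFact.subst, hun.2]⟩
  | send x y =>
    simp only [Multiset.insert_eq_cons, Multiset.mem_cons, Multiset.mem_singleton] at hmem
    rcases hmem with rfl | rfl
    · exact (hF₀u (unselectable_var x)).elim
    · exact (hF₀u (unselectable_var y)).elim

/-! ## The initial clauses -/

theorem finite_decomp (R : Clause) : (decomp R).Finite := by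
  unfold decomp
  split_ifs
  · exact Set.finite_singleton _
  · refine ((List.finite_toSet R.concl.decomp).image fun C => ⟨R.decompHyps, C⟩).subset ?_
    rintro ⟨H, C⟩ ⟨rfl, hC⟩
    exact ⟨C, hC, rfl⟩

theorem finite_simplify {Fnot : Finset HornFact} {red : Clause → Clause} (R : Clause) :
    (simplify Fnot red R).Finite := by
  refine ((finite_decomp R).image (elimhyps red)).subset ?_
  rintro _ ⟨D, hD, -, -, rfl⟩
  exact ⟨D, hD, rfl⟩

theorem finite_attackerClause (Sg : Signature) (Init : Finset ℕ) :
    {R | AttackerClause Sg Init R}.Finite := by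
  have h : ∀ R, AttackerClause Sg Init R → R ∈
      (fun a => (⟨0, .attacker (freeName a)⟩ : Clause)) '' (Init : Set ℕ) ∪
      (fun f : Constr => (⟨((List.range f.arity).map fun i => HornFact.attacker (.var i) :
        List HornFact), .attacker (.app f ((List.range f.arity).map .var))⟩ : Clause)) ''
        (Sg.constrs : Set Constr) ∪
      (fun g : Destr => (⟨((g.lhsPat 0).map HornFact.attacker : List HornFact),
        .attacker (g.rhsPat 0)⟩ : Clause)) '' (Sg.destrs : Set Destr) ∪
      {⟨0, .attacker (.name .b₀ [.var 0] [])⟩,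
        ⟨{.message (.var 0) (.var 1), .attacker (.var 0)}, .attacker (.var 1)⟩,
        ⟨{.attacker (.var 0), .attacker (.var 1)}, .message (.var 0) (.var 1)⟩} := by
    intro R hR
    cases hR with
    | init a ha => exact .inl (.inl (.inl ⟨a, ha, rfl⟩))
    | rn => exact .inr (.inl rfl)
    | rf f hf => exact .inl (.inl (.inr ⟨f, hf, rfl⟩))
    | rg g hg hp => exact .inl (.inr ⟨g, hg, rfl⟩)
    | rl => exact .inr (.inr (.inl rfl))
    | rs => exact .inr (.inr (.inr rfl))
  refine Set.Finite.subset ?_ h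
  refine (((Finset.finite_toSet _).image _).union ((Finset.finite_toSet _).image _)).union
    ((Finset.finite_toSet _).image _) |>.union (Set.toFinite _)

-- Simplification of the clauses of the adversary

theorem mem_decomp_of_flat {R D : Clause} (hf : Flat R) (h : D ∈ decomp R) : D = R := by
  unfold decomp at h
  split_ifs at h with hd
  · exact h
  · obtain ⟨h1, h2⟩ := h
    have key : ∀ F : HornFact, (∀ p, F = .attacker p → ¬ p.IsTuple) → F.decomp = [F] := by
      rintro F hF
      cases F with
      | attacker p => simp [HornFact.decomp, Pattern.flatten_of_not_isTuple (hF p rfl)]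
      | _ => rfl
    rw [key _ hf.2, List.mem_singleton] at h2
    have h3 : R.decompHyps = R.hyps := by
      rw [Clause.decompHyps, Multiset.bind_congr (g := fun F => {F}) fun F hF => ?_]
      · exact (Multiset.bind_singleton R.hyps id).trans (Multiset.map_id _)
      · rw [key F fun p hp => hf.1 p (hp ▸ hF)]
        rfl
    cases D
    simp only at h1 h2
    rw [h1, h2, h3]

theorem mem_decomp_self_of_flat {R : Clause} (hf : Flat R) : R ∈ decomp R := by
  have hne : (decomp R).Nonempty := by
    unfold decomp
    split_ifs with hd
    · exact ⟨R, rfl⟩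
    · cases hc : R.concl with
      | attacker p =>
        exact ⟨⟨R.decompHyps, .attacker p⟩, rfl, by
          simp [HornFact.decomp, Pattern.flatten_of_not_isTuple (hf.2 p hc)]⟩
      | _ => exact ⟨⟨R.decompHyps, _⟩, rfl, List.mem_singleton.2 rfl⟩
  obtain ⟨D, hD⟩ := hne
  have := mem_decomp_of_flat hf hD
  rwa [this] at hD

/-- Closed secrecy assumptions are their own only instances, so they cannot remove a clause without
closed hypotheses. This guarantees that the clauses needed to subsume others do get inserted. -/
theorem elimhyps_mem_simplify {Fnot : Finset HornFact} (hFnot : ∀ F ∈ Fnot, F.Closed)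
    {red : Clause → Clause} (hred : IsElimRedundantHyp red) {R : Clause} (hf : Flat R)
    (hopen : ∀ F ∈ R.hyps, ¬ F.Closed) (ht : R.concl ∉ R.hyps) :
    elimhyps red R ∈ simplify Fnot red R := by
  refine ⟨R, mem_decomp_self_of_flat hf, ?_, ?_, rfl⟩
  · rintro ⟨F, hF, F', hF', σ, rfl⟩
    refine hopen _ (Multiset.mem_of_le (red_elimdup_hyps_le hred R) hF) ?_
    rw [(hFnot F' hF').subst_eq]
    exact hFnot F' hF'
  · rw [IsTautology, red_concl hred]
    exact fun h => ht (Multiset.mem_of_le (red_elimdup_hyps_le hred R) h)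

/-- The clause of the adversary for signature verification. -/
def checksignatureClause : Clause :=
  ⟨{.attacker (.app .sign [.var 0, .var 1]), .attacker (.app .pk [.var 1])}, .attacker (.var 0)⟩

/-- The clause of the adversary for message recovery. -/
def getmessageClause : Clause := ⟨{.attacker (.app .sign [.var 0, .var 1])}, .attacker (.var 0)⟩

/-- The clause of the adversary for the verification of signatures without message recovery. -/
def nmrchecksignClause : Clause :=
  ⟨{.attacker (.app .nmrsign [.var 0, .var 1]), .attacker (.app .pk [.var 1]), .attacker (.var 0)},
    .attacker (.app .tru [])⟩

/-- The rule of `equal` gives a tautology and `getkey` is private. The two signature checks do not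
fit the shapes, as they have a hypothesis on a public key; they are left over here and dealt with by
subsumption after insertion. -/
theorem attackerClause_cases {Sg : Signature} {Init : Finset ℕ} (hSg : Sg.Admissible) (K : Set ℕ)
    (T T' : Set Pattern) (B : ℕ) {Fnot : Finset HornFact} {red : Clause → Clause}
    (hred : IsElimRedundantHyp red) {R D : Clause} (hR : AttackerClause Sg Init R)
    (hD : D ∈ simplify Fnot red R) : Shape K T T' B D ∨
      (Destr.checksignature ∈ Sg.destrs ∧ R = checksignatureClause) ∨
      (Destr.nmrchecksign ∈ Sg.destrs ∧ R = nmrchecksignClause) := by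
  obtain ⟨D₀, h1, rfl, h2⟩ := mem_simplify hred hD
  have hc := elimhyps_concl hred D₀
  have hh := elimhyps_hyps_le hred D₀
  have hshape : ∀ {C : HornFact}, D₀ = ⟨0, C⟩ → elimhyps red D₀ = ⟨0, C⟩ := by
    rintro C rfl
    cases h : elimhyps red ⟨0, C⟩
    rw [h] at hc hh
    simp only [nonpos_iff_eq_zero] at hc hh
    rw [hc, hh]
  cases hR with
  | init a ha =>
    have := mem_decomp_of_flat (by
      refine ⟨by simp, fun p hp => ?_⟩
      cases hp
      rintro ⟨n, ps, h⟩
      cases h) h1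
    rw [hshape this]
    exact .inl (.free a)
  | rn =>
    have := mem_decomp_of_flat (by
      refine ⟨by simp, fun p hp => ?_⟩
      cases hp
      rintro ⟨n, ps, h⟩
      cases h) h1
    rw [hshape this]
    exact .inl (.fresh 0)
  | rf f hf =>
    have : D₀ = ⟨attackers (List.range f.arity),
        .attacker (.app f ((List.range f.arity).map .var))⟩ := by
      by_cases ht : ∃ n, f = .tuple n
      · obtain ⟨n, rfl⟩ := ht
        unfold decomp at h1
        rw [if_pos] at h1
        · exact h1
        · exact ⟨List.range n, List.nodup_range, .inl (by simp [Constr.arity])⟩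
      · refine mem_decomp_of_flat ⟨fun p hp => ?_, fun p hp => ?_⟩ h1
        · obtain ⟨i, -, hi⟩ := List.mem_map.1 (Multiset.mem_coe.1 hp)
          cases hi
          rintro ⟨n, ps, h⟩
          cases h
        · cases hp
          rintro ⟨n, ps, h⟩
          cases h
          exact ht ⟨n, rfl⟩
    rw [this, elimhyps_con hred f List.nodup_range]
    exact .inl (.con f List.nodup_range)
  | rg g hg hp =>
    have flat : ∀ {R : Clause}, (∀ F ∈ R.hyps, ∀ p, F = .attacker p → ¬ p.IsTuple) →
        (∀ p, R.concl = .attacker p → ¬ p.IsTuple) → Flat R :=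
      fun h h' => ⟨fun p hp => h _ hp p rfl, h'⟩
    cases g with
    | nth i n =>
      have hin := hSg.nth_lt i n hg
      have hd : IsDataClause ⟨(((Destr.nth i n).lhsPat 0).map HornFact.attacker : List HornFact),
          .attacker ((Destr.nth i n).rhsPat 0)⟩ := by
        refine ⟨List.range n, List.nodup_range, .inr ⟨i, by simpa using hin, ?_⟩⟩
        simp [Destr.lhsPat, Destr.rhsPat, Destr.lhs, Destr.rhs, Term.toPattern, Function.comp_def]
      unfold decomp at h1
      rw [if_pos hd, Set.mem_singleton_iff] at h1
      subst h1
      refine .inl (.proj (n := n) (l := List.range n) (x := i) (by simpa using hin)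
        (hh.trans (le_of_eq ?_)) (hc.trans ?_))
      · simp [Destr.lhsPat, Destr.lhs, Term.toPattern, Function.comp_def]
      · simp [Destr.rhsPat, Destr.rhs, Term.toPattern]
    | getkey => exact (hp rfl).elim
    | checksignature =>
      refine .inr (.inl ⟨hg, ?_⟩)
      simp [checksignatureClause, Destr.lhsPat, Destr.rhsPat, Destr.lhs, Destr.rhs, Term.toPattern]
      rfl
    | nmrchecksign =>
      refine .inr (.inr ⟨hg, ?_⟩)
      simp [nmrchecksignClause, Destr.lhsPat, Destr.rhsPat, Destr.lhs, Destr.rhs, Term.toPattern]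
      rfl
    | equal =>
      rw [simplify_of_taut hred] at hD
      · exact hD.elim
      · simp [Destr.lhsPat, Destr.rhsPat, Destr.lhs, Destr.rhs, Term.toPattern]
    | sdecrypt =>
      have := mem_decomp_of_flat (flat (by
        simp [Destr.lhsPat, Destr.lhs, Term.toPattern, Pattern.IsTuple]) (by
        simp [Destr.rhsPat, Destr.rhs, Term.toPattern, Pattern.IsTuple])) h1
      subst this
      refine .inl (.decrypt (f := .sencrypt) (ps := [.var 0, .var 1]) ⟨trivial, .inl rfl⟩
        (hh.trans (le_of_eq ?_)) (hc.trans ?_))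
      · simp [Destr.lhsPat, Destr.lhs, Term.toPattern]; rfl
      · simp [Destr.rhsPat, Destr.rhs, Term.toPattern]
    | sdecryptP =>
      have := mem_decomp_of_flat (flat (by
        simp [Destr.lhsPat, Destr.lhs, Term.toPattern, Pattern.IsTuple]) (by
        simp [Destr.rhsPat, Destr.rhs, Term.toPattern, Pattern.IsTuple])) h1
      subst this
      refine .inl (.decrypt (f := .sencryptP) (ps := [.var 0, .var 1, .var 2])
        ⟨trivial, .inr (.inl rfl)⟩ (hh.trans (le_of_eq ?_)) (hc.trans ?_))
      · simp [Destr.lhsPat, Destr.lhs, Term.toPattern]; rfl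
      · simp [Destr.rhsPat, Destr.rhs, Term.toPattern]
    | pdecryptP =>
      have := mem_decomp_of_flat (flat (by
        simp [Destr.lhsPat, Destr.lhs, Term.toPattern, Pattern.IsTuple]) (by
        simp [Destr.rhsPat, Destr.rhs, Term.toPattern, Pattern.IsTuple])) h1
      subst this
      refine .inl (.decrypt (f := .pencryptP) (ps := [.var 0, .app .pk [.var 1], .var 2])
        ⟨trivial, .inr (.inr ⟨rfl, rfl⟩)⟩ (hh.trans (le_of_eq ?_)) (hc.trans ?_))
      · simp [Destr.lhsPat, Destr.lhs, Term.toPattern]; rfl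
      · simp [Destr.rhsPat, Destr.rhs, Term.toPattern]
    | getmessage =>
      have := mem_decomp_of_flat (flat (by
        simp [Destr.lhsPat, Destr.lhs, Term.toPattern, Pattern.IsTuple]) (by
        simp [Destr.rhsPat, Destr.rhs, Term.toPattern, Pattern.IsTuple])) h1
      subst this
      refine .inl (.decrypt (f := .sign) (ps := [.var 0, .var 1]) ⟨trivial, .inl rfl⟩
        (hh.trans ?_) (hc.trans ?_))
      · simp [Destr.lhsPat, Destr.lhs, Term.toPattern]
      · simp [Destr.rhsPat, Destr.rhs, Term.toPattern]
  | rl =>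
    have := mem_decomp_of_flat (by
      refine ⟨?_, ?_⟩ <;> simp [Pattern.IsTuple]) h1
    subst this
    exact .inl (.listen hh hc)
  | rs =>
    have := mem_decomp_of_flat (by
      refine ⟨?_, ?_⟩ <;> simp [Pattern.IsTuple]) h1
    subst this
    have h3 : (elimhyps red ⟨{.attacker (.var 0), .attacker (.var 1)},
        .message (.var 0) (.var 1)⟩).hyps = {.attacker (.var 0), .attacker (.var 1)} := by
      refine le_antisymm hh ((Multiset.le_iff_subset (by simp)).2 fun F hF =>
        mem_elimhyps hred _ hF fun v hv => ?_)
      simp only [Multiset.insert_eq_cons, Multiset.mem_cons, Multiset.mem_singleton] at hF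
      rw [vars_message]
      rcases hF with rfl | rfl
      · exact .inl (vars_attacker.1 hv)
      · exact .inr (vars_attacker.1 hv)
    cases h : elimhyps red ⟨{.attacker (.var 0), .attacker (.var 1)}, .message (.var 0) (.var 1)⟩
    rw [h] at h3 hc
    simp only at h3 hc
    rw [h3, hc]
    exact .inl (.send 0 1)

/-- Whatever elimination removes is subsumed by something that stays, and by transitivity this
persists to the end of the insertions. The order in which clauses are inserted is therefore
immaterial. -/
theorem Inserts.spec {A : Params} {L : List Clause} {𝓡 𝓡' : Set Clause} (h : Inserts A L 𝓡 𝓡') :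
    (∀ D ∈ 𝓡', D ∈ 𝓡 ∨ ∃ R ∈ L, D ∈ simplify A.Fnot A.red R) ∧
    (∀ D, (D ∈ 𝓡 ∨ ∃ R ∈ L, D ∈ simplify A.Fnot A.red R) → ∃ D' ∈ 𝓡', Subsumes D' D) ∧
    (ClauseAntichain 𝓡 → ClauseAntichain 𝓡') := by
  induction h with
  | nil 𝓡 =>
    refine ⟨fun D hD => .inl hD, fun D hD => ?_, id⟩
    simp only [List.not_mem_nil, false_and, exists_false, or_false] at hD
    exact ⟨D, hD, .refl D⟩
  | @cons R L 𝓡 𝓡' 𝓡'' hel hins ih =>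
    obtain ⟨h1, h2, h3⟩ := ih
    refine ⟨fun D hD => ?_, fun D hD => ?_, fun _ => h3 hel.2.2⟩
    · rcases h1 D hD with h | ⟨S, hS, h⟩
      · exact (hel.1 h).elim (fun h => .inr ⟨R, by simp, h⟩) .inl
      · exact .inr ⟨S, by simp [hS], h⟩
    · have hmem : D ∈ simplify A.Fnot A.red R ∪ 𝓡 ∨ ∃ S ∈ L, D ∈ simplify A.Fnot A.red S := by
        rcases hD with h | ⟨S, hS, h⟩
        · exact .inl (.inr h)
        · rcases List.mem_cons.1 hS with rfl | hS
          · exact .inl (.inl h)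
          · exact .inr ⟨S, hS, h⟩
      rcases hmem with h | h
      · obtain ⟨D', hD', hs⟩ := hel.2.1 D h
        obtain ⟨D'', hD'', hs'⟩ := h2 D' (.inl hD')
        exact ⟨D'', hD'', hs'.trans hs⟩
      · exact h2 D (.inr h)

theorem not_closed_of_mem_vars {F : HornFact} {v : Var} (h : v ∈ F.vars) : ¬ F.Closed := by
  intro hc
  rw [HornFact.Closed] at hc
  rw [hc] at h
  exact h

theorem vars_sign_zero : Var.ord 0 ∈ (HornFact.attacker (.app .sign [.var 0, .var 1])).vars :=
  vars_attacker.2 (.app (List.mem_cons_self ..) (.var 0))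

/-- Signature verification is as good as message recovery for the adversary. -/
theorem hyps_of_checksignature {Fnot : Finset HornFact} (hFnot : ∀ F ∈ Fnot, F.Closed)
    {red : Clause → Clause} (hred : IsElimRedundantHyp red) {𝓡 : Set Clause}
    (hanti : ClauseAntichain 𝓡) {D : Clause} (hD : D ∈ simplify Fnot red checksignatureClause)
    (hD𝓡 : D ∈ 𝓡) (hsub : ∀ G ∈ simplify Fnot red getmessageClause, ∃ D' ∈ 𝓡, Subsumes D' G) :
    D.hyps ≤ {.attacker (.app .sign [.var 0, .var 1])} ∧ D.concl = .attacker (.var 0) := by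
  obtain ⟨D₀, h1, rfl, -⟩ := mem_simplify hred hD
  have := mem_decomp_of_flat (by
    refine ⟨?_, ?_⟩ <;> simp [checksignatureClause, Pattern.IsTuple]) h1
  subst this
  set F₁ := HornFact.attacker (.app .sign [.var 0, .var 1]) with hF₁
  have hsign : F₁ ∈ (elimhyps red checksignatureClause).hyps := by
    have hr : F₁ ∈ (red (elimdup checksignatureClause)).hyps := by
      -- If the hypothesis on `sign` were eliminated as redundant, an instance of it would remain;
      -- the other hypothesis is about `pk`, so that instance would be the hypothesis itself.
      obtain ⟨H, σ, h2, -, h3, -⟩ := hred (elimdup checksignatureClause)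
      have hm : F₁ ∈ (elimdup checksignatureClause).hyps := by
        classical
        simp [elimdup, checksignatureClause, hF₁]
      rw [h2] at hm
      rcases Multiset.mem_add.1 hm with h | h
      · have h4 := h3 _ h
        have h5 := Multiset.mem_of_le (red_elimdup_hyps_le hred _) h4
        simp only [checksignatureClause, Multiset.insert_eq_cons, Multiset.mem_cons,
          Multiset.mem_singleton] at h5
        rcases h5 with h5 | h5
        · rwa [h5] at h4
        · simp [hF₁, HornFact.subst, Pattern.subst] at h5
      · exact h
    simp only [elimhyps, elimattx, Multiset.mem_filter]
    refine ⟨hr, ?_⟩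
    rintro ⟨x, K, h, -⟩
    simp [hF₁] at h
  have hg : elimhyps red getmessageClause ∈ simplify Fnot red getmessageClause := by
    refine elimhyps_mem_simplify hFnot hred ?_ ?_ ?_
    · refine ⟨?_, ?_⟩ <;> simp [getmessageClause, Pattern.IsTuple]
    · intro F hF
      simp only [getmessageClause, Multiset.mem_singleton] at hF
      subst hF
      exact not_closed_of_mem_vars vars_sign_zero
    · simp [getmessageClause]
  obtain ⟨D', hD', hs⟩ := hsub _ hg
  have hgle := elimhyps_hyps_le hred getmessageClause
  have hgc := elimhyps_concl hred getmessageClause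
  have hs2 : Subsumes (elimhyps red getmessageClause) (elimhyps red checksignatureClause) := by
    refine ⟨.id, ?_, ?_⟩
    · rw [hgc, elimhyps_concl hred]
      exact HornFact.subst_eq_self fun _ _ => by rename_i v _; cases v <;> rfl
    · rw [Multiset.map_congr rfl fun F _ => HornFact.subst_eq_self fun v _ => by cases v <;> rfl,
        Multiset.map_id']
      refine hgle.trans ?_
      simpa [getmessageClause] using hsign
  -- What is left of message recovery subsumes the verification clause; since both belong to an
  -- antichain, they are equal, and the clause has at most one hypothesis.
  have h6 := hanti _ hD𝓡 _ hD' (hs.trans hs2)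
  subst h6
  refine ⟨?_, elimhyps_concl hred _⟩
  have h7 := hs.card_le.trans (Multiset.card_le_card hgle)
  simp only [getmessageClause, Multiset.card_singleton] at h7
  have h8 : ({F₁} : Multiset HornFact) ≤ (elimhyps red checksignatureClause).hyps := by
    simpa using hsign
  exact (Multiset.eq_of_le_of_card_le h8 (by simpa using h7)).symm.le

/-- Termination of the solving algorithm for protocol clauses with a finite typing. -/
theorem solveTerminates_of_typing {K : Set ℕ} {T T' : Set Pattern} (hT : Typing K T)
    (hT' : T'.Finite) {B : ℕ} (hB : ∀ t ∈ T, 2 * t.size ≤ B) {Sg : Signature}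
    (hSg : Sg.Admissible) (Init : Finset ℕ) {𝓟 : Set Clause} (hfin : 𝓟.Finite)
    (hprot : ∀ R ∈ 𝓟, Prot K T T' B R) {A : Params} (hFnot : ∀ F ∈ A.Fnot, F.Closed)
    (hsel : IsSel₀ A.sel) (hred : IsElimRedundantHyp A.red) {F : HornFact} (hF : F.Closed) :
    SolveTerminates A (𝓟 ∪ {R | AttackerClause Sg Init R}) F := by
  refine ⟨hfin.union (finite_attackerClause Sg Init), fun L hL => ?_⟩
  -- The simplified clauses of the adversary need not be typed. They are finitely many, all present
  -- from the start, and represent themselves; every clause produced by resolution is typed.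
  set 𝒜 : Set Clause := ⋃ R ∈ {R | AttackerClause Sg Init R}, simplify A.Fnot A.red R with h𝒜
  have h𝒜f : 𝒜.Finite :=
    (finite_attackerClause Sg Init).biUnion fun R _ => finite_simplify R
  obtain ⟨𝒞, h𝒞, hrep⟩ := finite_prot hT hT' B
  set Cl : Clause → Prop := fun R =>
    (Shape K T T' B R ∧ Reduced R) ∧ (Prot K T T' B R ∨ R ∈ 𝒜) with hCl
  have hstart : ∀ 𝓡, Inserts A L ∅ 𝓡 →
      𝓡.Finite ∧ ClauseAntichain 𝓡 ∧ ∀ R ∈ 𝓡, Cl R := by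
    intro 𝓡 hins
    obtain ⟨h1, h2, h3⟩ := hins.spec
    have hanti : ClauseAntichain 𝓡 := h3 fun R hR => hR.elim
    refine ⟨?_, hanti, fun D hD => ?_⟩
    · refine ((List.finite_toSet L).biUnion fun R _ =>
        finite_simplify (Fnot := A.Fnot) (red := A.red) R).subset fun D hD => ?_
      obtain ⟨R, hR, h⟩ := (h1 D hD).resolve_left id
      exact Set.mem_biUnion hR h
    · obtain ⟨R, hR, h⟩ := (h1 D hD).resolve_left id
      have hr := reduced_of_mem_simplify hred h
      rcases (hL R).1 hR with hR | hR
      · obtain ⟨h4, h5⟩ := shape_of_prot hT hred (hprot R hR) h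
        exact ⟨⟨h5, hr⟩, .inl h4⟩
      · refine ⟨⟨?_, hr⟩, .inr (Set.mem_biUnion hR h)⟩
        rcases attackerClause_cases hSg K T T' B hred hR h with h4 | ⟨hg, rfl⟩ | ⟨hg, rfl⟩
        · exact h4
        · have hgm : AttackerClause Sg Init getmessageClause := by
            have := AttackerClause.rg (Init := Init) _ (hSg.getmessage_mem hg)
              (by simp [Destr.IsPublic])
            simpa [getmessageClause, Destr.lhsPat, Destr.rhsPat, Destr.lhs, Destr.rhs,
              Term.toPattern] using this
          obtain ⟨h4, h5⟩ := hyps_of_checksignature hFnot hred hanti h hD fun G hG =>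
            h2 G (.inr ⟨_, (hL _).2 (.inr hgm), hG⟩)
          exact .decrypt (f := .sign) (ps := [.var 0, .var 1]) ⟨trivial, .inl rfl⟩
            (h4.trans (by simp)) h5
        -- The rule of `nmrchecksign` brings the constructor `true` into the signature. The clause
        -- that gives the adversary `true` without hypothesis subsumes the verification clause, so
        -- the latter survives only if it equals the former.
        · have ht : AttackerClause Sg Init ⟨0, .attacker (.app .tru [])⟩ := by
            have h4 := (hSg.rules _ hg).2
            simp only [Destr.rhs] at h4
            cases h4 with
            | app hf => exact .rf _ hf
          have h6 : elimhyps A.red ⟨0, .attacker (.app .tru [])⟩ ∈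
              simplify A.Fnot A.red ⟨0, .attacker (.app .tru [])⟩ := by
            refine elimhyps_mem_simplify hFnot hred ?_ (by simp) (by simp)
            refine ⟨?_, ?_⟩ <;> simp [Pattern.IsTuple]
          obtain ⟨D', hD', hs⟩ := h2 _ (.inr ⟨_, (hL _).2 (.inr ht), h6⟩)
          have h7 : (elimhyps A.red ⟨0, .attacker (.app .tru [])⟩).hyps = 0 :=
            nonpos_iff_eq_zero.1 (elimhyps_hyps_le hred _)
          have h8 : D.concl = .attacker (.app .tru []) := by
            obtain ⟨D₀, h8, rfl, -⟩ := mem_simplify hred h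
            have := mem_decomp_of_flat (by
              refine ⟨?_, ?_⟩ <;> simp [nmrchecksignClause, Pattern.IsTuple]) h8
            subst this
            exact elimhyps_concl hred _
          have h9 : D' = D := by
            refine hanti D hD D' hD' (hs.trans ⟨.id, ?_, by simp [h7]⟩)
            rw [elimhyps_concl hred, h8]
            simp [HornFact.subst, Pattern.subst]
          subst h9
          have h10 : D'.hyps = 0 := by
            have := hs.card_le
            rw [h7] at this
            simpa using this
          cases D'
          simp only at h8 h10
          rw [h8, h10]
          exact .con .tru (l := []) List.nodup_nil
  refine ⟨fun 𝓡 hins => ?_, ?_⟩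
  · obtain ⟨-, h1, h2⟩ := hstart 𝓡 hins
    refine acc_satStep (Cl := Cl) (h𝒞.union h𝒜f) ?_ ?_ 𝓡 h1 h2
    · rintro R ⟨⟨-, h3⟩, h4 | h4⟩
      · obtain ⟨C, hC, h⟩ := hrep R h4 h3.nodup
        exact ⟨C, .inl hC, h⟩
      · exact ⟨R, .inr h4, .refl R, .refl R⟩
    · intro 𝓢 h3 h4 R hR hRs R' hR' F₀ hF₀ R'' hres D hD
      obtain ⟨h5, h6⟩ := saturation_step hT hB hred hsel h3 (fun R hR => (h4 R hR).1) hR hRs hR'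
        hF₀ hres hD
      exact ⟨h6, .inl h5⟩
  · rintro 𝓡₁ ⟨𝓡, 𝓡', hins, hsteps, -, rfl⟩
    have hinv : 𝓡'.Finite ∧ ClauseAntichain 𝓡' ∧ ∀ R ∈ 𝓡', Cl R := by
      induction hsteps with
      | refl => exact hstart 𝓡 hins
      | tail _ hs ih =>
        obtain ⟨h1, h2, h3⟩ := ih
        obtain ⟨R, hR, hRs, R', hR', F₀, hF₀, R'', hres, hel, -⟩ := hs
        refine ⟨((finite_simplify R'').union h1).subset hel.1, hel.2.2, fun D hD => ?_⟩
        rcases hel.1 hD with h | h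
        · obtain ⟨h5, h6⟩ := saturation_step hT hB hred hsel h2 (fun R hR => (h3 R hR).1) hR hRs
            hR' hF₀ hres h
          exact ⟨h6, .inl h5⟩
        · exact h3 D h
    have hsol : ∀ R ∈ {R ∈ 𝓡' | A.sel R = ∅}, Solved R := by
      rintro R ⟨hR, hRs⟩
      obtain ⟨h1, h2⟩ := (hinv.2.2 R hR).1
      refine h2.solved fun F hF => h1.hyps_kind hF ?_
      by_contra hu
      obtain ⟨F', -, -, h⟩ := (hsel R).2 ⟨F, hF, hu⟩
      rw [hRs] at h
      exact Set.singleton_ne_empty _ h.symm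
    exact ⟨hinv.1.subset fun _ h => h.1, fun F' hF' => derivable_terminates hred hsol (hFnot F' hF'),
      derivable_terminates hred hsol hF⟩

/-! ## Subterms -/

theorem Term.Sub.trans {M N L : Term} (h₁ : Term.Sub M N) (h₂ : Term.Sub N L) : Term.Sub M L := by
  induction h₂ with
  | refl => exact h₁
  | app h _ ih => exact .app h ih

theorem Term.sub_var {N : Term} {x : ℕ} : Term.Sub N (.var x) ↔ N = .var x :=
  ⟨fun h => by cases h; rfl, fun h => h ▸ .refl⟩

theorem Term.sub_name {N : Term} {a : ℕ} : Term.Sub N (.name a) ↔ N = .name a :=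
  ⟨fun h => by cases h; rfl, fun h => h ▸ .refl⟩

theorem Term.sub_app {N : Term} {f : Constr} {args : List Term} :
    Term.Sub N (.app f args) ↔ N = .app f args ∨ ∃ M ∈ args, Term.Sub N M := by
  constructor
  · intro h
    cases h with
    | refl => exact .inl rfl
    | app h h' => exact .inr ⟨_, h, h'⟩
  · rintro (rfl | ⟨M, h, h'⟩)
    · exact .refl
    · exact .app h h'

theorem Term.mem_occs {M : Term} {o : Constr × List Term} :
    o ∈ M.occs ↔ Term.Sub (.app o.1 o.2) M := by
  induction M using Term.induct with
  | hv x => simp [Term.occs, Term.sub_var]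
  | hn a => simp [Term.occs, Term.sub_name]
  | ha f args ih =>
    rw [Term.occs, List.mem_cons, List.mem_flatMap, Term.sub_app, Prod.ext_iff, Term.app.injEq]
    refine or_congr Iff.rfl ?_
    constructor
    · rintro ⟨M, h, h'⟩
      exact ⟨M, h, (ih M h).1 h'⟩
    · rintro ⟨M, h, h'⟩
      exact ⟨M, h, (ih M h).2 h'⟩

theorem Term.sub_inst {η ν : ℕ → Term} {M N : Term} (hν : ∀ a, ∃ b, ν a = .name b)
    (h : Term.Sub N (M.inst η ν)) : (∃ x, Term.Sub (.var x) M ∧ Term.Sub N (η x)) ∨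
      (∃ a, Term.Sub (.name a) M ∧ N = ν a) ∨
      ∃ f args, Term.Sub (.app f args) M ∧ N = (Term.app f args).inst η ν := by
  induction M using Term.induct with
  | hv x => exact .inl ⟨x, .refl, by simpa [Term.inst] using h⟩
  | hn a =>
    obtain ⟨b, hb⟩ := hν a
    simp only [Term.inst, hb, Term.sub_name] at h
    exact .inr (.inl ⟨a, .refl, h.trans hb.symm⟩)
  | ha f args ih =>
    have h0 := h
    rw [Term.inst, Term.sub_app] at h
    rcases h with h | ⟨M, hM, h⟩
    · exact .inr (.inr ⟨f, args, .refl, by rw [h, Term.inst]⟩)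
    · obtain ⟨M', hM', rfl⟩ := List.mem_map.1 hM
      rcases ih M' hM' h with ⟨x, h1, h2⟩ | ⟨a, h1, h2⟩ | ⟨g, as, h1, h2⟩
      · exact .inl ⟨x, .app hM' h1, h2⟩
      · exact .inr (.inl ⟨a, .app hM' h1, h2⟩)
      · exact .inr (.inr ⟨g, as, .app hM' h1, h2⟩)

theorem Term.WF.inst {Sg : Signature} {M : Term} (h : M.WF Sg) {η ν : ℕ → Term}
    (hη : ∀ x, Term.Sub (.var x) M → (η x).WF Sg) (hν : ∀ a, (ν a).WF Sg) :
    (M.inst η ν).WF Sg := by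
  induction h with
  | var x => simpa [Term.inst] using hη x .refl
  | name a => simpa [Term.inst] using hν a
  | app hf hl h ih =>
    rw [Term.inst]
    refine .app hf (by simpa using hl) fun N hN => ?_
    obtain ⟨M, hM, rfl⟩ := List.mem_map.1 hN
    exact ih M hM fun x hx => hη x (.app hM hx)

theorem Term.WF.sub {Sg : Signature} {M N : Term} (h : M.WF Sg) (hN : Term.Sub N M) : N.WF Sg := by
  induction hN with
  | refl => exact h
  | app hM _ ih =>
    cases h with
    | app _ _ h => exact ih (h _ hM)

theorem Term.inst_sub {η ν : ℕ → Term} {M N : Term} (h : Term.Sub N M) :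
    Term.Sub (N.inst η ν) (M.inst η ν) := by
  induction h with
  | refl => exact .refl
  | app hM _ ih =>
    rw [Term.inst]
    exact .app (List.mem_map_of_mem hM) ih

theorem Term.toPattern_inst (ρ θ : ℕ → Pattern) (η ν : ℕ → Term) (M : Term) :
    (M.inst η ν).toPattern ρ θ =
      M.toPattern (fun x => (η x).toPattern ρ θ) (fun a => (ν a).toPattern ρ θ) := by
  induction M using Term.induct with
  | hv x => simp [Term.inst, Term.toPattern]
  | hn a => simp [Term.inst, Term.toPattern]
  | ha f args ih =>
    simp only [Term.inst, Term.toPattern, List.map_map, Pattern.app.injEq, true_and]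
    exact List.map_congr_left ih

theorem Term.toPattern_congr {ρ ρ' θ θ' : ℕ → Pattern} {M : Term}
    (h : ∀ x, Term.Sub (.var x) M → ρ x = ρ' x) (h' : ∀ a, Term.Sub (.name a) M → θ a = θ' a) :
    M.toPattern ρ θ = M.toPattern ρ' θ' := by
  induction M using Term.induct with
  | hv x => simpa [Term.toPattern] using h x .refl
  | hn a => simpa [Term.toPattern] using h' a .refl
  | ha f args ih =>
    simp only [Term.toPattern, Pattern.app.injEq, true_and]
    exact List.map_congr_left fun M hM => ih M hM (fun x hx => h x (.app hM hx))
      fun a ha => h' a (.app hM ha)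

theorem Term.toPattern_subst (ρ θ : ℕ → Pattern) (σ : Subst) (M : Term) :
    (M.toPattern ρ θ).subst σ =
      M.toPattern (fun x => (ρ x).subst σ) (fun a => (θ a).subst σ) := by
  induction M using Term.induct with
  | hv x => simp [Term.toPattern]
  | hn a => simp [Term.toPattern]
  | ha f args ih =>
    simp only [Term.toPattern, Pattern.subst, List.map_map, Pattern.app.injEq, true_and]
    exact List.map_congr_left ih

/-! ## Subprocesses and places -/

namespace Proc

/-- The immediate subprocesses with their numbers. -/
def children : Proc → List (ℕ × Proc)
  | nil => []
  | par P Q => [(0, P), (1, Q)]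
  | repl P => [(0, P)]
  | res _ P => [(0, P)]
  | inp _ _ P => [(0, P)]
  | out _ _ P => [(0, P)]
  | letD _ _ _ P Q => [(0, P), (1, Q)]
  | cond _ _ P Q => [(0, P), (1, Q)]
  | event _ P => [(0, P)]
  | letT _ _ P => [(0, P)]

/-- The list of the occurrences of subprocesses, with their places. -/
def psubs : Proc → List (List ℕ × Proc)
  | nil => [([], nil)]
  | par P Q => ([], par P Q) :: ((psubs P).map (Prod.map (List.cons 0) id) ++
      (psubs Q).map (Prod.map (List.cons 1) id))
  | repl P => ([], repl P) :: (psubs P).map (Prod.map (List.cons 0) id)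
  | res a P => ([], res a P) :: (psubs P).map (Prod.map (List.cons 0) id)
  | inp M x P => ([], inp M x P) :: (psubs P).map (Prod.map (List.cons 0) id)
  | out M N P => ([], out M N P) :: (psubs P).map (Prod.map (List.cons 0) id)
  | letD x g Ms P Q => ([], letD x g Ms P Q) :: ((psubs P).map (Prod.map (List.cons 0) id) ++
      (psubs Q).map (Prod.map (List.cons 1) id))
  | cond M N P Q => ([], cond M N P Q) :: ((psubs P).map (Prod.map (List.cons 0) id) ++
      (psubs Q).map (Prod.map (List.cons 1) id))
  | event M P => ([], event M P) :: (psubs P).map (Prod.map (List.cons 0) id)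
  | letT x M P => ([], letT x M P) :: (psubs P).map (Prod.map (List.cons 0) id)

theorem map_snd_psubs (P : Proc) : P.psubs.map Prod.snd = P.subs := by
  induction P <;> simp_all [psubs, subs, Function.comp_def]

theorem nil_mem_psubs (P : Proc) : ([], P) ∈ P.psubs := by
  cases P <;> simp [psubs]

theorem psubs_child {P Q : Proc} {i : ℕ} (h : (i, Q) ∈ P.children) {q : List ℕ} {S : Proc}
    (hS : (q, S) ∈ Q.psubs) : (i :: q, S) ∈ P.psubs := by
  cases P <;> simp only [children, List.mem_cons, Prod.mk.injEq, List.not_mem_nil, or_false] at h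
  all_goals first
    | exact h.elim
    | (refine Or.elim h (fun h => ?_) (fun h => ?_) <;> obtain ⟨rfl, rfl⟩ := h <;> simp [psubs, hS])
    | (obtain ⟨rfl, rfl⟩ := h; simp [psubs, hS])

/-- The name bound by the first action. -/
def headName : Proc → List ℕ
  | res a _ => [a]
  | _ => []

theorem bn_eq_flatMap (P : Proc) : P.bn = P.psubs.flatMap fun x => x.2.headName := by
  induction P <;> simp_all [psubs, bn, headName, List.flatMap_append, List.flatMap_map,
    List.flatMap_cons]

theorem occs_eq_flatMap (P : Proc) :
    P.occs = P.psubs.flatMap fun x => x.2.headTerms.flatMap Term.occs := by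
  rw [occs, ← map_snd_psubs, List.flatMap_map]

theorem bn_child {P Q : Proc} {i : ℕ} (h : (i, Q) ∈ P.children) : Q.bn.Sublist P.bn := by
  cases P <;> simp only [children, List.mem_cons, Prod.mk.injEq, List.not_mem_nil, or_false] at h
  all_goals first
    | exact h.elim
    | (refine Or.elim h (fun h => ?_) (fun h => ?_) <;> obtain ⟨rfl, rfl⟩ := h <;> simp [bn])
    | (obtain ⟨rfl, rfl⟩ := h; simp [bn])

theorem nil_mem_points (P : Proc) : [] ∈ P.points := by
  cases P <;> simp [points]

theorem topNames_subset_bn (P : Proc) : ∀ a ∈ P.topNames, a ∈ P.bn := by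
  induction P <;> simp_all [topNames, bn]
  all_goals grind

theorem mem_fn_of_headTerms {P : Proc} {M : Term} (hM : M ∈ P.headTerms) {a : ℕ}
    (h : Term.Sub (.name a) M) : a ∈ P.fn := by
  cases P <;> simp_all [headTerms, fn]
  all_goals grind

theorem fn_child {P Q : Proc} {i : ℕ} (h : (i, Q) ∈ P.children) {a : ℕ} (ha : a ∈ Q.fn) :
    a ∈ P.fn ∨ a ∈ P.headName := by
  cases P <;> simp only [children, List.mem_cons, Prod.mk.injEq, List.not_mem_nil, or_false] at h
  all_goals simp_all [fn, headName]
  all_goals grind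

end Proc

/-! ## Executions with histories -/

/-- Threads with the terms received and the number of the replications unfolded before. -/
structure HThread extends Thread where
  ins : List Term
  k : ℕ

/-- The thread that goes on with an immediate subprocess. -/
def HThread.child (g : HThread) (i : ℕ) (P : Proc) : HThread :=
  { g with path := g.path ++ [i], proc := P }

/-- `ThreadStep g A s us`: the thread `g` executes the action `A` and goes on with the threads
`us`; if `A` is an input, then `s` is the sender of the message. -/
inductive ThreadStep (g : HThread) : Action → HThread → List HThread → Prop
  | nil : g.proc = .nil → ThreadStep g ⟨g.path, none, []⟩ g []
  | repl {P} : g.proc = .repl P →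
      ThreadStep g ⟨g.path, none, []⟩ g [{ g.child 0 P with k := g.k + 1 }]
  | par {P Q} : g.proc = .par P Q →
      ThreadStep g ⟨g.path, none, []⟩ g [g.child 0 P, g.child 1 Q]
  | res {a P a'} : g.proc = .res a P → ThreadStep g ⟨g.path, some (a, a'), []⟩ g
      [{ g.child 0 P with ν := Function.update g.ν a a' }]
  | inp {s : HThread} {M N Q M' x P} : s.proc = .out M N Q → g.proc = .inp M' x P →
      ThreadStep g ⟨g.path, none, [s.eval M, s.eval N]⟩ s
        [{ g.child 0 P with
            η := Function.update g.η x (s.eval N)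
            ins := g.ins ++ [s.eval N] }]
  | out {M N Q} : g.proc = .out M N Q →
      ThreadStep g ⟨g.path, none, [g.eval M, g.eval N]⟩ g [g.child 0 Q]
  | destr₁ {x d Ms P Q M'} : g.proc = .letD x d Ms P Q → d.Reduces (Ms.map g.eval) M' →
      ThreadStep g ⟨g.path, none, Ms.map g.eval ++ [M']⟩ g
        [{ g.child 0 P with η := Function.update g.η x M' }]
  | destr₂ {x d Ms P Q} : g.proc = .letD x d Ms P Q →
      ThreadStep g ⟨g.path, none, Ms.map g.eval⟩ g [g.child 1 Q]
  | cond₁ {M N P Q} : g.proc = .cond M N P Q → g.eval M = g.eval N →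
      ThreadStep g ⟨g.path, none, [g.eval M, g.eval N]⟩ g [g.child 0 P]
  | cond₂ {M N P Q} : g.proc = .cond M N P Q →
      ThreadStep g ⟨g.path, none, [g.eval M, g.eval N]⟩ g [g.child 1 Q]
  | event {M P} : g.proc = .event M P →
      ThreadStep g ⟨g.path, none, [g.eval M]⟩ g [g.child 0 P]
  | letT {x M P} : g.proc = .letT x M P →
      ThreadStep g ⟨g.path, none, [g.eval M]⟩ g
        [{ g.child 0 P with η := Function.update g.η x (g.eval M) }]

/-- An executed step of a thread. -/
structure ExecStep where
  g : HThread
  act : Action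
  src : HThread
  us : List HThread
  step : ThreadStep g act src us

/-- The names created by an action. -/
def Action.names (A : Action) : Set ℕ := {n | ∃ a, A.created = some (a, n)}

/-- Sequences of steps of threads, where `G` contains the threads available at the beginning and
`E` the names used before. -/
inductive Chain : Set HThread → Set ℕ → List ExecStep → Prop
  | nil {G E} : Chain G E []
  | cons {G E r rs} : r.g ∈ G → r.src ∈ G → (∀ n ∈ r.act.names, n ∉ E) →
      Chain (G ∪ {u | u ∈ r.us}) (E ∪ r.act.names) rs → Chain G E (r :: rs)

theorem names_none (p : List ℕ) (l : List Term) : Action.names ⟨p, none, l⟩ = ∅ := by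
  simp [Action.names]

theorem names_some (p : List ℕ) (a n : ℕ) (l : List Term) :
    Action.names ⟨p, some (a, n), l⟩ = {n} := by
  ext m
  simp [Action.names, eq_comm]

theorem Chain.cons_none {G : Set HThread} {E : Set ℕ} {g s : HThread} {p : List ℕ} {l : List Term}
    {us : List HThread} (h : ThreadStep g ⟨p, none, l⟩ s us) {rs : List ExecStep} (hg : g ∈ G)
    (hs : s ∈ G) (hr : Chain (G ∪ {u | u ∈ us}) E rs) : Chain G E (⟨g, _, s, us, h⟩ :: rs) := by
  refine .cons hg hs ?_ ?_
  · simp [names_none]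
  · simpa [names_none] using hr

/-- Every trace is a sequence of steps of threads. -/
theorem exists_chain {c c' : Config} {acts : List Action} (h : Trace c acts c') {G : Set HThread}
    (hG : ∀ t ∈ c.threads, ∃ g ∈ G, g.toThread = t) :
    ∃ rs : List ExecStep, rs.map ExecStep.act = acts ∧ Chain G (c.env : Set ℕ) rs ∧
      ∀ r ∈ rs, ∃ r' ∈ rs, r'.g = r.src := by
  induction h generalizing G with
  | refl c => exact ⟨[], rfl, .nil, by simp⟩
  | @step c c₁ c₂ l l' hred _ ih =>
    -- All steps of a single thread that create no name are treated alike.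
    have one : ∀ {g : HThread} {p : List ℕ} {L : List Term} {us : List HThread}
        {vs : List Thread}, ThreadStep g ⟨p, none, L⟩ g us → g ∈ G →
        l = [⟨p, none, L⟩] → us.map HThread.toThread = vs →
        (∀ t ∈ c₁.threads, t ∈ vs ∨ ∃ g ∈ G, g.toThread = t) → c₁.env = c.env →
        ∃ rs : List ExecStep, rs.map ExecStep.act = l ++ l' ∧ Chain G (c.env : Set ℕ) rs ∧
          ∀ r ∈ rs, ∃ r' ∈ rs, r'.g = r.src := by
      rintro g p L us vs hstep hg rfl rfl hT hE
      obtain ⟨rs, h1, h2, h3⟩ := ih (G := G ∪ {u | u ∈ us}) (by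
        intro t ht
        rcases hT t ht with h | ⟨g', h, h'⟩
        · obtain ⟨u, hu, rfl⟩ := List.mem_map.1 h
          exact ⟨u, .inr hu, rfl⟩
        · exact ⟨g', .inl h, h'⟩)
      refine ⟨⟨g, _, g, us, hstep⟩ :: rs, by simp [h1], .cons_none hstep hg hg (hE ▸ h2), ?_⟩
      intro r hr
      rcases List.mem_cons.1 hr with rfl | hr
      · exact ⟨_, List.mem_cons_self .., rfl⟩
      · obtain ⟨r', hr', h⟩ := h3 r hr
        exact ⟨r', List.mem_cons_of_mem _ hr', h⟩
    cases hred with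
    | nil ht =>
      obtain ⟨g, hg, rfl⟩ := hG _ (Multiset.mem_cons_self ..)
      exact one (.nil ht) hg rfl rfl (fun t h => .inr (hG t (by simp [h]))) rfl
    | repl ht =>
      obtain ⟨g, hg, rfl⟩ := hG _ (Multiset.mem_cons_self ..)
      refine one (.repl ht) hg rfl rfl (fun t h => ?_) rfl
      rcases Multiset.mem_cons.1 h with rfl | h
      · exact .inl (by simp [Thread.next, HThread.child])
      · exact .inr (hG t h)
    | par ht =>
      obtain ⟨g, hg, rfl⟩ := hG _ (Multiset.mem_cons_self ..)
      refine one (.par ht) hg rfl rfl (fun t h => ?_) rfl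
      simp only [Multiset.mem_cons] at h
      rcases h with rfl | rfl | h
      · exact .inl (by simp [Thread.next, HThread.child])
      · exact .inl (by simp [Thread.next, HThread.child])
      · exact .inr (hG t (by simp [h]))
    | @res E T t a P a' ht ha' =>
      obtain ⟨g, hg, rfl⟩ := hG _ (Multiset.mem_cons_self ..)
      obtain ⟨rs, h1, h2, h3⟩ := ih
        (G := G ∪ {u | u ∈ [{ g.child 0 P with ν := Function.update g.ν a a' }]}) (by
          intro t ht
          rcases Multiset.mem_cons.1 ht with rfl | ht
          · exact ⟨_, .inr (List.mem_singleton.2 rfl), rfl⟩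
          · obtain ⟨g', h, h'⟩ := hG t (by simp [ht])
            exact ⟨g', .inl h, h'⟩)
      refine ⟨⟨g, _, g, _, .res (a' := a') ht⟩ :: rs, by simp [h1], .cons hg hg ?_ ?_, ?_⟩
      · simpa [names_some] using ha'
      · rw [names_some]
        convert h2 using 1
        simp
      · intro r hr
        rcases List.mem_cons.1 hr with rfl | hr
        · exact ⟨_, List.mem_cons_self .., rfl⟩
        · obtain ⟨r', hr', h⟩ := h3 r hr
          exact ⟨r', List.mem_cons_of_mem _ hr', h⟩
    | @io E T t u M N Q M' x P ht hu he =>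
      obtain ⟨s, hs, rfl⟩ := hG t (by simp)
      obtain ⟨g, hg, rfl⟩ := hG u (by simp)
      -- A communication is split into the output and the input, which records the sender as its
      -- source. The sender is still available for the second step, because chains never withdraw
      -- threads.
      obtain ⟨rs, h1, h2, h3⟩ := ih (G := (G ∪ {u | u ∈ [s.child 0 Q]}) ∪
          {u | u ∈ [{ g.child 0 P with
            η := Function.update g.η x (s.eval N), ins := g.ins ++ [s.eval N] }]}) (by
        intro t ht
        simp only [Multiset.mem_cons] at ht
        rcases ht with rfl | rfl | ht
        · exact ⟨_, .inl (.inr (List.mem_singleton.2 rfl)), rfl⟩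
        · exact ⟨_, .inr (List.mem_singleton.2 rfl), rfl⟩
        · obtain ⟨g', h, h'⟩ := hG t (by simp [ht])
          exact ⟨g', .inl (.inl h), h'⟩)
      refine ⟨⟨s, _, s, _, .out ht⟩ :: ⟨g, _, s, _, .inp ht hu⟩ :: rs, by simp [h1],
        .cons_none _ hs hs (.cons_none _ (.inl hg) (.inl hs) h2), ?_⟩
      intro r hr
      simp only [List.mem_cons] at hr
      rcases hr with rfl | rfl | hr
      · exact ⟨_, List.mem_cons_self .., rfl⟩
      · exact ⟨_, List.mem_cons_self .., rfl⟩
      · obtain ⟨r', hr', h⟩ := h3 r hr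
        exact ⟨r', List.mem_cons_of_mem _ (List.mem_cons_of_mem _ hr'), h⟩
    | destr₁ ht hd =>
      obtain ⟨g, hg, rfl⟩ := hG _ (Multiset.mem_cons_self ..)
      refine one (.destr₁ ht hd) hg rfl rfl (fun t h => ?_) rfl
      rcases Multiset.mem_cons.1 h with rfl | h
      · exact .inl (by simp [Thread.next, Thread.bindVar, HThread.child])
      · exact .inr (hG t (by simp [h]))
    | destr₂ ht hd =>
      obtain ⟨g, hg, rfl⟩ := hG _ (Multiset.mem_cons_self ..)
      refine one (.destr₂ ht) hg rfl rfl (fun t h => ?_) rfl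
      rcases Multiset.mem_cons.1 h with rfl | h
      · exact .inl (by simp [Thread.next, HThread.child])
      · exact .inr (hG t (by simp [h]))
    | cond₁ ht he =>
      obtain ⟨g, hg, rfl⟩ := hG _ (Multiset.mem_cons_self ..)
      refine one (.cond₁ ht he) hg rfl rfl (fun t h => ?_) rfl
      rcases Multiset.mem_cons.1 h with rfl | h
      · exact .inl (by simp [Thread.next, HThread.child])
      · exact .inr (hG t (by simp [h]))
    | cond₂ ht he =>
      obtain ⟨g, hg, rfl⟩ := hG _ (Multiset.mem_cons_self ..)
      refine one (.cond₂ ht) hg rfl rfl (fun t h => ?_) rfl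
      rcases Multiset.mem_cons.1 h with rfl | h
      · exact .inl (by simp [Thread.next, HThread.child])
      · exact .inr (hG t (by simp [h]))
    | event ht =>
      obtain ⟨g, hg, rfl⟩ := hG _ (Multiset.mem_cons_self ..)
      refine one (.event ht) hg rfl rfl (fun t h => ?_) rfl
      rcases Multiset.mem_cons.1 h with rfl | h
      · exact .inl (by simp [Thread.next, HThread.child])
      · exact .inr (hG t (by simp [h]))
    | letT ht =>
      obtain ⟨g, hg, rfl⟩ := hG _ (Multiset.mem_cons_self ..)
      refine one (.letT ht) hg rfl rfl (fun t h => ?_) rfl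
      rcases Multiset.mem_cons.1 h with rfl | h
      · exact .inl (by simp [Thread.next, Thread.bindVar, HThread.child])
      · exact .inr (hG t (by simp [h]))

/-- Invariants of the threads of an execution. -/
theorem Chain.invariant {G : Set HThread} {E : Set ℕ} {rs : List ExecStep} (h : Chain G E rs)
    {I : HThread → Prop} (hG : ∀ g ∈ G, I g)
    (hstep : ∀ r ∈ rs, I r.g → I r.src → ∀ u ∈ r.us, I u) :
    ∀ r ∈ rs, I r.g ∧ I r.src ∧ ∀ u ∈ r.us, I u := by
  induction h with
  | nil => simp
  | @cons G E r rs hg hs hn _ ih =>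
    have h1 := hstep r (by simp) (hG _ hg) (hG _ hs)
    intro r' hr'
    rcases List.mem_cons.1 hr' with rfl | hr'
    · exact ⟨hG _ hg, hG _ hs, h1⟩
    · exact ih (fun g hg => hg.elim (hG g) (h1 g)) (fun r hr => hstep r (by simp [hr])) r' hr'

/-- Executed threads are initial ones or successors of executed threads. -/
theorem Chain.mem_or {G : Set HThread} {E : Set ℕ} {rs : List ExecStep} (h : Chain G E rs) :
    ∀ r ∈ rs, r.g ∈ G ∨ ∃ r' ∈ rs, r.g ∈ r'.us := by
  induction h with
  | nil => simp
  | @cons G E r rs hg hs hn _ ih =>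
    intro r' hr'
    rcases List.mem_cons.1 hr' with rfl | hr'
    · exact .inl hg
    · rcases ih r' hr' with (h | h) | ⟨r'', h, h'⟩
      · exact .inl h
      · exact .inr ⟨r, by simp, h⟩
      · exact .inr ⟨r'', by simp [h], h'⟩

/-! ### Names of an execution -/

/-- The names of the terms at hand in a thread belong to `E`. -/
structure HThread.NamesIn (E : Set ℕ) (g : HThread) : Prop where
  var : ∀ x a, Term.Sub (.name a) (g.η x) → a ∈ E
  name : ∀ a ∈ g.proc.fn, g.ν a ∈ E
  ins : ∀ M ∈ g.ins, ∀ a, Term.Sub (.name a) M → a ∈ E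

theorem HThread.NamesIn.mono {E E' : Set ℕ} (h : E ⊆ E') {g : HThread} (hg : g.NamesIn E) :
    g.NamesIn E' :=
  ⟨fun x a ha => h (hg.var x a ha), fun a ha => h (hg.name a ha),
    fun M hM a ha => h (hg.ins M hM a ha)⟩

theorem HThread.sub_eval {g : HThread} {M N : Term} (h : Term.Sub N (g.eval M)) :
    (∃ x, Term.Sub (.var x) M ∧ Term.Sub N (g.η x)) ∨
      (∃ a, Term.Sub (.name a) M ∧ N = .name (g.ν a)) ∨
      ∃ f args, Term.Sub (.app f args) M ∧ N = g.eval (.app f args) :=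
  Term.sub_inst (fun _ => ⟨_, rfl⟩) h

theorem HThread.NamesIn.eval {E : Set ℕ} {g : HThread} (hg : g.NamesIn E) {M : Term}
    (hM : M ∈ g.proc.headTerms) {a : ℕ} (ha : Term.Sub (.name a) (g.eval M)) : a ∈ E := by
  rcases g.sub_eval ha with ⟨x, -, h⟩ | ⟨b, h1, h2⟩ | ⟨_, _, -, h⟩
  · exact hg.var x a h
  · cases h2
    exact hg.name b (Proc.mem_fn_of_headTerms hM h1)
  · simp [Thread.eval, Term.inst] at h

theorem Destr.lhs_sub {d : Destr} {x : ℕ} (hx : d.rhs = .var x) (hd : ∀ i n, d = .nth i n → i < n) :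
    ∃ M ∈ d.lhs, Term.Sub (.var x) M := by
  cases d with
  | nth i n =>
    cases hx
    have := hd _ n rfl
    exact ⟨_, List.mem_singleton.2 rfl, .app (List.mem_map_of_mem (List.mem_range.2 this)) .refl⟩
  | nmrchecksign => cases hx
  | _ =>
    cases hx
    refine ⟨_, List.mem_cons_self .., ?_⟩
    first
      | exact .refl
      | exact .app (List.mem_cons_self ..) .refl

/-- Destructors extract subterms. -/
theorem Destr.Reduces.sub {d : Destr} {args : List Term} {M' : Term} (h : d.Reduces args M')
    (hd : ∀ i n, d = .nth i n → i < n) :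
    (∃ M ∈ args, Term.Sub M' M) ∨ (d = .nmrchecksign ∧ M' = .app .tru []) := by
  obtain ⟨σ, rfl, rfl⟩ := h
  by_cases hx : ∃ x, d.rhs = .var x
  · obtain ⟨x, hx⟩ := hx
    obtain ⟨M, hM, hs⟩ := Destr.lhs_sub hx hd
    refine .inl ⟨_, List.mem_map_of_mem hM, ?_⟩
    rw [hx]
    exact Term.inst_sub hs
  · refine .inr ?_
    cases d <;> simp [Destr.rhs, Term.inst] at hx ⊢

theorem ThreadStep.path_eq {g s : HThread} {A : Action} {us : List HThread}
    (h : ThreadStep g A s us) : A.path = g.path := by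
  cases h <;> rfl

theorem ThreadStep.mem_children {g s u : HThread} {A : Action} {us : List HThread}
    (h : ThreadStep g A s us) (hu : u ∈ us) :
    ∃ i, (i, u.proc) ∈ g.proc.children ∧ u.path = g.path ++ [i] := by
  cases h <;> simp only [List.mem_cons, List.not_mem_nil, or_false] at hu
  case par h =>
    rcases hu with rfl | rfl
    · exact ⟨0, by simp [h, Proc.children, HThread.child], rfl⟩
    · exact ⟨1, by simp [h, Proc.children, HThread.child], rfl⟩
  case destr₂ h =>
    subst hu
    exact ⟨1, by simp [h, Proc.children, HThread.child], rfl⟩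
  case cond₂ h =>
    subst hu
    exact ⟨1, by simp [h, Proc.children, HThread.child], rfl⟩
  case inp h _ =>
    subst hu
    exact ⟨0, by simp [h, Proc.children, HThread.child], rfl⟩
  all_goals
    subst hu
    exact ⟨0, by simp_all [Proc.children, HThread.child], rfl⟩

/-- The initial thread. -/
def HThread.initial (P₀ : Proc) : HThread :=
  { path := [], η := .var, ν := id, proc := P₀, ins := [], k := 0 }

/-- Executions of all program points of `P₀`. -/
structure Execution (P₀ : Proc) (rs : List ExecStep) : Prop where
  chain : Chain {HThread.initial P₀} P₀.fn rs
  src : ∀ r ∈ rs, ∃ r' ∈ rs, r'.g = r.src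
  count : ∀ p ∈ P₀.points, (rs.map fun r => r.g.path).count p = 1

theorem eq_of_count_map_eq_one {α β : Type*} [BEq β] [LawfulBEq β] {l : List α} {f : α → β} {b : β}
    (h : (l.map f).count b = 1) {x y : α} (hx : x ∈ l) (hy : y ∈ l) (hfx : f x = b)
    (hfy : f y = b) : x = y := by
  induction l with
  | nil => simp at hx
  | cons a l ih =>
    rw [List.map_cons, List.count_cons] at h
    have key : ∀ z ∈ l, f z = b → 0 < (l.map f).count b :=
      fun z hz hzb => List.count_pos_iff.2 (hzb ▸ List.mem_map_of_mem hz)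
    rcases List.mem_cons.1 hx with rfl | hx' <;> rcases List.mem_cons.1 hy with rfl | hy'
    · rfl
    · have := key y hy' hfy
      simp only [hfx, beq_self_eq_true, if_true] at h
      omega
    · have := key x hx' hfx
      simp only [hfy, beq_self_eq_true, if_true] at h
      omega
    · have := key x hx' hfx
      exact ih (by split_ifs at h <;> omega) hx' hy'

/-- Facts about the place of a thread of the initial process `P₀`. -/
structure HThread.At (P₀ : Proc) (g : HThread) : Prop where
  psubs : ∀ q S, (q, S) ∈ g.proc.psubs → (g.path ++ q, S) ∈ P₀.psubs
  points : g.proc = .nil ∨ ∀ q ∈ g.proc.points, g.path ++ q ∈ P₀.points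
  bn : g.proc.bn.Sublist P₀.bn
  top : ∀ a ∈ P₀.topNames, a ∈ g.proc.bn → g.ins = [] ∧ g.k = 0 ∧ a ∈ g.proc.topNames
  free : ∀ a ∈ P₀.fn, g.ν a = a

theorem HThread.At.mem_psubs {P₀ : Proc} {g : HThread} (h : g.At P₀) :
    (g.path, g.proc) ∈ P₀.psubs := by
  simpa using h.psubs [] g.proc g.proc.nil_mem_psubs

theorem HThread.At.mem_subs {P₀ : Proc} {g : HThread} (h : g.At P₀) : g.proc ∈ P₀.subs := by
  rw [← Proc.map_snd_psubs]
  exact List.mem_map_of_mem h.mem_psubs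

theorem HThread.At.mem_points {P₀ : Proc} {g : HThread} (h : g.At P₀) (hn : g.proc ≠ .nil) :
    g.path ∈ P₀.points := by
  simpa using h.points.resolve_left hn [] g.proc.nil_mem_points

/-- Else branches are the only children without program points, and they are `nil`. -/
theorem IsTagged.points_child {Sg : Signature} {Init : Finset ℕ} {P₀ : Proc}
    (hP : IsTagged Sg Init P₀) {P Q : Proc} (hPs : P ∈ P₀.subs) {i : ℕ}
    (h : (i, Q) ∈ P.children) : Q = .nil ∨ ∀ q ∈ Q.points, i :: q ∈ P.points := by
  cases P
  case letD x g Ms P Q' =>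
    have := hP.no_else_letD _ _ _ _ _ hPs
    simp only [Proc.children, List.mem_cons, Prod.mk.injEq, List.not_mem_nil, or_false] at h
    rcases h with ⟨rfl, rfl⟩ | ⟨rfl, rfl⟩
    · exact .inr fun q hq => by simp [Proc.points, hq]
    · exact .inl this
  case cond M N P Q' =>
    have := hP.no_else_cond _ _ _ _ hPs
    simp only [Proc.children, List.mem_cons, Prod.mk.injEq, List.not_mem_nil, or_false] at h
    rcases h with ⟨rfl, rfl⟩ | ⟨rfl, rfl⟩
    · exact .inr fun q hq => by simp [Proc.points, hq]
    · exact .inl this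
  case par P Q' =>
    simp only [Proc.children, List.mem_cons, Prod.mk.injEq, List.not_mem_nil, or_false] at h
    rcases h with ⟨rfl, rfl⟩ | ⟨rfl, rfl⟩ <;> exact .inr fun q hq => by simp [Proc.points, hq]
  case nil => simp [Proc.children] at h
  all_goals
    simp only [Proc.children, List.mem_cons, Prod.mk.injEq, List.not_mem_nil, or_false] at h
    obtain ⟨rfl, rfl⟩ := h
    exact .inr fun q hq => by simp [Proc.points, hq]

theorem HThread.At.initial (P₀ : Proc) : (HThread.initial P₀).At P₀ :=
  ⟨fun _ _ h => h, .inr fun _ h => h, List.Sublist.refl _, fun _ h _ => ⟨rfl, rfl, h⟩,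
    fun _ _ => rfl⟩

theorem HThread.At.step {Sg : Signature} {Init : Finset ℕ} {P₀ : Proc}
    (hP : IsTagged Sg Init P₀) {g s u : HThread} {A : Action} {us : List HThread}
    (h : g.At P₀) (hstep : ThreadStep g A s us) (hu : u ∈ us) : u.At P₀ := by
  obtain ⟨i, hi, hp⟩ := hstep.mem_children hu
  have hne : g.proc ≠ .nil := by
    intro h0
    rw [h0] at hi
    simp [Proc.children] at hi
  refine ⟨fun q S hS => ?_, ?_, (Proc.bn_child hi).trans h.bn, fun a ha hab => ?_, fun a ha => ?_⟩
  · rw [hp, List.append_assoc]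
    exact h.psubs _ _ (Proc.psubs_child hi hS)
  · refine (hP.points_child h.mem_subs hi).imp id fun h1 q hq => ?_
    rw [hp, List.append_assoc]
    exact h.points.resolve_left hne _ (h1 q hq)
  -- A restriction counted in `topNames` is never reached through an input or a replication, since
  -- `topNames` is empty there. As bound names are distinct, it lies in only one branch of a
  -- parallel composition.
  · have h1 := h.top a ha ((Proc.bn_child hi).subset hab)
    have hnd : g.proc.bn.Nodup := h.bn.nodup hP.bn_nodup
    cases hstep <;> simp only [List.mem_cons, List.not_mem_nil, or_false] at hu
    case par P Q hg =>
      rw [hg] at h1 hnd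
      simp only [Proc.bn, List.nodup_append] at hnd
      rcases hu with rfl | rfl
      · refine ⟨h1.1, h1.2.1, h1.2.2.resolve_right fun h2 => ?_⟩
        exact hnd.2.2 a hab a (Proc.topNames_subset_bn _ _ h2) rfl
      · refine ⟨h1.1, h1.2.1, h1.2.2.resolve_left fun h2 => ?_⟩
        exact hnd.2.2 a (Proc.topNames_subset_bn _ _ h2) a hab rfl
    case repl P hg =>
      rw [hg] at h1
      exact h1.2.2.elim
    case inp hg hs =>
      rw [hg] at h1
      exact h1.2.2.elim
    case res b P a' hg =>
      subst hu
      rw [hg] at h1 hnd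
      simp only [Proc.bn, List.nodup_cons] at hnd
      refine ⟨h1.1, h1.2.1, h1.2.2.resolve_left fun h2 => ?_⟩
      rw [Set.mem_singleton_iff] at h2
      exact hnd.1 (h2 ▸ hab)
    case out hg =>
      subst hu
      rw [hg] at h1
      exact h1
    case destr₁ hg hd =>
      subst hu
      have hQ := hP.no_else_letD _ _ _ _ _ (hg ▸ h.mem_subs)
      subst hQ
      rw [hg] at h1
      exact ⟨h1.1, h1.2.1, h1.2.2.resolve_right id⟩
    case destr₂ hg =>
      subst hu
      have hQ := hP.no_else_letD _ _ _ _ _ (hg ▸ h.mem_subs)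
      subst hQ
      simp [HThread.child, Proc.bn] at hab
    case cond₁ hg hd =>
      subst hu
      have hQ := hP.no_else_cond _ _ _ _ (hg ▸ h.mem_subs)
      subst hQ
      rw [hg] at h1
      exact ⟨h1.1, h1.2.1, h1.2.2.resolve_right id⟩
    case cond₂ hg =>
      subst hu
      have hQ := hP.no_else_cond _ _ _ _ (hg ▸ h.mem_subs)
      subst hQ
      simp [HThread.child, Proc.bn] at hab
    case event hg =>
      subst hu
      rw [hg] at h1
      exact h1
    case letT hg =>
      subst hu
      rw [hg] at h1
      exact h1
  · have h1 := h.free a ha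
    cases hstep <;> simp only [List.mem_cons, List.not_mem_nil, or_false] at hu
    case par => rcases hu with rfl | rfl <;> exact h1
    case res b P a' hg =>
      subst hu
      have hb : b ∈ P₀.bn := h.bn.subset (by simp [hg, Proc.bn])
      have : a ≠ b := by
        rintro rfl
        exact (hP.bn_fresh _ hb).1 ha
      simpa [Function.update_of_ne this] using h1
    all_goals
      subst hu
      exact h1

namespace Execution

theorem at_mem {Sg : Signature} {Init : Finset ℕ} {P₀ : Proc} {rs : List ExecStep}
    (hP : IsTagged Sg Init P₀) (hrs : Execution P₀ rs) : ∀ r ∈ rs, r.g.At P₀ ∧ r.src.At P₀ ∧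
      ∀ u ∈ r.us, u.At P₀ := by
  refine hrs.chain.invariant ?_ fun r _ h _ u hu => h.step hP r.step hu
  rintro g rfl
  exact .initial P₀

theorem eq_of_path_eq {P₀ : Proc} {rs : List ExecStep} (hrs : Execution P₀ rs) {r r' : ExecStep}
    (hr : r ∈ rs) (hr' : r' ∈ rs) (hp : r.g.path = r'.g.path) (h : r.g.path ∈ P₀.points) :
    r = r' :=
  eq_of_count_map_eq_one (f := fun r => r.g.path) (hrs.count _ h) hr hr' rfl hp.symm

/-- The successor of an executed thread at a program point is executed. -/
theorem exists_next {P₀ : Proc} {rs : List ExecStep} (hrs : Execution P₀ rs) {r : ExecStep}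
    (hr : r ∈ rs) {i : ℕ} (h1 : r.g.path ∈ P₀.points) (h2 : r.g.path ++ [i] ∈ P₀.points) :
    ∃ r' ∈ rs, r'.g ∈ r.us ∧ r'.g.path = r.g.path ++ [i] := by
  have h3 : r.g.path ++ [i] ∈ rs.map fun r => r.g.path := by
    rw [← List.count_pos_iff, hrs.count _ h2]
    exact Nat.one_pos
  obtain ⟨r', hr', h4⟩ := List.mem_map.1 h3
  refine ⟨r', hr', ?_, h4⟩
  -- The thread is not the initial one, since its path is not empty. Its predecessor has the path of
  -- `r`, and that program point is executed only once, so the predecessor is `r`.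
  rcases hrs.chain.mem_or r' hr' with h5 | ⟨r'', hr'', h5⟩
  · rw [Set.mem_singleton_iff.1 h5] at h4
    simp [HThread.initial] at h4
  · obtain ⟨j, -, h6⟩ := r''.step.mem_children h5
    rw [h4] at h6
    have h7 := (List.append_inj' h6 rfl).1
    rwa [hrs.eq_of_path_eq hr hr'' h7 h1]

end Execution

/-- The term is the value of a constructor application in an executed action. -/
def IsOccurrence (rs : List ExecStep) (N : Term) : Prop :=
  ∃ r ∈ rs, ∃ S ∈ r.g.proc.headTerms, ∃ f args, Term.Sub (.app f args) S ∧
    N = r.g.eval (.app f args)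

/-- Terms over the signature whose cryptographic subterms stem from executed actions. -/
structure Term.Genuine (Sg : Signature) (rs : List ExecStep) (M : Term) : Prop where
  wf : M.WF Sg
  occ : ∀ f args, f.NeedsTag → Term.Sub (.app f args) M → IsOccurrence rs (.app f args)

theorem Term.Genuine.sub {Sg : Signature} {rs : List ExecStep} {M N : Term}
    (h : M.Genuine Sg rs) (hN : Term.Sub N M) : N.Genuine Sg rs :=
  ⟨h.wf.sub hN, fun f args hf hs => h.occ f args hf (hs.trans hN)⟩

/-- A cryptographic subterm of the value either lies in the value of a variable or is the value of
an occurrence written in the process. -/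
theorem genuine_eval {Sg : Signature} {rs : List ExecStep} {r : ExecStep} (hr : r ∈ rs)
    (hη : ∀ x, (r.g.η x).Genuine Sg rs) {M : Term} (hM : M ∈ r.g.proc.headTerms) (hwf : M.WF Sg) :
    (r.g.eval M).Genuine Sg rs := by
  refine ⟨hwf.inst (fun x _ => (hη x).wf) fun a => .name _, fun f args hf hs => ?_⟩
  rcases r.g.sub_eval hs with ⟨x, -, h⟩ | ⟨a, -, h⟩ | ⟨g, as, h1, h2⟩
  · exact (hη x).occ f args hf h
  · cases h
  · exact ⟨r, hr, M, hM, g, as, h1, h2⟩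

theorem IsTagged.nth_lt {Sg : Signature} {Init : Finset ℕ} {P₀ : Proc} (hP : IsTagged Sg Init P₀)
    {x : ℕ} {d : Destr} {Ms : List Term} {P Q : Proc} (h : Proc.letD x d Ms P Q ∈ P₀.subs) :
    ∀ i n, d = .nth i n → i < n := by
  rintro i n rfl
  exact hP.sig.nth_lt i n (hP.wf_destr _ _ _ _ _ h).1

theorem genuine_reduct {Sg : Signature} {Init : Finset ℕ} {P₀ : Proc} {rs : List ExecStep}
    (hP : IsTagged Sg Init P₀) {r : ExecStep} (hr : r ∈ rs) (hsub : r.g.proc ∈ P₀.subs)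
    (hη : ∀ x, (r.g.η x).Genuine Sg rs) {x : ℕ} {d : Destr} {Ms : List Term} {P Q : Proc}
    {M' : Term} (h1 : r.g.proc = .letD x d Ms P Q) (h2 : d.Reduces (Ms.map r.g.eval) M') :
    M'.Genuine Sg rs := by
  rcases h2.sub (hP.nth_lt (h1 ▸ hsub)) with ⟨N, hN, h3⟩ | ⟨rfl, rfl⟩
  · obtain ⟨M, hM, rfl⟩ := List.mem_map.1 hN
    refine Term.Genuine.sub (genuine_eval hr hη (by simpa [h1, Proc.headTerms] using hM) ?_) h3
    exact hP.wf_term _ hsub (by simp [h1]) _ (by simpa [h1, Proc.headTerms] using hM)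
  · refine ⟨?_, fun f args hf hs => ?_⟩
    · exact (hP.sig.rules _ (hP.wf_destr _ _ _ _ _ (h1 ▸ hsub)).1).2
    · rcases Term.sub_app.1 hs with h | ⟨N, h, -⟩
      · cases h
        exact hf.elim
      · simp at h

namespace Execution

/-- Without adversary, all terms are built by the process: values are evaluated terms, received
values were evaluated by their sender, and destructors only extract subterms or yield `true`. -/
theorem genuine_env {Sg : Signature} {Init : Finset ℕ} {P₀ : Proc} {rs : List ExecStep}
    (hP : IsTagged Sg Init P₀) (hrs : Execution P₀ rs) :
    ∀ r ∈ rs, ∀ x, (r.g.η x).Genuine Sg rs := by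
  suffices H : ∀ r ∈ rs, (∀ x, (r.g.η x).Genuine Sg rs) ∧ (∀ x, (r.src.η x).Genuine Sg rs) ∧
      ∀ u ∈ r.us, ∀ x, (u.η x).Genuine Sg rs from fun r hr => (H r hr).1
  refine hrs.chain.invariant (I := fun g => ∀ x, (g.η x).Genuine Sg rs) ?_ ?_
  · rintro g rfl x
    refine ⟨.var x, fun f args _ hs => ?_⟩
    cases hs
  · rintro r hr hg hs u hu
    have hat := (hrs.at_mem hP r hr).1
    have hsub := hat.mem_subs
    have upd : ∀ (x : ℕ) (M : Term), M.Genuine Sg rs → ∀ y,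
        (Function.update r.g.η x M y).Genuine Sg rs := by
      intro x M hM y
      by_cases hy : y = x
      · subst hy
        simpa using hM
      · simpa [Function.update_of_ne hy] using hg y
    obtain ⟨r', hr', he⟩ := hrs.src r hr
    have hsub' := (hrs.at_mem hP r' hr').1.mem_subs
    obtain ⟨g, A, s, us, step⟩ := r
    simp only at hg hs hu hsub upd he
    subst he
    cases step <;> simp only [List.mem_cons, List.not_mem_nil, or_false] at hu
    case par => rcases hu with rfl | rfl <;> exact hg
    case inp M N Q M' x P h1 h2 =>
      subst hu
      refine upd _ _ (genuine_eval hr' hs (by simp [h2, Proc.headTerms]) ?_)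
      exact hP.wf_term _ hsub' (by simp [h2]) _ (by simp [h2, Proc.headTerms])
    case letT x M P h1 =>
      subst hu
      refine upd _ _ (genuine_eval hr hg (by simp [h1, Proc.headTerms]) ?_)
      exact hP.wf_term _ hsub (by simp [h1]) _ (by simp [h1, Proc.headTerms])
    case destr₁ x d Ms P Q M' h1 h2 =>
      subst hu
      exact upd _ _ (genuine_reduct hP hr hsub hg h1 h2)
    all_goals
      subst hu
      exact hg

/-- The terms of all actions but events are genuine. -/
theorem genuine_terms {Sg : Signature} {Init : Finset ℕ} {P₀ : Proc} {rs : List ExecStep}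
    (hP : IsTagged Sg Init P₀) (hrs : Execution P₀ rs) {r : ExecStep} (hr : r ∈ rs)
    (hev : ∀ M P, r.g.proc ≠ .event M P) {N : Term} (hN : N ∈ r.act.terms) :
    N.Genuine Sg rs := by
  have key : ∀ r ∈ rs, (∀ M P, r.g.proc ≠ .event M P) → ∀ M ∈ r.g.proc.headTerms,
      (r.g.eval M).Genuine Sg rs := fun r hr hev M hM =>
    genuine_eval hr (hrs.genuine_env hP r hr) hM
      (hP.wf_term _ (hrs.at_mem hP r hr).1.mem_subs hev M hM)
  have hk := key r hr hev
  obtain ⟨r', hr', he⟩ := hrs.src r hr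
  have hk' := key r' hr'
  have hred := fun x d Ms P Q M' h1 h2 => genuine_reduct (x := x) (d := d) (Ms := Ms) (P := P)
    (Q := Q) (M' := M') hP hr (hrs.at_mem hP r hr).1.mem_subs (hrs.genuine_env hP r hr) h1 h2
  obtain ⟨g, A, s, us, step⟩ := r
  simp only at hev hk he hN hred
  subst he
  cases step <;> simp only [List.mem_append, List.mem_cons, List.not_mem_nil, or_false] at hN
  case inp M N Q M' x P h1 h2 =>
    rcases hN with rfl | rfl <;>
      exact hk' (by simp [h2]) _ (by simp [h2, Proc.headTerms])
  case out h =>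
    rcases hN with rfl | rfl <;> exact hk _ (by simp [h, Proc.headTerms])
  case cond₁ h _ =>
    rcases hN with rfl | rfl <;> exact hk _ (by simp [h, Proc.headTerms])
  case cond₂ h =>
    rcases hN with rfl | rfl <;> exact hk _ (by simp [h, Proc.headTerms])
  case event h => exact (hev _ _ h).elim
  case letT h =>
    subst hN
    exact hk _ (by simp [h, Proc.headTerms])
  case destr₁ h1 h2 =>
    rcases hN with h | rfl
    · obtain ⟨M, hM, rfl⟩ := List.mem_map.1 h
      exact hk _ (by simpa [h1, Proc.headTerms] using hM)
    · exact hred _ _ _ _ _ _ h1 h2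
  case destr₂ h =>
    obtain ⟨M, hM, rfl⟩ := List.mem_map.1 hN
    exact hk _ (by simpa [h, Proc.headTerms] using hM)

end Execution
/-! ## Names as patterns -/

/-- The pattern of a term, when `φ` gives the patterns of names. -/
def Term.label (φ : ℕ → Pattern) (M : Term) : Pattern := M.toPattern (fun _ => .app .tru []) φ

theorem HThread.label_eval (φ : ℕ → Pattern) (g : HThread) (M : Term) :
    (g.eval M).label φ = M.toPattern (fun x => (g.η x).label φ) (fun a => φ (g.ν a)) := by
  rw [Term.label, Thread.eval, Term.toPattern_inst]
  simp only [Term.toPattern]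
  rfl

theorem HThread.NamesIn.step {E : Set ℕ} {g s u : HThread} {A : Action} {us : List HThread}
    (hd : ∀ x d Ms P Q, g.proc = .letD x d Ms P Q → ∀ i n, d = .nth i n → i < n)
    (h : ThreadStep g A s us) (hg : g.NamesIn E) (hs : s.NamesIn E) (hu : u ∈ us) :
    u.NamesIn (E ∪ A.names) := by
  have upd : ∀ {x : ℕ} {M : Term}, (∀ a, Term.Sub (.name a) M → a ∈ E) →
      ∀ y a, Term.Sub (.name a) (Function.update g.η x M y) → a ∈ E := by
    intro x M hM y a ha
    by_cases hy : y = x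
    · subst hy
      exact hM a (by simpa using ha)
    · exact hg.var y a (by simpa [Function.update_of_ne hy] using ha)
  have huE : A.created = none → u.NamesIn E → u.NamesIn (E ∪ A.names) :=
    fun _ h => h.mono Set.subset_union_left
  have hfn : ∀ {i : ℕ} {Q : Proc}, (i, Q) ∈ g.proc.children → g.proc.headName = [] →
      ∀ a ∈ Q.fn, g.ν a ∈ E := by
    intro i Q hi h0 a ha
    refine hg.name a ((Proc.fn_child hi ha).resolve_right ?_)
    simp [h0]
  cases h <;> simp only [List.mem_cons, List.not_mem_nil, or_false] at hu
  case par P Q h =>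
    rcases hu with rfl | rfl
    · exact huE rfl ⟨hg.var, hfn (i := 0) (by simp [h, Proc.children, HThread.child])
        (by simp [h, Proc.headName]), hg.ins⟩
    · exact huE rfl ⟨hg.var, hfn (i := 1) (by simp [h, Proc.children, HThread.child])
        (by simp [h, Proc.headName]), hg.ins⟩
  case res a P a' h =>
    subst hu
    rw [names_some]
    refine ⟨fun x b hb => .inl (hg.var x b hb), fun b hb => ?_,
      fun M hM b hb => .inl (hg.ins M hM b hb)⟩
    by_cases hba : b = a
    · subst hba
      exact .inr (by simp)
    · refine .inl ?_
      change Function.update g.ν a a' b ∈ E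
      rw [Function.update_of_ne hba]
      refine hg.name b ?_
      rw [h]
      exact ⟨hb, hba⟩
  case inp M N Q M' x P h1 h2 =>
    subst hu
    have hN : ∀ a, Term.Sub (.name a) (s.eval N) → a ∈ E :=
      fun a ha => hs.eval (by simp [h2, Proc.headTerms]) ha
    refine huE rfl ⟨upd hN, hfn (i := 0) (by simp [h1, Proc.children, HThread.child])
        (by simp [h1, Proc.headName]), fun M hM a ha => ?_⟩
    rcases List.mem_append.1 hM with hM | hM
    · exact hg.ins M hM a ha
    · rw [List.mem_singleton.1 hM] at ha
      exact hN a ha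
  case destr₁ x d Ms P Q M' h1 h2 =>
    subst hu
    refine huE rfl ⟨upd fun a ha => ?_, hfn (i := 0) (by simp [h1, Proc.children, HThread.child])
        (by simp [h1, Proc.headName]), hg.ins⟩
    rcases h2.sub (hd _ _ _ _ _ h1) with ⟨N, hN, h3⟩ | ⟨-, rfl⟩
    · obtain ⟨M, hM, rfl⟩ := List.mem_map.1 hN
      exact hg.eval (by simpa [h1, Proc.headTerms] using hM) (ha.trans h3)
    · rcases Term.sub_app.1 ha with h | ⟨M, h, -⟩
      · cases h
      · simp at h
  case letT x M P h =>
    subst hu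
    exact huE rfl ⟨upd fun a ha => hg.eval (by simp [h, Proc.headTerms]) ha,
      hfn (i := 0) (by simp [h, Proc.children, HThread.child]) (by simp [h, Proc.headName]), hg.ins⟩
  case destr₂ h =>
    subst hu
    exact huE rfl ⟨hg.var, hfn (i := 1) (by simp [h, Proc.children, HThread.child])
        (by simp [h, Proc.headName]), hg.ins⟩
  case cond₂ h =>
    subst hu
    exact huE rfl ⟨hg.var, hfn (i := 1) (by simp [h, Proc.children, HThread.child])
        (by simp [h, Proc.headName]), hg.ins⟩
  all_goals
    subst hu
    exact huE rfl ⟨hg.var, hfn (i := 0) (by simp_all [Proc.children, HThread.child])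
        (by simp_all [Proc.headName]), hg.ins⟩

/-- The names created in an execution can be encoded by the restrictions that create them. -/
theorem Chain.exists_label {G : Set HThread} {E : Set ℕ} {rs : List ExecStep} (h : Chain G E rs)
    (hG : ∀ g ∈ G, g.NamesIn E)
    (hd : ∀ r ∈ rs, ∀ x d Ms P Q, r.g.proc = .letD x d Ms P Q → ∀ i n, d = .nth i n → i < n)
    (φ₀ : ℕ → Pattern) :
    ∃ φ : ℕ → Pattern, (∀ n ∈ E, φ n = φ₀ n) ∧ ∀ r ∈ rs, ∀ a n, r.act.created = some (a, n) →
      φ n = .name (.nm a) (r.g.ins.map (Term.label φ)) (List.replicate r.g.k (.const 0)) := by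
  classical
  induction h generalizing φ₀ with
  | nil => exact ⟨φ₀, fun _ _ => rfl, by simp⟩
  | @cons G E r rs hg hs hn _ ih =>
    have hG' : ∀ g ∈ G ∪ {u | u ∈ r.us}, g.NamesIn (E ∪ r.act.names) := by
      rintro g (h | h)
      · exact (hG g h).mono Set.subset_union_left
      · exact .step (hd r (by simp)) r.step (hG _ hg) (hG _ hs) h
    cases hc : r.act.created with
    | none =>
      obtain ⟨φ, h1, h2⟩ := ih hG' (fun r hr => hd r (by simp [hr])) φ₀
      refine ⟨φ, fun n hn => h1 n (.inl hn), fun r' hr' a n ha => ?_⟩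
      rcases List.mem_cons.1 hr' with rfl | hr'
      · rw [hc] at ha
        cases ha
      · exact h2 r' hr' a n ha
    | some an =>
      obtain ⟨a, n⟩ := an
      set p : Pattern := .name (.nm a) (r.g.ins.map (Term.label φ₀))
        (List.replicate r.g.k (.const 0)) with hp
      have hnn : n ∈ r.act.names := ⟨a, hc⟩
      have hnE := hn n hnn
      -- The encoding is extended at the new name. The terms received before contain only older
      -- names, so their encodings, which are the arguments of the new pattern, do not change.
      obtain ⟨φ, h1, h2⟩ := ih hG' (fun r hr => hd r (by simp [hr])) (Function.update φ₀ n p)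
      have hE : ∀ m ∈ E, φ m = φ₀ m := by
        intro m hm
        rw [h1 m (.inl hm), Function.update_of_ne]
        rintro rfl
        exact hnE hm
      refine ⟨φ, hE, fun r' hr' b m hb => ?_⟩
      rcases List.mem_cons.1 hr' with rfl | hr'
      · rw [hc] at hb
        cases hb
        rw [h1 n (.inr hnn), Function.update_self, hp]
        congr 1
        refine List.map_congr_left fun M hM => Term.toPattern_congr (fun _ _ => rfl) fun b hb => ?_
        exact (hE b ((hG _ hg).ins M hM b hb)).symm
      · exact h2 r' hr' b m hb

/-- The names that occur in an execution. -/
def usedNames (P₀ : Proc) (rs : List ExecStep) : Set ℕ := P₀.fn ∪ {n | ∃ r ∈ rs, n ∈ r.act.names}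

/-- The encoding of the names of an execution. -/
structure IsLabelling (P₀ : Proc) (rs : List ExecStep) (φ : ℕ → Pattern) : Prop where
  free : ∀ a ∈ P₀.fn, φ a = freeName a
  created : ∀ r ∈ rs, ∀ a n, r.act.created = some (a, n) →
    φ n = .name (.nm a) (r.g.ins.map (Term.label φ)) (List.replicate r.g.k (.const 0))

namespace Execution

theorem namesIn_initial (P₀ : Proc) : (HThread.initial P₀).NamesIn P₀.fn :=
  ⟨fun _ _ h => (by cases h), fun _ h => h, fun _ h => (by simp [HThread.initial] at h)⟩

theorem nth_lt {Sg : Signature} {Init : Finset ℕ} {P₀ : Proc} {rs : List ExecStep}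
    (hP : IsTagged Sg Init P₀) (hrs : Execution P₀ rs) : ∀ r ∈ rs, ∀ x d Ms P Q,
      r.g.proc = .letD x d Ms P Q → ∀ i n, d = .nth i n → i < n :=
  fun r hr _ _ _ _ _ h => hP.nth_lt (h ▸ (hrs.at_mem hP r hr).1.mem_subs)

theorem exists_labelling {Sg : Signature} {Init : Finset ℕ} {P₀ : Proc} {rs : List ExecStep}
    (hP : IsTagged Sg Init P₀) (hrs : Execution P₀ rs) : ∃ φ, IsLabelling P₀ rs φ := by
  obtain ⟨φ, h1, h2⟩ := hrs.chain.exists_label (by rintro g rfl; exact namesIn_initial P₀)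
    (hrs.nth_lt hP) freeName
  exact ⟨φ, h1, h2⟩

theorem namesIn {Sg : Signature} {Init : Finset ℕ} {P₀ : Proc} {rs : List ExecStep}
    (hP : IsTagged Sg Init P₀) (hrs : Execution P₀ rs) :
    ∀ r ∈ rs, r.g.NamesIn (usedNames P₀ rs) := by
  refine fun r hr => (hrs.chain.invariant (I := HThread.NamesIn (usedNames P₀ rs)) ?_ ?_ r hr).1
  · rintro g rfl
    exact (namesIn_initial P₀).mono Set.subset_union_left
  · intro r hr hg hs u hu
    refine (HThread.NamesIn.step (hrs.nth_lt hP r hr) r.step hg hs hu).mono ?_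
    exact Set.union_subset subset_rfl fun n hn => .inr ⟨r, hr, hn⟩

theorem names_terms {Sg : Signature} {Init : Finset ℕ} {P₀ : Proc} {rs : List ExecStep}
    (hP : IsTagged Sg Init P₀) (hrs : Execution P₀ rs) {r : ExecStep} (hr : r ∈ rs) {N : Term}
    (hN : N ∈ r.act.terms) {a : ℕ} (ha : Term.Sub (.name a) N) : a ∈ usedNames P₀ rs := by
  have hg := hrs.namesIn hP r hr
  have hd := hrs.nth_lt hP r hr
  obtain ⟨r', hr', he⟩ := hrs.src r hr
  have hs := hrs.namesIn hP r' hr'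
  obtain ⟨g, A, s, us, step⟩ := r
  simp only at he hN hg hd
  rw [he] at hs
  cases step <;> simp only [List.mem_append, List.mem_cons, List.not_mem_nil, or_false] at hN
  case inp M N Q M' x P h1 h2 =>
    rcases hN with rfl | rfl <;> exact hs.eval (by simp [h2, Proc.headTerms]) ha
  case out h =>
    rcases hN with rfl | rfl <;> exact hg.eval (by simp [h, Proc.headTerms]) ha
  case cond₁ h _ =>
    rcases hN with rfl | rfl <;> exact hg.eval (by simp [h, Proc.headTerms]) ha
  case cond₂ h =>
    rcases hN with rfl | rfl <;> exact hg.eval (by simp [h, Proc.headTerms]) ha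
  case event h =>
    subst hN
    exact hg.eval (by simp [h, Proc.headTerms]) ha
  case letT h =>
    subst hN
    exact hg.eval (by simp [h, Proc.headTerms]) ha
  case destr₁ x d Ms P Q M' h1 h2 =>
    have key : ∀ N ∈ Ms.map g.eval, ∀ a, Term.Sub (.name a) N → a ∈ usedNames P₀ rs := by
      intro N hN a ha
      obtain ⟨M, hM, rfl⟩ := List.mem_map.1 hN
      exact hg.eval (by simpa [h1, Proc.headTerms] using hM) ha
    rcases hN with h | rfl
    · exact key N h a ha
    · rcases h2.sub (hd _ _ _ _ _ h1) with ⟨N', hN', h3⟩ | ⟨-, rfl⟩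
      · exact key N' hN' a (ha.trans h3)
      · rcases Term.sub_app.1 ha with h | ⟨M, h, -⟩
        · cases h
        · simp at h
  case destr₂ h =>
    obtain ⟨M, hM, rfl⟩ := List.mem_map.1 hN
    exact hg.eval (by simpa [h, Proc.headTerms] using hM) ha

/-- Received terms are terms of executed actions. -/
theorem mem_terms_of_mem_ins {P₀ : Proc} {rs : List ExecStep} (hrs : Execution P₀ rs) :
    ∀ r ∈ rs, ∀ N ∈ r.g.ins, ∃ r' ∈ rs, (∀ M P, r'.g.proc ≠ .event M P) ∧ N ∈ r'.act.terms := by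
  refine fun r hr => (hrs.chain.invariant (I := fun g => ∀ N ∈ g.ins, ∃ r' ∈ rs,
    (∀ M P, r'.g.proc ≠ .event M P) ∧ N ∈ r'.act.terms) ?_ ?_ r hr).1
  · rintro g rfl
    simp [HThread.initial]
  · rintro ⟨g, A, s, us, step⟩ hr hg - u hu
    simp only at hg hu
    cases step <;> simp only [List.mem_cons, List.not_mem_nil, or_false] at hu
    case par => rcases hu with rfl | rfl <;> exact hg
    case inp M N Q M' x P h1 h2 =>
      subst hu
      intro L hL
      rcases List.mem_append.1 hL with hL | hL
      · exact hg L hL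
      · rw [List.mem_singleton.1 hL]
        exact ⟨_, hr, by simp [h1], by simp⟩
    all_goals
      subst hu
      exact hg

/-- Under no input and no replication, nothing has been received and no session opened, so the
encoding has no arguments. -/
theorem created_const {Sg : Signature} {Init : Finset ℕ} {P₀ : Proc} {rs : List ExecStep}
    (hP : IsTagged Sg Init P₀) (hrs : Execution P₀ rs) {φ : ℕ → Pattern}
    (hφ : IsLabelling P₀ rs φ) {r : ExecStep} (hr : r ∈ rs) {a n : ℕ} (ha : a ∈ P₀.topNames)
    (hc : r.act.created = some (a, n)) : φ n = freeName a := by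
  have h1 := (hrs.at_mem hP r hr).1.top a ha
  rw [hφ.created r hr a n hc]
  obtain ⟨g, A, s, us, step⟩ := r
  cases step <;> cases hc
  case res h =>
    obtain ⟨h2, h3, -⟩ := h1 (by simp [h, Proc.bn])
    simp only at h2 h3
    simp [h2, h3, freeName]

/-- The names of `P₀` that are constants are encoded by themselves. -/
theorem label_const {Sg : Signature} {Init : Finset ℕ} {P₀ : Proc} {rs : List ExecStep}
    (hP : IsTagged Sg Init P₀) (hrs : Execution P₀ rs) {φ : ℕ → Pattern}
    (hφ : IsLabelling P₀ rs φ) : ∀ r ∈ rs, ∀ a ∈ r.g.proc.fn, a ∈ P₀.fn ∨ a ∈ P₀.topNames →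
      φ (r.g.ν a) = freeName a := by
  have H : ∀ r ∈ rs, ∀ a ∈ r.g.proc.fn, a ∈ P₀.topNames → φ (r.g.ν a) = freeName a := by
    refine fun r hr => (hrs.chain.invariant (I := fun g => ∀ a ∈ g.proc.fn, a ∈ P₀.topNames →
      φ (g.ν a) = freeName a) ?_ ?_ r hr).1
    · rintro g rfl a ha hat
      exact ((hP.bn_fresh a (Proc.topNames_subset_bn _ _ hat)).1 ha).elim
    · intro r hr hg hs u hu a ha hat
      clear hs
      by_cases hres : ∃ b, b ∈ r.g.proc.headName
      · obtain ⟨b, hb⟩ := hres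
        have hcc := fun n => hrs.created_const hP hφ (n := n) hr hat
        obtain ⟨g, A, s, us, step⟩ := r
        cases step <;> simp only [List.mem_cons, List.not_mem_nil, or_false] at hu
        case res a₁ P n h =>
          subst hu
          by_cases hba : a = a₁
          · subst hba
            simpa using hcc n rfl
          · simp only [Function.update_of_ne hba]
            exact hg a (by simp only [h]; exact ⟨ha, hba⟩) hat
        all_goals simp_all [Proc.headName]
      · have h2 : a ∈ r.g.proc.fn := by
          obtain ⟨i, hi, -⟩ := r.step.mem_children hu
          exact (Proc.fn_child hi ha).resolve_right fun h => hres ⟨a, h⟩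
        have h3 := hg a h2 hat
        obtain ⟨g, A, s, us, step⟩ := r
        cases step <;> simp only [List.mem_cons, List.not_mem_nil, or_false] at hu
        case par => rcases hu with rfl | rfl <;> exact h3
        case res b P n h => exact (hres ⟨b, by simp [h, Proc.headName]⟩).elim
        all_goals
          subst hu
          exact h3
  rintro r hr a ha (h | h)
  · rw [(hrs.at_mem hP r hr).1.free a h]
    exact hφ.free a h
  · exact H r hr a ha h

end Execution

/-! ## The types of an execution -/

theorem Term.label_var (φ : ℕ → Pattern) (x : ℕ) : (Term.var x).label φ = .app .tru [] := by
  simp [Term.label, Term.toPattern]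

theorem Term.label_name (φ : ℕ → Pattern) (n : ℕ) : (Term.name n).label φ = φ n := by
  simp [Term.label, Term.toPattern]

theorem Term.label_app (φ : ℕ → Pattern) (f : Constr) (args : List Term) :
    (Term.app f args).label φ = .app f (args.map (Term.label φ)) := by
  simp only [Term.label, Term.toPattern]
  rfl

theorem Term.finite_sub (M : Term) : {N | Term.Sub N M}.Finite := by
  induction M using Term.induct with
  | hv x => simp [Term.sub_var]
  | hn a => simp [Term.sub_name]
  | ha f args ih =>
    have : {N | Term.Sub N (.app f args)} =
        {.app f args} ∪ ⋃ M ∈ {M | M ∈ args}, {N | Term.Sub N M} := by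
      ext N
      simp [Term.sub_app]
    rw [this]
    exact (Set.finite_singleton _).union ((List.finite_toSet args).biUnion ih)

/-- The constants of `P₀` that are not used as tags. -/
def keySet (P₀ : Proc) : Set ℕ :=
  {a | (a ∈ P₀.fn ∨ a ∈ P₀.topNames) ∧ ¬ IsTag P₀ (.name a)}

/-- The types of the terms in some of the actions. -/
def typeSet (P₀ : Proc) (rs : List ExecStep) (φ : ℕ → Pattern) (p : ExecStep → Prop) :
    Set Pattern :=
  {t | ∃ r ∈ rs, p r ∧ ∃ N ∈ r.act.terms, ∃ N', Term.Sub N' N ∧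
    t = (N'.label φ).erase (keySet P₀)}

theorem finite_typeSet (P₀ : Proc) (rs : List ExecStep) (φ : ℕ → Pattern) (p : ExecStep → Prop) :
    (typeSet P₀ rs φ p).Finite := by
  have : (⋃ r ∈ {r | r ∈ rs}, ⋃ N ∈ {N | N ∈ r.act.terms},
      (fun N' => (Term.label φ N').erase (keySet P₀)) '' {N' | Term.Sub N' N}).Finite :=
    (List.finite_toSet rs).biUnion fun r _ => (List.finite_toSet _).biUnion fun N _ =>
      N.finite_sub.image _
  refine this.subset ?_
  rintro t ⟨r, hr, -, N, hN, N', h, rfl⟩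
  exact Set.mem_biUnion hr (Set.mem_biUnion hN ⟨N', h, rfl⟩)

/-- The action is not an event. -/
def ExecStep.IsPlain (r : ExecStep) : Prop := ∀ M P, r.g.proc ≠ .event M P

theorem finite_keySet {P₀ : Proc} (h : P₀.fn.Finite) : (keySet P₀).Finite := by
  refine (h.union (List.finite_toSet P₀.bn)).subset ?_
  rintro a ⟨ha, -⟩
  exact ha.imp id (Proc.topNames_subset_bn _ a)

-- Names and tags determine places of the process

theorem List.Pairwise.rel_of_ne {α : Type*} {R : α → α → Prop} {l : List α} (hl : l.Pairwise R)
    (hR : ∀ a b, R a b → R b a) {a b : α} (ha : a ∈ l) (hb : b ∈ l) (hne : a ≠ b) : R a b := by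
  induction hl with
  | nil => simp at ha
  | cons h _ ih =>
    rcases List.mem_cons.1 ha with rfl | ha' <;> rcases List.mem_cons.1 hb with rfl | hb'
    · exact (hne rfl).elim
    · exact h _ hb'
    · exact hR _ _ (h _ ha')
    · exact ih ha' hb'

/-- A name is bound at only one place. -/
theorem IsTagged.path_eq_of_headName {Sg : Signature} {Init : Finset ℕ} {P₀ : Proc}
    (hP : IsTagged Sg Init P₀) {p p' : List ℕ} {S S' : Proc} (h : (p, S) ∈ P₀.psubs)
    (h' : (p', S') ∈ P₀.psubs) {a : ℕ} (ha : a ∈ S.headName) (ha' : a ∈ S'.headName) : p = p' := by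
  by_contra hne
  have h1 := hP.bn_nodup
  rw [Proc.bn_eq_flatMap, List.nodup_flatMap] at h1
  refine List.Pairwise.rel_of_ne h1.2 (fun _ _ h => List.Disjoint.symm h) h h' (fun he => ?_) ha ha'
  exact hne (congrArg Prod.fst he)

/-- A tag determines an occurrence of a constructor. -/
theorem IsTagged.occ_eq {Sg : Signature} {Init : Finset ℕ} {P₀ : Proc}
    (hP : IsTagged Sg Init P₀) {p p' : List ℕ} {S S' : Proc} (h : (p, S) ∈ P₀.psubs)
    (h' : (p', S') ∈ P₀.psubs) {M M' : Term} (hM : M ∈ S.headTerms) (hM' : M' ∈ S'.headTerms)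
    {f : Constr} {args args' : List Term} (hf : f.NeedsTag) (ho : Term.Sub (.app f args) M)
    (ho' : Term.Sub (.app f args') M') {ct : Term} (ht : HasTag args ct) (ht' : HasTag args' ct) :
    p = p' ∧ args = args' := by
  have h1 := hP.tags_distinct
  rw [Proc.occs_eq_flatMap, List.pairwise_flatMap] at h1
  have hsymm : ∀ o o' : Constr × List Term,
      (o.1 = o'.1 → o.1.NeedsTag → ∀ ct, HasTag o.2 ct → ¬ HasTag o'.2 ct) →
      (o'.1 = o.1 → o'.1.NeedsTag → ∀ ct, HasTag o'.2 ct → ¬ HasTag o.2 ct) :=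
    fun o o' h he hf ct ht ht' => h he.symm (he ▸ hf) ct ht' ht
  have hm : (f, args) ∈ S.headTerms.flatMap Term.occs :=
    List.mem_flatMap.2 ⟨M, hM, Term.mem_occs.2 ho⟩
  have hm' : (f, args') ∈ S'.headTerms.flatMap Term.occs :=
    List.mem_flatMap.2 ⟨M', hM', Term.mem_occs.2 ho'⟩
  by_cases he : (p, S) = (p', S')
  · cases he
    refine ⟨rfl, ?_⟩
    by_contra hne
    exact List.Pairwise.rel_of_ne (h1.1 _ h) hsymm hm hm' (fun he => hne (congrArg Prod.snd he))
      rfl hf ct ht ht'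
  · exact (List.Pairwise.rel_of_ne h1.2 (fun a b hab x hx y hy => hsymm _ _ (hab y hy x hx)) h h' he
      _ hm _ hm' rfl hf ct ht ht').elim

namespace Execution

/-- Each symbol is bound at one place at most, distinct from the free names, and that place is
executed once. So the symbol fixes the arguments, which are received terms and hence terms of
inputs, not of events. -/
theorem name_cases {Sg : Signature} {Init : Finset ℕ} {P₀ : Proc} {rs : List ExecStep}
    (hP : IsTagged Sg Init P₀) (hrs : Execution P₀ rs) {φ : ℕ → Pattern}
    (hφ : IsLabelling P₀ rs φ) {n : ℕ} (hn : n ∈ usedNames P₀ rs) :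
    ∃ a qs is, φ n = .name (.nm a) qs is ∧
      (∀ q ∈ qs, ∃ r ∈ rs, r.IsPlain ∧ ∃ N ∈ r.act.terms, q = N.label φ) ∧
      ∀ n' ∈ usedNames P₀ rs, ∀ qs' is', φ n' = .name (.nm a) qs' is' → qs' = qs ∧ is' = is := by
  have bound : ∀ r ∈ rs, ∀ a m, r.act.created = some (a, m) →
      a ∈ P₀.bn ∧ a ∈ r.g.proc.headName := by
    intro r hr a m hc
    have h1 := (hrs.at_mem hP r hr).1.bn
    obtain ⟨g, A, s, us, step⟩ := r
    cases step <;> cases hc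
    case res h => exact ⟨h1.subset (by simp [h, Proc.bn]), by simp [h, Proc.headName]⟩
  rcases hn with hn | ⟨r, hr, a, hc⟩
  · refine ⟨n, [], [], hφ.free n hn, by simp, ?_⟩
    rintro n' (hn' | ⟨r', hr', a', hc'⟩) qs' is' he
    · rw [hφ.free n' hn'] at he
      cases he
      exact ⟨rfl, rfl⟩
    · rw [hφ.created r' hr' a' n' hc'] at he
      cases he
      exact ((hP.bn_fresh _ (bound r' hr' _ _ hc').1).1 hn).elim
  · refine ⟨a, _, _, hφ.created r hr a n hc, ?_, ?_⟩
    · intro q hq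
      obtain ⟨N, hN, rfl⟩ := List.mem_map.1 hq
      obtain ⟨r', h1, h2, h3⟩ := hrs.mem_terms_of_mem_ins r hr N hN
      exact ⟨r', h1, h2, N, h3, rfl⟩
    · rintro n' (hn' | ⟨r', hr', a', hc'⟩) qs' is' he
      · rw [hφ.free n' hn'] at he
        cases he
        exact ((hP.bn_fresh _ (bound r hr _ _ hc).1).1 hn').elim
      · rw [hφ.created r' hr' a' n' hc'] at he
        cases he
        have h1 := (hrs.at_mem hP r hr).1
        have h2 := (bound r hr _ _ hc).2
        have h3 := hP.path_eq_of_headName h1.mem_psubs (hrs.at_mem hP r' hr').1.mem_psubs h2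
          (bound r' hr' _ _ hc').2
        have h4 : r.g.proc ≠ .nil := by
          intro h0
          rw [h0] at h2
          simp [Proc.headName] at h2
        rw [hrs.eq_of_path_eq hr hr' h3 (h1.mem_points h4)]
        exact ⟨rfl, rfl⟩

theorem typeSet_name {Sg : Signature} {Init : Finset ℕ} {P₀ : Proc} {rs : List ExecStep}
    (hP : IsTagged Sg Init P₀) (hrs : Execution P₀ rs) {φ : ℕ → Pattern}
    (hφ : IsLabelling P₀ rs φ) {p : ExecStep → Prop} {s : NameSym} {ps : List Pattern}
    {is : List SessId} (h : Pattern.name s ps is ∈ typeSet P₀ rs φ p) :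
    (s = .b₀ ∧ ps = [] ∧ is = []) ∨ ∃ a qs, s = .nm a ∧ ps = qs.map (Pattern.erase (keySet P₀)) ∧
      (∀ q ∈ qs, ∃ r ∈ rs, r.IsPlain ∧ ∃ N ∈ r.act.terms, q = N.label φ) ∧
      ∃ n ∈ usedNames P₀ rs, φ n = .name (.nm a) qs is ∧
      ∀ n' ∈ usedNames P₀ rs, ∀ qs' is', φ n' = .name (.nm a) qs' is' → qs' = qs ∧ is' = is := by
  obtain ⟨r, hr, -, N, hN, N', hs, he⟩ := h
  cases N' with
  | var x => simp [Term.label_var, erase_app] at he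
  | app f args => simp [Term.label_app, erase_app] at he
  | name n =>
    have hn := hrs.names_terms hP hr hN hs
    obtain ⟨a, qs, js, h1, h2, h3⟩ := hrs.name_cases hP hφ hn
    rw [Term.label_name, h1] at he
    by_cases hk : IsKey (keySet P₀) (.name (.nm a) qs js)
    · rw [erase_key hk, star] at he
      cases he
      exact .inl ⟨rfl, rfl, rfl⟩
    · rw [erase_name hk] at he
      cases he
      exact .inr ⟨a, qs, rfl, rfl, h2, n, hn, h1, h3⟩

theorem typeSet_app {Sg : Signature} {Init : Finset ℕ} {P₀ : Proc} {rs : List ExecStep}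
    (hP : IsTagged Sg Init P₀) (hrs : Execution P₀ rs) {φ : ℕ → Pattern}
    (hφ : IsLabelling P₀ rs φ) {p : ExecStep → Prop} {f : Constr} {ps : List Pattern}
    (h : Pattern.app f ps ∈ typeSet P₀ rs φ p) : (f = .tru ∧ ps = []) ∨
      ∃ r ∈ rs, p r ∧ ∃ N ∈ r.act.terms, ∃ args, Term.Sub (.app f args) N ∧
        ps = args.map fun M => (M.label φ).erase (keySet P₀) := by
  obtain ⟨r, hr, hp, N, hN, N', hs, he⟩ := h
  cases N' with
  -- Variables without a value are labelled `true`.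
  | var x =>
    simp only [Term.label_var, erase_app, Pattern.app.injEq] at he
    exact .inl ⟨he.1, by simpa using he.2⟩
  | app g args =>
    simp only [Term.label_app, erase_app, Pattern.app.injEq, List.map_map] at he
    obtain ⟨rfl, rfl⟩ := he
    exact .inr ⟨r, hr, hp, N, hN, args, hs, rfl⟩
  | name n =>
    have hn := hrs.names_terms hP hr hN hs
    obtain ⟨a, qs, js, h1, h2, h3⟩ := hrs.name_cases hP hφ hn
    rw [Term.label_name, h1] at he
    by_cases hk : IsKey (keySet P₀) (.name (.nm a) qs js)
    · rw [erase_key hk, star] at he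
      cases he
    · rw [erase_name hk] at he
      cases he

/-- Tagged cryptographic subterms stem from tagged occurrences in the process. -/
theorem tagged_occurrence {Sg : Signature} {Init : Finset ℕ} {P₀ : Proc} {rs : List ExecStep}
    (hP : IsTagged Sg Init P₀) (hrs : Execution P₀ rs) {φ : ℕ → Pattern}
    (hφ : IsLabelling P₀ rs φ) {f : Constr} (hf : f.NeedsTag) {args : List Term}
    (h : IsOccurrence rs (.app f args)) {ct : Pattern} {n : ℕ} {us vs : List Pattern}
    (he : args.map (fun M => (M.label φ).erase (keySet P₀)) = .app (.tuple n) (ct :: us) :: vs) :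
    ∃ r ∈ rs, ∃ S ∈ r.g.proc.headTerms, ∃ as, Term.Sub (.app f as) S ∧
      Term.app f args = r.g.eval (.app f as) ∧ ∃ ct₀, HasTag as ct₀ ∧
        ct = ct₀.toPattern (fun _ => .app .tru []) freeName ∧ IsConstant P₀ ct₀ := by
  obtain ⟨r, hr, S, hS, g, as, hs, h1⟩ := h
  have h1' := h1
  simp only [Thread.eval, Term.inst, Term.app.injEq] at h1
  obtain ⟨rfl, rfl⟩ := h1
  have hat := (hrs.at_mem hP r hr).1
  have hocc : (f, as) ∈ P₀.occs := by
    rw [Proc.occs_eq_flatMap]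
    exact List.mem_flatMap.2 ⟨_, hat.mem_psubs, List.mem_flatMap.2 ⟨S, hS, Term.mem_occs.2 hs⟩⟩
  obtain ⟨ct₀, ht, hc⟩ := hP.tagged _ hocc hf
  refine ⟨r, hr, S, hS, as, hs, h1', ct₀, ht, ?_, hc⟩
  obtain ⟨Ms, rest, has⟩ := ht
  simp only at has
  subst has
  simp only [List.map_cons, Term.inst, Term.label_app, erase_app, List.cons.injEq,
    Pattern.app.injEq] at he
  obtain ⟨⟨-, rfl, -⟩, -⟩ := he
  rcases hc with ⟨a, rfl, ha⟩ | rfl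
  · have hfn : a ∈ r.g.proc.fn := by
      refine Proc.mem_fn_of_headTerms hS (.trans ?_ hs)
      exact .app (List.mem_cons_self ..) (.app (List.mem_cons_self ..) .refl)
    simp only [Term.inst, Term.label_name, Term.toPattern]
    rw [hrs.label_const hP hφ r hr a hfn ha, freeName, erase_name]
    · simp
    -- A constant used as a tag is not a key, so erasure leaves tags visible.
    · rintro ⟨b, hb, h⟩
      cases h
      exact hb.2 ⟨_, hocc, hf, Ms, rest, rfl⟩
  · simp [Term.inst, Term.label_app, Term.toPattern, erase_app]

/-- The types of the terms of an execution. -/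
theorem typing {Sg : Signature} {Init : Finset ℕ} {P₀ : Proc} {rs : List ExecStep}
    (hP : IsTagged Sg Init P₀) (hrs : Execution P₀ rs) (hfn : P₀.fn.Finite) {φ : ℕ → Pattern}
    (hφ : IsLabelling P₀ rs φ)
    (hpenc : ∀ r ∈ rs, ∀ M ∈ r.act.terms, ∀ M₁ M₂ M₃ : Term,
      Term.Sub (.app .pencryptP [M₁, M₂, M₃]) M → ∃ K, M₂ = .app .pk [K])
    (hkey : ∀ r ∈ rs, ∀ M ∈ r.act.terms, ∀ K : Term,
      (Term.Sub (.app .pk [K]) M ∨ Term.Sub (.app .host [K]) M) →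
        ∃ n a, K = .name n ∧ IsAtomic P₀ (rs.map ExecStep.act) n a ∧ ¬ IsTag P₀ (.name a)) :
    Typing (keySet P₀) (typeSet P₀ rs φ ExecStep.IsPlain) := by
  have hterm : ∀ {r}, r ∈ rs → r.IsPlain → ∀ {N}, N ∈ r.act.terms → N.Genuine Sg rs :=
    fun hr hp _ hN => hrs.genuine_terms hP hr hp hN
  have harity : ∀ {f ps}, Pattern.app f ps ∈ typeSet P₀ rs φ ExecStep.IsPlain →
      (f = .tru ∧ ps = []) ∨ (f ∈ Sg.constrs ∧ ∃ r ∈ rs, r.IsPlain ∧ ∃ N ∈ r.act.terms, ∃ args,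
        Term.Sub (.app f args) N ∧ args.length = f.arity ∧
        ps = args.map fun M => (M.label φ).erase (keySet P₀)) := by
    intro f ps h
    refine (hrs.typeSet_app hP hφ h).imp id ?_
    rintro ⟨r, hr, hp, N, hN, args, hs, rfl⟩
    cases (hterm hr hp hN).wf.sub hs with
    | app h1 h2 _ => exact ⟨h1, r, hr, hp, N, hN, args, hs, h2, rfl⟩
  -- An atomic constant is encoded without arguments, whether free or created at the top, and as it
  -- is not a tag it is a key; its type is `star`.
  have hatom : ∀ r ∈ rs, ∀ M ∈ r.act.terms, ∀ K : Term,
      (Term.Sub (.app .pk [K]) M ∨ Term.Sub (.app .host [K]) M) →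
        (K.label φ).erase (keySet P₀) = star := by
    intro r hr M hM K hK
    obtain ⟨n, a, rfl, h1, h2⟩ := hkey r hr M hM K hK
    rw [Term.label_name]
    rcases h1 with ⟨rfl, h1⟩ | ⟨h1, A, hA, hc⟩
    · rw [hφ.free _ h1]
      exact erase_key ⟨_, ⟨.inl h1, h2⟩, rfl⟩
    · obtain ⟨r', hr', rfl⟩ := List.mem_map.1 hA
      rw [hrs.created_const hP hφ hr' h1 hc]
      exact erase_key ⟨_, ⟨.inr h1, h2⟩, rfl⟩
  have hone : ∀ {f ps}, Constr.arity f = 1 → (f = .pk ∨ f = .host) →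
      Pattern.app f ps ∈ typeSet P₀ rs φ ExecStep.IsPlain → ps = [star] := by
    intro f ps hf hf' h
    rcases harity h with ⟨rfl, -⟩ | ⟨-, r, hr, hp, N, hN, args, hs, hl, rfl⟩
    · simp [Constr.arity] at hf
    · rw [hf, List.length_eq_one_iff] at hl
      obtain ⟨K, rfl⟩ := hl
      rw [List.map_singleton, hatom r hr N hN K]
      rcases hf' with rfl | rfl
      · exact .inl hs
      · exact .inr hs
  refine ⟨finite_keySet hfn, finite_typeSet .., ?_, ?_, ?_, ?_, fun ps h => hone rfl (.inl rfl) h,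
    fun ps h => hone rfl (.inr rfl) h, ?_, ?_, ?_, ?_⟩
  · intro s ps is h q hq
    rcases hrs.typeSet_name hP hφ h with ⟨-, rfl, -⟩ | ⟨a, qs, -, rfl, h1, -⟩
    · simp at hq
    · obtain ⟨q', hq', rfl⟩ := List.mem_map.1 hq
      obtain ⟨r, hr, hp, N, hN, rfl⟩ := h1 q' hq'
      exact ⟨r, hr, hp, N, hN, N, .refl, rfl⟩
  · intro f ps h q hq
    rcases hrs.typeSet_app hP hφ h with ⟨-, rfl⟩ | ⟨r, hr, hp, N, hN, args, hs, rfl⟩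
    · simp at hq
    · obtain ⟨M, hM, rfl⟩ := List.mem_map.1 hq
      exact ⟨r, hr, hp, N, hN, M, .trans (.app hM .refl) hs, rfl⟩
  · intro s ps is ps' is' h h'
    rcases hrs.typeSet_name hP hφ h with ⟨rfl, rfl, rfl⟩ | ⟨a, qs, rfl, rfl, -, n, hn, h1, h2⟩
    · rcases hrs.typeSet_name hP hφ h' with ⟨-, rfl, rfl⟩ | ⟨a, qs, h, -⟩
      · exact ⟨rfl, rfl⟩
      · cases h
    · rcases hrs.typeSet_name hP hφ h' with ⟨h, -⟩ | ⟨a', qs', he, rfl, -, n', hn', h1', h2'⟩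
      · cases h
      · cases he
        obtain ⟨rfl, rfl⟩ := h2 n' hn' _ _ h1'
        exact ⟨rfl, rfl⟩
  · intro ps is h
    rcases hrs.typeSet_name hP hφ h with ⟨-, h, -⟩ | ⟨a, qs, h, -⟩
    · exact h
    · cases h
  · intro ps h
    rcases harity h with ⟨-, h⟩ | ⟨-, r, hr, hp, N, hN, args, hs, hl, rfl⟩
    · exact h
    · rw [Constr.arity, List.length_eq_zero_iff] at hl
      simp [hl]
  · intro e ps h
    rcases harity h with ⟨h, -⟩ | ⟨h, -⟩
    · cases h
    · exact hP.sig.noEvt e h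
  · intro p q r h
    rcases harity h with ⟨h, -⟩ | ⟨-, r', hr', hp, N, hN, args, hs, hl, he⟩
    · cases h
    · match args, hl with
      | [M₁, M₂, M₃], _ =>
        obtain ⟨K, rfl⟩ := hpenc r' hr' N hN _ _ _ hs
        simp only [List.map_cons, List.cons.injEq, Term.label_app, erase_app] at he
        exact ⟨_, he.2.1⟩
  -- Equal tags come from one occurrence in the process, this occurrence belongs to one program
  -- point, and the point is executed once. So both terms are the same value.
  · intro f hf ct n us vs n' us' vs' h h'
    rcases hrs.typeSet_app hP hφ h with ⟨rfl, -⟩ | ⟨r, hr, hp, N, hN, args, hs, he⟩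
    · exact hf.elim
    rcases hrs.typeSet_app hP hφ h' with ⟨rfl, -⟩ | ⟨r', hr', hp', N', hN', args', hs', he'⟩
    · exact hf.elim
    obtain ⟨r₁, hr₁, S, hS, as, h1, h2, ct₀, h3, h4, h5⟩ := hrs.tagged_occurrence hP hφ hf
      ((hterm hr hp hN).occ f args hf hs) he.symm
    obtain ⟨r₁', hr₁', S', hS', as', h1', h2', ct₀', h3', h4', h5'⟩ := hrs.tagged_occurrence hP hφ hf
      ((hterm hr' hp' hN').occ f args' hf hs') he'.symm
    have hct : ct₀ = ct₀' := by
      rw [h4] at h4'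
      rcases h5 with ⟨a, rfl, -⟩ | rfl <;> rcases h5' with ⟨b, rfl, -⟩ | rfl
      · simp only [Term.toPattern, freeName, Pattern.name.injEq, NameSym.nm.injEq] at h4'
        rw [h4'.1]
      · simp [Term.toPattern, freeName] at h4'
      · simp [Term.toPattern, freeName] at h4'
      · rfl
    subst hct
    have hat := (hrs.at_mem hP r₁ hr₁).1
    obtain ⟨h6, rfl⟩ := hP.occ_eq hat.mem_psubs (hrs.at_mem hP r₁' hr₁').1.mem_psubs hS hS' hf h1
      h1' h3 h3'
    have h7 : r₁.g.proc ≠ .nil := by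
      intro h0
      rw [h0] at hS
      simp [Proc.headTerms] at hS
    have h8 := hrs.eq_of_path_eq hr₁ hr₁' h6 (hat.mem_points h7)
    subst h8
    rw [he, he']
    have h9 := h2.trans h2'.symm
    simp only [Term.app.injEq, true_and] at h9
    rw [h9]

end Execution

/-- The intended execution of a tagged protocol. -/
theorem IsTagged.exists_execution {Sg : Signature} {Init : Finset ℕ} {P₀ : Proc}
    (hP : IsTagged Sg Init P₀) : ∃ rs φ, Execution P₀ rs ∧ IsLabelling P₀ rs φ ∧
      Typing (keySet P₀) (typeSet P₀ rs φ ExecStep.IsPlain) := by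
  obtain ⟨acts, ⟨E, c, hE, htr⟩, hcount, hpenc, hkey⟩ := hP.trace
  obtain ⟨rs, h1, h2, h3⟩ := exists_chain (G := {HThread.initial P₀}) htr (by
    intro t ht
    refine ⟨_, rfl, ?_⟩
    rw [Multiset.mem_singleton.1 ht]
    rfl)
  subst h1
  have hrs : Execution P₀ rs := by
    refine ⟨?_, h3, fun p hp => ?_⟩
    · rw [← hE]
      exact h2
    · rw [← hcount p hp, List.map_map]
      congr 1
      exact List.map_congr_left fun r _ => r.step.path_eq.symm
  obtain ⟨φ, hφ⟩ := hrs.exists_labelling hP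
  refine ⟨rs, φ, hrs, hφ, hrs.typing hP (hE ▸ E.finite_toSet) hφ ?_ ?_⟩
  · exact fun r hr => hpenc _ (List.mem_map_of_mem hr)
  · exact fun r hr => hkey _ (List.mem_map_of_mem hr)

/-! ## Steps of the execution of all program points -/

namespace Execution

theorem exists_child {Sg : Signature} {Init : Finset ℕ} {P₀ : Proc} {rs : List ExecStep}
    (hP : IsTagged Sg Init P₀) (hrs : Execution P₀ rs) {r : ExecStep} (hr : r ∈ rs) {i : ℕ}
    (hn : r.g.proc ≠ .nil) (hi : [i] ∈ r.g.proc.points) :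
    ∃ r' ∈ rs, r'.g ∈ r.us ∧ r'.g.path = r.g.path ++ [i] := by
  have hat := (hrs.at_mem hP r hr).1
  exact hrs.exists_next hr (hat.mem_points hn) (hat.points.resolve_left hn _ hi)

theorem next_par {Sg : Signature} {Init : Finset ℕ} {P₀ : Proc} {rs : List ExecStep}
    (hP : IsTagged Sg Init P₀) (hrs : Execution P₀ rs) {r : ExecStep} (hr : r ∈ rs) {P Q : Proc}
    (h : r.g.proc = .par P Q) :
    (∃ r' ∈ rs, r'.g = r.g.child 0 P) ∧ ∃ r' ∈ rs, r'.g = r.g.child 1 Q := by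
  have h0 := hrs.exists_child hP hr (i := 0) (by simp [h])
    (by rw [h]; simp [Proc.points, Proc.nil_mem_points])
  have h1 := hrs.exists_child hP hr (i := 1) (by simp [h])
    (by rw [h]; simp [Proc.points, Proc.nil_mem_points])
  obtain ⟨g, A, s, us, step⟩ := r
  simp only at h h0 h1
  cases step <;> simp_all only [reduceCtorEq, Proc.par.injEq, List.mem_cons, List.not_mem_nil,
    or_false]
  obtain ⟨r₀, hr₀, h2, h3⟩ := h0
  obtain ⟨r₁, hr₁, h4, h5⟩ := h1
  refine ⟨⟨r₀, hr₀, h2.resolve_right fun h => ?_⟩, ⟨r₁, hr₁, h4.resolve_left fun h => ?_⟩⟩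
  · rw [h] at h3
    simp [HThread.child] at h3
  · rw [h] at h5
    simp [HThread.child] at h5

theorem next_repl {Sg : Signature} {Init : Finset ℕ} {P₀ : Proc} {rs : List ExecStep}
    (hP : IsTagged Sg Init P₀) (hrs : Execution P₀ rs) {r : ExecStep} (hr : r ∈ rs) {P : Proc}
    (h : r.g.proc = .repl P) : ∃ r' ∈ rs, r'.g = { r.g.child 0 P with k := r.g.k + 1 } := by
  obtain ⟨r', hr', h1, h2⟩ := hrs.exists_child hP hr (i := 0) (by simp [h])
    (by rw [h]; simp [Proc.points, Proc.nil_mem_points])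
  refine ⟨r', hr', ?_⟩
  obtain ⟨g, A, s, us, step⟩ := r
  simp only at h h1 h2
  cases step <;> simp_all only [reduceCtorEq, Proc.repl.injEq, List.mem_singleton]

theorem next_res {Sg : Signature} {Init : Finset ℕ} {P₀ : Proc} {rs : List ExecStep}
    (hP : IsTagged Sg Init P₀) (hrs : Execution P₀ rs) {φ : ℕ → Pattern}
    (hφ : IsLabelling P₀ rs φ) {r : ExecStep} (hr : r ∈ rs) {a : ℕ} {P : Proc}
    (h : r.g.proc = .res a P) : ∃ a', ∃ r' ∈ rs,
      r'.g = { r.g.child 0 P with ν := Function.update r.g.ν a a' } ∧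
      φ a' = .name (.nm a) (r.g.ins.map (Term.label φ)) (List.replicate r.g.k (.const 0)) := by
  obtain ⟨r', hr', h1, h2⟩ := hrs.exists_child hP hr (i := 0) (by simp [h])
    (by rw [h]; simp [Proc.points, Proc.nil_mem_points])
  have h3 := hφ.created r hr
  obtain ⟨g, A, s, us, step⟩ := r
  simp only at h h1 h2 h3
  cases step <;> simp_all only [reduceCtorEq, Proc.res.injEq, List.mem_singleton]
  case res b P' a' _ =>
    obtain ⟨rfl, rfl⟩ := h
    exact ⟨a', r', hr', List.mem_singleton.1 h1, h3 _ _ rfl⟩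

theorem next_inp {Sg : Signature} {Init : Finset ℕ} {P₀ : Proc} {rs : List ExecStep}
    (hP : IsTagged Sg Init P₀) (hrs : Execution P₀ rs) {r : ExecStep} (hr : r ∈ rs) {M : Term}
    {x : ℕ} {P : Proc} (h : r.g.proc = .inp M x P) : ∃ N ∈ r.act.terms, ∃ r' ∈ rs,
      r'.g = { r.g.child 0 P with η := Function.update r.g.η x N, ins := r.g.ins ++ [N] } := by
  obtain ⟨r', hr', h1, h2⟩ := hrs.exists_child hP hr (i := 0) (by simp [h])
    (by rw [h]; simp [Proc.points, Proc.nil_mem_points])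
  obtain ⟨g, A, s, us, step⟩ := r
  simp only at h h1 h2
  cases step <;> simp_all only [reduceCtorEq, Proc.inp.injEq, List.mem_singleton]
  case inp M N Q M' x P hs _ =>
    obtain ⟨rfl, rfl, rfl⟩ := h
    exact ⟨_, List.mem_cons_of_mem _ (List.mem_singleton.2 rfl), r', hr',
      List.mem_singleton.1 h1⟩

theorem next_out {Sg : Signature} {Init : Finset ℕ} {P₀ : Proc} {rs : List ExecStep}
    (hP : IsTagged Sg Init P₀) (hrs : Execution P₀ rs) {r : ExecStep} (hr : r ∈ rs) {M N : Term}
    {P : Proc} (h : r.g.proc = .out M N P) :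
    r.g.eval N ∈ r.act.terms ∧ ∃ r' ∈ rs, r'.g = r.g.child 0 P := by
  obtain ⟨r', hr', h1, h2⟩ := hrs.exists_child hP hr (i := 0) (by simp [h])
    (by rw [h]; simp [Proc.points, Proc.nil_mem_points])
  obtain ⟨g, A, s, us, step⟩ := r
  simp only at h h1 h2
  cases step <;> simp_all only [reduceCtorEq, Proc.out.injEq, List.mem_singleton]
  case out =>
    obtain ⟨rfl, rfl, rfl⟩ := h
    exact ⟨List.mem_cons_of_mem _ (List.mem_singleton.2 rfl), r', hr', h1⟩

/-- The point after success is executed, while failure would continue at the place of the else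
branch. Hence the destructor succeeds in the intended execution. -/
theorem next_letD {Sg : Signature} {Init : Finset ℕ} {P₀ : Proc} {rs : List ExecStep}
    (hP : IsTagged Sg Init P₀) (hrs : Execution P₀ rs) {r : ExecStep} (hr : r ∈ rs) {x : ℕ}
    {d : Destr} {Ms : List Term} {P Q : Proc} (h : r.g.proc = .letD x d Ms P Q) :
    ∃ M', d.Reduces (Ms.map r.g.eval) M' ∧ ∃ r' ∈ rs,
      r'.g = { r.g.child 0 P with η := Function.update r.g.η x M' } := by
  obtain ⟨r', hr', h1, h2⟩ := hrs.exists_child hP hr (i := 0) (by simp [h])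
    (by rw [h]; simp [Proc.points, Proc.nil_mem_points])
  obtain ⟨g, A, s, us, step⟩ := r
  simp only at h h1 h2
  cases step <;> simp_all only [reduceCtorEq, Proc.letD.injEq, List.mem_singleton]
  case destr₁ M' _ hd =>
    obtain ⟨rfl, rfl, rfl, rfl, rfl⟩ := h
    exact ⟨M', hd, r', hr', List.mem_singleton.1 h1⟩
  case destr₂ => simp [HThread.child] at h2

theorem next_cond {Sg : Signature} {Init : Finset ℕ} {P₀ : Proc} {rs : List ExecStep}
    (hP : IsTagged Sg Init P₀) (hrs : Execution P₀ rs) {r : ExecStep} (hr : r ∈ rs) {M N : Term}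
    {P Q : Proc} (h : r.g.proc = .cond M N P Q) :
    r.g.eval M = r.g.eval N ∧ ∃ r' ∈ rs, r'.g = r.g.child 0 P := by
  obtain ⟨r', hr', h1, h2⟩ := hrs.exists_child hP hr (i := 0) (by simp [h])
    (by rw [h]; simp [Proc.points, Proc.nil_mem_points])
  obtain ⟨g, A, s, us, step⟩ := r
  simp only at h h1 h2
  cases step <;> simp_all only [reduceCtorEq, Proc.cond.injEq, List.mem_singleton]
  case cond₁ _ he =>
    obtain ⟨rfl, rfl, rfl, rfl⟩ := h
    exact ⟨he, r', hr', h1⟩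
  case cond₂ => simp [HThread.child] at h2

theorem next_event {Sg : Signature} {Init : Finset ℕ} {P₀ : Proc} {rs : List ExecStep}
    (hP : IsTagged Sg Init P₀) (hrs : Execution P₀ rs) {r : ExecStep} (hr : r ∈ rs) {M : Term}
    {P : Proc} (h : r.g.proc = .event M P) :
    r.g.eval M ∈ r.act.terms ∧ ∃ r' ∈ rs, r'.g = r.g.child 0 P := by
  obtain ⟨r', hr', h1, h2⟩ := hrs.exists_child hP hr (i := 0) (by simp [h])
    (by rw [h]; simp [Proc.points, Proc.nil_mem_points])
  obtain ⟨g, A, s, us, step⟩ := r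
  simp only at h h1 h2
  cases step <;> simp_all only [reduceCtorEq, Proc.event.injEq, List.mem_singleton]
  case event =>
    obtain ⟨rfl, rfl⟩ := h
    exact ⟨trivial, r', hr', h1⟩

theorem next_letT {Sg : Signature} {Init : Finset ℕ} {P₀ : Proc} {rs : List ExecStep}
    (hP : IsTagged Sg Init P₀) (hrs : Execution P₀ rs) {r : ExecStep} (hr : r ∈ rs) {x : ℕ}
    {M : Term} {P : Proc} (h : r.g.proc = .letT x M P) : ∃ r' ∈ rs,
      r'.g = { r.g.child 0 P with η := Function.update r.g.η x (r.g.eval M) } := by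
  obtain ⟨r', hr', h1, h2⟩ := hrs.exists_child hP hr (i := 0) (by simp [h])
    (by rw [h]; simp [Proc.points, Proc.nil_mem_points])
  refine ⟨r', hr', ?_⟩
  obtain ⟨g, A, s, us, step⟩ := r
  simp only at h h1 h2
  cases step <;> simp_all only [reduceCtorEq, Proc.letT.injEq, List.mem_singleton]

end Execution

/-! ## Contexts of the translation with typed instances -/

theorem Term.occurs_toPattern {ρ θ : ℕ → Pattern} {v : Var} {M : Term}
    (h : v.Occurs (M.toPattern ρ θ)) : (∃ x, Term.Sub (.var x) M ∧ v.Occurs (ρ x)) ∨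
      ∃ a, Term.Sub (.name a) M ∧ v.Occurs (θ a) := by
  induction M using Term.induct with
  | hv x => exact .inl ⟨x, .refl, by simpa [Term.toPattern] using h⟩
  | hn a => exact .inr ⟨a, .refl, by simpa [Term.toPattern] using h⟩
  | ha f args ih =>
    rw [Term.toPattern, occurs_app] at h
    obtain ⟨p, hp, h⟩ := h
    obtain ⟨M, hM, rfl⟩ := List.mem_map.1 hp
    rcases ih M hM h with ⟨x, h1, h2⟩ | ⟨a, h1, h2⟩
    · exact .inl ⟨x, .app hM h1, h2⟩
    · exact .inr ⟨a, .app hM h1, h2⟩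

/-- The pattern `p` uses only variables below `n`, its instance by `σ` is `q`, and all
substitutions that satisfy `cond` are compatible with its cryptographic terms. -/
structure PatLink (n : ℕ) (cond : Subst → Prop) (σ : Subst) (p q : Pattern) : Prop where
  subst : p.subst σ = q
  below : ∀ v : Var, v.Occurs p → v.idx < n
  cut : ∀ τ, cond τ → CutOK τ p

/-- The data of a context have the values of an executed thread as instances. -/
structure Link (P₀ : Proc) (φ : ℕ → Pattern) (K : Set ℕ) (T : Set Pattern) (cond : Subst → Prop)
    (c : Ctx) (σ : Subst) (g : HThread) (V N : Set ℕ) : Prop where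
  var : ∀ x ∈ V, PatLink c.fresh cond σ (c.var x) ((g.η x).label φ)
  name : ∀ a ∈ N, PatLink c.fresh cond σ (c.name a) (φ (g.ν a))
  const : ∀ a ∈ N, a ∈ P₀.fn ∨ a ∈ P₀.topNames → c.name a = freeName a
  ins : List.Forall₂ (PatLink c.fresh cond σ) c.ins (g.ins.map (Term.label φ))
  sids : c.sids.map (SessId.subst σ) = List.replicate g.k (.const 0)
  sids_below : ∀ i, SessId.var i ∈ c.sids → i < c.fresh
  hyps : ∀ F ∈ c.hyps, ∃ p q, F = .attacker p ∧ PatLink c.fresh cond σ p q ∧ q.erase K ∈ T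

theorem Link.mono {P₀ : Proc} {φ : ℕ → Pattern} {K : Set ℕ} {T : Set Pattern}
    {cond : Subst → Prop} {c : Ctx} {σ : Subst} {g : HThread} {V N V' N' : Set ℕ}
    (h : Link P₀ φ K T cond c σ g V N) (hV : V' ⊆ V) (hN : N' ⊆ N) :
    Link P₀ φ K T cond c σ g V' N' :=
  { h with
    var := fun x hx => h.var x (hV hx)
    name := fun a ha => h.name a (hN ha)
    const := fun a ha => h.const a (hN ha) }

theorem PatLink.extend {n n' : ℕ} {cond : Subst → Prop} {σ σ' : Subst} {p q : Pattern}
    (h : PatLink n cond σ p q) (hn : n ≤ n') (hσ : ∀ v : Var, v.idx < n → v.Agree σ' σ) :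
    PatLink n' cond σ' p q :=
  ⟨(Pattern.subst_congr fun v hv => hσ v (h.below v hv)).trans h.subst,
    fun v hv => (h.below v hv).trans_le hn, h.cut⟩

theorem map_sess_congr {is : List SessId} {σ τ : Subst}
    (h : ∀ i, SessId.var i ∈ is → σ.sess i = τ.sess i) :
    is.map (SessId.subst σ) = is.map (SessId.subst τ) := by
  refine List.map_congr_left fun i hi => ?_
  cases i with
  | var i => exact h i hi
  | const l => rfl

theorem Link.extend {P₀ : Proc} {φ : ℕ → Pattern} {K : Set ℕ} {T : Set Pattern}
    {cond : Subst → Prop} {c : Ctx} {σ σ' : Subst} {g : HThread} {V N : Set ℕ} {n' : ℕ}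
    (h : Link P₀ φ K T cond c σ g V N) (hn : c.fresh ≤ n')
    (hσ : ∀ v : Var, v.idx < c.fresh → v.Agree σ' σ) :
    Link P₀ φ K T cond { c with fresh := n' } σ' g V N where
  var x hx := (h.var x hx).extend hn hσ
  name a ha := (h.name a ha).extend hn hσ
  const := h.const
  ins := h.ins.imp fun _ _ h => h.extend hn hσ
  sids := (map_sess_congr fun i hi => hσ (.sess i) (h.sids_below i hi)).trans h.sids
  sids_below i hi := (h.sids_below i hi).trans_le hn
  hyps F hF := by
    obtain ⟨p, q, h1, h2, h3⟩ := h.hyps F hF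
    exact ⟨p, q, h1, h2.extend hn hσ, h3⟩

/-- Cryptographic terms are tagged with constants. -/
def Term.TaggedIn (P₀ : Proc) (M : Term) : Prop :=
  ∀ f args, f.NeedsTag → Term.Sub (.app f args) M → ∃ ct, HasTag args ct ∧ IsConstant P₀ ct

theorem IsTagged.taggedIn {Sg : Signature} {Init : Finset ℕ} {P₀ : Proc}
    (hP : IsTagged Sg Init P₀) {S : Proc} (hS : S ∈ P₀.subs) {M : Term} (hM : M ∈ S.headTerms) :
    M.TaggedIn P₀ := fun f args hf h =>
  hP.tagged (f, args) (List.mem_flatMap.2 ⟨S, hS, List.mem_flatMap.2 ⟨M, hM, Term.mem_occs.2 h⟩⟩) hf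

theorem Link.isConstPat {P₀ : Proc} {φ : ℕ → Pattern} {K : Set ℕ} {T : Set Pattern}
    {cond : Subst → Prop} {c : Ctx} {σ : Subst} {g : HThread} {V N : Set ℕ}
    (h : Link P₀ φ K T cond c σ g V N) {ct : Term} (hct : IsConstant P₀ ct)
    (hN : ∀ a, Term.Sub (.name a) ct → a ∈ N) : IsConstPat (c.eval ct) := by
  rcases hct with ⟨a, rfl, ha⟩ | rfl
  · rw [Ctx.eval, Term.toPattern, h.const a (hN a .refl) ha]
    exact .inl ⟨a, rfl⟩
  · exact .inr (by simp [Ctx.eval, Term.toPattern])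

/-- Evaluation of terms in contexts and threads. -/
theorem Link.eval {P₀ : Proc} {φ : ℕ → Pattern} {K : Set ℕ} {T : Set Pattern}
    {cond : Subst → Prop} {c : Ctx} {σ : Subst} {g : HThread} {V N : Set ℕ}
    (h : Link P₀ φ K T cond c σ g V N) {M : Term} (hV : ∀ x, Term.Sub (.var x) M → x ∈ V)
    (hN : ∀ a, Term.Sub (.name a) M → a ∈ N) (ht : M.TaggedIn P₀) :
    PatLink c.fresh cond σ (c.eval M) ((g.eval M).label φ) := by
  refine ⟨?_, fun v hv => ?_, fun τ hτ => ?_⟩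
  · rw [Ctx.eval, Term.toPattern_subst, HThread.label_eval]
    exact Term.toPattern_congr (fun x hx => (h.var x (hV x hx)).subst)
      fun a ha => (h.name a (hN a ha)).subst
  · rcases Term.occurs_toPattern hv with ⟨x, h1, h2⟩ | ⟨a, h1, h2⟩
    · exact (h.var x (hV x h1)).below v h2
    · exact (h.name a (hN a h1)).below v h2
  · induction M using Term.induct with
    | hv x =>
      rw [Ctx.eval, Term.toPattern]
      exact (h.var x (hV x .refl)).cut τ hτ
    | hn a =>
      rw [Ctx.eval, Term.toPattern]
      exact (h.name a (hN a .refl)).cut τ hτ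
    | ha f args ih =>
      rw [Ctx.eval, Term.toPattern]
      refine .app (fun p hp => ?_) fun hf => ?_
      · obtain ⟨M, hM, rfl⟩ := List.mem_map.1 hp
        exact ih M hM (fun x hx => hV x (.app hM hx)) (fun a ha => hN a (.app hM ha))
          fun f' args' hf' h' => ht f' args' hf' (.app hM h')
      · obtain ⟨ct, ⟨Ms, rest, rfl⟩, hct⟩ := ht f args hf .refl
        have h1 := h.isConstPat hct fun a ha =>
          hN a (.app (List.mem_cons_self ..) (.app (List.mem_cons_self ..) ha))
        refine ⟨c.eval ct, h1, Ms.length + 1, (Ms.map c.eval).map (Pattern.subst τ),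
          (rest.map c.eval).map (Pattern.subst τ), ?_⟩
        simp only [List.map_cons, Term.toPattern, Pattern.subst, List.map_map]
        have h2 : Pattern.subst τ (Term.toPattern c.var c.name ct) = c.eval ct := h1.subst τ
        rw [h2]
        rfl

/-! ### Most general unifiers in the translation -/

theorem mgu_spec {U : Set Subst} {W : Set Var} {σ : Subst} (h : mgu U W = some σ) :
    IsMGU U W σ := by
  unfold mgu at h
  split_ifs at h with hex
  cases h
  exact hex.choose_spec

theorem IsMGU.below {U : Set Subst} {W : Set Var} {μ : Subst} (hμ : IsMGU U W μ) {n : ℕ}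
    (hW : ∀ v ∈ W, v.idx < n) {p : Pattern} (hp : ∀ v : Var, v.Occurs p → v.idx < n) :
    ∀ v : Var, v.Occurs (p.subst μ) → v.idx < n := by
  intro v hv
  rw [Pattern.occurs_subst] at hv
  rcases hv with ⟨x, h1, h2⟩ | ⟨i, j, h1, rfl, h2⟩
  · by_cases hx : Var.ord x ∈ W
    · exact hW v (hμ.pat_vars x hx v h2)
    · rw [hμ.pat_eq x hx, occurs_var] at h2
      subst h2
      exact hp _ h1
  · by_cases hi : Var.sess i ∈ W
    · exact hW _ (hμ.sess_vars i hi j h2)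
    · rw [hμ.sess_eq i hi] at h2
      cases h2
      exact hp _ h1

/-- The values of the thread, extended to the new variables, form the unifier `θ`. It factors
through `μ`, and the second factor links the substituted context to the same thread. The condition
`cond'` must ensure that `μ` introduces no untagged term, which holds once the cut unifier is still
a unifier. -/
theorem Link.mgu {P₀ : Proc} {φ : ℕ → Pattern} {K : Set ℕ} {T : Set Pattern}
    {cond cond' : Subst → Prop} {c : Ctx} {σ θ : Subst} {g : HThread} {V N : Set ℕ}
    (h : Link P₀ φ K T cond c σ g V N) {U : Set Subst} {W : Set Var} {μ : Subst}
    (hμ : IsMGU U W μ) {n' : ℕ} (hn : c.fresh ≤ n') (hW : ∀ v ∈ W, v.idx < n') (hθ : θ ∈ U)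
    (hσ : ∀ v : Var, v.idx < c.fresh → v.Agree θ σ)
    (hcond : ∀ ρ, cond' ρ → cond (μ.comp ρ) ∧ (μ.comp ρ).cut ∈ U) :
    ∃ τ, θ = μ.comp τ ∧ Link P₀ φ K T cond' { c.subst μ with fresh := n' } τ g V N := by
  obtain ⟨τ, hτ⟩ := hμ.general θ hθ
  have key : ∀ {p q}, PatLink c.fresh cond σ p q → PatLink n' cond' τ (p.subst μ) q := by
    intro p q hp
    have h1 := hp.extend hn hσ
    refine ⟨?_, hμ.below hW h1.below, fun ρ hρ => ?_⟩
    · rw [Pattern.subst_subst, ← hτ]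
      exact h1.subst
    · exact CutOK.comp (hp.cut _ (hcond ρ hρ).1) (hμ.cutOK (hcond ρ hρ).2)
  refine ⟨τ, hτ, fun x hx => key (h.var x hx), fun a ha => key (h.name a ha), fun a ha hc => ?_, ?_,
    ?_, ?_, ?_⟩
  · simp only [Ctx.subst, h.const a ha hc]
    simp [freeName, Pattern.subst]
  · simp only [Ctx.subst]
    rw [List.forall₂_map_left_iff]
    exact h.ins.imp fun _ _ h => key h
  · simp only [Ctx.subst, List.map_map]
    rw [← h.sids, ← map_sess_congr fun i hi => hσ (.sess i) (h.sids_below i hi), hτ]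
    exact List.map_congr_left fun i _ => SessId.subst_subst μ τ i
  · intro i hi
    simp only [Ctx.subst] at hi
    obtain ⟨j, hj, h1⟩ := List.mem_map.1 hi
    cases j with
    | const l => cases h1
    | var j =>
      simp only [SessId.subst] at h1
      by_cases hjW : Var.sess j ∈ W
      · exact hW _ (hμ.sess_vars j hjW i h1)
      · rw [hμ.sess_eq j hjW] at h1
        cases h1
        exact (h.sids_below _ hj).trans_le hn
  · intro F hF
    simp only [Ctx.subst] at hF
    obtain ⟨F', hF', rfl⟩ := List.mem_map.1 hF
    obtain ⟨p, q, rfl, h1, h2⟩ := h.hyps F' hF'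
    exact ⟨p.subst μ, q, rfl, key h1, h2⟩

/-- The unifiers of two lists of patterns. -/
def listUnifiers (ps qs : List Pattern) : Set Subst :=
  {σ | ps.map (Pattern.subst σ) = qs.map (Pattern.subst σ)}

/-- Where cutting commutes with instantiation, both sides of an equation can be cut. -/
theorem cut_mem_listUnifiers {ps qs : List Pattern} {θ : Subst} (h : θ ∈ listUnifiers ps qs)
    (hp : ∀ p ∈ ps, CutOK θ p) (hq : ∀ q ∈ qs, CutOK θ q) : θ.cut ∈ listUnifiers ps qs := by
  have key : ∀ {rs : List Pattern}, (∀ r ∈ rs, CutOK θ r) →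
      rs.map (Pattern.subst θ.cut) = (rs.map (Pattern.subst θ)).map Pattern.cut := by
    intro rs hr
    rw [List.map_map]
    exact List.map_congr_left fun r h => (hr r h).symm
  change ps.map (Pattern.subst θ.cut) = qs.map (Pattern.subst θ.cut)
  rw [key hp, key hq]
  exact congrArg _ h

theorem Destr.lhs_spec {d : Destr} {L : Term} (hL : L ∈ d.lhs) :
    (∀ a, ¬ Term.Sub (.name a) L) ∧ ∀ i, Term.Sub (.var i) L → i < d.nvars := by
  cases d with
  | nth i n =>
    rw [Destr.lhs, List.mem_singleton] at hL
    subst hL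
    refine ⟨fun a h => ?_, fun j h => ?_⟩
    · rcases Term.sub_app.1 h with h | ⟨M, hM, h⟩
      · cases h
      · obtain ⟨k, -, rfl⟩ := List.mem_map.1 hM
        cases h
    · rcases Term.sub_app.1 h with h | ⟨M, hM, h⟩
      · cases h
      · obtain ⟨k, hk, rfl⟩ := List.mem_map.1 hM
        cases h
        exact List.mem_range.1 hk
  | _ =>
    simp only [Destr.lhs, List.mem_cons, List.not_mem_nil, or_false] at hL
    refine ⟨fun a h => ?_, fun j h => ?_⟩ <;>
      rcases hL with rfl | rfl | rfl <;> simp_all [Term.sub_app, Term.sub_var, Destr.nvars] <;> omega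

theorem Destr.rhs_spec {d : Destr} (hd : ∀ i n, d = .nth i n → i < n) :
    (∀ a, ¬ Term.Sub (.name a) d.rhs) ∧ ∀ i, Term.Sub (.var i) d.rhs → i < d.nvars := by
  by_cases hx : ∃ x, d.rhs = .var x
  · obtain ⟨x, hx⟩ := hx
    obtain ⟨L, hL, hs⟩ := Destr.lhs_sub hx hd
    rw [hx]
    refine ⟨fun a h => (by cases h), fun i h => ?_⟩
    cases h
    exact (Destr.lhs_spec hL).2 _ hs
  · cases d <;> simp [Destr.rhs] at hx
    simp [Destr.rhs, Term.sub_app]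

/-- Rule patterns with fresh variables, as compared with instances of the rule. -/
theorem Term.rule_subst {φ : ℕ → Pattern} {n : ℕ} {θ : Subst} {τ : ℕ → Term}
    (hθ : ∀ i, θ.pat (n + i) = (τ i).label φ) {L : Term} (hL : ∀ a, ¬ Term.Sub (.name a) L) :
    (L.toPattern (fun i => .var (n + i)) freeName).subst θ = (L.inst τ .name).label φ := by
  rw [Term.toPattern_subst, Term.label, Term.toPattern_inst]
  refine Term.toPattern_congr (fun i _ => ?_) fun a ha => (hL a ha).elim
  rw [Pattern.subst, hθ]
  rfl

theorem Term.rule_below {n m : ℕ} {L : Term} (hL : ∀ a, ¬ Term.Sub (.name a) L)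
    (hm : ∀ i, Term.Sub (.var i) L → i < m) :
    ∀ v : Var, v.Occurs (L.toPattern (fun i => .var (n + i)) freeName) → v.idx < n + m := by
  intro v hv
  rcases Term.occurs_toPattern hv with ⟨i, h1, h2⟩ | ⟨a, h1, -⟩
  · rw [occurs_var] at h2
    subst h2
    have := hm i h1
    simp only [Var.idx]
    omega
  · exact (hL a h1).elim

/-- Destructors compatible with a substitution: the message of a cryptographic term on the
left-hand side of the rule is tagged. -/
theorem Destr.lhsPat_cutOK {d : Destr} {n : ℕ} {θ : Subst}
    (h : (d.ChecksTag ∨ d = .nmrchecksign) →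
      ∃ ct m us, IsConstPat ct ∧ θ.pat n = .app (.tuple m) (ct :: us)) :
    ∀ q ∈ d.lhsPat n, CutOK θ q := by
  have tagged : ∀ {f : Constr} {ps : List ℕ}, (d.ChecksTag ∨ d = .nmrchecksign) →
      CutOK θ (.app f (.var n :: ps.map .var)) := by
    intro f ps hd
    refine .app (fun p hp => ?_) fun _ => ?_
    · rcases List.mem_cons.1 hp with rfl | hp
      · exact .var θ n
      · obtain ⟨y, -, rfl⟩ := List.mem_map.1 hp
        exact .var θ y
    · obtain ⟨ct, m, us, h1, h2⟩ := h hd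
      refine ⟨ct, h1, m, us, (ps.map Pattern.var).map (Pattern.subst θ), ?_⟩
      rw [List.map_cons, Pattern.subst, h2]
  have plain : ∀ {f : Constr} {ps : List Pattern}, ¬ f.NeedsTag → (∀ p ∈ ps, CutOK θ p) →
      CutOK θ (.app f ps) := fun hf hp => .app hp fun h => (hf h).elim
  have hpk : ∀ y, CutOK θ (.app .pk [.var y]) := fun y => plain id (by
    intro p hp
    rw [List.mem_singleton.1 hp]
    exact .var θ y)
  intro q hq
  cases d <;> simp only [Destr.lhsPat, Destr.lhs, List.map_cons, List.map_nil, Term.toPattern,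
    List.mem_cons, List.not_mem_nil, or_false, Nat.add_zero] at hq
  case nth i m =>
    subst hq
    refine plain id fun p hp => ?_
    simp only [List.map_map, List.mem_map, Function.comp] at hp
    obtain ⟨j, -, rfl⟩ := hp
    simp only [Term.toPattern]
    exact .var θ _
  case sdecrypt =>
    rcases hq with rfl | rfl
    · exact tagged (ps := [n + 1]) (.inl trivial)
    · exact .var θ _
  case sdecryptP =>
    rcases hq with rfl | rfl
    · exact tagged (ps := [n + 1, n + 2]) (.inl trivial)
    · exact .var θ _
  case pdecryptP =>
    rcases hq with rfl | rfl
    · refine .app (fun p hp => ?_) fun _ => ?_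
      · simp only [List.mem_cons, List.not_mem_nil, or_false] at hp
        rcases hp with rfl | rfl | rfl
        · exact .var θ _
        · exact hpk _
        · exact .var θ _
      · obtain ⟨ct, m, us, h1, h2⟩ := h (.inl trivial)
        refine ⟨ct, h1, m, us, [.app .pk [θ.pat (n + 1)], θ.pat (n + 2)], ?_⟩
        simp [Pattern.subst, h2]
    · exact .var θ _
  case checksignature =>
    rcases hq with rfl | rfl
    · exact tagged (ps := [n + 1]) (.inl trivial)
    · exact hpk _
  case getmessage =>
    subst hq
    exact tagged (ps := [n + 1]) (.inl trivial)
  case nmrchecksign =>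
    rcases hq with rfl | rfl | rfl
    · exact tagged (ps := [n + 1]) (.inr rfl)
    · exact hpk _
    · exact .var θ _
  case getkey =>
    subst hq
    refine plain id fun p hp => ?_
    rw [List.mem_singleton.1 hp]
    exact .var θ _
  case equal =>
    rcases hq with rfl | rfl <;> exact .var θ _

theorem finite_translate (Init : Finset ℕ) (P : Proc) (c : Ctx) : (translate Init P c).Finite := by
  induction P generalizing c with
  | nil => exact Set.finite_empty
  | par P Q ihP ihQ => exact (ihP c).union (ihQ c)
  | repl P ih => exact ih _
  | res a P ih => exact ih _
  | inp M x P ih => exact ih _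
  | out M N P ih => exact (ih c).union (Set.finite_singleton _)
  | letD x g Ms P Q ihP ihQ =>
    rw [translate]
    refine Set.Finite.union ?_ (ihQ c)
    cases mguLists (Ms.map c.eval) (g.lhsPat c.fresh) with
    | none => exact Set.finite_empty
    | some σ => exact ihP _
  | cond M N P Q ihP ihQ =>
    rw [translate]
    refine Set.Finite.union ?_ (ihQ c)
    cases mguLists [c.eval M] [c.eval N] with
    | none => exact Set.finite_empty
    | some σ => exact ihP _
  | event M P ih => exact (ih c).union (Set.finite_singleton _)
  | letT x M P ih => exact ih _

theorem mem_listUnifiers_comp {ps qs : List Pattern} {μ : Subst} (h : μ ∈ listUnifiers ps qs)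
    (ρ : Subst) : μ.comp ρ ∈ listUnifiers ps qs := by
  have key : ∀ rs : List Pattern, rs.map (Pattern.subst (μ.comp ρ)) =
      (rs.map (Pattern.subst μ)).map (Pattern.subst ρ) := by
    intro rs
    rw [List.map_map]
    exact List.map_congr_left fun r _ => (Pattern.subst_subst μ ρ r).symm
  change ps.map _ = qs.map _
  rw [key, key]
  exact congrArg _ h

/-- The condition `cond` is ensured by the pending tests of the tag of a decrypted message. -/
inductive Pending (P₀ : Proc) (cond : Subst → Prop) (c : Ctx) : Proc → Prop
  | free (P : Proc) : (∀ τ, cond τ) → Pending P₀ cond c P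
  | nth (y n x : ℕ) (ct : Term) (P Q Q' : Proc) : IsConstant P₀ ct →
      (∀ τ m p us, IsConstPat p → (c.var x).subst τ = .app (.tuple m) (p :: us) → cond τ) →
      Pending P₀ cond c (.letD y (.nth 0 n) [.var x] (.cond (.var y) ct P Q) Q')
  | test (y : ℕ) (ct : Term) (P Q : Proc) : IsConstant P₀ ct →
      (∀ τ, IsConstPat ((c.var y).subst τ) → cond τ) →
      Pending P₀ cond c (.cond (.var y) ct P Q)

theorem mem_typeSet {P₀ : Proc} {rs : List ExecStep} {φ : ℕ → Pattern} {p : ExecStep → Prop}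
    {r : ExecStep} (hr : r ∈ rs) (hp : p r) {N : Term} (hN : N ∈ r.act.terms) :
    (N.label φ).erase (keySet P₀) ∈ typeSet P₀ rs φ p :=
  ⟨r, hr, hp, N, hN, N, .refl, rfl⟩

theorem messageFact_public {Init : Finset ℕ} {a : ℕ} (ha : a ∈ Init) (q : Pattern) :
    messageFact Init (freeName a) q = .attacker q := if_pos ⟨a, ha, rfl⟩

/-- When no tag test is pending, the patterns of the hypotheses are tagged, and the values of the
thread are the typed instance. The bound is just the weight of this instance. -/
theorem Link.prot {P₀ : Proc} {φ : ℕ → Pattern} {K : Set ℕ} {T T' : Set Pattern}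
    {cond : Subst → Prop} {c : Ctx} {σ : Subst} {g : HThread} {V N : Set ℕ}
    (h : Link P₀ φ K T cond c σ g V N) (hc : ∀ τ, cond τ) {F : HornFact}
    (hF : TypedConcl K T T' σ F) : ∃ B, Prot K T T' B (c.clause F) := by
  refine ⟨weight σ (c.hyps : Multiset HornFact), σ, fun G hG => ?_, hF, le_rfl⟩
  obtain ⟨p, q, rfl, h1, h2⟩ := h.hyps G (by simpa [Ctx.clause] using hG)
  exact ⟨p, rfl, by rwa [h1.subst], cutOK_id.1 (h1.cut .id (hc _))⟩

/-- The bindings of a context are updated along with those of a thread. -/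
theorem Link.bindVar {P₀ : Proc} {φ : ℕ → Pattern} {K : Set ℕ} {T : Set Pattern}
    {cond : Subst → Prop} {c : Ctx} {σ : Subst} {g : HThread} {V N : Set ℕ}
    (h : Link P₀ φ K T cond c σ g V N) {x : ℕ} {p : Pattern} {M : Term}
    (hp : PatLink c.fresh cond σ p (M.label φ)) {V' : Set ℕ} (hV : ∀ y ∈ V', y ≠ x → y ∈ V) :
    Link P₀ φ K T cond { c with var := Function.update c.var x p } σ
      { g with η := Function.update g.η x M } V' N :=
  { h with
    var := fun y hy => by
      by_cases hyx : y = x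
      · subst hyx
        simpa using hp
      · simpa [Function.update_of_ne hyx] using h.var y (hV y hy hyx) }

/-- Only the environment of a thread matters. -/
theorem Link.thread {P₀ : Proc} {φ : ℕ → Pattern} {K : Set ℕ} {T : Set Pattern}
    {cond : Subst → Prop} {c : Ctx} {σ : Subst} {g g' : HThread} {V N : Set ℕ}
    (h : Link P₀ φ K T cond c σ g V N) (hη : g'.η = g.η) (hν : g'.ν = g.ν) (hi : g'.ins = g.ins)
    (hk : g'.k = g.k) : Link P₀ φ K T cond c σ g' V N :=
  ⟨hη ▸ h.var, hν ▸ h.name, h.const, hi ▸ h.ins, hk ▸ h.sids, h.sids_below, h.hyps⟩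

namespace Execution

/-- The clauses of a tagged protocol are typed by its intended execution. -/
theorem translate_prot {Sg : Signature} {Init : Finset ℕ} {P₀ : Proc} {rs : List ExecStep}
    (hP : IsTagged Sg Init P₀) (hrs : Execution P₀ rs) {φ : ℕ → Pattern}
    (hφ : IsLabelling P₀ rs φ) (P : Proc) : ∀ r ∈ rs, r.g.proc = P → ∀ c σ cond,
      Link P₀ φ (keySet P₀) (typeSet P₀ rs φ ExecStep.IsPlain) cond c σ r.g P.fv P.fn →
      Pending P₀ cond c P → ∀ R ∈ translate Init P c, ∃ B,
        Prot (keySet P₀) (typeSet P₀ rs φ ExecStep.IsPlain) (typeSet P₀ rs φ fun _ => True) B R := by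
  have fresh_link : ∀ {n : ℕ} {cond : Subst → Prop} {σ : Subst} {q : Pattern}, σ.pat n = q →
      PatLink (n + 1) cond σ (.var n) q := by
    intro n cond σ q h
    refine ⟨by rw [Pattern.subst, h], fun v hv => ?_, fun τ _ => .var τ n⟩
    rw [occurs_var] at hv
    subst hv
    exact Nat.lt_succ_self n
  induction P with
  | nil => exact fun _ _ _ _ _ _ _ _ _ hR => hR.elim
  | par P Q ihP ihQ =>
    intro r hr hg c σ cond hl hpd R hR
    cases hpd with
    | free _ hc =>
    obtain ⟨⟨r₁, hr₁, h1⟩, r₂, hr₂, h2⟩ := hrs.next_par hP hr hg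
    rcases hR with hR | hR
    · refine ihP r₁ hr₁ (by rw [h1]; rfl) c σ cond ?_ (.free _ hc) R hR
      rw [h1]
      exact (hl.mono Set.subset_union_left Set.subset_union_left).thread rfl rfl rfl rfl
    · refine ihQ r₂ hr₂ (by rw [h2]; rfl) c σ cond ?_ (.free _ hc) R hR
      rw [h2]
      exact (hl.mono Set.subset_union_right Set.subset_union_right).thread rfl rfl rfl rfl
  | repl P ih =>
    intro r hr hg c σ cond hl hpd R hR
    cases hpd with
    | free _ hc =>
    obtain ⟨r₁, hr₁, h1⟩ := hrs.next_repl hP hr hg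
    -- The new session identifier becomes the constant 0, as in the encoding of runtime names; one
    -- session suffices, since every point is executed once.
    set σ' : Subst := ⟨σ.pat, Function.update σ.sess c.fresh (.const 0)⟩ with hσ'
    have hag : ∀ v : Var, v.idx < c.fresh → v.Agree σ' σ := by
      rintro (x | i) hv
      · rfl
      · exact Function.update_of_ne (Nat.ne_of_lt hv) ..
    have h2 := hl.extend (n' := c.fresh + 1) (Nat.le_succ _) hag
    refine ih r₁ hr₁ (by rw [h1]; rfl) _ σ' cond ?_ (.free _ hc) R hR
    rw [h1]
    refine ⟨h2.var, h2.name, h2.const, h2.ins, ?_, ?_, h2.hyps⟩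
    · have h3 := h2.sids
      simp only [List.map_append, List.replicate_succ', List.map_singleton] at h3 ⊢
      rw [h3]
      simp [SessId.subst, hσ']
    · intro i hi
      rcases List.mem_append.1 hi with hi | hi
      · exact h2.sids_below i hi
      · rw [List.mem_singleton, SessId.var.injEq] at hi
        subst hi
        exact Nat.lt_succ_self _
  | res a P ih =>
    intro r hr hg c σ cond hl hpd R hR
    cases hpd with
    | free _ hc =>
    obtain ⟨a', r₁, hr₁, h1, h2⟩ := hrs.next_res hP hφ hr hg
    have hat := (hrs.at_mem hP r hr).1
    refine ih r₁ hr₁ (by rw [h1]; rfl) _ σ cond ?_ (.free _ hc) R hR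
    rw [h1]
    have hins : c.ins.map (Pattern.subst σ) = r.g.ins.map (Term.label φ) := by
      have := hl.ins.imp fun _ _ h => h.subst
      rw [← List.forall₂_map_left_iff (f := Pattern.subst σ) (R := Eq), List.forall₂_eq_eq_eq]
        at this
      exact this
    have hinsl : ∀ p ∈ c.ins, ∃ q, PatLink c.fresh cond σ p q := by
      intro p hp
      have := hl.ins
      clear hins
      revert hp
      generalize r.g.ins.map (Term.label φ) = qs at this
      generalize c.ins = ps at this ⊢
      intro hp
      induction this with
      | nil => simp at hp
      | cons h _ ih =>
        rcases List.mem_cons.1 hp with rfl | hp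
        · exact ⟨_, h⟩
        · exact ih hp
    refine ⟨hl.var, fun b hb => ?_, fun b hb hbc => ?_, hl.ins, hl.sids, hl.sids_below, hl.hyps⟩
    · by_cases hba : b = a
      · subst hba
        simp only [Function.update_self]
        refine ⟨?_, fun v hv => ?_, fun τ hτ => ?_⟩
        · rw [h2, Pattern.subst, hins, hl.sids]
        · rcases occurs_name.1 hv with ⟨p, hp, h⟩ | ⟨i, rfl, h⟩
          · obtain ⟨q, hq⟩ := hinsl p hp
            exact hq.below v h
          · exact hl.sids_below i h
        · refine .name fun p hp => ?_
          obtain ⟨q, hq⟩ := hinsl p hp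
          exact hq.cut τ hτ
      · simp only [Function.update_of_ne hba]
        exact hl.name b ⟨hb, hba⟩
    · by_cases hba : b = a
      · subst hba
        have hbn : b ∈ r.g.proc.bn := by simp [hg, Proc.bn]
        have hbt := hbc.resolve_left (hP.bn_fresh b (hat.bn.subset hbn)).1
        obtain ⟨h3, h4, -⟩ := hat.top b hbt hbn
        have h5 : c.ins = [] := by
          rw [h3] at hins
          simpa using hins
        have h6 : c.sids = [] := by
          have := hl.sids
          rw [h4] at this
          simpa using this
        simp [h5, h6, freeName]
      · simp only [Function.update_of_ne hba]
        exact hl.const b ⟨hb, hba⟩ hbc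
  | inp M x P ih =>
    intro r hr hg c σ cond hl hpd R hR
    cases hpd with
    | free _ hc =>
    obtain ⟨N, hN, r₁, hr₁, h1⟩ := hrs.next_inp hP hr hg
    have hsub := (hrs.at_mem hP r hr).1.mem_subs
    obtain ⟨ch, rfl, hch, hchI⟩ := hP.chan_inp _ _ _ (hg ▸ hsub)
    -- The fresh variable of the input takes the encoding of the term that was received.
    set σ' : Subst := ⟨Function.update σ.pat c.fresh (N.label φ), σ.sess⟩ with hσ'
    have hag : ∀ v : Var, v.idx < c.fresh → v.Agree σ' σ := by
      rintro (x | i) hv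
      · exact Function.update_of_ne (Nat.ne_of_lt hv) ..
      · rfl
    have hnew : PatLink (c.fresh + 1) cond σ' (.var c.fresh) (N.label φ) :=
      fresh_link (by simp [hσ'])
    have h2 := (hl.extend (n' := c.fresh + 1) (Nat.le_succ _) hag).bindVar (x := x) hnew
      (V' := P.fv) fun y hy hyx => .inr ⟨hy, hyx⟩
    have hchan : c.eval (.name ch) = freeName ch := by
      rw [Ctx.eval, Term.toPattern]
      exact hl.const ch (.inl .refl) (.inl hch)
    rw [translate, hchan, messageFact_public hchI] at hR
    refine ih r₁ hr₁ (by rw [h1]; rfl) _ σ' cond ?_ (.free _ hc) R hR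
    rw [h1]
    refine ⟨h2.var, fun a ha => h2.name a (.inr ha), fun a ha => h2.const a (.inr ha), ?_, h2.sids,
      h2.sids_below, fun F hF => ?_⟩
    · rw [List.map_append, List.map_singleton]
      exact List.rel_append h2.ins (.cons hnew .nil)
    · rcases List.mem_append.1 hF with hF | hF
      · exact h2.hyps F hF
      · exact ⟨_, _, List.mem_singleton.1 hF, hnew, mem_typeSet hr (by simp [ExecStep.IsPlain, hg]) hN⟩
  | out M N P ih =>
    intro r hr hg c σ cond hl hpd R hR
    cases hpd with
    | free _ hc =>
    obtain ⟨hN, r₁, hr₁, h1⟩ := hrs.next_out hP hr hg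
    have hsub := (hrs.at_mem hP r hr).1.mem_subs
    rcases hR with hR | hR
    · refine ih r₁ hr₁ (by rw [h1]; rfl) c σ cond ?_ (.free _ hc) R hR
      rw [h1]
      exact (hl.mono Set.subset_union_right Set.subset_union_right).thread rfl rfl rfl rfl
    · obtain ⟨ch, rfl, hch, hchI⟩ := hP.chan_out _ _ _ (hg ▸ hsub)
      have hchan : c.eval (.name ch) = freeName ch := by
        rw [Ctx.eval, Term.toPattern]
        exact hl.const ch (.inl (.inl .refl)) (.inl hch)
      rw [Set.mem_singleton_iff, hchan, messageFact_public hchI] at hR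
      subst hR
      have he := hl.eval (M := N) (fun x hx => .inl (.inr hx)) (fun a ha => .inl (.inr ha))
        (hP.taggedIn (hg ▸ hsub) (by simp [Proc.headTerms]))
      refine hl.prot hc (.inl ⟨_, rfl, ?_, cutOK_id.1 (he.cut .id (hc _))⟩)
      rw [he.subst]
      exact mem_typeSet hr (by simp [ExecStep.IsPlain, hg]) hN
  | event M P ih =>
    intro r hr hg c σ cond hl hpd R hR
    cases hpd with
    | free _ hc =>
    obtain ⟨hM, r₁, hr₁, h1⟩ := hrs.next_event hP hr hg
    have hsub := (hrs.at_mem hP r hr).1.mem_subs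
    rcases hR with hR | hR
    · refine ih r₁ hr₁ (by rw [h1]; rfl) c σ cond ?_ (.free _ hc) R hR
      rw [h1]
      exact (hl.mono Set.subset_union_right Set.subset_union_right).thread rfl rfl rfl rfl
    · rw [Set.mem_singleton_iff] at hR
      subst hR
      have he := hl.eval (M := M) (fun x hx => .inl hx) (fun a ha => .inl ha)
        (hP.taggedIn (hg ▸ hsub) (by simp [Proc.headTerms]))
      refine hl.prot hc (.inr ⟨_, rfl, ?_⟩)
      rw [he.subst]
      exact mem_typeSet hr trivial hM
  | letT x M P ih =>
    intro r hr hg c σ cond hl hpd R hR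
    cases hpd with
    | free _ hc =>
    obtain ⟨r₁, hr₁, h1⟩ := hrs.next_letT hP hr hg
    have hsub := (hrs.at_mem hP r hr).1.mem_subs
    have he := hl.eval (M := M) (fun x hx => .inl hx) (fun a ha => .inl ha)
      (hP.taggedIn (hg ▸ hsub) (by simp [Proc.headTerms]))
    have h2 := (hl.bindVar (x := x) he (V' := P.fv) fun y hy hyx => .inr ⟨hy, hyx⟩).mono
      subset_rfl (N' := P.fn) Set.subset_union_right
    refine ih r₁ hr₁ (by rw [h1]; rfl) _ σ cond ?_ (.free _ hc) R hR
    rw [h1]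
    exact h2.thread rfl rfl rfl rfl
  | cond M N P Q ihP ihQ =>
    intro r hr hg c σ cond hl hpd R hR
    obtain ⟨heq, r₁, hr₁, h1⟩ := hrs.next_cond hP hr hg
    have hsub := (hrs.at_mem hP r hr).1.mem_subs
    have hQ := hP.no_else_cond _ _ _ _ (hg ▸ hsub)
    subst hQ
    have heM := hl.eval (M := M) (fun x hx => .inl (.inl (.inl hx))) (fun a ha => .inl (.inl (.inl ha)))
      (hP.taggedIn (hg ▸ hsub) (by simp [Proc.headTerms]))
    have heN := hl.eval (M := N) (fun x hx => .inl (.inl (.inr hx))) (fun a ha => .inl (.inl (.inr ha)))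
      (hP.taggedIn (hg ▸ hsub) (by simp [Proc.headTerms]))
    rw [translate] at hR
    rcases hR with hR | hR
    swap
    · exact hR.elim
    cases hm : mguLists [c.eval M] [c.eval N] with
    | none =>
      rw [hm] at hR
      exact hR.elim
    | some μ =>
      rw [hm] at hR
      have hμ : IsMGU (listUnifiers [c.eval M] [c.eval N]) _ μ := mgu_spec hm
      -- If this is the awaited tag test, unification with the constant on the right makes the
      -- tested component a constant, which is what the pending condition asks for.
      have hcond : ∀ ρ, cond (μ.comp ρ) := by
        intro ρ
        cases hpd with
        | free _ hc => exact hc _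
        | test y ct _ _ hct hc =>
          refine hc _ ?_
          have h2 := mem_listUnifiers_comp hμ.unifies ρ
          have h3 : (c.eval (.var y)).subst (μ.comp ρ) = (c.eval N).subst (μ.comp ρ) := by
            simpa [listUnifiers] using h2
          have h4 := hl.isConstPat hct fun a ha => .inl (.inl (.inr ha))
          rw [Ctx.eval, Term.toPattern, h4.subst] at h3
          rw [h3]
          exact h4
      have hW : ∀ v ∈ listVars [c.eval M] ∪ listVars [c.eval N], v.idx < c.fresh := by
        rintro v (⟨p, hp, hv⟩ | ⟨p, hp, hv⟩)
        · rw [List.mem_singleton.1 hp] at hv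
          exact heM.below v hv
        · rw [List.mem_singleton.1 hp] at hv
          exact heN.below v hv
      have hσU : σ ∈ listUnifiers [c.eval M] [c.eval N] := by
        simp [listUnifiers, heM.subst, heN.subst, heq]
      obtain ⟨τ, -, h2⟩ := hl.mgu (cond' := fun _ => True) hμ le_rfl hW hσU
        (fun v _ => by cases v <;> rfl) fun ρ _ => ⟨hcond ρ, cut_mem_listUnifiers
          (mem_listUnifiers_comp hμ.unifies ρ)
          (fun p hp => List.mem_singleton.1 hp ▸ heM.cut _ (hcond ρ))
          fun p hp => List.mem_singleton.1 hp ▸ heN.cut _ (hcond ρ)⟩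
      refine ihP r₁ hr₁ (by rw [h1]; rfl) _ τ _ ?_ (.free _ fun _ => trivial) R hR
      rw [h1]
      exact (h2.mono (fun x hx => .inl (.inr hx)) (fun a ha => .inl (.inr ha))).thread rfl rfl rfl rfl
  | letD x d Ms P Q ihP ihQ =>
    intro r hr hg c σ cond hl hpd R hR
    obtain ⟨M', ⟨ι, hι, rfl⟩, r₁, hr₁, h1⟩ := hrs.next_letD hP hr hg
    have hsub := hg ▸ (hrs.at_mem hP r hr).1.mem_subs
    have hQ := hP.no_else_letD _ _ _ _ _ hsub
    subst hQ
    have hnth := hP.nth_lt hsub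
    have heMs : ∀ M ∈ Ms, PatLink c.fresh cond σ (c.eval M) ((r.g.eval M).label φ) := fun M hM =>
      hl.eval (fun x hx => .inl (.inl ⟨M, hM, hx⟩)) (fun a ha => .inl (.inl ⟨M, hM, ha⟩))
        (hP.taggedIn hsub hM)
    rw [translate] at hR
    rcases hR with hR | hR
    swap
    · exact hR.elim
    cases hm : mguLists (Ms.map c.eval) (d.lhsPat c.fresh) with
    | none =>
      rw [hm] at hR
      exact hR.elim
    | some μ =>
      rw [hm] at hR
      have hμ : IsMGU (listUnifiers (Ms.map c.eval) (d.lhsPat c.fresh)) _ μ := mgu_spec hm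
      -- Variables from `c.fresh` on belong to the rule of the destructor and take the values for
      -- which the rule was applied in the execution; the others keep their values.
      set θ : Subst := ⟨fun y => if c.fresh ≤ y then (ι (y - c.fresh)).label φ else σ.pat y,
        σ.sess⟩ with hθ
      have hθι : ∀ i, θ.pat (c.fresh + i) = (ι i).label φ := fun i => by simp [hθ]
      have hag : ∀ v : Var, v.idx < c.fresh → v.Agree θ σ := by
        rintro (y | i) hv
        · simp only [Var.idx] at hv
          exact if_neg (by omega)
        · rfl
      have hθU : θ ∈ listUnifiers (Ms.map c.eval) (d.lhsPat c.fresh) := by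
        change (Ms.map c.eval).map (Pattern.subst θ) = (d.lhsPat c.fresh).map (Pattern.subst θ)
        have h2 : (Ms.map c.eval).map (Pattern.subst θ) = (Ms.map r.g.eval).map (Term.label φ) := by
          rw [List.map_map, List.map_map]
          exact List.map_congr_left fun M hM => ((heMs M hM).extend le_rfl hag).subst
        rw [h2, hι, Destr.lhsPat, List.map_map, List.map_map]
        exact List.map_congr_left fun L hL => (Term.rule_subst hθι (Destr.lhs_spec hL).1).symm
      have hW : ∀ v ∈ listVars (Ms.map c.eval) ∪ listVars (d.lhsPat c.fresh),
          v.idx < c.fresh + d.nvars := by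
        rintro v (⟨p, hp, hv⟩ | ⟨p, hp, hv⟩)
        · obtain ⟨M, hM, rfl⟩ := List.mem_map.1 hp
          exact ((heMs M hM).below v hv).trans_le (Nat.le_add_right ..)
        · obtain ⟨L, hL, rfl⟩ := List.mem_map.1 hp
          exact Term.rule_below (Destr.lhs_spec hL).1 (Destr.lhs_spec hL).2 v hv
      obtain ⟨cond', hc1, hc2, hc3⟩ : ∃ cond' : Subst → Prop,
          (∀ ρ, cond' ρ → cond (μ.comp ρ)) ∧
          (∀ ρ, cond' ρ → (d.ChecksTag ∨ d = .nmrchecksign) → ∃ ct m us, IsConstPat ct ∧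
            (μ.comp ρ).pat c.fresh = .app (.tuple m) (ct :: us)) ∧
          Pending P₀ cond'
            { c.subst μ with
              fresh := c.fresh + d.nvars
              var := Function.update (c.subst μ).var x ((d.rhsPat c.fresh).subst μ) } P := by
        cases hpd with
        | free _ hc =>
          by_cases hd : d.ChecksTag
          · obtain ⟨y, n, ct, P', Q₁, Q₂, rfl, hct⟩ := hP.tag_checked _ _ _ _ _ hsub hd
            -- The decrypted message is not yet known to be tagged. This becomes the condition on
            -- later instances, to be ensured by the projection and the test that follow.
            refine ⟨fun ρ => ∃ ct m us, IsConstPat ct ∧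
              (μ.comp ρ).pat c.fresh = .app (.tuple m) (ct :: us), fun _ _ => hc _, fun ρ h _ => h,
              .nth y n x ct P' Q₁ Q₂ hct fun τ m p us hp h => ⟨p, m, us, hp, ?_⟩⟩
            have hrhs : d.rhsPat c.fresh = .var c.fresh := by
              cases d <;> first | exact hd.elim | simp [Destr.rhsPat, Destr.rhs, Term.toPattern]
            simpa [hrhs, Pattern.subst, Subst.comp] using h
          · refine ⟨fun _ => True, fun _ _ => hc _, fun ρ _ h => ?_, .free _ fun _ => trivial⟩
            obtain rfl := h.resolve_left hd
            -- For `nmrchecksign` the signed message is the third argument, which is already tagged,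
            -- so nothing remains pending.
            obtain ⟨M₁, M₂, ct, Ms', rfl, hct⟩ := hP.nmr_tagged _ _ _ _ hsub
            have h2 := mem_listUnifiers_comp hμ.unifies ρ
            have h3 := hl.isConstPat hct fun a ha => .inl (.inl ⟨.app (.tuple (Ms'.length + 1)) (ct :: Ms'),
              by simp, .app (List.mem_cons_self ..) ha⟩)
            have h4 : (c.eval (.app (.tuple (Ms'.length + 1)) (ct :: Ms'))).subst (μ.comp ρ) =
                (μ.comp ρ).pat c.fresh := by
              simp only [listUnifiers, Set.mem_ofPred_eq, Destr.lhsPat, Destr.lhs, List.map_cons,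
                List.map_nil, List.cons.injEq, and_true, Term.toPattern, Nat.add_zero] at h2
              rw [h2.2.2, Pattern.subst]
            refine ⟨c.eval ct, Ms'.length + 1, (Ms'.map c.eval).map (Pattern.subst (μ.comp ρ)), h3, ?_⟩
            rw [← h4, Ctx.eval, Term.toPattern, Pattern.subst, List.map_cons, List.map_cons]
            congr 2
            exact h3.subst _
        | nth y n x' ct P' Q' _ hct hc =>
          -- After projecting the first component, it remains to know that this component is a
          -- constant; the equation of the projection then shows the message to be a tuple that
          -- starts with it.
          refine ⟨fun ρ => IsConstPat ((μ.comp ρ).pat c.fresh), fun ρ hρ => ?_, fun ρ _ h => ?_,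
            .test x ct P' Q' hct fun τ h => ?_⟩
          · have h2 := mem_listUnifiers_comp hμ.unifies ρ
            -- The projection on component 0 exists, so the tuple is not empty.
            obtain ⟨m, rfl⟩ : ∃ m, n = m + 1 := ⟨n - 1, by have := hnth 0 n rfl; omega⟩
            have h3 : (c.var x').subst (μ.comp ρ) = .app (.tuple (m + 1))
                ((μ.comp ρ).pat c.fresh :: (List.range m).map fun i =>
                  (μ.comp ρ).pat (c.fresh + (i + 1))) := by
              simp only [listUnifiers, Set.mem_ofPred_eq, Destr.lhsPat, Destr.lhs, List.map_cons,
                List.map_nil, List.cons.injEq, and_true, Term.toPattern, Ctx.eval] at h2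
              rw [h2]
              simp [Pattern.subst, List.range_succ_eq_map, Function.comp_def, Term.toPattern]
            exact hc _ _ _ _ hρ h3
          · rcases h with h | h
            · exact h.elim
            · cases h
          · simpa [Destr.rhsPat, Destr.rhs, Term.toPattern, Pattern.subst, Subst.comp] using h
      have hcut : ∀ ρ, cond' ρ →
          (μ.comp ρ).cut ∈ listUnifiers (Ms.map c.eval) (d.lhsPat c.fresh) := fun ρ hρ =>
        cut_mem_listUnifiers (mem_listUnifiers_comp hμ.unifies ρ) (fun p hp => by
          obtain ⟨M, hM, rfl⟩ := List.mem_map.1 hp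
          exact (heMs M hM).cut _ (hc1 ρ hρ)) (Destr.lhsPat_cutOK (hc2 ρ hρ))
      obtain ⟨τ, hτ, h2⟩ := hl.mgu (cond' := cond') hμ (Nat.le_add_right ..) hW hθU hag
        fun ρ hρ => ⟨hc1 ρ hρ, hcut ρ hρ⟩
      obtain ⟨hr1, hr2⟩ := Destr.rhs_spec hnth
      have hres : PatLink (c.fresh + d.nvars) cond' τ ((d.rhsPat c.fresh).subst μ)
          ((d.rhs.inst ι .name).label φ) := by
        refine ⟨?_, hμ.below hW (Term.rule_below hr1 hr2), fun ρ hρ => ?_⟩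
        · rw [Pattern.subst_subst, ← hτ]
          exact Term.rule_subst hθι hr1
        · refine CutOK.comp ?_ (hμ.cutOK (hcut ρ hρ))
          cases d <;> simp only [Destr.rhsPat, Destr.rhs, Term.toPattern] <;>
            first
              | exact .var _ _
              | exact .app (by simp) fun h => h.elim
      have h3 := (h2.bindVar (x := x) hres (V' := P.fv) fun y hy hyx => .inl (.inr ⟨hy, hyx⟩)).mono
        subset_rfl (N' := P.fn) fun a ha => .inl (.inr ha)
      refine ihP r₁ hr₁ (by rw [h1]; rfl) _ τ cond' ?_ hc3 R hR
      rw [h1]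
      exact h3.thread rfl rfl rfl rfl

end Execution

-- Initial context and closed queries

theorem freeName_closed (a : ℕ) (v : Var) : ¬ v.Occurs (freeName a) := fun h => by
  rcases occurs_name.1 h with ⟨p, hp, -⟩ | ⟨i, -, hi⟩
  · cases hp
  · cases hi

theorem Execution.exists_initial {P₀ : Proc} {rs : List ExecStep} (hrs : Execution P₀ rs) :
    ∃ r ∈ rs, r.g = HThread.initial P₀ := by
  have h0 : [] ∈ P₀.points := by cases P₀ <;> simp [Proc.points]
  have h1 := hrs.count _ h0
  rcases hrs.chain with _ | ⟨h, -, -, -⟩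
  · simp at h1
  · exact ⟨_, List.mem_cons_self .., h⟩

theorem Link.initial {P₀ : Proc} {rs : List ExecStep} {φ : ℕ → Pattern} (h0 : P₀.fv = ∅)
    (hφ : IsLabelling P₀ rs φ) (K : Set ℕ) (T : Set Pattern) (cond : Subst → Prop) :
    Link P₀ φ K T cond Ctx.initial .id (HThread.initial P₀) P₀.fv P₀.fn where
  var x hx := by simp [h0] at hx
  name a ha := ⟨(hφ.free a ha).symm ▸ Pattern.subst_id _, fun v h => (freeName_closed a v h).elim,
    fun τ _ => .name fun p hp => by cases hp⟩
  const _ _ _ := rfl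
  ins := .nil
  sids := rfl
  sids_below i hi := by cases hi
  hyps F hF := by cases hF

theorem Prot.mono {K : Set ℕ} {T T' : Set Pattern} {B B' : ℕ} {R : Clause}
    (h : Prot K T T' B R) (hB : B ≤ B') : Prot K T T' B' R := by
  obtain ⟨σ, h1, h2, h3⟩ := h
  exact ⟨σ, h1, h2, h3.trans hB⟩

theorem Atom.Closed.toFact {α : Atom} (hα : α.Closed) : α.toFact.Closed := by
  have key : ∀ M ∈ α.terms, ∀ v : Var, ¬ v.Occurs (M.toPattern .var freeName) := by
    intro M hM v hv
    rcases Term.occurs_toPattern hv with ⟨x, h1, -⟩ | ⟨a, -, h2⟩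
    · exact hα M hM x h1
    · exact freeName_closed a v h2
  refine Set.eq_empty_iff_forall_notMem.2 ?_
  rintro v ⟨p, hp, hv⟩
  cases α <;> simp only [Atom.toFact, HornFact.patterns, List.mem_cons, List.not_mem_nil,
    or_false] at hp
  case message M N =>
    rcases hp with rfl | rfl
    · exact key M (by simp [Atom.terms]) v hv
    · exact key N (by simp [Atom.terms]) v hv
  all_goals
    subst hp
    exact key _ (by simp [Atom.terms]) v hv

end CryptoHorn

theorem mainTheorem5 (Sg : Signature) (Init : Finset ℕ) (P₀ : Proc) (hP : IsTagged Sg Init P₀)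
    (Fnot : Finset HornFact) (hFnot : ∀ F ∈ Fnot, F.Closed)
    (α : Atom) (hα : α.Closed)
    (sel : Clause → Set HornFact) (hsel : IsSel₀ sel)
    (red : Clause → Clause) (hred : IsElimRedundantHyp red) :
    SolveTerminates ⟨Fnot, sel, red⟩ (protocolClauses Sg Init P₀) α.toFact := by
  obtain ⟨rs, φ, hrs, hφ, hT⟩ := hP.exists_execution
  have hfin := finite_translate Init P₀ Ctx.initial
  obtain ⟨r, hr, hg⟩ := hrs.exists_initial
  have h1 := hrs.translate_prot hP hφ P₀ r hr (by rw [hg]; rfl) Ctx.initial .id (fun _ => True)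
    (by rw [hg]; exact .initial hP.closed hφ ..) (.free _ fun _ => trivial)
  choose! b hb using h1
  -- Finitely many protocol clauses have a common bound on the weight of their typed instances. The
  -- maximum with twice the size of the types leaves room for decryption.
  obtain ⟨B₁, hB₁⟩ := (hfin.image b).bddAbove
  obtain ⟨B₂, hB₂⟩ :=
    ((finite_typeSet P₀ rs φ ExecStep.IsPlain).image fun t => 2 * t.size).bddAbove
  exact solveTerminates_of_typing hT (finite_typeSet P₀ rs φ fun _ => True)
    (fun t ht => (hB₂ (Set.mem_image_of_mem _ ht)).trans (le_max_right B₁ B₂)) hP.sig Init hfin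
    (fun R hR => (hb R hR).mono ((hB₁ (Set.mem_image_of_mem _ hR)).trans (le_max_left ..)))
    hFnot hsel hred hα.toFact
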